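/- **Setting.** Let $\Sigma,V$ be finite sets. Graphs are finite, directed, with a multiset of edges, a source $n_b$ and a sink $n_e$. A *series-parallel graph grammar* $\mathcal G$ over $\Sigma$ with variables $V$ has a start variable $v_0$ and rules of the forms $v\to\sigma$ (one edge labeled $\sigma\in\Sigma$), $v\to v_1\cdot v_2$ (two edges labeled $v_1,v_2$ in series) and $v\to v_1\parallel v_2$ (two parallel edges labeled $v_1,v_2$). It derives graphs from a single edge labeled $v_0$, between two distinct nodes, by replacing an edge labeled with a variable by the right-hand side of a rule for it; $\mathcal L(\mathcal G)$ is the set of derived graphs with labels in $\Sigma$. The symmetric closure of such a graph has, for each edge $(n,n',\sigma)$, the edges $(n,n',(\sigma,1))$ and $(n',n,(\sigma,-1))$. For $k\ge 0$, $\mathcal G^k$ stands for the pairs $(G,\kappa)$ of the symmetric closure $G$ of a graph in $\mathcal L(\mathcal G)$ and a marking $\kappa$ of at most $k$ of its nodes (the nodes with a register). A *machine* $\mathcal M=(Q,q^0,\Sigma,\delta)$ has a finite state set $Q$ and $\delta\subseteq Q\times(\Sigma\times\{1,-1\})\times\mathbb B\times Q\times\mathbb B$. In $T(\mathcal M,m,\mathcal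 G^k)$, $m$ copies of $\mathcal M$ move on some $(G,\kappa)$ of $\mathcal G^k$. A configuration assigns to each machine one node and one state, and to each node a value $\beta(n)\in\mathbb B$; initially all machines are at $n_b$ in state $q^0$ and $\beta=0$. In a step, one machine in state $q$ at node $n$ takes an edge $(n,n',(\sigma,d))$ of $G$, moves to $n'$ and changes to $q'$, where either $n$ is marked, $(q,(\sigma,d),\beta(n),q',b')\in\delta$ and $\beta(n)$ becomes $b'$, or $n$ is not marked, $(q,(\sigma,d),0,q',0)\in\delta$ and $\beta(n)=0$ afterwards; everything else is unchanged. A run is a finite sequence of steps from an initial configuration; it is *$r$-reversal-bounded* if along it each machine changes at most $r$ times between taking an edge of direction $1$ and taking one of direction $-1$. A *configuration property* $F$ is a positive Boolean combination of properties "there is a node at which the multiset of the states of the machines contains $S$", for multisets $S$ over $Q$. **The PDA $\mathcal A$.** Put $\tilde r=r+1$, $t=m\tilde r$, $p=m(k\tilde r+1)$. Rows are the pairs $(n,h)$ of a machine $n$ and a path number $1\le h\le\tilde r$; path $h$ is followed forwards if $h$ is odd and backwards if $h$ is even. The trace alphabet $\Sigma_{\mathsf t}$ consists of *edge letters*, which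 have in each row a label in $\Sigma\cup\{\flat\}$ ($\flat$ is padding), the identifiers in $\{0,\dots,k\}$ of the registers at the source and the target of the edge ($0$: no register) and a path index in $\{1,\dots,t\}$, and of *node letters*, which have in each row a path index. A letter of the execution alphabet $\Sigma_{\mathsf e}$ has in each row a block number in $\{0,\dots,p\}$ ($0$: the machine is inactive), a value read, a value written, a successor state and a row of the trace. Words are read between end markers $\vdash,\dashv$; PDAs accept by having read the whole input and having exactly the start symbol on the stack; 2NFAs accept by leaving the word on either side in an accepting state. * $\mathcal P_{\mathsf t}=\mathcal P\cap\mathcal A_{\mathsf r}$. The PDA $\mathcal P$ expands stack symbols $(v,R)$, where $R$ is the set of rows running through the subgraph generated by $v$, starting with (node letter where all rows meet)$\,(v_0,\text{all rows})\,$(node letter where all rows meet). For $v\to\sigma$ it reads an edge letter with label $\sigma$ in the rows in $R$ and $\flat$ in the others; for $v\to v_1\cdot v_2$ it replaces $(v,R)$ by $(v_1,R)$, a node letter, $(v_2,R)$; for $v\to v_1\parallel v_2$ it replaces $(v,R)$ by $(v_1,R_1),(v_2,R_2)$ for a partition of $R$ into nonempty sets $R_1,R_2$, or by one of $(v_1,R)$,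 $(v_2,R)$ if the other variable derives some graph without variables. In these letters the rows in $R$ share one path index and all other path indices are distinct. The NFA $\mathcal A_{\mathsf r}$ checks that register identifiers are consistent: along a row the source identifier of an edge is the identifier of the current node; rows that meet at a node letter have the same current identifier; when a node with identifier $j>0$ is left for the first time, all rows with current identifier $j$ have the same path index in the last node letter, and from then on no row enters a node with identifier $j$. * For each machine $n$, $\mathcal A_n$ is the standard conversion to an NFA of a 2NFA which checks that on each path the machine is active (block number $>0$) in a nonempty interval of the word, the first interval beginning at the first letter and intervals $h,h+1$ ending on the right for odd $h$, and beginning on the left for even $h$, at the same position; and which simulates $\mathcal M$ from $q^0$ along its paths in order, reading in active cells the indicated trace row: at an edge of direction matching the path it checks that $\delta$ has the transition with the given values and successor state (values $0$ where the register identifier is $0$); at $\flat$ and at node letters the state is unchanged; the trace row can change only at a node letter, to a row with the same path index. * $\mathcal A_{\mathsf c}$ is the standard conversion to an NFA of a 2NFA which checks, by guessing for each block the register valuation at its beginning (assumption) and recording the one at its end (guarantee), that each block number belongs to a single machine, that the positive block numbers of each machine are nondecreasing in execution order, that every value read is the current value in the block, that block $1$, if present, begins with all registers $0$, and that each other block $i+1$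 that occurs begins with the valuation at the end of block $i$, which has to occur. * $\mathcal A_{\mathsf s}$ is an NFA which finds the atoms of $F$ that hold finally: an atom $S$ is found between two consecutive symbols if some set of machines, whose multiset of states contains $S$, end their last paths (the paths $\tilde r$) exactly there, on rows which have the same path index in one of these two symbols (a node letter, or an edge letter without $\flat$ in these rows). It accepts iff the atoms found make $F$ true. $\mathcal A_{\mathsf e}$ is the projection to $\Sigma_{\mathsf t}$ of the intersection of $\mathcal A_1,\dots,\mathcal A_m$, $\mathcal A_{\mathsf c}$ and $\mathcal A_{\mathsf s}$, and $\mathcal A$ is the PDA obtained as the product of $\mathcal P_{\mathsf t}$ and $\mathcal A_{\mathsf e}$. **Theorem.** For all $\mathcal M$, $m$, $r$, $k$, $\mathcal G$ and $F$ as above, $\mathcal L(\mathcal A)\neq\emptyset$ if and only if there is an $r$-reversal-bounded run $\rho=\gamma_0\dots\gamma_f$ of $T(\mathcal M,m,\mathcal G^k)$ such that $\gamma_i\models F$ for some $0\le i\le f$. -/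

import Mathlib

namespace SPAutomata

/-! # Series-parallel graph grammars -/

/-- The direction in which an edge is traversed, or in which the head of a two-way automaton
moves. -/
inductive Dir
  | fwd
  | bwd

/-- Finite multigraphs with edges labeled in `L`, a source and a sink. -/
structure Graph (L : Type*) where
  Node : Type
  finite_node : Finite Node
  edges : Multiset (Node × Node × L)
  source : Node
  sink : Node

/-- Relabeling of the edges. -/
def Graph.mapLabel {L L' : Type*} (f : L → L') (G : Graph L) : Graph L' where
  Node := G.Node
  finite_node := G.finite_node
  edges := G.edges.map fun e => (e.1, e.2.1, f e.2.2)
  source := G.source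
  sink := G.sink

open Classical in
/-- Where a node of `H` goes when the edge `e` of `G` is replaced by `H`: the source and the sink
of `H` are fused with the end points of `e`. -/
noncomputable def Graph.fuse {L : Type*} (G : Graph L) (e : G.Node × G.Node × L) (H : Graph L)
    (x : H.Node) : G.Node ⊕ {x : H.Node // x ≠ H.source ∧ x ≠ H.sink} :=
  if hs : x = H.source then Sum.inl e.1
  else if ht : x = H.sink then Sum.inl e.2.1
  else Sum.inr ⟨x, hs, ht⟩

open Classical in
/-- Edge replacement: one copy of `e` is removed and `H` is inserted in its place. -/
noncomputable def Graph.replace {L : Type*} (G : Graph L) (e : G.Node × G.Node × L)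
    (H : Graph L) : Graph L where
  Node := G.Node ⊕ {x : H.Node // x ≠ H.source ∧ x ≠ H.sink}
  finite_node :=
    haveI := G.finite_node
    haveI := H.finite_node
    inferInstance
  edges := ((G.edges.erase e).map fun d => (Sum.inl d.1, Sum.inl d.2.1, d.2.2)) +
    H.edges.map fun d => (G.fuse e H d.1, G.fuse e H d.2.1, d.2.2)
  source := Sum.inl G.source
  sink := Sum.inl G.sink

/-- The three admissible forms of a right-hand side of a rule. -/
inductive Rhs (A V : Type*)
  | letter (a : A)
  | series (v w : V)
  | parallel (v w : V)

/-- The graph of a right-hand side. -/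
def Rhs.graph {A V : Type*} : Rhs A V → Graph (A ⊕ V)
  | .letter a => ⟨Fin 2, inferInstance, {(0, 1, Sum.inl a)}, 0, 1⟩
  | .series v w => ⟨Fin 3, inferInstance, {(0, 1, Sum.inr v), (1, 2, Sum.inr w)}, 0, 2⟩
  | .parallel v w => ⟨Fin 2, inferInstance, {(0, 1, Sum.inr v), (0, 1, Sum.inr w)}, 0, 1⟩

/-- A series-parallel graph grammar over the alphabet `A` with variables `V` (both finite where the
grammar is used, so that the set of rules is finite). -/
structure SPGG (A V : Type*) where
  rules : Set (V × Rhs A V)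
  start : V

/-- The initial graph: a single edge labeled with the start variable. -/
def SPGG.initial {A V : Type*} (𝒢 : SPGG A V) : Graph (A ⊕ V) :=
  ⟨Fin 2, inferInstance, {(0, 1, Sum.inr 𝒢.start)}, 0, 1⟩

/-- The graphs reachable from the initial graph by derivation steps. -/
inductive SPGG.Derives {A V : Type*} (𝒢 : SPGG A V) : Graph (A ⊕ V) → Prop
  | init : 𝒢.Derives 𝒢.initial
  | step (G : Graph (A ⊕ V)) (e : G.Node × G.Node × (A ⊕ V)) (v : V) (ρ : Rhs A V) :
      𝒢.Derives G → e ∈ G.edges → e.2.2 = Sum.inr v → (v, ρ) ∈ 𝒢.rules →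
      𝒢.Derives (G.replace e ρ.graph)

/-- The graphs without variables that are derived by the grammar. -/
def SPGG.language {A V : Type*} (𝒢 : SPGG A V) : Set (Graph A) :=
  {G | 𝒢.Derives (G.mapLabel Sum.inl)}

/-- The symmetric closure: every edge is kept with direction `fwd`, and its reverse is added with
direction `bwd`. -/
def Graph.symmClosure {A : Type*} (G : Graph A) : Graph (A × Dir) where
  Node := G.Node
  finite_node := G.finite_node
  edges := (G.edges.map fun e => (e.1, e.2.1, (e.2.2, Dir.fwd))) +
    G.edges.map fun e => (e.2.1, e.1, (e.2.2, Dir.bwd))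
  source := G.source
  sink := G.sink

/-- `(G, κ)` is the symmetric closure of a derived graph together with a marking of at most `k` of
its nodes (the nodes that carry a register). -/
def SPGG.IsMarkedGraph {A V : Type*} (𝒢 : SPGG A V) (k : ℕ) (G : Graph (A × Dir))
    (κ : G.Node → Bool) : Prop :=
  (∃ H ∈ 𝒢.language, G = H.symmClosure) ∧ {x | κ x = true}.ncard ≤ k

/-! # Systems of machines and their runs -/

/-- A finite-state machine; `(q, (a, d), b, q', b') ∈ δ` allows it to go from state `q` to state
`q'` along an edge labeled `(a, d)`, reading `b` from and writing `b'` to the register at the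
source of this edge. -/
structure Machine (A Q : Type*) where
  start : Q
  δ : Set (Q × (A × Dir) × Bool × Q × Bool)

/-- A configuration of `m` machines on the graph `G`. -/
structure Config {A : Type*} (Q : Type*) (m : ℕ) (G : Graph (A × Dir)) where
  μ : G.Node → Set (Fin m × Q)
  β : G.Node → Bool
  located : ∀ i : Fin m, ∃! x : G.Node × Q, (i, x.2) ∈ μ x.1

/-- Initially all machines are at the source in their start state and all registers are `0`. -/
def Config.IsInitial {A Q : Type*} {m : ℕ} {G : Graph (A × Dir)} (M : Machine A Q)
    (γ : Config Q m G) : Prop :=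
  γ.μ G.source = {x | x.2 = M.start} ∧ (∀ x, x ≠ G.source → γ.μ x = ∅) ∧ ∀ x, γ.β x = false

/-- Machine `i` moves along the edge `e`. A machine reads and writes only at marked nodes; at other
nodes it behaves as if the register held the value `0` and it has to leave this value there. -/
def Step {A Q : Type*} {m : ℕ} {G : Graph (A × Dir)} (M : Machine A Q) (κ : G.Node → Bool)
    (i : Fin m) (e : G.Node × G.Node × (A × Dir)) (γ γ' : Config Q m G) : Prop :=
  e ∈ G.edges ∧ ∃ (q q' : Q) (b' : Bool),
    (i, q) ∈ γ.μ e.1 ∧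
    (κ e.1 = true → (q, e.2.2, γ.β e.1, q', b') ∈ M.δ) ∧
    (κ e.1 = false → b' = false ∧ (q, e.2.2, false, q', false) ∈ M.δ) ∧
    γ'.μ e.1 = γ.μ e.1 \ {(i, q)} ∧
    γ'.μ e.2.1 = γ.μ e.2.1 ∪ {(i, q')} ∧
    (∀ x, x ≠ e.1 → x ≠ e.2.1 → γ'.μ x = γ.μ x) ∧
    γ'.β e.1 = b' ∧
    ∀ x, x ≠ e.1 → γ'.β x = γ.β x

/-- A run of the system on `(G, κ)`, from an initial configuration; the `l`-th step is made by the
machine `mover l` along the edge `edge l`. (The successor relation never changes the graph, so a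
run of the transition system of a grammar is a run on one of the graphs of the grammar.) -/
structure Run {A Q : Type*} (M : Machine A Q) (m : ℕ) (G : Graph (A × Dir))
    (κ : G.Node → Bool) where
  length : ℕ
  config : Fin (length + 1) → Config Q m G
  mover : Fin length → Fin m
  edge : Fin length → G.Node × G.Node × (A × Dir)
  init : (config 0).IsInitial M
  step : ∀ l : Fin length, Step M κ (mover l) (edge l) (config l.castSucc) (config l.succ)

open Classical in
/-- The number of positions of a sequence of directions at which the direction changes. -/
noncomputable def reversals (l : List Dir) : ℕ :=
  (l.zip l.tail).countP fun x => decide (x.1 ≠ x.2)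

/-- The directions of the edges taken by machine `j`, in the order in which they are taken. -/
def Run.directions {A Q : Type*} {M : Machine A Q} {m : ℕ} {G : Graph (A × Dir)}
    {κ : G.Node → Bool} (ρ : Run M m G κ) (j : Fin m) : List Dir :=
  ((List.finRange ρ.length).filter fun l => ρ.mover l = j).map fun l => (ρ.edge l).2.2.2

/-- Every machine makes at most `r` reversals. -/
def Run.ReversalBounded {A Q : Type*} {M : Machine A Q} {m : ℕ} {G : Graph (A × Dir)}
    {κ : G.Node → Bool} (ρ : Run M m G κ) (r : ℕ) : Prop :=
  ∀ j : Fin m, reversals (ρ.directions j) ≤ r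

/-- Configuration properties: positive Boolean combinations of the properties "there is a node at
which the multiset of states of the machines contains `S`". -/
inductive ConfigProp (Q : Type*)
  | atom (S : Q → ℕ)
  | and (F F' : ConfigProp Q)
  | or (F F' : ConfigProp Q)

/-- The truth value of a positive Boolean combination, given those of the atoms. -/
def ConfigProp.Holds {Q : Type*} (val : (Q → ℕ) → Prop) : ConfigProp Q → Prop
  | .atom S => val S
  | .and F F' => F.Holds val ∧ F'.Holds val
  | .or F F' => F.Holds val ∨ F'.Holds val

/-- The atoms of a positive Boolean combination. -/
def ConfigProp.atoms {Q : Type*} : ConfigProp Q → List (Q → ℕ)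
  | .atom S => [S]
  | .and F F' => F.atoms ++ F'.atoms
  | .or F F' => F.atoms ++ F'.atoms

/-- The configuration `γ` satisfies `F`. -/
def Config.Satisfies {A Q : Type*} {m : ℕ} {G : Graph (A × Dir)} (γ : Config Q m G)
    (F : ConfigProp Q) : Prop :=
  F.Holds fun S => ∃ x : G.Node, ∀ q, S q ≤ {i : Fin m | (i, q) ∈ γ.μ x}.ncard

/-! # Automata -/

/-- An alphabet extended with the two end markers. -/
inductive Marked (α : Type*)
  | left
  | right
  | letter (a : α)

/-- The word `w` between end markers. -/
def Marked.wrap {α : Type*} (w : List α) : List (Marked α) :=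
  Marked.left :: w.map Marked.letter ++ [Marked.right]

def Marked.map {α β : Type*} (f : α → β) : Marked α → Marked β
  | .left => .left
  | .right => .right
  | .letter a => .letter (f a)

/-- The language of an NFA that reads words between end markers. -/
def markedLanguage {α σ : Type*} (N : NFA (Marked α) σ) : Language α :=
  {w | Marked.wrap w ∈ N.accepts}

/-- The product of two NFAs. -/
def nfaInter {α σ τ : Type*} (N : NFA α σ) (N' : NFA α τ) : NFA α (σ × τ) where
  step s a := {s' | s'.1 ∈ N.step s.1 a ∧ s'.2 ∈ N'.step s.2 a}
  start := {s | s.1 ∈ N.start ∧ s.2 ∈ N'.start}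
  accept := {s | s.1 ∈ N.accept ∧ s.2 ∈ N'.accept}

/-- The product of a family of NFAs. -/
def nfaInterFamily {ι α σ : Type*} (N : ι → NFA α σ) : NFA α (ι → σ) where
  step s a := {s' | ∀ i, s' i ∈ (N i).step (s i) a}
  start := {s | ∀ i, s i ∈ (N i).start}
  accept := {s | ∀ i, s i ∈ (N i).accept}

/-- The projection of an NFA to the first component of its alphabet. -/
def nfaProj {α β σ : Type*} (N : NFA (Marked (α × β)) σ) : NFA (Marked α) σ where
  step s a := {s' | ∃ c, Marked.map Prod.fst c = a ∧ s' ∈ N.step s c}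
  start := N.start
  accept := N.accept

/-- Two-way nondeterministic finite automata. -/
structure TwoNFA (α σ : Type*) where
  start : σ
  δ : Set (σ × α × σ × Dir)
  accept : Set σ

/-- One step on the word `u`; a configuration is a state with a head position. -/
def TwoNFA.Step {α σ : Type*} (N : TwoNFA α σ) (u : List α) (c c' : σ × ℤ) : Prop :=
  ∃ (a : α) (d : Dir), 0 ≤ c.2 ∧ u[c.2.toNat]? = some a ∧ (c.1, a, c'.1, d) ∈ N.δ ∧
    c'.2 = match d with
      | .fwd => c.2 + 1
      | .bwd => c.2 - 1

/-- A 2NFA accepts if it leaves the word, between end markers, on either side in an accepting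
state. -/
def TwoNFA.language {α σ : Type*} (N : TwoNFA (Marked α) σ) : Language α :=
  {w | ∃ q ∈ N.accept, ∃ i : ℤ, (i = -1 ∨ i = (Marked.wrap w).length) ∧
    Relation.ReflTransGen (N.Step (Marked.wrap w)) (N.start, 0) (q, i)}

/-- The standard conversion of a 2NFA to an NFA. After a prefix `u` of the input has been read, the
state `(X, T)` records how the 2NFA can leave `u` for the first time: to the right in state `q`
(`Sum.inl q`) or to the left in state `q` (`Sum.inr q`), where for `X` it starts in its start state
on the first letter of `u`, and a pair `(p, x) ∈ T` says that it can leave in the way `x` when it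
starts in state `p` on the last letter of `u`. -/
def TwoNFA.toNFA {α σ : Type*} (N : TwoNFA α σ) :
    NFA α (Set (σ ⊕ σ) × Set (σ × (σ ⊕ σ))) where
  step s a :=
    let back : σ → σ → Prop := fun p p' => ∃ p₁, (p, a, p₁, Dir.bwd) ∈ N.δ ∧ (p₁, Sum.inl p') ∈ s.2
    let T : Set (σ × (σ ⊕ σ)) := {x | ∃ p', Relation.ReflTransGen back x.1 p' ∧
      ((∃ q, x.2 = Sum.inl q ∧ (p', a, q, Dir.fwd) ∈ N.δ) ∨
        ∃ q p₁, x.2 = Sum.inr q ∧ (p', a, p₁, Dir.bwd) ∈ N.δ ∧ (p₁, Sum.inr q) ∈ s.2)}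
    {({x | (∃ p, Sum.inl p ∈ s.1 ∧ (p, x) ∈ T) ∨ ∃ q, x = Sum.inr q ∧ x ∈ s.1}, T)}
  start := {({Sum.inl N.start}, {x | x.2 = Sum.inr x.1})}
  accept := {s | ∃ q ∈ N.accept, Sum.inl q ∈ s.1 ∨ Sum.inr q ∈ s.1}

/-- Pushdown automata over the input alphabet `α` with states `σ` and stack alphabet `Γ`. -/
structure PDA (α σ Γ : Type*) [Finite α] [Finite σ] [Finite Γ] where
  start : σ
  bot : Γ
  δ : Set (σ × Option α × Γ × σ × List Γ)
  finite_δ : δ.Finite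

section PDA

variable {α σ τ Γ : Type*} [Finite α] [Finite σ] [Finite τ] [Finite Γ]

/-- One step; a configuration consists of a state, the remaining input and the stack. -/
def PDA.Step (P : PDA α σ Γ) (c c' : σ × List α × List Γ) : Prop :=
  ∃ (x : Option α) (g : Γ) (s t : List Γ), c.2.1 = x.toList ++ c'.2.1 ∧ c.2.2 = g :: s ∧
    c'.2.2 = t ++ s ∧ (c.1, x, g, c'.1, t) ∈ P.δ

instance {α : Type*} [Finite α] : Finite (Marked α) :=
  Finite.of_injective (β := Option (Option α))
    (fun x => match x with
      | .left => none
      | .right => some none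
      | .letter a => some (some a))
    (by rintro (_ | _ | a) (_ | _ | b) h <;> simp_all)

/-- A PDA accepts if it has read the whole word, between end markers, and the stack consists of the
start symbol alone. -/
def PDA.language (P : PDA (Marked α) σ Γ) : Language α :=
  {w | ∃ q, Relation.ReflTransGen P.Step (P.start, Marked.wrap w, [P.bot]) (q, [], [P.bot])}

/-- The states of the product of a PDA and an NFA. -/
inductive InterState (σ τ : Type*)
  | start
  | run (q : σ) (s : τ)
  | done

instance : Finite (InterState σ τ) :=
  Finite.of_injective (β := Option (Option (σ × τ)))
    (fun x => match x with
      | .start => none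
      | .done => some none
      | .run q s => some (some (q, s)))
    (by rintro (_ | ⟨a, b⟩ | _) (_ | ⟨c, d⟩ | _) h <;> simp_all)

/-- The transitions of the product of a PDA and an NFA. The product has a new start symbol `none`
below the stack of the PDA; it may remove the start symbol of the PDA, and stop, when the NFA is in
an accepting state. -/
inductive InterTrans (P : PDA α σ Γ) (N : NFA α τ) :
    InterState σ τ → Option α → Option Γ → InterState σ τ → List (Option Γ) → Prop
  | init (s : τ) (h : s ∈ N.start) :
      InterTrans P N .start none none (.run P.start s) [some P.bot, none]
  | read (q q' : σ) (s s' : τ) (a : α) (g : Γ) (t : List Γ)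
      (hP : (q, some a, g, q', t) ∈ P.δ) (hN : s' ∈ N.step s a) :
      InterTrans P N (.run q s) (some a) (some g) (.run q' s') (t.map some)
  | silent (q q' : σ) (s : τ) (g : Γ) (t : List Γ) (hP : (q, none, g, q', t) ∈ P.δ) :
      InterTrans P N (.run q s) none (some g) (.run q' s) (t.map some)
  | accept (q : σ) (s : τ) (h : s ∈ N.accept) :
      InterTrans P N (.run q s) none (some P.bot) .done []

theorem finite_of_stackWords {L : Set (List Γ)} (hL : L.Finite)
    {D : Set (σ × Option α × Γ × σ × List Γ)} (hD : ∀ x ∈ D, x.2.2.2.2 ∈ L) : D.Finite := by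
  have h : (Set.univ ×ˢ Set.univ ×ˢ Set.univ ×ˢ Set.univ ×ˢ L :
      Set (σ × Option α × Γ × σ × List Γ)).Finite :=
    Set.finite_univ.prod (Set.finite_univ.prod (Set.finite_univ.prod (Set.finite_univ.prod hL)))
  refine h.subset fun x hx => ?_
  simpa using hD x hx

/-- The product of a PDA and an NFA, a PDA for the intersection of their languages. -/
def PDA.inter (P : PDA α σ Γ) (N : NFA α τ) : PDA α (InterState σ τ) (Option Γ) where
  start := .start
  bot := none
  δ := {x | InterTrans P N x.1 x.2.1 x.2.2.1 x.2.2.2.1 x.2.2.2.2}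
  finite_δ := by
    refine finite_of_stackWords
      (L := {[some P.bot, none], []} ∪ (fun x => x.2.2.2.2.map some) '' P.δ)
      ((Set.toFinite _).union (P.finite_δ.image _)) ?_
    rintro ⟨a, b, c, d, e⟩ h
    cases h with
    | init s h => simp
    | read q q' s s' a g t hP hN => exact Or.inr ⟨_, hP, rfl⟩
    | silent q q' s g t hP => exact Or.inr ⟨_, hP, rfl⟩
    | accept q s h => simp

end PDA

/-! # The alphabets -/

/-- The rows of a word: one for every machine and each of the `r + 1` paths of this machine. -/
abbrev Row (m r : ℕ) := Fin m × Fin (r + 1)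

/-- A path index, one of `m * (r + 1)` values. -/
abbrev PathIndex (m r : ℕ) := Fin (m * (r + 1))

/-- The bound on the number of blocks: every machine has an initial block, and on each of its
`r + 1` paths it starts a new block at most once for each of the `k` registers. -/
abbrev blockBound (m r k : ℕ) : ℕ := m * (k * (r + 1) + 1)

/-- A row of a letter of the first type of the trace alphabet: an edge label (`none` is the padding
symbol), the register identifiers of the source and the target of the edge (`none` if there is no
register), and a path index. -/
structure TraceCell (A : Type*) (m r k : ℕ) where
  sym : Option A
  src : Option (Fin k)
  tgt : Option (Fin k)
  idx : PathIndex m r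

/-- The trace alphabet. -/
inductive TraceLetter (A : Type*) (m r k : ℕ)
  | edge (f : Row m r → TraceCell A m r k)
  | node (idx : Row m r → PathIndex m r)

/-- A row of a letter of the execution alphabet: a block number (`none` if the machine is not
active here), the value read and the value written, the successor state, and a row of the trace. -/
structure ExecCell (Q : Type*) (m r k : ℕ) where
  block : Option (Fin (blockBound m r k))
  read : Bool
  write : Bool
  state : Q
  row : Row m r

/-- The execution alphabet. -/
abbrev ExecLetter (Q : Type*) (m r k : ℕ) := Row m r → ExecCell Q m r k

/-- The product of the trace alphabet and the execution alphabet. -/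
abbrev Letter (A Q : Type*) (m r k : ℕ) := TraceLetter A m r k × ExecLetter Q m r k

instance {A : Type*} [Finite A] {m r k : ℕ} : Finite (TraceCell A m r k) :=
  Finite.of_injective (β := Option A × Option (Fin k) × Option (Fin k) × PathIndex m r)
    (fun c => (c.sym, c.src, c.tgt, c.idx))
    (by rintro ⟨_, _, _, _⟩ ⟨_, _, _, _⟩ h; simp_all)

instance {A : Type*} [Finite A] {m r k : ℕ} : Finite (TraceLetter A m r k) :=
  Finite.of_injective (β := (Row m r → TraceCell A m r k) ⊕ (Row m r → PathIndex m r))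
    (fun c => match c with
      | .edge f => Sum.inl f
      | .node i => Sum.inr i)
    (by rintro (_ | _) (_ | _) h <;> simp_all)

instance {Q : Type*} [Finite Q] {m r k : ℕ} : Finite (ExecCell Q m r k) :=
  Finite.of_injective (β := Option (Fin (blockBound m r k)) × Bool × Bool × Q × Row m r)
    (fun c => (c.block, c.read, c.write, c.state, c.row))
    (by rintro ⟨_, _, _, _, _⟩ ⟨_, _, _, _, _⟩ h; simp_all)

/-- The paths of a machine are alternately followed forwards and backwards, starting forwards. -/
def segDir {r : ℕ} (h : Fin (r + 1)) : Dir :=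
  if h.val % 2 = 0 then .fwd else .bwd

/-- The register identifier at the node that is left when the edge of `c` is taken in direction
`d`. -/
def TraceCell.reg {A : Type*} {m r k : ℕ} (d : Dir) (c : TraceCell A m r k) : Option (Fin k) :=
  match d with
  | .fwd => c.src
  | .bwd => c.tgt

/-! # The PDA for traces -/

/-- The variable `v` derives some graph without variables. -/
inductive SPGG.Productive {A V : Type*} (𝒢 : SPGG A V) : V → Prop
  | letter (v : V) (a : A) : (v, Rhs.letter a) ∈ 𝒢.rules → 𝒢.Productive v
  | series (v w w' : V) : (v, Rhs.series w w') ∈ 𝒢.rules → 𝒢.Productive w → 𝒢.Productive w' →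
      𝒢.Productive v
  | parallel (v w w' : V) : (v, Rhs.parallel w w') ∈ 𝒢.rules → 𝒢.Productive w →
      𝒢.Productive w' → 𝒢.Productive v

/-- The rows in `R` have the same path index, and no other two rows have the same path index. -/
def Shares {m r : ℕ} (R : Set (Row m r)) (idx : Row m r → PathIndex m r) : Prop :=
  ∀ i i', idx i = idx i' ↔ i = i' ∨ (i ∈ R ∧ i' ∈ R)

/-- Stack symbols: the start symbol, input symbols still to be matched, and variables `v` together
with the set `R` of rows whose traces run through the subgraph generated by `v`. -/
inductive TraceStack (A V : Type*) (m r k : ℕ)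
  | bot
  | input (x : Marked (TraceLetter A m r k))
  | var (v : V) (R : Set (Row m r))

instance {A V : Type*} [Finite A] [Finite V] {m r k : ℕ} : Finite (TraceStack A V m r k) :=
  Finite.of_injective (β := Option (Marked (TraceLetter A m r k) ⊕ (V × Set (Row m r))))
    (fun c => match c with
      | .bot => none
      | .input x => some (Sum.inl x)
      | .var v R => some (Sum.inr (v, R)))
    (by rintro (_ | _ | ⟨_, _⟩) (_ | _ | ⟨_, _⟩) h <;> simp_all)

/-- The transitions of the PDA obtained from the grammar. The state is `false` initially and `true`
afterwards. In a subgraph only the rows that run through it read edges, the others are padded; two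
parallel subgraphs are traversed one after the other, and at the common node of a series
composition, as well as at the source and at the sink of the graph, a letter with path indices shows
which rows meet there. -/
inductive TraceTrans {A V : Type*} (𝒢 : SPGG A V) (m r k : ℕ) :
    Bool → Option (Marked (TraceLetter A m r k)) → TraceStack A V m r k → Bool →
      List (TraceStack A V m r k) → Prop
  | init (idx idx' : Row m r → PathIndex m r) (h : Shares Set.univ idx)
      (h' : Shares Set.univ idx') :
      TraceTrans 𝒢 m r k false none .bot true
        [.input .left, .input (.letter (.node idx)), .var 𝒢.start Set.univ,
          .input (.letter (.node idx')), .input .right, .bot]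
  | match (x : Marked (TraceLetter A m r k)) :
      TraceTrans 𝒢 m r k true (some x) (.input x) true []
  | letter (v : V) (a : A) (R : Set (Row m r)) (f : Row m r → TraceCell A m r k)
      (hv : (v, Rhs.letter a) ∈ 𝒢.rules) (hin : ∀ i ∈ R, (f i).sym = some a)
      (hout : ∀ i ∉ R, (f i).sym = none) (hf : Shares R fun i => (f i).idx) :
      TraceTrans 𝒢 m r k true none (.var v R) true [.input (.letter (.edge f))]
  | series (v w w' : V) (R : Set (Row m r)) (idx : Row m r → PathIndex m r)
      (hv : (v, Rhs.series w w') ∈ 𝒢.rules) (h : Shares R idx) :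
      TraceTrans 𝒢 m r k true none (.var v R) true
        [.var w R, .input (.letter (.node idx)), .var w' R]
  | parallel (v w w' : V) (R₁ R₂ : Set (Row m r)) (hv : (v, Rhs.parallel w w') ∈ 𝒢.rules)
      (h₁ : R₁.Nonempty) (h₂ : R₂.Nonempty) (h : Disjoint R₁ R₂) :
      TraceTrans 𝒢 m r k true none (.var v (R₁ ∪ R₂)) true [.var w R₁, .var w' R₂]
  | parallelLeft (v w w' : V) (R : Set (Row m r)) (hv : (v, Rhs.parallel w w') ∈ 𝒢.rules)
      (hw' : 𝒢.Productive w') :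
      TraceTrans 𝒢 m r k true none (.var v R) true [.var w R]
  | parallelRight (v w w' : V) (R : Set (Row m r)) (hv : (v, Rhs.parallel w w') ∈ 𝒢.rules)
      (hw : 𝒢.Productive w) :
      TraceTrans 𝒢 m r k true none (.var v R) true [.var w' R]

/-- The PDA obtained from the grammar. -/
def grammarPDA {A V : Type*} [Finite A] [Finite V] (𝒢 : SPGG A V) (m r k : ℕ) :
    PDA (Marked (TraceLetter A m r k)) Bool (TraceStack A V m r k) where
  start := false
  bot := .bot
  δ := {x | TraceTrans 𝒢 m r k x.1 x.2.1 x.2.2.1 x.2.2.2.1 x.2.2.2.2}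
  finite_δ := by
    refine finite_of_stackWords (List.finite_length_le _ 6) ?_
    rintro ⟨a, b, c, d, e⟩ h
    cases h <;> simp

/-- The states of the NFA for register identifiers: for every row its path index at the last node
letter and the register identifier at its current node, and the set of the identifiers of the nodes
that have already been left by some row. -/
inductive RegState (m r k : ℕ)
  | start
  | track (l : Row m r → PathIndex m r) (ι : Row m r → Option (Fin k)) (U : Set (Fin k))
  | done

/-- The transitions of the NFA for register identifiers. At a node letter, rows that meet must have
the same identifier. When a row takes an edge, the identifier at the source must be the current one.
When a node with a register is left for the first time, all rows that currently have its identifier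
must be at this node, and from then on no row may enter a node with this identifier. -/
inductive RegTrans {A : Type*} {m r k : ℕ} :
    RegState m r k → Marked (TraceLetter A m r k) → RegState m r k → Prop
  | start (l : Row m r → PathIndex m r) (j : Option (Fin k)) :
      RegTrans .start .left (.track l (fun _ => j) ∅)
  | node (l idx : Row m r → PathIndex m r) (ι : Row m r → Option (Fin k)) (U : Set (Fin k))
      (h : ∀ i i', idx i = idx i' → ι i = ι i') :
      RegTrans (.track l ι U) (.letter (.node idx)) (.track idx ι U)
  | edge (l : Row m r → PathIndex m r) (ι ι' : Row m r → Option (Fin k)) (U U' : Set (Fin k))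
      (f : Row m r → TraceCell A m r k)
      (hsrc : ∀ i, (f i).sym ≠ none → (f i).src = ι i)
      (hι : ∀ i, (f i).sym ≠ none → ι' i = (f i).tgt)
      (hι' : ∀ i, (f i).sym = none → ι' i = ι i)
      (hU : U' = U ∪ {j | ∃ i, (f i).sym ≠ none ∧ ι i = some j})
      (hleave : ∀ i j, (f i).sym ≠ none → ι i = some j → j ∉ U →
        ∀ i', ι i' = some j → l i' = l i)
      (henter : ∀ i j, (f i).sym ≠ none → (f i).tgt = some j → j ∉ U') :
      RegTrans (.track l ι U) (.letter (.edge f)) (.track l ι' U')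
  | done (l : Row m r → PathIndex m r) (ι : Row m r → Option (Fin k)) (U : Set (Fin k)) :
      RegTrans (.track l ι U) .right .done

instance {m r k : ℕ} : Finite (RegState m r k) :=
  Finite.of_injective (β := Option (Option
      ((Row m r → PathIndex m r) × (Row m r → Option (Fin k)) × Set (Fin k))))
    (fun c => match c with
      | .start => none
      | .done => some none
      | .track l ι U => some (some (l, ι, U)))
    (by rintro (_ | ⟨_, _, _⟩ | _) (_ | ⟨_, _, _⟩ | _) h <;> simp_all)

/-- The NFA for register identifiers. -/
def registerNFA (A : Type*) (m r k : ℕ) : NFA (Marked (TraceLetter A m r k)) (RegState m r k) where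
  step s x := {s' | RegTrans s x s'}
  start := {.start}
  accept := {.done}

/-- The trace-checking PDA. -/
def tracePDA {A V : Type*} [Finite A] [Finite V] (𝒢 : SPGG A V) (m r k : ℕ) :
    PDA (Marked (TraceLetter A m r k)) (InterState Bool (RegState m r k))
      (Option (TraceStack A V m r k)) :=
  (grammarPDA 𝒢 m r k).inter (registerNFA A m r k)

/-! # The 2NFAs for executions -/

/-- Machine `n` is active on its path `h` at the symbol `x`. -/
def Active {A Q : Type*} {m r k : ℕ} (n : Fin m) (h : Fin (r + 1))
    (x : Marked (Letter A Q m r k)) : Prop :=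
  match x with
  | .letter (_, e) => (e (n, h)).block ≠ none
  | _ => False

/-- Before, during and after the part of the word in which the machine is active on a path. -/
inductive Phase
  | before
  | during
  | after

/-- `PhaseNext P a P'`: from phase `P`, phase `P'` is entered at a letter at which the machine is
active (`a` holds) or not. -/
inductive PhaseNext : Phase → Prop → Phase → Prop
  | wait (a : Prop) (h : ¬a) : PhaseNext .before a .before
  | begin (a : Prop) (h : a) : PhaseNext .before a .during
  | stay (a : Prop) (h : a) : PhaseNext .during a .during
  | finish (a : Prop) (h : ¬a) : PhaseNext .during a .after
  | rest (a : Prop) (h : ¬a) : PhaseNext .after a .after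

/-- The states of the 2NFA for the execution of a machine. In `sim h q i s` it simulates the machine
in state `q` on path `h`, reading row `i` of the trace; `s` tells if the machine has been active on
this path already. -/
inductive ExecState (Q : Type*) (m r : ℕ)
  | scan (φ : Fin (r + 1) → Phase)
  | rewind
  | sim (h : Fin (r + 1)) (q : Q) (i : Row m r) (s : Bool)
  | done

/-- A machine in state `q` that reads row `i` of the trace, in direction `d`, processes the trace
letter `a` as described by the cell `c`. It can change to another row only where the rows meet. -/
def Processes {A Q : Type*} {m r k : ℕ} (M : Machine A Q) (d : Dir) (a : TraceLetter A m r k)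
    (i : Row m r) (q : Q) (c : ExecCell Q m r k) : Prop :=
  match a with
  | .node idx => idx c.row = idx i ∧ c.state = q
  | .edge f => c.row = i ∧
    match (f i).sym with
    | none => c.state = q
    | some σ => (q, (σ, d), c.read, c.state, c.write) ∈ M.δ ∧
        ((f i).reg d = none → c.read = false ∧ c.write = false)

/-- The transitions of the 2NFA for the execution of machine `n`. A first pass over the word checks
that on each path the machine is active in a nonempty interval of the word. A second pass simulates
the machine, which follows its paths alternately forwards and backwards; it passes to the next path
where both intervals end. -/
inductive ExecTrans {A Q : Type*} (M : Machine A Q) {m r k : ℕ} (n : Fin m) :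
    ExecState Q m r → Marked (Letter A Q m r k) → ExecState Q m r → Dir → Prop
  | scanLeft (φ : Fin (r + 1) → Phase) : ExecTrans M n (.scan φ) .left (.scan φ) .fwd
  | scanLetter (φ φ' : Fin (r + 1) → Phase) (x : Letter A Q m r k)
      (h : ∀ h, PhaseNext (φ h) (Active n h (.letter x)) (φ' h)) :
      ExecTrans M n (.scan φ) (.letter x) (.scan φ') .fwd
  | scanRight (φ : Fin (r + 1) → Phase) (h : ∀ h, φ h ≠ .before) :
      ExecTrans M n (.scan φ) .right .rewind .bwd
  | rewind (x : Letter A Q m r k) : ExecTrans M n .rewind (.letter x) .rewind .bwd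
  | begin (i : Row m r) : ExecTrans M n .rewind .left (.sim 0 M.start i false) .fwd
  | move (h : Fin (r + 1)) (q : Q) (i : Row m r) (s : Bool) (a : TraceLetter A m r k)
      (e : ExecLetter Q m r k) (hact : Active n h (.letter (a, e)))
      (hc : Processes M (segDir h) a i q (e (n, h))) :
      ExecTrans M n (.sim h q i s) (.letter (a, e))
        (.sim h (e (n, h)).state (e (n, h)).row true) (segDir h)
  | turn (h h' : Fin (r + 1)) (q : Q) (i : Row m r) (x : Marked (Letter A Q m r k))
      (hh : h'.val = h.val + 1) (hx : ¬Active n h x) (hx' : ¬Active n h' x) :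
      ExecTrans M n (.sim h q i true) x (.sim h' q i false) (segDir h')
  | finish (q : Q) (i : Row m r) (x : Marked (Letter A Q m r k))
      (hx : ¬Active n (Fin.last r) x) :
      ExecTrans M n (.sim (Fin.last r) q i true) x .done .fwd
  | done (x : Marked (Letter A Q m r k)) : ExecTrans M n .done x .done .fwd

/-- The 2NFA for the execution of machine `n`. -/
def execTwoNFA {A Q : Type*} (M : Machine A Q) {m : ℕ} (r k : ℕ) (n : Fin m) :
    TwoNFA (Marked (Letter A Q m r k)) (ExecState Q m r) where
  start := .scan fun _ => .before
  δ := {x | ExecTrans M n x.1 x.2.1 x.2.2.1 x.2.2.2}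
  accept := Set.univ

/-! # The 2NFA for read-write consistency -/

/-- Valuations of the registers. -/
abbrev Valuation (k : ℕ) := Fin k → Bool

/-- Partial functions from block numbers to valuations: an assumption (guarantee) records the
valuations at the beginning (end) of blocks. -/
abbrev BlockMap (m r k : ℕ) := Fin (blockBound m r k) → Option (Valuation k)

/-- The current block of the current machine, the current valuation, the assumption and the
guarantee. The blocks seen so far are those at which the assumption is defined. -/
structure RWMemory (m r k : ℕ) where
  block : Option (Fin (blockBound m r k))
  val : Valuation k
  assumption : BlockMap m r k
  guarantee : BlockMap m r k

/-- The guarantee after the end of the current block, if any. -/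
def RWMemory.close {m r k : ℕ} (s : RWMemory m r k) : BlockMap m r k :=
  match s.block with
  | none => s.guarantee
  | some b => Function.update s.guarantee b (some s.val)

/-- The effect on the valuation of the operation described by the cell `c`: the value read must be
the current one. -/
def Operates {A Q : Type*} {m r k : ℕ} (d : Dir) (a : TraceLetter A m r k) (c : ExecCell Q m r k)
    (β β' : Valuation k) : Prop :=
  match a with
  | .node _ => β' = β
  | .edge f =>
    match (f c.row).sym, (f c.row).reg d with
    | some _, some j => c.read = β j ∧ β' = Function.update β j c.write
    | _, _ => β' = β

/-- Processing a cell. A new block must have a greater number than the current one and must not have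
occurred yet; the valuation at its beginning is guessed. -/
inductive RWStep {A Q : Type*} {m r k : ℕ} (d : Dir) (a : TraceLetter A m r k)
    (c : ExecCell Q m r k) : RWMemory m r k → RWMemory m r k → Prop
  | idle (s : RWMemory m r k) (h : c.block = none) : RWStep d a c s s
  | continue (s : RWMemory m r k) (b : Fin (blockBound m r k)) (β' : Valuation k)
      (hc : c.block = some b) (hs : s.block = some b) (hop : Operates d a c s.val β') :
      RWStep d a c s { s with val := β' }
  | new (s : RWMemory m r k) (b : Fin (blockBound m r k)) (β β' : Valuation k)
      (hc : c.block = some b) (hs : ∀ b', s.block = some b' → b' < b)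
      (hfresh : s.assumption b = none) (hop : Operates d a c β β') :
      RWStep d a c s ⟨some b, β', Function.update s.assumption b (some β), s.close⟩

/-- All assumptions are discharged: the first block begins with all registers `0`, and each other
block begins with the valuation at the end of the preceding one (which, therefore, has been seen). -/
def Discharged {m r k : ℕ} (assumption guarantee : BlockMap m r k) : Prop :=
  ∀ b β, assumption b = some β → (b.val = 0 ∧ β = fun _ => false) ∨
    ∃ b', b'.val + 1 = b.val ∧ guarantee b' = some β

/-- The states of the 2NFA for read-write consistency. In `sweep n h s` it passes over the word to
collect the operations of machine `n` on its path `h`. -/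
inductive RWState (m r k : ℕ)
  | start
  | sweep (n : Fin m) (h : Fin (r + 1)) (s : RWMemory m r k)
  | rewind (n : Fin m) (assumption guarantee : BlockMap m r k)
  | done

/-- The marker at which a pass in direction `d` ends. -/
def endMarker {α : Type*} (d : Dir) : Marked α :=
  match d with
  | .fwd => .right
  | .bwd => .left

/-- The transitions of the 2NFA for read-write consistency: for each machine in turn, it passes over
the word once for every path, in the direction of this path. -/
inductive RWTrans {A Q : Type*} {m r k : ℕ} :
    RWState m r k → Marked (Letter A Q m r k) → RWState m r k → Dir → Prop
  | start (n : Fin m) (hn : n.val = 0) :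
      RWTrans .start .left
        (.sweep n 0 ⟨none, fun _ => false, fun _ => none, fun _ => none⟩) .fwd
  | startEmpty (hm : m = 0) : RWTrans .start .left .done .fwd
  | letter (n : Fin m) (h : Fin (r + 1)) (s s' : RWMemory m r k) (a : TraceLetter A m r k)
      (e : ExecLetter Q m r k) (hs : RWStep (segDir h) a (e (n, h)) s s') :
      RWTrans (.sweep n h s) (.letter (a, e)) (.sweep n h s') (segDir h)
  | nextPath (n : Fin m) (h h' : Fin (r + 1)) (s : RWMemory m r k) (hh : h'.val = h.val + 1) :
      RWTrans (.sweep n h s) (endMarker (segDir h)) (.sweep n h' s) (segDir h')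
  | nextMachineRight (n n' : Fin m) (s : RWMemory m r k) (hn : n'.val = n.val + 1)
      (hd : segDir (Fin.last r) = .fwd) :
      RWTrans (.sweep n (Fin.last r) s) .right (.rewind n' s.assumption s.close) .bwd
  | rewind (n : Fin m) (x : Letter A Q m r k) (assumption guarantee : BlockMap m r k) :
      RWTrans (.rewind n assumption guarantee) (.letter x) (.rewind n assumption guarantee) .bwd
  | rewound (n : Fin m) (assumption guarantee : BlockMap m r k) :
      RWTrans (.rewind n assumption guarantee) .left
        (.sweep n 0 ⟨none, fun _ => false, assumption, guarantee⟩) .fwd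
  | nextMachineLeft (n n' : Fin m) (s : RWMemory m r k) (hn : n'.val = n.val + 1)
      (hd : segDir (Fin.last r) = .bwd) :
      RWTrans (.sweep n (Fin.last r) s) .left
        (.sweep n' 0 ⟨none, fun _ => false, s.assumption, s.close⟩) .fwd
  | finish (n : Fin m) (s : RWMemory m r k) (hn : n.val + 1 = m)
      (hs : Discharged s.assumption s.close) :
      RWTrans (.sweep n (Fin.last r) s) (endMarker (segDir (Fin.last r))) .done .fwd
  | done (x : Marked (Letter A Q m r k)) : RWTrans .done x .done .fwd

/-- The 2NFA for read-write consistency. -/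
def rwTwoNFA (A Q : Type*) (m r k : ℕ) :
    TwoNFA (Marked (Letter A Q m r k)) (RWState m r k) where
  start := .start
  δ := {x | RWTrans x.1 x.2.1 x.2.2.1 x.2.2.2}
  accept := {.done}

/-! # The NFA for configuration properties -/

/-- Between the consecutive symbols `c'` and `c''` machine `n` reaches the end of its last path, in
state `q` and on row `i` of the trace. The cell of the last letter that it processes is in `c'` if
it follows this path forwards, and in `c''` otherwise. -/
def EndsBetween {A Q : Type*} {m r k : ℕ} (c' c'' : Marked (Letter A Q m r k)) (n : Fin m)
    (i : Row m r) (q : Q) : Prop :=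
  match segDir (Fin.last r) with
  | .fwd => ¬Active n (Fin.last r) c'' ∧ ∃ x : Letter A Q m r k, c' = .letter x ∧
      (x.2 (n, Fin.last r)).block ≠ none ∧ (x.2 (n, Fin.last r)).row = i ∧
      (x.2 (n, Fin.last r)).state = q
  | .bwd => ¬Active n (Fin.last r) c' ∧ ∃ x : Letter A Q m r k, c'' = .letter x ∧
      (x.2 (n, Fin.last r)).block ≠ none ∧ (x.2 (n, Fin.last r)).row = i ∧
      (x.2 (n, Fin.last r)).state = q

/-- The rows in `I` have the same path index in the trace letter `a`, and none of them is padded. -/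
def TraceLetter.Meet {A : Type*} {m r k : ℕ} (a : TraceLetter A m r k) (I : Set (Row m r)) : Prop :=
  match a with
  | .node idx => ∀ i ∈ I, ∀ i' ∈ I, idx i = idx i'
  | .edge f => (∀ i ∈ I, (f i).sym ≠ none) ∧ ∀ i ∈ I, ∀ i' ∈ I, (f i).idx = (f i').idx

/-- The node predicate: machines whose multiset of states contains `S` reach, between `c'` and
`c''`, the end of their last paths, on rows that meet in one of these two letters. -/
def NodeProperty {A Q : Type*} {m r k : ℕ} (S : Q → ℕ) (c' c'' : Marked (Letter A Q m r k)) :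
    Prop :=
  ∃ (N : Set (Fin m)) (row : Fin m → Row m r) (state : Fin m → Q),
    (∀ n ∈ N, EndsBetween c' c'' n (row n) (state n)) ∧
    (∀ q, S q ≤ {n | n ∈ N ∧ state n = q}.ncard) ∧
    ∃ x : Letter A Q m r k, (c' = .letter x ∨ c'' = .letter x) ∧ x.1.Meet (row '' N)

/-- The states of the NFA for the configuration property `F`: the previous symbol and the set of the
atoms of `F` found to be true; `none` is the initial state. -/
abbrev PropState (A : Type*) {Q : Type*} (m r k : ℕ) (F : ConfigProp Q) :=
  Option (Marked (Letter A Q m r k) × Set {S // S ∈ F.atoms})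

/-- The NFA for the configuration property `F`. -/
def propertyNFA (A : Type*) {Q : Type*} (m r k : ℕ) (F : ConfigProp Q) :
    NFA (Marked (Letter A Q m r k)) (PropState A m r k F) where
  step s c := match s with
    | none => {some (c, ∅)}
    | some (c', X) => {some (c, X ∪ {S | NodeProperty S.1 c' c})}
  start := {none}
  accept := {s | ∃ c X, s = some (c, X) ∧ F.Holds fun S => ∃ h : S ∈ F.atoms, ⟨S, h⟩ ∈ X}

/-! # The PDA of the algorithm -/

instance : Finite Phase :=
  Finite.of_injective (β := Option Bool)
    (fun c => match c with
      | .before => none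
      | .during => some false
      | .after => some true)
    (by rintro (_ | _ | _) (_ | _ | _) h <;> simp_all)

instance {Q : Type*} [Finite Q] {m r : ℕ} : Finite (ExecState Q m r) :=
  Finite.of_injective
    (β := (Fin (r + 1) → Phase) ⊕ Bool ⊕ (Fin (r + 1) × Q × Row m r × Bool))
    (fun c => match c with
      | .scan φ => Sum.inl φ
      | .rewind => Sum.inr (Sum.inl false)
      | .done => Sum.inr (Sum.inl true)
      | .sim h q i s => Sum.inr (Sum.inr (h, q, i, s)))
    (by rintro (_ | _ | ⟨_, _, _, _⟩ | _) (_ | _ | ⟨_, _, _, _⟩ | _) h <;> simp_all)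

instance {m r k : ℕ} : Finite (RWMemory m r k) :=
  Finite.of_injective (β := Option (Fin (blockBound m r k)) × Valuation k × BlockMap m r k ×
      BlockMap m r k)
    (fun s => (s.block, s.val, s.assumption, s.guarantee))
    (by rintro ⟨_, _, _, _⟩ ⟨_, _, _, _⟩ h; simp_all)

instance {m r k : ℕ} : Finite (RWState m r k) :=
  Finite.of_injective (β := Bool ⊕ (Fin m × Fin (r + 1) × RWMemory m r k) ⊕
      (Fin m × BlockMap m r k × BlockMap m r k))
    (fun c => match c with
      | .start => Sum.inl false
      | .done => Sum.inl true
      | .sweep n h s => Sum.inr (Sum.inl (n, h, s))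
      | .rewind n a g => Sum.inr (Sum.inr (n, a, g)))
    (by rintro (_ | ⟨_, _, _⟩ | ⟨_, _, _⟩ | _) (_ | ⟨_, _, _⟩ | ⟨_, _, _⟩ | _) h <;> simp_all)

instance {Q : Type*} (F : ConfigProp Q) : Finite {S // S ∈ F.atoms} :=
  (List.finite_toSet F.atoms).to_subtype

/-- The states of the NFA for executions. -/
abbrev ExecNFAState (A : Type*) {Q : Type*} (m r k : ℕ) (F : ConfigProp Q) :=
  ((Fin m → Set (ExecState Q m r ⊕ ExecState Q m r) ×
      Set (ExecState Q m r × (ExecState Q m r ⊕ ExecState Q m r))) ×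
    Set (RWState m r k ⊕ RWState m r k) ×
      Set (RWState m r k × (RWState m r k ⊕ RWState m r k))) ×
  PropState A m r k F

/-- The NFA for executions: the intersection of the NFAs for the executions of the machines, for
read-write consistency and for the configuration property, projected to the trace alphabet. -/
def execNFA {A Q : Type*} (M : Machine A Q) (m r k : ℕ) (F : ConfigProp Q) :
    NFA (Marked (TraceLetter A m r k)) (ExecNFAState A m r k F) :=
  nfaProj
    (nfaInter
      (nfaInter
        (nfaInterFamily fun n : Fin m => (execTwoNFA M r k n).toNFA)
        (rwTwoNFA A Q m r k).toNFA)
      (propertyNFA A m r k F))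

/-- The PDA of the algorithm: the intersection of the trace-checking PDA and of the NFA for
executions. -/
def reachPDA {A V Q : Type*} [Finite A] [Finite V] [Finite Q] (M : Machine A Q) (m r k : ℕ)
    (𝒢 : SPGG A V) (F : ConfigProp Q) :
    PDA (Marked (TraceLetter A m r k))
      (InterState (InterState Bool (RegState m r k)) (ExecNFAState A m r k F))
      (Option (Option (TraceStack A V m r k))) :=
  (tracePDA 𝒢 m r k).inter (execNFA M m r k F)

end SPAutomata

/-!
By `mem_language_reachPDA`, the language of `reachPDA` is nonempty iff there is a word `w` over the
product of the trace alphabet and the execution alphabet which is accepted by the automata for the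
executions, for read-write consistency and for `F`, and whose projection to the trace alphabet is
accepted by the grammar PDA and the register NFA. The standard conversion of a two-way automaton
preserves the language because a crossing table determines that of a longer prefix
(`evalFrom_toNFA`). It remains to read off a run from such a word and to write down a word for a
run.

*Traces.* A graph of the grammar is the graph of a series-parallel tree (`exists_tree_of_mem_language`
and `Gen.exists_mem_language`). A word of the grammar PDA lists a linearization of this tree (`Lin`):
every row follows a path from the source to the sink, a parallel composition is listed one branch
after the other, and each branch is used by some rows or left out. During such a traversal no row
enters a node that some row has left already, so that rows which share a path index are at the same
node, and the conditions checked by the register NFA say that the identifiers in the letters name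
nodes injectively (`exists_isTrace_of_mem_language`).
Conversely, every family of paths, one for each row, is described by a word (`exists_isWord`).

*Soundness.* Acceptance by the two-way automata is reformulated in terms of the list of active cells
of each machine, in the order in which it follows its paths: `TrackChain` for the simulation of a
machine, and `BlocksConsistent` for the blocks. Executing the blocks in the order of their numbers
interleaves these lists (`BlocksConsistent.exists_interleaving`). A block is owned by one machine,
and its valuation at the beginning is that at the end of the preceding block, so the values read are
the current ones. Every cell with an edge label is then a step of the run, and the paths bound the
reversals (`exists_run_of_word`).

*Completeness.* In a run with at most `r` reversals each machine follows at most `r + 1` paths, the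
first of them forwards, because no edge enters the source. As every node lies on a walk from the
source to the sink, these paths extend to families of paths through the whole graph, and there is a
word for them (`Schedule.exists_placement`). The machine changes from one row to the next at the
node letter where its path ends. For the blocks, every register operation begins a new one: the
machines own one initial block each, and operation number `c` of the run is block `m + c`. A path
visits no node twice, so a machine performs at most `k` operations on each path and the block
numbers suffice (`Timeline.countBefore_op_le`). The machines that are finally at the same node end
at the node letter where the rows that visit this node meet, which is where the NFA for `F` finds
the atoms (`Placement.exists_nodeProperty`, `exists_word_of_run`).
-/

namespace SPAutomata

/-! ### Runs of nondeterministic automata -/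

/-- The NFA `N` can go from state `s` to state `s'` while it reads the given word. -/
def NRun {α σ : Type*} (N : NFA α σ) : σ → List α → σ → Prop
  | s, [], s' => s = s'
  | s, a :: w, s' => ∃ t ∈ N.step s a, NRun N t w s'

theorem mem_evalFrom_iff_nRun {α σ : Type*} (N : NFA α σ) (w : List α) (S : Set σ) (s' : σ) :
    s' ∈ N.evalFrom S w ↔ ∃ s ∈ S, NRun N s w s' := by
  induction w generalizing S with
  | nil => simp [NRun]
  | cons a w ih =>
    simp only [NFA.evalFrom_cons, ih, NFA.mem_stepSet, NRun]
    constructor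
    · rintro ⟨t, ⟨s, hs, ht⟩, h⟩; exact ⟨s, hs, t, ht, h⟩
    · rintro ⟨s, hs, t, ht, h⟩; exact ⟨t, ⟨s, hs, ht⟩, h⟩

theorem mem_accepts_iff_nRun {α σ : Type*} (N : NFA α σ) (w : List α) :
    w ∈ N.accepts ↔ ∃ s ∈ N.start, ∃ s' ∈ N.accept, NRun N s w s' := by
  rw [NFA.mem_accepts]
  simp only [mem_evalFrom_iff_nRun]
  constructor
  · rintro ⟨s', h', s, h, hr⟩; exact ⟨s, h, s', h', hr⟩
  · rintro ⟨s, h, s', h', hr⟩; exact ⟨s', h', s, h, hr⟩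

theorem nRun_append {α σ : Type*} {N : NFA α σ} {w w' : List α} {s s' : σ} :
    NRun N s (w ++ w') s' ↔ ∃ t, NRun N s w t ∧ NRun N t w' s' := by
  induction w generalizing s with
  | nil => simp [NRun]
  | cons a w ih =>
    simp only [List.cons_append, NRun, ih]
    constructor
    · rintro ⟨t, ht, u, h, h'⟩; exact ⟨u, ⟨t, ht, h⟩, h'⟩
    · rintro ⟨u, ⟨t, ht, h⟩, h'⟩; exact ⟨t, ht, u, h, h'⟩

theorem mem_accepts_nfaInter {α σ τ : Type*} (N : NFA α σ) (N' : NFA α τ) (w : List α) :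
    w ∈ (nfaInter N N').accepts ↔ w ∈ N.accepts ∧ w ∈ N'.accepts := by
  have key : ∀ (w : List α) (s s' : σ × τ),
      NRun (nfaInter N N') s w s' ↔ NRun N s.1 w s'.1 ∧ NRun N' s.2 w s'.2 := by
    intro w
    induction w with
    | nil => intro s s'; simp [NRun, Prod.ext_iff]
    | cons a w ih =>
      intro s s'
      simp only [NRun, ih]
      constructor
      · rintro ⟨t, ⟨h1, h2⟩, h3, h4⟩; exact ⟨⟨_, h1, h3⟩, _, h2, h4⟩
      · rintro ⟨⟨t, h1, h3⟩, t', h2, h4⟩; exact ⟨(t, t'), ⟨h1, h2⟩, h3, h4⟩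
  simp only [mem_accepts_iff_nRun, key]
  constructor
  · rintro ⟨s, ⟨h1, h2⟩, s', ⟨h3, h4⟩, h5, h6⟩
    exact ⟨⟨_, h1, _, h3, h5⟩, _, h2, _, h4, h6⟩
  · rintro ⟨⟨_, h1, _, h3, h5⟩, _, h2, _, h4, h6⟩
    exact ⟨(_, _), ⟨h1, h2⟩, (_, _), ⟨h3, h4⟩, h5, h6⟩

theorem mem_accepts_nfaInterFamily {ι α σ : Type*} (N : ι → NFA α σ) (w : List α) :
    w ∈ (nfaInterFamily N).accepts ↔ ∀ i, w ∈ (N i).accepts := by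
  have key : ∀ (w : List α) (s s' : ι → σ),
      NRun (nfaInterFamily N) s w s' ↔ ∀ i, NRun (N i) (s i) w (s' i) := by
    intro w
    induction w with
    | nil => intro s s'; simp [NRun, funext_iff]
    | cons a w ih =>
      intro s s'
      simp only [NRun, ih]
      constructor
      · rintro ⟨t, h1, h2⟩ i; exact ⟨_, h1 i, h2 i⟩
      · intro h
        choose t h1 h2 using h
        exact ⟨t, h1, h2⟩
  simp only [mem_accepts_iff_nRun, key]
  constructor
  · rintro ⟨s, h1, s', h3, h5⟩ i
    exact ⟨_, h1 i, _, h3 i, h5 i⟩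
  · intro h
    choose s h1 s' h3 h5 using h
    exact ⟨s, h1, s', h3, h5⟩

theorem mem_accepts_nfaProj {α β σ : Type*} (N : NFA (Marked (α × β)) σ) (w : List α) :
    Marked.wrap w ∈ (nfaProj N).accepts ↔
      ∃ w' : List (α × β), w'.map Prod.fst = w ∧ Marked.wrap w' ∈ N.accepts := by
  have key : ∀ (w : List (Marked α)) (s s' : σ),
      NRun (nfaProj N) s w s' ↔ ∃ w', w'.map (Marked.map Prod.fst) = w ∧ NRun N s w' s' := by
    intro w
    induction w with
    | nil => intro s s'; simp [NRun]
    | cons a w ih =>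
      intro s s'
      simp only [NRun, ih]
      constructor
      · rintro ⟨t, ⟨c, rfl, hc⟩, w', rfl, h⟩
        exact ⟨c :: w', by simp, t, hc, h⟩
      · rintro ⟨w', hw', h⟩
        cases w' with
        | nil => simp at hw'
        | cons c w' =>
          simp only [List.map_cons, List.cons.injEq] at hw'
          obtain ⟨t, ht, h⟩ := h
          exact ⟨t, ⟨c, hw'.1, ht⟩, w', hw'.2, h⟩
  have unwrap : ∀ (u : List (Marked (α × β))), u.map (Marked.map Prod.fst) = Marked.wrap w →
      ∃ w' : List (α × β), w'.map Prod.fst = w ∧ u = Marked.wrap w' := by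
    intro u hu
    have letters : ∀ (w : List α) (u : List (Marked (α × β))),
        u.map (Marked.map Prod.fst) = w.map Marked.letter ++ [Marked.right] →
        ∃ w' : List (α × β), w'.map Prod.fst = w ∧ u = w'.map Marked.letter ++ [Marked.right] := by
      intro w
      induction w with
      | nil =>
        intro u hu
        refine ⟨[], rfl, ?_⟩
        rcases u with _ | ⟨c, _ | ⟨d, u⟩⟩
        · simp at hu
        · cases c <;> simp_all [Marked.map]
        · simp at hu
      | cons a w ih =>
        intro u hu
        rcases u with _ | ⟨c, u⟩
        · simp at hu
        · simp only [List.map_cons, List.cons_append, List.cons.injEq] at hu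
          obtain ⟨w', h1, h2⟩ := ih u hu.2
          rcases c with _ | _ | x
          · simp [Marked.map] at hu
          · simp [Marked.map] at hu
          · simp only [Marked.map, Marked.letter.injEq] at hu
            exact ⟨x :: w', by simp [h1, hu.1], by simp [h2]⟩
    rcases u with _ | ⟨c, u⟩
    · simp [Marked.wrap] at hu
    · simp only [Marked.wrap, List.map_cons, List.cons_append, List.cons.injEq] at hu
      obtain ⟨w', h1, h2⟩ := letters w u hu.2
      refine ⟨w', h1, ?_⟩
      rcases c with _ | _ | x
      · simp [Marked.wrap, h2]
      · simp [Marked.map] at hu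
      · simp [Marked.map] at hu
  simp only [mem_accepts_iff_nRun, key]
  constructor
  · rintro ⟨s, h1, s', h2, u, h3, h4⟩
    obtain ⟨w', h5, rfl⟩ := unwrap u h3
    exact ⟨w', h5, s, h1, s', h2, h4⟩
  · rintro ⟨w', rfl, s, h1, s', h2, h4⟩
    refine ⟨s, h1, s', h2, _, ?_, h4⟩
    simp [Marked.wrap, Marked.map, Function.comp_def]

/-! ### The conversion of two-way automata -/

section TwoWay

variable {α σ : Type*} (N : TwoNFA α σ)

/-- The head position at which the way `x` of leaving a word of length `n` ends. -/
def exitPos (n : ℕ) : σ ⊕ σ → σ × ℤ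
  | .inl q => (q, n)
  | .inr q => (q, -1)

/-- The state of the converted automaton after the word `u`. -/
def crossing (u : List α) : Set (σ ⊕ σ) × Set (σ × (σ ⊕ σ)) :=
  ({x | Relation.ReflTransGen (N.Step u) (N.start, 0) (exitPos u.length x)},
    {y | Relation.ReflTransGen (N.Step u) (y.1, (u.length : ℤ) - 1) (exitPos u.length y.2)})

variable {N}

theorem TwoNFA.Step.append {u : List α} {a : α} {c c' : σ × ℤ} (h : N.Step u c c') :
    N.Step (u ++ [a]) c c' := by
  obtain ⟨b, d, h0, hb, h⟩ := h
  refine ⟨b, d, h0, ?_, h⟩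
  have := (List.getElem?_eq_some_iff.1 hb).1
  rw [List.getElem?_append_left this, hb]

theorem TwoNFA.Step.pos_lt {u : List α} {c c' : σ × ℤ} (h : N.Step u c c') :
    0 ≤ c.2 ∧ c.2 < u.length := by
  obtain ⟨b, d, h0, hb, h⟩ := h
  have := (List.getElem?_eq_some_iff.1 hb).1
  omega

theorem TwoNFA.Step.of_append {u : List α} {a : α} {c c' : σ × ℤ} (h : N.Step (u ++ [a]) c c')
    (hc : c.2 < u.length) : N.Step u c c' := by
  obtain ⟨b, d, h0, hb, h⟩ := h
  refine ⟨b, d, h0, ?_, h⟩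
  rwa [List.getElem?_append_left (by omega)] at hb

theorem TwoNFA.reflTransGen_append {u : List α} {a : α} {c c' : σ × ℤ}
    (h : Relation.ReflTransGen (N.Step u) c c') :
    Relation.ReflTransGen (N.Step (u ++ [a])) c c' :=
  Relation.ReflTransGen.mono (fun _ _ h => TwoNFA.Step.append h) _ _ h

/-- No step is possible once the head has left the word. -/
theorem TwoNFA.eq_of_reflTransGen {u : List α} {c c' : σ × ℤ}
    (h : Relation.ReflTransGen (N.Step u) c c') (hc : c.2 < 0 ∨ u.length ≤ c.2) : c = c' := by
  rcases Relation.ReflTransGen.cases_head h with rfl | ⟨d, hd, -⟩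
  · rfl
  · have := hd.pos_lt
    omega

/-- One step of the conversion extends the crossing information by one letter. The decomposition of
a computation on `u ++ [a]` follows its visits of the last letter. -/
theorem crossing_append (u : List α) (a : α) :
    N.toNFA.step (crossing N u) a = {crossing N (u ++ [a])} := by
  simp only [TwoNFA.toNFA, Set.singleton_eq_singleton_iff]
  set T : Set (σ × (σ ⊕ σ)) := {x | ∃ p', Relation.ReflTransGen (fun p p' => ∃ p₁,
      (p, a, p₁, Dir.bwd) ∈ N.δ ∧ (p₁, Sum.inl p') ∈ (crossing N u).2) x.1 p' ∧
      ((∃ q, x.2 = Sum.inl q ∧ (p', a, q, Dir.fwd) ∈ N.δ) ∨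
        ∃ q p₁, x.2 = Sum.inr q ∧ (p', a, p₁, Dir.bwd) ∈ N.δ ∧
          (p₁, Sum.inr q) ∈ (crossing N u).2)} with hT
  have hlast : ∀ {p q d i}, (p, a, q, d) ∈ N.δ →
      (i = match d with
      | Dir.fwd => (u.length : ℤ) + 1
      | Dir.bwd => (u.length : ℤ) - 1) → N.Step (u ++ [a]) (p, u.length) (q, i) := by
    intro p q d i h hi
    exact ⟨a, d, by simp, by simp, h, hi⟩
  have len : ((u ++ [a]).length : ℤ) = u.length + 1 := by simp
  -- Exits found by the conversion are exits of the two-way automaton.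
  have sound : ∀ p x, (p, x) ∈ T →
      Relation.ReflTransGen (N.Step (u ++ [a])) (p, u.length) (exitPos (u ++ [a]).length x) := by
    rintro p x ⟨p', hp', h⟩
    have h1 : Relation.ReflTransGen (N.Step (u ++ [a])) (p, (u.length : ℤ)) (p', u.length) := by
      clear h
      simp only at hp'
      induction hp' with
      | refl => exact .refl
      | tail _ h ih =>
        obtain ⟨p₁, h2, h3⟩ := h
        exact ih.trans (.head (hlast h2 rfl) (TwoNFA.reflTransGen_append h3))
    refine h1.trans ?_
    rcases h with ⟨q, hq, h⟩ | ⟨q, p₁, hq, h, h'⟩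
    · simp only at hq
      subst hq
      refine .single (hlast h ?_)
      simp
    · simp only at hq
      subst hq
      exact .head (hlast h rfl) (TwoNFA.reflTransGen_append h')
  have complete : ∀ c x,
      Relation.ReflTransGen (N.Step (u ++ [a])) c (exitPos (u ++ [a]).length x) →
      (∃ p', Relation.ReflTransGen (N.Step u) c (p', u.length) ∧ (p', x) ∈ T) ∨
      (∃ q, x = Sum.inr q ∧ Relation.ReflTransGen (N.Step u) c (q, -1)) ∨
      (x = Sum.inl c.1 ∧ c.2 = u.length + 1) := by
    intro c x h
    induction h using Relation.ReflTransGen.head_induction_on with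
    | refl =>
      rcases x with q | q
      · exact Or.inr (Or.inr ⟨rfl, by simp [exitPos]⟩)
      · exact Or.inr (Or.inl ⟨q, rfl, .refl⟩)
    | head h h' ih =>
      rename_i c c'
      have hpos := h.pos_lt
      rw [len] at hpos
      rcases lt_or_eq_of_le (show c.2 ≤ u.length by omega) with hlt | heq
      · have hs := h.of_append hlt
        rcases ih with ⟨p', h1, h2⟩ | ⟨q, h1, h2⟩ | ⟨h1, h2⟩
        · exact Or.inl ⟨p', .head hs h1, h2⟩
        · exact Or.inr (Or.inl ⟨q, h1, .head hs h2⟩)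
        · obtain ⟨b, d, -, -, -, h5⟩ := h
          cases d <;> simp only at h5 <;> omega
      · obtain ⟨b, d, h0, hb, hδ, h5⟩ := h
        obtain ⟨p, i⟩ := c
        obtain ⟨p₁, i'⟩ := c'
        simp only at heq hδ h5 h0 hb
        subst heq
        have : b = a := by simpa using hb.symm
        subst this
        refine Or.inl ⟨p, .refl, ?_⟩
        cases d with
        | fwd =>
          simp only at h5
          subst h5
          rcases ih with ⟨p', h1, h2⟩ | ⟨q, h1, h2⟩ | ⟨h1, h2⟩
          · have := TwoNFA.eq_of_reflTransGen h1 (Or.inr (by simp))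
            simp [Prod.ext_iff] at this
          · have := TwoNFA.eq_of_reflTransGen h2 (Or.inr (by simp))
            simp only [Prod.ext_iff] at this
            omega
          · exact ⟨p, .refl, Or.inl ⟨p₁, h1, hδ⟩⟩
        | bwd =>
          simp only at h5
          subst h5
          rcases ih with ⟨p', h1, h2⟩ | ⟨q, h1, h2⟩ | ⟨h1, h2⟩
          · obtain ⟨p'', h3, h4⟩ := h2
            exact ⟨p'', .head ⟨p₁, hδ, h1⟩ h3, h4⟩
          · exact ⟨p, .refl, Or.inr ⟨q, p₁, h1, hδ, h2⟩⟩
          · simp only at h2; omega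
  have hTeq : T = (crossing N (u ++ [a])).2 := by
    ext ⟨p, x⟩
    constructor
    · intro h
      have := sound p x h
      simpa [crossing] using this
    · intro h
      have h' : Relation.ReflTransGen (N.Step (u ++ [a])) (p, (u.length : ℤ))
          (exitPos (u ++ [a]).length x) := by
        have h' : Relation.ReflTransGen (N.Step (u ++ [a])) (p, ((u ++ [a]).length : ℤ) - 1)
          (exitPos (u ++ [a]).length x) := h
        rwa [len, add_sub_cancel_right] at h'
      rcases complete _ x h' with ⟨p', h1, h2⟩ | ⟨q, h1, h2⟩ | ⟨h1, h2⟩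
      · have := TwoNFA.eq_of_reflTransGen h1 (Or.inr (by simp))
        simp only [Prod.mk.injEq, and_true] at this
        rwa [this]
      · have := TwoNFA.eq_of_reflTransGen h2 (Or.inr (by simp))
        simp only [Prod.ext_iff] at this
        omega
      · simp only at h2; omega
  refine Prod.ext ?_ hTeq
  ext x
  constructor
  · rintro (⟨p, h1, h2⟩ | ⟨q, rfl, h⟩)
    · exact (TwoNFA.reflTransGen_append h1).trans (sound p x h2)
    · exact TwoNFA.reflTransGen_append h
  · intro h
    rcases complete _ x h with ⟨p', h1, h2⟩ | ⟨q, h1, h2⟩ | ⟨h1, h2⟩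
    · exact Or.inl ⟨p', h1, h2⟩
    · exact Or.inr ⟨q, h1, by subst h1; exact h2⟩
    · simp only at h2; omega

theorem crossing_nil : N.toNFA.start = {crossing N []} := by
  simp only [TwoNFA.toNFA, Set.singleton_eq_singleton_iff, crossing, Prod.mk.injEq]
  constructor
  · ext x
    constructor
    · rintro rfl; exact .refl
    · intro h
      have := TwoNFA.eq_of_reflTransGen h (Or.inr (by simp))
      rcases x with q | q <;> simp_all [exitPos, Prod.ext_iff]
  · ext ⟨p, x⟩
    constructor
    · intro h
      have h' : x = Sum.inr p := h
      subst h'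
      exact .refl
    · intro h
      have := TwoNFA.eq_of_reflTransGen h (Or.inl (by simp))
      rcases x with q | q <;> simp_all [exitPos, Prod.ext_iff]

theorem evalFrom_toNFA (u : List α) :
    N.toNFA.evalFrom N.toNFA.start u = {crossing N u} := by
  induction u using List.reverseRecOn with
  | nil => exact crossing_nil
  | append_singleton u a ih =>
    rw [NFA.evalFrom_append, ih, NFA.evalFrom_singleton, NFA.stepSet_singleton, crossing_append]

end TwoWay

/-- The conversion of a 2NFA to an NFA is correct. -/
theorem TwoNFA.mem_accepts_toNFA {α σ : Type*} (N : TwoNFA (Marked α) σ) (w : List α) :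
    Marked.wrap w ∈ N.toNFA.accepts ↔ w ∈ N.language := by
  rw [NFA.mem_accepts, evalFrom_toNFA]
  constructor
  · rintro ⟨s, ⟨q, hq, h⟩, rfl⟩
    rcases h with h | h
    · exact ⟨q, hq, _, Or.inr rfl, h⟩
    · exact ⟨q, hq, _, Or.inl rfl, h⟩
  · rintro ⟨q, hq, i, rfl | rfl, h⟩
    · exact ⟨crossing N (Marked.wrap w), ⟨q, hq, Or.inr h⟩, rfl⟩
    · exact ⟨crossing N (Marked.wrap w), ⟨q, hq, Or.inl h⟩, rfl⟩

/-! ### The product of a pushdown automaton and an NFA -/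

section Product

variable {α σ τ Γ : Type*} [Finite α] [Finite σ] [Finite τ] [Finite Γ]

/-- An accepting run of the product splits into an accepting run of `P` and an accepting run of `N`. The
product has its own bottom symbol `none`, below the stack of `P`. -/
theorem nRun_of_inter {P : PDA α σ Γ} {N : NFA α τ}
    (hbot : ∀ q x q' t, (q, x, P.bot, q', t) ∈ P.δ → P.bot ∈ t) {q' : InterState σ τ}
    {c : InterState σ τ × List α × List (Option Γ)}
    (hc : Relation.ReflTransGen (P.inter N).Step c (q', [], [none])) :
    ∀ q s w st, c = (.run q s, w, st.map some ++ [none]) → P.bot ∈ st →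
      ∃ q'' s'', Relation.ReflTransGen P.Step (q, w, st) (q'', [], [P.bot]) ∧ NRun N s w s'' ∧
        s'' ∈ N.accept := by
  induction hc using Relation.ReflTransGen.head_induction_on with
  | refl =>
    intro q s w st h hst
    cases st with
    | nil => simp at hst
    | cons g st => simp at h
  | head h h' ih =>
    rename_i c c'
    rintro q s w st rfl hst
    obtain ⟨x, g, s₁, t, h1, h2, h3, h4⟩ := h
    obtain ⟨q₂, w₂, st₂⟩ := c'
    simp only at h1 h2 h3
    have h4' : InterTrans P N (.run q s) x g q₂ t := h4
    cases st with
    | nil => simp at hst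
    | cons g' st =>
      simp only [List.map_cons, List.cons_append, List.cons.injEq] at h2
      obtain ⟨rfl, rfl⟩ := h2
      subst h1 h3
      have mem : ∀ t', (∃ q x q', (q, x, g', q', t') ∈ P.δ) → P.bot ∈ t' ++ st := by
        rintro t' ⟨q, x, q', h⟩
        rcases List.mem_cons.1 hst with rfl | h'
        · exact List.mem_append_left _ (hbot _ _ _ _ h)
        · exact List.mem_append_right _ h'
      cases h4' with
      | read _ q₂ _ s₂ a _ t' hP hN =>
        obtain ⟨q'', s'', h5, h6, h7⟩ := ih q₂ s₂ w₂ (t' ++ st) (by simp) (mem _ ⟨_, _, _, hP⟩)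
        exact ⟨q'', s'', .head ⟨some a, g', st, t', rfl, rfl, rfl, hP⟩ h5, ⟨s₂, hN, h6⟩, h7⟩
      | silent _ q₂ _ _ t' hP =>
        obtain ⟨q'', s'', h5, h6, h7⟩ := ih q₂ s w₂ (t' ++ st) (by simp) (mem _ ⟨_, _, _, hP⟩)
        exact ⟨q'', s'', .head ⟨none, g', st, t', rfl, rfl, rfl, hP⟩ h5, h6, h7⟩
      | accept _ _ h =>
        rcases Relation.ReflTransGen.cases_head h' with heq | ⟨d, ⟨_, _, _, _, _, _, _, hd⟩, -⟩
        · simp only [List.nil_append, Prod.mk.injEq] at heq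
          obtain ⟨-, rfl, heq⟩ := heq
          cases st with
          | nil => exact ⟨q, s, .refl, rfl, h⟩
          | cons _ _ => exact absurd (congrArg List.length heq) (by simp)
        · have hd' : InterTrans P N .done _ _ _ _ := hd
          cases hd'

/-- A run of `P` and a run of `N` on the same input combine to a run of the product. -/
theorem PDA.reflTransGen_inter {P : PDA α σ Γ} {N : NFA α τ} {c c' : σ × List α × List Γ}
    (hc : Relation.ReflTransGen P.Step c c') {s s' : τ}
    (hs : ∃ u, c.2.1 = u ++ c'.2.1 ∧ NRun N s u s') :
    Relation.ReflTransGen (P.inter N).Step (.run c.1 s, c.2.1, c.2.2.map some ++ [none])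
      (.run c'.1 s', c'.2.1, c'.2.2.map some ++ [none]) := by
  induction hc using Relation.ReflTransGen.head_induction_on generalizing s with
  | refl =>
    obtain ⟨u, hu, h⟩ := hs
    have : u = [] := by simpa using hu
    subst this
    cases h
    exact .refl
  | head h h' ih =>
    rename_i c c₁
    obtain ⟨u, hu, hr⟩ := hs
    obtain ⟨x, g, s₁, t, h1, h2, h3, h4⟩ := h
    have hsuf : ∀ {c c' : σ × List α × List Γ}, Relation.ReflTransGen P.Step c c' →
        ∃ u, c.2.1 = u ++ c'.2.1 := by
      intro c c' h
      induction h using Relation.ReflTransGen.head_induction_on with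
      | refl => exact ⟨[], rfl⟩
      | head h _ ih =>
        obtain ⟨x, g, s₁, t, h1, _⟩ := h
        obtain ⟨u, hu⟩ := ih
        exact ⟨x.toList ++ u, by rw [h1, hu, List.append_assoc]⟩
    obtain ⟨u₁, hu₁⟩ := hsuf h'
    have hu₂ : u = x.toList ++ u₁ := by
      have : u ++ c'.2.1 = (x.toList ++ u₁) ++ c'.2.1 := by
        rw [← hu, h1, hu₁, List.append_assoc]
      exact List.append_cancel_right this
    cases x with
    | none =>
      simp only [Option.toList_none, List.nil_append] at h1 hu₂
      subst hu₂
      refine .head ⟨none, some g, s₁.map some ++ [none], t.map some, ?_, ?_, ?_, ?_⟩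
        (ih ⟨u, hu₁, hr⟩)
      · simp [h1]
      · simp [h2]
      · simp [h3]
      · exact InterTrans.silent _ _ _ _ _ h4
    | some a =>
      simp only [Option.toList_some, List.singleton_append] at h1 hu₂
      subst hu₂
      obtain ⟨s₂, hs₂, hr⟩ := hr
      refine .head ⟨some a, some g, s₁.map some ++ [none], t.map some, ?_, ?_, ?_, ?_⟩
        (ih ⟨u₁, hu₁, hr⟩)
      · simp [h1]
      · simp [h2]
      · simp [h3]
      · exact InterTrans.read _ _ _ _ _ _ _ h4 hs₂

/-- The product of a PDA, which never removes its start symbol, with an NFA accepts the intersection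
of their languages. -/
theorem PDA.mem_language_inter (P : PDA (Marked α) σ Γ) (N : NFA (Marked α) τ)
    (hbot : ∀ q x q' t, (q, x, P.bot, q', t) ∈ P.δ → P.bot ∈ t) (w : List α) :
    w ∈ (P.inter N).language ↔ w ∈ P.language ∧ Marked.wrap w ∈ N.accepts := by
  rw [mem_accepts_iff_nRun]
  constructor
  · rintro ⟨q, h⟩
    rcases Relation.ReflTransGen.cases_head h with h | ⟨d, ⟨x, g, s, t, h1, h2, h3, h4⟩, h⟩
    · simp [Marked.wrap] at h
    · obtain ⟨q₂, w₂, st₂⟩ := d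
      have h4' : InterTrans P N .start x g q₂ t := h4
      cases h4' with
      | init s₀ hs₀ =>
        simp only [Option.toList_none, List.nil_append] at h1
        subst h1
        have : s = [] := by
          have : (P.inter N).bot = none := rfl
          simp_all
        subst this
        simp only at h3
        subst h3
        obtain ⟨q'', s'', h5, h6, h7⟩ :=
          nRun_of_inter hbot h P.start s₀ (Marked.wrap w) [P.bot] (by simp) (by simp)
        exact ⟨⟨q'', h5⟩, s₀, hs₀, s'', h7, h6⟩
  · rintro ⟨⟨q, h⟩, s, hs, s', hs', hr⟩
    refine ⟨.done, ?_⟩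
    refine .head (b := (InterState.run P.start s, Marked.wrap w, [some P.bot, none]))
      ⟨none, none, [], [some P.bot, none], rfl, rfl, rfl,
        InterTrans.init s hs⟩ ?_
    refine (PDA.reflTransGen_inter h (s := s) (s' := s')
      ⟨Marked.wrap w, by simp, hr⟩).trans (.single ?_)
    exact ⟨none, some P.bot, [none], [], rfl, rfl, rfl, InterTrans.accept q s' hs'⟩

end Product

theorem bot_mem_of_inter {α σ τ Γ : Type*} [Finite α] [Finite σ] [Finite τ] [Finite Γ]
    (P : PDA α σ Γ) (N : NFA α τ) :
    ∀ q x q' t, (q, x, (P.inter N).bot, q', t) ∈ (P.inter N).δ → (P.inter N).bot ∈ t := by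
  intro q x q' t h
  have h' : InterTrans P N q x none q' t := h
  cases h'
  exact List.mem_cons_of_mem _ (List.mem_singleton.2 rfl)

/-- The PDA of the algorithm accepts a trace if the three automata from which it is built do. -/
theorem mem_language_reachPDA {A V Q : Type*} [Finite A] [Finite V] [Finite Q] (M : Machine A Q)
    (m r k : ℕ) (𝒢 : SPGG A V) (F : ConfigProp Q) (w : List (TraceLetter A m r k)) :
    w ∈ (reachPDA M m r k 𝒢 F).language ↔ w ∈ (grammarPDA 𝒢 m r k).language ∧
      Marked.wrap w ∈ (registerNFA A m r k).accepts ∧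
      ∃ w' : List (Letter A Q m r k), w'.map Prod.fst = w ∧
        (∀ n, w' ∈ (execTwoNFA M r k n).language) ∧ w' ∈ (rwTwoNFA A Q m r k).language ∧
        Marked.wrap w' ∈ (propertyNFA A m r k F).accepts := by
  have hbot : ∀ q x q' t, (q, x, (grammarPDA 𝒢 m r k).bot, q', t) ∈ (grammarPDA 𝒢 m r k).δ →
      (grammarPDA 𝒢 m r k).bot ∈ t := by
    intro q x q' t h
    have h' : TraceTrans 𝒢 m r k q x .bot q' t := h
    cases h'
    simp [grammarPDA]
  rw [reachPDA, PDA.mem_language_inter (tracePDA 𝒢 m r k) _ (bot_mem_of_inter _ _), tracePDA,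
    PDA.mem_language_inter _ _ hbot, execNFA, mem_accepts_nfaProj]
  simp only [mem_accepts_nfaInter, mem_accepts_nfaInterFamily, TwoNFA.mem_accepts_toNFA, and_assoc]

/-! ### Series-parallel trees and the graphs of a grammar -/

/-- Decomposition trees of series-parallel graphs with edges labeled in `L`: the end points of the
graph are not part of the tree, and a series composition is labeled with the middle node. -/
inductive SPTree (N L : Type*)
  | leaf (a : L)
  | ser (T₁ : SPTree N L) (u : N) (T₂ : SPTree N L)
  | par (T₁ T₂ : SPTree N L)

namespace SPTree

variable {N N' N'' L : Type*}

/-- The edges of the graph with end points `s` and `t`. -/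
def edges : SPTree N L → N → N → Multiset (N × N × L)
  | leaf a, s, t => {(s, t, a)}
  | ser T₁ u T₂, s, t => T₁.edges s u + T₂.edges u t
  | par T₁ T₂, s, t => T₁.edges s t + T₂.edges s t

/-- The inner nodes, in an order which extends the order along the edges. -/
def inner : SPTree N L → List N
  | leaf _ => []
  | ser T₁ u T₂ => T₁.inner ++ u :: T₂.inner
  | par T₁ T₂ => T₁.inner ++ T₂.inner

/-- Renaming of the nodes. -/
def map (f : N → N') : SPTree N L → SPTree N' L
  | leaf a => leaf a
  | ser T₁ u T₂ => ser (T₁.map f) (f u) (T₂.map f)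
  | par T₁ T₂ => par (T₁.map f) (T₂.map f)

/-- Renaming of the end points of an edge. -/
def mapEdge (f : N → N') (e : N × N × L) : N' × N' × L := (f e.1, f e.2.1, e.2.2)

theorem edges_map (f : N → N') (T : SPTree N L) (s t : N) :
    (T.map f).edges (f s) (f t) = (T.edges s t).map (mapEdge f) := by
  induction T generalizing s t with
  | leaf a => rfl
  | ser T₁ u T₂ ih₁ ih₂ => simp [edges, map, ih₁, ih₂]
  | par T₁ T₂ ih₁ ih₂ => simp [edges, map, ih₁, ih₂]

theorem inner_map (f : N → N') (T : SPTree N L) : (T.map f).inner = T.inner.map f := by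
  induction T with
  | leaf a => rfl
  | ser T₁ u T₂ ih₁ ih₂ => simp [inner, map, ih₁, ih₂]
  | par T₁ T₂ ih₁ ih₂ => simp [inner, map, ih₁, ih₂]

theorem map_map (f : N → N') (g : N' → N'') (T : SPTree N L) :
    (T.map f).map g = T.map (g ∘ f) := by
  induction T with
  | leaf a => rfl
  | ser T₁ u T₂ ih₁ ih₂ => simp [map, ih₁, ih₂]
  | par T₁ T₂ ih₁ ih₂ => simp [map, ih₁, ih₂]

/-- The nodes in an order which extends the order along the edges. -/
def nodes (T : SPTree N L) (s t : N) : List N := s :: T.inner ++ [t]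

/-- The graph is acyclic. -/
theorem sublist_nodes {T : SPTree N L} {s t : N} {e : N × N × L} (he : e ∈ T.edges s t) :
    [e.1, e.2.1].Sublist (T.nodes s t) := by
  induction T generalizing s t with
  | leaf a =>
    simp only [edges, Multiset.mem_singleton] at he
    subst he
    simp [nodes, inner]
  | ser T₁ u T₂ ih₁ ih₂ =>
    simp only [edges, Multiset.mem_add] at he
    rcases he with he | he
    · refine (ih₁ he).trans ?_
      have : (ser T₁ u T₂).nodes s t = T₁.nodes s u ++ (T₂.inner ++ [t]) := by simp [nodes, inner]
      rw [this]
      exact List.sublist_append_left _ _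
    · refine (ih₂ he).trans ?_
      have : (ser T₁ u T₂).nodes s t = (s :: T₁.inner) ++ T₂.nodes u t := by simp [nodes, inner]
      rw [this]
      exact List.sublist_append_right _ _
  | par T₁ T₂ ih₁ ih₂ =>
    simp only [edges, Multiset.mem_add] at he
    rcases he with he | he
    · refine (ih₁ he).trans ?_
      simp only [nodes, inner]
      exact ((List.sublist_append_left _ _).cons_cons _).append_right _
    · refine (ih₂ he).trans ?_
      simp only [nodes, inner]
      exact ((List.sublist_append_right _ _).cons_cons _).append_right _

theorem mem_nodes_of_mem_edges {T : SPTree N L} {s t : N} {e : N × N × L}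
    (he : e ∈ T.edges s t) : e.1 ∈ T.nodes s t ∧ e.2.1 ∈ T.nodes s t :=
  ⟨(sublist_nodes he).subset (by simp), (sublist_nodes he).subset (by simp)⟩

/-- Nodes can be numbered increasingly along the edges. -/
theorem exists_rank {T : SPTree N L} {s t : N} (h : (T.nodes s t).Nodup) :
    ∃ rank : N → ℕ, ∀ e ∈ T.edges s t, rank e.1 < rank e.2.1 := by
  classical
  refine ⟨fun x => (T.nodes s t).idxOf x, fun e he => ?_⟩
  have key : ∀ (l : List N) (x y : N), l.Nodup → [x, y].Sublist l → l.idxOf x < l.idxOf y := by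
    intro l x y
    induction l with
    | nil => intro _ h; cases h
    | cons z l ih =>
      intro hn h
      rw [List.nodup_cons] at hn
      cases h with
      | cons _ h =>
        have hx : x ∈ l := h.subset (by simp)
        have hy : y ∈ l := h.subset (by simp)
        rw [List.idxOf_cons_ne _ (by rintro rfl; exact hn.1 hx),
          List.idxOf_cons_ne _ (by rintro rfl; exact hn.1 hy)]
        exact Nat.succ_lt_succ (ih hn.2 h)
      | cons_cons _ h =>
        have hy : y ∈ l := h.subset (by simp)
        rw [List.idxOf_cons_self, List.idxOf_cons_ne _ (by rintro rfl; exact hn.1 hy)]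
        exact Nat.succ_pos _
  exact key _ _ _ h (sublist_nodes he)

/-- No edge enters the source. -/
theorem ne_source_of_mem_edges {T : SPTree N L} {s t : N} (h : (T.nodes s t).Nodup)
    {e : N × N × L} (he : e ∈ T.edges s t) : e.2.1 ≠ s := by
  intro hs
  have h' := sublist_nodes he
  simp only [nodes, List.cons_append, List.nodup_cons] at h h'
  cases h' with
  | cons _ h' => exact h.1 (hs ▸ h'.subset (by simp))
  | cons_cons _ h' => exact h.1 (hs ▸ h'.subset (by simp))

end SPTree

/-- The tree describes a graph derived from an edge labeled `x`, which may still contain edges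
labeled with variables. -/
inductive PartialGen {A V N : Type*} (𝒢 : SPGG A V) : A ⊕ V → SPTree N (A ⊕ V) → Prop
  | refl (x : A ⊕ V) : PartialGen 𝒢 x (.leaf x)
  | letter (v : V) (a : A) (h : (v, Rhs.letter a) ∈ 𝒢.rules) :
      PartialGen 𝒢 (.inr v) (.leaf (.inl a))
  | series (v w w' : V) (T₁ : SPTree N (A ⊕ V)) (u : N) (T₂ : SPTree N (A ⊕ V))
      (h : (v, Rhs.series w w') ∈ 𝒢.rules) (h₁ : PartialGen 𝒢 (.inr w) T₁)
      (h₂ : PartialGen 𝒢 (.inr w') T₂) : PartialGen 𝒢 (.inr v) (.ser T₁ u T₂)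
  | parallel (v w w' : V) (T₁ T₂ : SPTree N (A ⊕ V))
      (h : (v, Rhs.parallel w w') ∈ 𝒢.rules) (h₁ : PartialGen 𝒢 (.inr w) T₁)
      (h₂ : PartialGen 𝒢 (.inr w') T₂) : PartialGen 𝒢 (.inr v) (.par T₁ T₂)

/-- The tree describes a graph without variables that is derived from an edge labeled `v`. -/
inductive Gen {A V N : Type*} (𝒢 : SPGG A V) : V → SPTree N A → Prop
  | letter (v : V) (a : A) (h : (v, Rhs.letter a) ∈ 𝒢.rules) : Gen 𝒢 v (.leaf a)
  | series (v w w' : V) (T₁ : SPTree N A) (u : N) (T₂ : SPTree N A)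
      (h : (v, Rhs.series w w') ∈ 𝒢.rules) (h₁ : Gen 𝒢 w T₁)
      (h₂ : Gen 𝒢 w' T₂) : Gen 𝒢 v (.ser T₁ u T₂)
  | parallel (v w w' : V) (T₁ T₂ : SPTree N A)
      (h : (v, Rhs.parallel w w') ∈ 𝒢.rules) (h₁ : Gen 𝒢 w T₁)
      (h₂ : Gen 𝒢 w' T₂) : Gen 𝒢 v (.par T₁ T₂)

theorem PartialGen.map {A V N N' : Type*} {𝒢 : SPGG A V} {x : A ⊕ V} {T : SPTree N (A ⊕ V)}
    (h : PartialGen 𝒢 x T) (f : N → N') : PartialGen 𝒢 x (T.map f) := by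
  induction h with
  | refl x => exact .refl x
  | letter v a h => exact .letter v a h
  | series v w w' T₁ u T₂ h _ _ ih₁ ih₂ => exact .series v w w' _ _ _ h ih₁ ih₂
  | parallel v w w' T₁ T₂ h _ _ ih₁ ih₂ => exact .parallel v w w' _ _ h ih₁ ih₂

theorem Gen.productive {A V N : Type*} {𝒢 : SPGG A V} {v : V} {T : SPTree N A}
    (h : Gen 𝒢 v T) : 𝒢.Productive v := by
  induction h with
  | letter v a h => exact .letter v a h
  | series v w w' T₁ u T₂ h _ _ ih₁ ih₂ => exact .series v w w' h ih₁ ih₂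
  | parallel v w w' T₁ T₂ h _ _ ih₁ ih₂ => exact .parallel v w w' h ih₁ ih₂

theorem SPGG.Productive.exists_gen {A V N : Type*} [Inhabited N] {𝒢 : SPGG A V} {v : V}
    (h : 𝒢.Productive v) : ∃ T : SPTree N A, Gen 𝒢 v T := by
  induction h with
  | letter v a h => exact ⟨_, .letter v a h⟩
  | series v w w' h _ _ ih₁ ih₂ =>
    obtain ⟨T₁, h₁⟩ := ih₁
    obtain ⟨T₂, h₂⟩ := ih₂
    exact ⟨_, .series v w w' T₁ default T₂ h h₁ h₂⟩
  | parallel v w w' h _ _ ih₁ ih₂ =>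
    obtain ⟨T₁, h₁⟩ := ih₁
    obtain ⟨T₂, h₂⟩ := ih₂
    exact ⟨_, .parallel v w w' T₁ T₂ h h₁ h₂⟩

/-- If all edges of a derived graph are labeled with letters, then its derivation is complete. -/
theorem PartialGen.exists_gen {A V N : Type*} {𝒢 : SPGG A V} {x : A ⊕ V} {T : SPTree N (A ⊕ V)}
    (h : PartialGen 𝒢 x T) {v : V} (hx : x = .inr v) {s t : N}
    (hl : ∀ e ∈ T.edges s t, ∃ a, e.2.2 = Sum.inl a) :
    ∃ T' : SPTree N A, Gen 𝒢 v T' ∧ T'.inner = T.inner ∧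
      T.edges s t = (T'.edges s t).map fun e => (e.1, e.2.1, Sum.inl e.2.2) := by
  induction h generalizing v s t with
  | refl x =>
    subst hx
    obtain ⟨a, ha⟩ := hl (s, t, .inr v) (by simp [SPTree.edges])
    cases ha
  | letter v a h =>
    cases hx
    exact ⟨_, .letter v a h, rfl, by simp [SPTree.edges]⟩
  | series v w w' T₁ u T₂ h _ _ ih₁ ih₂ =>
    cases hx
    simp only [SPTree.edges, Multiset.mem_add] at hl
    obtain ⟨T₁', h1, h2, h3⟩ := ih₁ rfl fun e he => hl e (Or.inl he)
    obtain ⟨T₂', h4, h5, h6⟩ := ih₂ rfl fun e he => hl e (Or.inr he)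
    exact ⟨_, .series v w w' T₁' u T₂' h h1 h4, by simp [SPTree.inner, h2, h5],
      by simp [SPTree.edges, h3, h6]⟩
  | parallel v w w' T₁ T₂ h _ _ ih₁ ih₂ =>
    cases hx
    simp only [SPTree.edges, Multiset.mem_add] at hl
    obtain ⟨T₁', h1, h2, h3⟩ := ih₁ rfl fun e he => hl e (Or.inl he)
    obtain ⟨T₂', h4, h5, h6⟩ := ih₂ rfl fun e he => hl e (Or.inr he)
    exact ⟨_, .parallel v w w' T₁' T₂' h h1 h4, by simp [SPTree.inner, h2, h5],
      by simp [SPTree.edges, h3, h6]⟩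

/-- Replacement of an edge by a tree, in a tree whose nodes are renamed by `f`. -/
theorem exists_substitute {A V N N' : Type*} {𝒢 : SPGG A V} [DecidableEq (N × N × (A ⊕ V))]
    (f : N → N') (X : SPTree N' (A ⊕ V)) (T : SPTree N (A ⊕ V)) (s t : N) (e : N × N × (A ⊕ V))
    (he : e ∈ T.edges s t) :
    ∃ T' : SPTree N' (A ⊕ V),
      T'.edges (f s) (f t) = ((T.edges s t).erase e).map (SPTree.mapEdge f) +
        X.edges (f e.1) (f e.2.1) ∧
      T'.inner.Perm (T.inner.map f ++ X.inner) ∧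
      ∀ x, PartialGen 𝒢 x T → PartialGen 𝒢 e.2.2 X → PartialGen 𝒢 x T' := by
  induction T generalizing s t with
  | leaf a =>
    simp only [SPTree.edges, Multiset.mem_singleton] at he
    subst he
    refine ⟨X, by simp [SPTree.edges], by simp [SPTree.inner], ?_⟩
    intro x h hX
    cases h with
    | refl => exact hX
    | letter v a h => cases hX; exact .letter v a h
  | ser T₁ u T₂ ih₁ ih₂ =>
    simp only [SPTree.edges, Multiset.mem_add] at he
    by_cases he₁ : e ∈ T₁.edges s u
    · obtain ⟨T', h1, h2, h3⟩ := ih₁ s u he₁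
      refine ⟨.ser T' (f u) (T₂.map f), ?_, ?_, ?_⟩
      · simp only [SPTree.edges, h1, SPTree.edges_map, Multiset.erase_add_left_pos _ he₁,
          Multiset.map_add]
        abel
      · simp only [SPTree.inner, SPTree.inner_map, List.map_append, List.map_cons]
        refine (h2.append_right _).trans ?_
        simp only [List.append_assoc]
        exact List.Perm.append_left _ List.perm_append_comm
      · intro x h hX
        cases h with
        | series v w w' _ _ _ h h₁ h₂ => exact .series v w w' _ _ _ h (h3 _ h₁ hX) (h₂.map f)
    · have he₂ := he.resolve_left he₁
      obtain ⟨T', h1, h2, h3⟩ := ih₂ u t he₂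
      refine ⟨.ser (T₁.map f) (f u) T', ?_, ?_, ?_⟩
      · simp only [SPTree.edges, h1, SPTree.edges_map, Multiset.erase_add_right_pos _ he₂,
          Multiset.map_add]
        abel
      · simp only [SPTree.inner, SPTree.inner_map, List.map_append, List.map_cons,
          List.append_assoc, List.cons_append]
        exact List.Perm.append_left _ (h2.cons _)
      · intro x h hX
        cases h with
        | series v w w' _ _ _ h h₁ h₂ => exact .series v w w' _ _ _ h (h₁.map f) (h3 _ h₂ hX)
  | par T₁ T₂ ih₁ ih₂ =>
    simp only [SPTree.edges, Multiset.mem_add] at he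
    by_cases he₁ : e ∈ T₁.edges s t
    · obtain ⟨T', h1, h2, h3⟩ := ih₁ s t he₁
      refine ⟨.par T' (T₂.map f), ?_, ?_, ?_⟩
      · simp only [SPTree.edges, h1, SPTree.edges_map, Multiset.erase_add_left_pos _ he₁,
          Multiset.map_add]
        abel
      · simp only [SPTree.inner, SPTree.inner_map, List.map_append]
        refine (h2.append_right _).trans ?_
        simp only [List.append_assoc]
        exact List.Perm.append_left _ List.perm_append_comm
      · intro x h hX
        cases h with
        | parallel v w w' _ _ h h₁ h₂ => exact .parallel v w w' _ _ h (h3 _ h₁ hX) (h₂.map f)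
    · have he₂ := he.resolve_left he₁
      obtain ⟨T', h1, h2, h3⟩ := ih₂ s t he₂
      refine ⟨.par (T₁.map f) T', ?_, ?_, ?_⟩
      · simp only [SPTree.edges, h1, SPTree.edges_map, Multiset.erase_add_right_pos _ he₂,
          Multiset.map_add]
        abel
      · simp only [SPTree.inner, SPTree.inner_map, List.map_append, List.append_assoc]
        exact List.Perm.append_left _ h2
      · intro x h hX
        cases h with
        | parallel v w w' _ _ h h₁ h₂ => exact .parallel v w w' _ _ h (h₁.map f) (h3 _ h₂ hX)

section Replace

variable {A V : Type*} (G : Graph (A ⊕ V)) (e : G.Node × G.Node × (A ⊕ V))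

/-- A node of a graph, as a node of the graph after the replacement of an edge. -/
def oldNode (H : Graph (A ⊕ V)) (x : G.Node) : (G.replace e H).Node := Sum.inl x

/-- The middle node of a series composition that replaces an edge. -/
def midNode (v w : V) : (G.replace e (Rhs.series (A := A) v w).graph).Node :=
  Sum.inr ⟨(1 : Fin 3), by simp [Rhs.graph], by simp [Rhs.graph]⟩

theorem oldNode_injective (H : Graph (A ⊕ V)) : (oldNode G e H).Injective :=
  Sum.inl_injective

theorem midNode_ne (v w : V) (x : G.Node) : midNode G e v w ≠ oldNode G e _ x :=
  Sum.inr_ne_inl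

/-- A node of the inserted graph, as a node of the graph after the replacement of an edge. -/
noncomputable def newNode (H : Graph (A ⊕ V)) (x : H.Node) : (G.replace e H).Node := G.fuse e H x

theorem newNode_source (H : Graph (A ⊕ V)) : newNode G e H H.source = oldNode G e H e.1 :=
  dif_pos rfl

theorem newNode_sink (H : Graph (A ⊕ V)) (h : H.sink ≠ H.source) :
    newNode G e H H.sink = oldNode G e H e.2.1 :=
  (dif_neg h).trans (dif_pos rfl)

theorem newNode_mid (v w : V) :
    newNode G e (Rhs.series (A := A) v w).graph (1 : Fin 3) = midNode G e v w :=
  (dif_neg (show (1 : Fin 3) ≠ 0 by decide)).trans (dif_neg (show (1 : Fin 3) ≠ 2 by decide))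

theorem replace_edges (H : Graph (A ⊕ V)) {R : Multiset (G.Node × G.Node × (A ⊕ V))}
    (hR : G.edges = e ::ₘ R) :
    (G.replace e H).edges = H.edges.map (SPTree.mapEdge (newNode G e H)) +
      R.map (SPTree.mapEdge (oldNode G e H)) := by
  simp only [Graph.replace, hR, Multiset.erase_cons_head]
  rw [add_comm]
  rfl

variable {R : Multiset (G.Node × G.Node × (A ⊕ V))}

theorem replace_letter_edges (hR : G.edges = e ::ₘ R) (a : A) :
    (G.replace e (Rhs.letter (V := V) a).graph).edges =
      (oldNode G e _ e.1, oldNode G e _ e.2.1, Sum.inl a) ::ₘ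
        R.map (SPTree.mapEdge (oldNode G e _)) := by
  rw [replace_edges G e _ hR, ← Multiset.singleton_add, ← newNode_source,
    ← newNode_sink _ _ _ (by simp [Rhs.graph])]
  rfl

theorem replace_series_edges (hR : G.edges = e ::ₘ R) (v w : V) :
    (G.replace e (Rhs.series (A := A) v w).graph).edges =
      (oldNode G e _ e.1, midNode G e v w, Sum.inr v) ::ₘ
        (midNode G e v w, oldNode G e _ e.2.1, Sum.inr w) ::ₘ
        R.map (SPTree.mapEdge (oldNode G e _)) := by
  rw [replace_edges G e _ hR, ← Multiset.singleton_add, ← Multiset.singleton_add, ← add_assoc,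
    ← newNode_source, ← newNode_sink _ _ _ (by simp [Rhs.graph]), ← newNode_mid]
  rfl

theorem replace_parallel_edges (hR : G.edges = e ::ₘ R) (v w : V) :
    (G.replace e (Rhs.parallel (A := A) v w).graph).edges =
      (oldNode G e _ e.1, oldNode G e _ e.2.1, Sum.inr v) ::ₘ
        (oldNode G e _ e.1, oldNode G e _ e.2.1, Sum.inr w) ::ₘ
        R.map (SPTree.mapEdge (oldNode G e _)) := by
  rw [replace_edges G e _ hR, ← Multiset.singleton_add, ← Multiset.singleton_add, ← add_assoc,
    ← newNode_source, ← newNode_sink _ _ _ (by simp [Rhs.graph])]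
  rfl

end Replace

/-- Every derived graph is described by a tree. -/
theorem SPGG.Derives.exists_tree {A V : Type*} {𝒢 : SPGG A V} {G : Graph (A ⊕ V)}
    (h : 𝒢.Derives G) : ∃ T : SPTree G.Node (A ⊕ V), PartialGen 𝒢 (.inr 𝒢.start) T ∧
      G.edges = T.edges G.source G.sink ∧ (T.nodes G.source G.sink).Nodup := by
  classical
  induction h with
  | init =>
    refine ⟨.leaf (.inr 𝒢.start), .refl _, rfl, ?_⟩
    change [(0 : Fin 2), 1].Nodup
    decide
  | step G e v ρ hG he hv hρ ih =>
    obtain ⟨T, h1, h2, h3⟩ := ih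
    obtain ⟨R, hR⟩ := Multiset.exists_cons_of_mem he
    have rhs : ∃ X : SPTree (G.replace e ρ.graph).Node (A ⊕ V), PartialGen 𝒢 (.inr v) X ∧
        (G.replace e ρ.graph).edges =
          R.map (SPTree.mapEdge (oldNode G e ρ.graph)) +
          X.edges (oldNode G e _ e.1) (oldNode G e _ e.2.1) ∧ X.inner.Nodup ∧
        ∀ y ∈ X.inner, ∀ z, y ≠ oldNode G e _ z := by
      cases ρ with
      | letter a =>
        refine ⟨.leaf (.inl a), .letter v a hρ, ?_, by simp [SPTree.inner],
          by simp [SPTree.inner]⟩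
        rw [replace_letter_edges G e hR, add_comm, ← Multiset.singleton_add]
        rfl
      | series w w' =>
        refine ⟨.ser (.leaf (.inr w)) (midNode G e w w') (.leaf (.inr w')),
          .series v w w' _ _ _ hρ (.refl _) (.refl _), ?_, by simp [SPTree.inner], ?_⟩
        · rw [replace_series_edges G e hR, add_comm, ← Multiset.singleton_add,
            ← Multiset.singleton_add,
            ← add_assoc]
          rfl
        · intro y hy z
          have hy' : y = midNode G e w w' := by simpa [SPTree.inner] using hy
          rw [hy']
          exact midNode_ne G e w w' z
      | parallel w w' =>
        refine ⟨.par (.leaf (.inr w)) (.leaf (.inr w')), .parallel v w w' _ _ hρ (.refl _)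
          (.refl _),
          ?_, by simp [SPTree.inner], by simp [SPTree.inner]⟩
        rw [replace_parallel_edges G e hR, add_comm, ← Multiset.singleton_add,
          ← Multiset.singleton_add, ← add_assoc]
        rfl
    obtain ⟨X, hX, hE, hnd, hne⟩ := rhs
    rw [h2] at he
    obtain ⟨T', h4, h5, h6⟩ := exists_substitute (𝒢 := 𝒢) (oldNode G e ρ.graph) X T _ _ e he
    refine ⟨T', h6 _ h1 (hv ▸ hX), ?_, ?_⟩
    · rw [hE]
      rw [← h2, hR, Multiset.erase_cons_head] at h4
      exact h4.symm
    · have : (T'.nodes (G.replace e ρ.graph).source (G.replace e ρ.graph).sink).Perm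
          ((T.nodes G.source G.sink).map (oldNode G e ρ.graph) ++ X.inner) := by
        simp only [SPTree.nodes, List.map_append, List.map_cons, List.map_nil, List.cons_append]
        refine List.Perm.cons _ ((h5.append_right _).trans ?_)
        simp only [List.append_assoc]
        exact List.Perm.append_left _ List.perm_append_comm
      rw [this.nodup_iff, List.nodup_append]
      refine ⟨h3.map (oldNode_injective G e _), hnd, ?_⟩
      intro a ha b hb
      obtain ⟨z, -, rfl⟩ := List.mem_map.1 ha
      exact fun h => hne b hb z h.symm

/-- The graphs of the language are described by trees. -/
theorem exists_tree_of_mem_language {A V : Type*} {𝒢 : SPGG A V} {H : Graph A}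
    (h : H ∈ 𝒢.language) : ∃ T : SPTree H.Node A, Gen 𝒢 𝒢.start T ∧
      H.edges = T.edges H.source H.sink ∧ (T.nodes H.source H.sink).Nodup := by
  obtain ⟨T, h1, h2, h3⟩ := SPGG.Derives.exists_tree h
  have hl : ∀ e ∈ T.edges H.source H.sink, ∃ a, e.2.2 = Sum.inl a := by
    intro e he
    have he' : e ∈ (H.mapLabel Sum.inl).edges := h2 ▸ he
    obtain ⟨d, -, rfl⟩ := Multiset.mem_map.1 he'
    exact ⟨_, rfl⟩
  obtain ⟨T', h4, h5, h6⟩ := h1.exists_gen rfl hl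
  refine ⟨T', h4, ?_, ?_⟩
  · have h7 : H.edges.map (fun e => (e.1, e.2.1, (Sum.inl e.2.2 : A ⊕ V))) =
        (T'.edges H.source H.sink).map fun e => (e.1, e.2.1, Sum.inl e.2.2) := h6 ▸ h2
    refine Multiset.map_injective ?_ h7
    rintro ⟨a, b, c⟩ ⟨a', b', c'⟩ h
    simpa using h
  · have : T'.nodes H.source H.sink = T.nodes H.source H.sink := by
      simp only [SPTree.nodes, h5]
    exact this ▸ h3

/-- In any derived graph, an edge labeled with a variable can be replaced by a graph of any given
shape that the variable generates. -/
theorem Gen.exists_derives {A V : Type*} {𝒢 : SPGG A V} {v : V} {T₀ : SPTree Unit A}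
    (h : Gen 𝒢 v T₀) (G : Graph (A ⊕ V)) (hG : 𝒢.Derives G) (x y : G.Node)
    (R : Multiset (G.Node × G.Node × (A ⊕ V))) (hR : G.edges = (x, y, .inr v) ::ₘ R) :
    ∃ (G' : Graph (A ⊕ V)) (f : G.Node → G'.Node) (T : SPTree G'.Node A), 𝒢.Derives G' ∧
      f.Injective ∧ f G.source = G'.source ∧ f G.sink = G'.sink ∧
      T.map (fun _ => ()) = T₀ ∧
      G'.edges = R.map (SPTree.mapEdge f) +
        (T.edges (f x) (f y)).map (fun e => (e.1, e.2.1, Sum.inl e.2.2)) ∧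
      T.inner.Nodup ∧ ∀ z ∈ T.inner, z ∉ Set.range f := by
  classical
  induction h generalizing G with
  | letter v a h =>
    set e : G.Node × G.Node × (A ⊕ V) := (x, y, .inr v) with he
    refine ⟨G.replace e (Rhs.letter a).graph, oldNode G e _, .leaf a,
      .step G _ v _ hG (by simp [hR]) rfl h, oldNode_injective G e _, rfl, rfl, rfl, ?_,
      by simp [SPTree.inner], by simp [SPTree.inner]⟩
    rw [replace_letter_edges G e hR, add_comm,
      ← Multiset.singleton_add]
    rfl
  | series v w w' T₁ u T₂ h _ _ ih₁ ih₂ =>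
    set e : G.Node × G.Node × (A ⊕ V) := (x, y, .inr v) with he
    have hd : 𝒢.Derives (G.replace e (Rhs.series w w').graph) :=
      .step G e v _ hG (by simp [hR]) rfl h
    have hE := replace_series_edges G e hR w w'
    obtain ⟨G₂, f₂, T₁', hd₂, hf₂, hs₂, ht₂, hm₂, hE₂, hn₂, hi₂⟩ := ih₁ _ hd (oldNode G e _ x)
      (midNode G e w w')
      ((midNode G e w w', oldNode G e _ y, Sum.inr w') ::ₘ R.map (SPTree.mapEdge
        (oldNode G e _))) hE
    obtain ⟨G₃, f₃, T₂', hd₃, hf₃, hs₃, ht₃, hm₃, hE₃, hn₃, hi₃⟩ := ih₂ G₂ hd₂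
      (f₂ (midNode G e w w')) (f₂ (oldNode G e _ y))
      ((R.map (SPTree.mapEdge (oldNode G e _))).map (SPTree.mapEdge f₂) +
        (T₁'.edges (f₂ (oldNode G e _ x)) (f₂ (midNode G e w w'))).map
          (fun e => (e.1, e.2.1, Sum.inl e.2.2))) (by
        rw [hE₂, Multiset.map_cons, Multiset.cons_add]
        rfl)
    refine ⟨G₃, f₃ ∘ f₂ ∘ oldNode G e _, .ser (T₁'.map f₃) (f₃ (f₂ (midNode G e w w'))) T₂', hd₃,
      hf₃.comp (hf₂.comp (oldNode_injective G e _)), ?_, ?_, ?_, ?_, ?_, ?_⟩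
    · rw [← hs₃, ← hs₂]; rfl
    · rw [← ht₃, ← ht₂]; rfl
    · simp only [SPTree.map, SPTree.map_map, hm₃, ← hm₂, Function.comp_def]
    · rw [hE₃]
      simp only [SPTree.edges, Function.comp_apply, SPTree.edges_map, Multiset.map_add,
        Multiset.map_map]
      rw [add_assoc]
      rfl
    · simp only [SPTree.inner, SPTree.inner_map]
      rw [List.nodup_append]
      refine ⟨hn₂.map hf₃, ?_, ?_⟩
      · rw [List.nodup_cons]
        exact ⟨fun hmem => hi₃ _ hmem ⟨_, rfl⟩, hn₃⟩
      · intro a ha b hb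
        obtain ⟨a', ha', rfl⟩ := List.mem_map.1 ha
        rcases List.mem_cons.1 hb with rfl | hb
        · intro heq
          exact hi₂ _ ha' ⟨_, (hf₃ heq).symm⟩
        · intro heq
          exact hi₃ _ hb ⟨_, heq⟩
    · intro z hz
      simp only [SPTree.inner, SPTree.inner_map, List.mem_append, List.mem_cons] at hz
      rintro ⟨c, rfl⟩
      rcases hz with hz | hz | hz
      · obtain ⟨a', ha', hz⟩ := List.mem_map.1 hz
        exact hi₂ _ ha' ⟨_, (hf₃ hz).symm⟩
      · have := hf₂ (hf₃ hz)
        exact midNode_ne G e w w' c this.symm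
      · exact hi₃ _ hz ⟨_, rfl⟩
  | parallel v w w' T₁ T₂ h _ _ ih₁ ih₂ =>
    set e : G.Node × G.Node × (A ⊕ V) := (x, y, .inr v) with he
    have hd : 𝒢.Derives (G.replace e (Rhs.parallel w w').graph) :=
      .step G e v _ hG (by simp [hR]) rfl h
    have hE := replace_parallel_edges G e hR w w'
    obtain ⟨G₂, f₂, T₁', hd₂, hf₂, hs₂, ht₂, hm₂, hE₂, hn₂, hi₂⟩ := ih₁ _ hd (oldNode G e _ x)
      (oldNode G e _ y)
      ((oldNode G e _ x, oldNode G e _ y, Sum.inr w') ::ₘ R.map (SPTree.mapEdge (oldNode G e _))) hE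
    obtain ⟨G₃, f₃, T₂', hd₃, hf₃, hs₃, ht₃, hm₃, hE₃, hn₃, hi₃⟩ := ih₂ G₂ hd₂
      (f₂ (oldNode G e _ x)) (f₂ (oldNode G e _ y))
      ((R.map (SPTree.mapEdge (oldNode G e _))).map (SPTree.mapEdge f₂) +
        (T₁'.edges (f₂ (oldNode G e _ x)) (f₂ (oldNode G e _ y))).map
          (fun e => (e.1, e.2.1, Sum.inl e.2.2))) (by
        rw [hE₂, Multiset.map_cons, Multiset.cons_add]
        rfl)
    refine ⟨G₃, f₃ ∘ f₂ ∘ oldNode G e _, .par (T₁'.map f₃) T₂', hd₃,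
      hf₃.comp (hf₂.comp (oldNode_injective G e _)), ?_, ?_, ?_, ?_, ?_, ?_⟩
    · rw [← hs₃, ← hs₂]; rfl
    · rw [← ht₃, ← ht₂]; rfl
    · simp only [SPTree.map, SPTree.map_map, hm₃, ← hm₂, Function.comp_def]
    · rw [hE₃]
      simp only [SPTree.edges, Function.comp_apply, SPTree.edges_map, Multiset.map_add,
        Multiset.map_map]
      rw [add_assoc]
      rfl
    · simp only [SPTree.inner, SPTree.inner_map]
      rw [List.nodup_append]
      refine ⟨hn₂.map hf₃, hn₃, ?_⟩
      intro a ha b hb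
      obtain ⟨a', ha', rfl⟩ := List.mem_map.1 ha
      intro heq
      exact hi₃ _ hb ⟨_, heq⟩
    · intro z hz
      simp only [SPTree.inner, SPTree.inner_map, List.mem_append] at hz
      rintro ⟨c, rfl⟩
      rcases hz with hz | hz
      · obtain ⟨a', ha', hz⟩ := List.mem_map.1 hz
        exact hi₂ _ ha' ⟨_, (hf₃ hz).symm⟩
      · exact hi₃ _ hz ⟨_, rfl⟩

theorem mapLabel_eq {L L' : Type*} {N : Type} [Finite N] {g : L → L'} {E' : Multiset (N × N × L')}
    {E : Multiset (N × N × L)} (s t : N)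
    (h : E' = E.map fun e => (e.1, e.2.1, g e.2.2)) :
    Graph.mapLabel g ⟨N, inferInstance, E, s, t⟩ = ⟨N, inferInstance, E', s, t⟩ := by
  subst h
  rfl

/-- Every shape generated by the grammar is the shape of a graph of the language. -/
theorem Gen.exists_mem_language {A V : Type*} {𝒢 : SPGG A V} {T₀ : SPTree Unit A}
    (h : Gen 𝒢 𝒢.start T₀) : ∃ H ∈ 𝒢.language, ∃ T : SPTree H.Node A,
      T.map (fun _ => ()) = T₀ ∧ H.edges = T.edges H.source H.sink ∧
      (T.nodes H.source H.sink).Nodup := by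
  obtain ⟨G, f, T, h1, h2, h3, h4, h5, h6, h7, h8⟩ := h.exists_derives 𝒢.initial .init
    (0 : Fin 2) (1 : Fin 2) 0 rfl
  have h3' : f (0 : Fin 2) = G.source := h3
  have h4' : f (1 : Fin 2) = G.sink := h4
  rw [h3', h4'] at h6
  refine ⟨⟨G.Node, G.finite_node, T.edges G.source G.sink, G.source, G.sink⟩, ?_, T, h5, rfl, ?_⟩
  · change 𝒢.Derives _
    have := G.finite_node
    rw [mapLabel_eq (E' := G.edges) G.source G.sink (by simpa using h6)]
    exact h1
  · simp only [SPTree.nodes, List.cons_append, List.nodup_cons, List.mem_append,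
      List.mem_singleton, not_or]
    refine ⟨⟨fun hmem => h8 _ hmem ⟨_, h3⟩, ?_⟩, ?_⟩
    · rw [← h3', ← h4']
      intro heq
      exact absurd (h2 heq) Fin.zero_ne_one
    · rw [List.nodup_append]
      refine ⟨h7, by simp, ?_⟩
      intro a ha b hb heq
      rw [List.mem_singleton] at hb
      exact h8 _ ha ⟨_, h4.trans (hb.symm.trans heq.symm)⟩

/-! ### Linearizations of series-parallel graphs -/

/-- The events of a traversal of a series-parallel graph by a family of rows: the rows in `R` take
the edge `e`, or meet at the node `x`. -/
inductive Item (N A ι : Type*)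
  | edge (R : Set ι) (e : N × N × A)
  | node (R : Set ι) (x : N)

/-- The traversals of a series-parallel graph by the rows in `R`, in the order in which the pushdown
automaton for traces describes them. -/
inductive Lin {N A ι : Type*} : SPTree N A → N → N → Set ι → List (Item N A ι) → Prop
  | leaf (a : A) (s t : N) (R : Set ι) : Lin (.leaf a) s t R [.edge R (s, t, a)]
  | ser (T₁ T₂ : SPTree N A) (s u t : N) (R : Set ι) (l₁ l₂ : List (Item N A ι))
      (h₁ : Lin T₁ s u R l₁) (h₂ : Lin T₂ u t R l₂) :
      Lin (.ser T₁ u T₂) s t R (l₁ ++ .node R u :: l₂)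
  | par (T₁ T₂ : SPTree N A) (s t : N) (R₁ R₂ : Set ι) (l₁ l₂ : List (Item N A ι))
      (hR₁ : R₁.Nonempty) (hR₂ : R₂.Nonempty) (hd : Disjoint R₁ R₂)
      (h₁ : Lin T₁ s t R₁ l₁) (h₂ : Lin T₂ s t R₂ l₂) : Lin (.par T₁ T₂) s t (R₁ ∪ R₂) (l₁ ++ l₂)
  | parLeft (T₁ T₂ : SPTree N A) (s t : N) (R : Set ι) (l : List (Item N A ι))
      (h : Lin T₁ s t R l) : Lin (.par T₁ T₂) s t R l
  | parRight (T₁ T₂ : SPTree N A) (s t : N) (R : Set ι) (l : List (Item N A ι))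
      (h : Lin T₂ s t R l) : Lin (.par T₁ T₂) s t R l

/-- The traversal of the whole graph by all rows. -/
def fullItems {N A ι : Type*} (s t : N) (its : List (Item N A ι)) : List (Item N A ι) :=
  .node Set.univ s :: its ++ [.node Set.univ t]

/-- Renaming of the nodes. -/
def Item.map {N N' A ι : Type*} (f : N → N') : Item N A ι → Item N' A ι
  | .edge R e => .edge R (f e.1, f e.2.1, e.2.2)
  | .node R x => .node R (f x)

theorem Lin.exists_of_map {N N' A ι : Type*} (f : N → N') {T : SPTree N A} {s t : N} {s' t' : N'}
    {R : Set ι} {l : List (Item N' A ι)} (h : Lin (T.map f) s' t' R l)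
    (hs : s' = f s) (ht : t' = f t) :
    ∃ l', Lin T s t R l' ∧ l = l'.map (Item.map f) := by
  induction T generalizing s t s' t' R l with
  | leaf a =>
    cases h
    subst hs ht
    exact ⟨_, .leaf a s t R, rfl⟩
  | ser T₁ u T₂ ih₁ ih₂ =>
    cases h with
    | ser _ _ _ _ _ _ l₁ l₂ h₁ h₂ =>
      obtain ⟨l₁', h1, rfl⟩ := ih₁ h₁ hs rfl
      obtain ⟨l₂', h2, rfl⟩ := ih₂ h₂ rfl ht
      exact ⟨_, .ser _ _ _ _ _ _ _ _ h1 h2, by simp [Item.map]⟩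
  | par T₁ T₂ ih₁ ih₂ =>
    cases h with
    | par _ _ _ _ R₁ R₂ l₁ l₂ hR₁ hR₂ hd h₁ h₂ =>
      obtain ⟨l₁', h1, rfl⟩ := ih₁ h₁ hs ht
      obtain ⟨l₂', h2, rfl⟩ := ih₂ h₂ hs ht
      exact ⟨_, .par _ _ _ _ _ _ _ _ hR₁ hR₂ hd h1 h2, by simp⟩
    | parLeft _ _ _ _ _ _ h =>
      obtain ⟨l', h1, rfl⟩ := ih₁ h hs ht
      exact ⟨_, .parLeft _ _ _ _ _ _ h1, rfl⟩
    | parRight _ _ _ _ _ _ h =>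
      obtain ⟨l', h1, rfl⟩ := ih₂ h hs ht
      exact ⟨_, .parRight _ _ _ _ _ _ h1, rfl⟩

/-- The letter `x` of the trace alphabet describes the event `it`, up to register identifiers. -/
def Describes {N A : Type*} {m r k : ℕ} (x : TraceLetter A m r k) (it : Item N A (Row m r)) :
    Prop :=
  match x, it with
  | .edge f, .edge R e => (∀ i ∈ R, (f i).sym = some e.2.2) ∧ (∀ i ∉ R, (f i).sym = none) ∧
      Shares R fun i => (f i).idx
  | .node idx, .node R _ => Shares R idx
  | _, _ => False

theorem describes_map {N N' A : Type*} {m r k : ℕ} (f : N → N') (x : TraceLetter A m r k)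
    (it : Item N A (Row m r)) : Describes x (it.map f) ↔ Describes x it := by
  cases x <;> cases it <;> rfl

/-! ### The language of the pushdown automaton for traces -/

section Grammar

variable {A V : Type*} [Finite A] [Finite V] {𝒢 : SPGG A V} {m r k : ℕ}

/-- The words that are read while a stack symbol is processed. -/
def Yields (𝒢 : SPGG A V) (g : TraceStack A V m r k) (u : List (Marked (TraceLetter A m r k))) :
    Prop :=
  match g with
  | .bot => u = []
  | .input x => u = [x]
  | .var v R => ∃ (T : SPTree Unit A) (its : List (Item Unit A (Row m r)))
      (w : List (TraceLetter A m r k)), Gen 𝒢 v T ∧ Lin T () () R its ∧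
        List.Forall₂ Describes w its ∧ u = w.map Marked.letter

/-- Soundness of the expansion: an accepting computation unfolds to a derivation of the word from
the stack. -/
theorem yields_of_reflTransGen {c : Bool × List (Marked (TraceLetter A m r k)) ×
      List (TraceStack A V m r k)} {q : Bool}
    (h : Relation.ReflTransGen (grammarPDA 𝒢 m r k).Step c (q, [], [.bot])) (hc : c.1 = true) :
    ∃ us, List.Forall₂ (Yields 𝒢) c.2.2 us ∧ c.2.1 = us.flatten := by
  induction h using Relation.ReflTransGen.head_induction_on with
  | refl => exact ⟨[[]], .cons rfl .nil, rfl⟩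
  | head h h' ih =>
    rename_i c c'
    obtain ⟨x, g, s, t, h1, h2, h3, h4⟩ := h
    obtain ⟨q₁, u₁, st₁⟩ := c
    obtain ⟨q₂, u₂, st₂⟩ := c'
    simp only at h1 h2 h3 hc
    subst hc h1 h2 h3
    have h4' : TraceTrans 𝒢 m r k true x g q₂ t := h4
    cases h4' with
    | letter v a R f hv hin hout hf =>
      obtain ⟨us, h5, h6⟩ := ih rfl
      simp only [List.singleton_append] at h5 h6
      cases h5 with
      | cons h5 h7 =>
        cases h5
        refine ⟨_, .cons ⟨.leaf a, _, [.edge f], .letter v a hv, .leaf a () () R,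
          .cons ⟨hin, hout, hf⟩ .nil, rfl⟩ h7, ?_⟩
        simp [h6]
    | series v w w' R idx hv h =>
      obtain ⟨us, h5, h6⟩ := ih rfl
      simp only [List.cons_append, List.nil_append] at h5 h6
      cases h5 with
      | cons h5 h7 =>
        cases h7 with
        | cons h7 h8 =>
          cases h8 with
          | cons h8 h9 =>
            cases h7
            obtain ⟨T₁, its₁, w₁, a1, a2, a3, rfl⟩ := h5
            obtain ⟨T₂, its₂, w₂, b1, b2, b3, rfl⟩ := h8
            refine ⟨_, .cons ⟨.ser T₁ () T₂, _, w₁ ++ .node idx :: w₂,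
              .series v w w' _ _ _ hv a1 b1,
              .ser _ _ _ _ _ _ _ _ a2 b2, ?_, rfl⟩ h9, ?_⟩
            · exact List.rel_append a3 (.cons h b3)
            · simp [h6]
    | parallel v w w' R₁ R₂ hv h₁ h₂ h =>
      obtain ⟨us, h5, h6⟩ := ih rfl
      simp only [List.cons_append, List.nil_append] at h5 h6
      cases h5 with
      | cons h5 h7 =>
        cases h7 with
        | cons h8 h9 =>
          obtain ⟨T₁, its₁, w₁, a1, a2, a3, rfl⟩ := h5
          obtain ⟨T₂, its₂, w₂, b1, b2, b3, rfl⟩ := h8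
          refine ⟨_, .cons ⟨.par T₁ T₂, _, w₁ ++ w₂, .parallel v w w' _ _ hv a1 b1,
            .par _ _ _ _ _ _ _ _ h₁ h₂ h a2 b2, List.rel_append a3 b3, rfl⟩ h9, ?_⟩
          simp [h6]
    | parallelLeft v w w' R hv hw' =>
      obtain ⟨us, h5, h6⟩ := ih rfl
      simp only [List.cons_append, List.nil_append] at h5 h6
      cases h5 with
      | cons h5 h9 =>
        obtain ⟨T₁, its₁, w₁, a1, a2, a3, rfl⟩ := h5
        obtain ⟨T₂, b1⟩ := hw'.exists_gen (N := Unit)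
        exact ⟨_, .cons ⟨.par T₁ T₂, _, w₁, .parallel v w w' _ _ hv a1 b1,
          .parLeft _ _ _ _ _ _ a2, a3, rfl⟩ h9, by simp [h6]⟩
    | parallelRight v w w' R hv hw =>
      obtain ⟨us, h5, h6⟩ := ih rfl
      simp only [List.cons_append, List.nil_append] at h5 h6
      cases h5 with
      | cons h5 h9 =>
        obtain ⟨T₁, its₁, w₁, a1, a2, a3, rfl⟩ := h5
        obtain ⟨T₂, b1⟩ := hw.exists_gen (N := Unit)
        exact ⟨_, .cons ⟨.par T₂ T₁, _, w₁, .parallel v w w' _ _ hv b1 a1,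
          .parRight _ _ _ _ _ _ a2, a3, rfl⟩ h9, by simp [h6]⟩
    | _ =>
      obtain ⟨us, h5, h6⟩ := ih rfl
      exact ⟨_, .cons rfl h5, by simpa using h6⟩

/-- The trace words describe linearizations of derived trees. Letters do not name nodes, so a tree
over `Unit` is all that can be read off a word. -/
theorem exists_lin_of_mem_language {w : List (TraceLetter A m r k)}
    (h : w ∈ (grammarPDA 𝒢 m r k).language) :
    ∃ (T : SPTree Unit A) (its : List (Item Unit A (Row m r))), Gen 𝒢 𝒢.start T ∧
      Lin T () () Set.univ its ∧ List.Forall₂ Describes w (fullItems () () its) := by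
  obtain ⟨q, h⟩ := h
  rcases Relation.ReflTransGen.cases_head h with h | ⟨d, ⟨x, g, s, t, h1, h2, h3, h4⟩, h⟩
  · simp [Marked.wrap] at h
  · obtain ⟨q₂, w₂, st₂⟩ := d
    have h4' : TraceTrans 𝒢 m r k false x g q₂ t := h4
    cases h4' with
    | init idx idx' hi hi' =>
      simp only [Option.toList_none, List.nil_append] at h1 h2 h3
      have : s = [] := by simpa [grammarPDA] using h2
      subst h1 h3 this
      obtain ⟨us, h5, h6⟩ := yields_of_reflTransGen h rfl
      simp only [List.append_nil] at h5 h6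
      rcases h5 with _ | ⟨e1, _ | ⟨e2, _ | ⟨e3, _ | ⟨e4, _ | ⟨e5, _ | ⟨e6, e7⟩⟩⟩⟩⟩⟩
      cases e1; cases e2; cases e4; cases e5; cases e6; cases e7
      obtain ⟨T, its, w', a1, a2, a3, rfl⟩ := e3
      refine ⟨T, its, a1, a2, ?_⟩
      have hw : w = .node idx :: w' ++ [.node idx'] := by
        have hinj : Function.Injective (Marked.letter : TraceLetter A m r k → _) :=
          fun a b h => by cases h; rfl
        apply hinj.list_map
        have h7 : w.map Marked.letter ++ [Marked.right] =
            (TraceLetter.node idx :: w' ++ [TraceLetter.node idx']).map Marked.letter ++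
              [Marked.right] := by
          simpa [Marked.wrap] using h6
        exact List.append_cancel_right h7
      rw [hw]
      exact .cons hi (List.rel_append a3 (.cons hi' .nil))

theorem grammarPDA_reads {x : Marked (TraceLetter A m r k)} {u : List (Marked
    (TraceLetter A m r k))}
    {st : List (TraceStack A V m r k)} :
    (grammarPDA 𝒢 m r k).Step (true, x :: u, .input x :: st) (true, u, st) :=
  ⟨some x, .input x, st, [], rfl, rfl, rfl, TraceTrans.match x⟩

theorem grammarPDA_expands {v : V} {R : Set (Row m r)} {t : List (TraceStack A V m r k)}
    (h : TraceTrans 𝒢 m r k true none (.var v R) true t)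
    {u : List (Marked (TraceLetter A m r k))} {st : List (TraceStack A V m r k)} :
    (grammarPDA 𝒢 m r k).Step (true, u, .var v R :: st) (true, u, t ++ st) :=
  ⟨none, .var v R, st, t, rfl, rfl, rfl, h⟩

theorem Lin.reflTransGen {N : Type*} {T : SPTree N A} {s t : N} {R : Set (Row m r)}
    {its : List (Item N A (Row m r))} (h : Lin T s t R its) {v : V} (hT : Gen 𝒢 v T)
    {w : List (TraceLetter A m r k)} (hw : List.Forall₂ Describes w its)
    (u : List (Marked (TraceLetter A m r k))) (st : List (TraceStack A V m r k)) :
    Relation.ReflTransGen (grammarPDA 𝒢 m r k).Step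
      (true, w.map Marked.letter ++ u, .var v R :: st) (true, u, st) := by
  induction h generalizing v w u st with
  | leaf a s t R =>
    cases hT with
    | letter _ _ hv =>
      rcases hw with _ | ⟨h1, _ | _⟩
      rename_i x
      cases x with
      | edge f =>
        obtain ⟨h1, h2, h3⟩ := h1
        exact .head (grammarPDA_expands (.letter v a R f hv h1 h2 h3)) (.single grammarPDA_reads)
      | node idx => exact h1.elim
  | ser T₁ T₂ s u' t R l₁ l₂ h₁ h₂ ih₁ ih₂ =>
    cases hT with
    | series _ w₁ w₂ _ _ _ hv g₁ g₂ =>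
      obtain ⟨wa, wb, hwa, hwb, rfl⟩ : ∃ wa wb, List.Forall₂ Describes wa l₁ ∧
          List.Forall₂ Describes wb (.node R u' :: l₂) ∧ w = wa ++ wb := by
        refine ⟨w.take l₁.length, w.drop l₁.length, ?_, ?_, (List.take_append_drop _ _).symm⟩
        · simpa using List.forall₂_take l₁.length hw
        · simpa using List.forall₂_drop l₁.length hw
      rcases hwb with _ | ⟨h1, hwb⟩
      rename_i x wb
      cases x with
      | edge f => exact h1.elim
      | node idx =>
        refine .head (grammarPDA_expands (.series v w₁ w₂ R idx hv h1)) ?_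
        simp only [List.map_append, List.map_cons, List.append_assoc, List.cons_append]
        exact (ih₁ g₁ hwa _ _).trans (.head grammarPDA_reads (ih₂ g₂ hwb _ _))
  | par T₁ T₂ s t R₁ R₂ l₁ l₂ hR₁ hR₂ hd h₁ h₂ ih₁ ih₂ =>
    cases hT with
    | parallel _ w₁ w₂ _ _ hv g₁ g₂ =>
      obtain ⟨wa, wb, hwa, hwb, rfl⟩ : ∃ wa wb, List.Forall₂ Describes wa l₁ ∧
          List.Forall₂ Describes wb l₂ ∧ w = wa ++ wb := by
        refine ⟨w.take l₁.length, w.drop l₁.length, ?_, ?_, (List.take_append_drop _ _).symm⟩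
        · simpa using List.forall₂_take l₁.length hw
        · simpa using List.forall₂_drop l₁.length hw
      refine .head (grammarPDA_expands (.parallel v w₁ w₂ R₁ R₂ hv hR₁ hR₂ hd)) ?_
      simp only [List.map_append, List.append_assoc, List.cons_append]
      exact (ih₁ g₁ hwa _ _).trans (ih₂ g₂ hwb _ _)
  | parLeft T₁ T₂ s t R l h ih =>
    cases hT with
    | parallel _ w₁ w₂ _ _ hv g₁ g₂ =>
      exact .head (grammarPDA_expands (.parallelLeft v w₁ w₂ R hv g₂.productive)) (ih g₁ hw _ _)
  | parRight T₁ T₂ s t R l h ih =>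
    cases hT with
    | parallel _ w₁ w₂ _ _ hv g₁ g₂ =>
      exact .head (grammarPDA_expands (.parallelRight v w₁ w₂ R hv g₁.productive)) (ih g₂ hw _ _)

/-- Conversely, every linearization of a derived tree is described by a trace word. -/
theorem mem_language_grammarPDA {N : Type*} {T : SPTree N A} {s t : N}
    {its : List (Item N A (Row m r))} (h : Lin T s t Set.univ its) (hT : Gen 𝒢 𝒢.start T)
    {w : List (TraceLetter A m r k)} (hw : List.Forall₂ Describes w (fullItems s t its)) :
    w ∈ (grammarPDA 𝒢 m r k).language := by
  obtain ⟨x, w', y, rfl, hx, hw', hy⟩ : ∃ x w' y, w = x :: w' ++ [y] ∧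
      Describes x (.node Set.univ s : Item N A (Row m r)) ∧ List.Forall₂ Describes w' its ∧
      Describes y (.node Set.univ t : Item N A (Row m r)) := by
    rcases hw with _ | ⟨hx, hw⟩
    rename_i x w
    have h1 := by simpa using List.forall₂_take its.length hw
    have h2 := by simpa using List.forall₂_drop its.length hw
    generalize hd : w.drop its.length = d at h2
    rcases h2 with _ | ⟨hy, _ | _⟩
    rename_i y
    refine ⟨x, w.take its.length, y, ?_, hx, h1, hy⟩
    rw [List.cons_append, ← hd, List.take_append_drop]
  cases x with
  | edge f => exact hx.elim
  | node idx =>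
    cases y with
    | edge f => exact hy.elim
    | node idx' =>
      refine ⟨true, .head (b := (true, Marked.wrap (TraceLetter.node idx :: w' ++ [.node idx']),
        [.input .left, .input (.letter (.node idx)), .var 𝒢.start Set.univ,
          .input (.letter (.node idx')), .input .right, .bot]))
        ⟨none, .bot, [], _, rfl, rfl, rfl, TraceTrans.init idx idx' hx hy⟩ ?_⟩
      simp only [Marked.wrap, List.map_append, List.map_cons, List.map_nil, List.append_assoc,
        List.cons_append, List.nil_append]
      exact .head grammarPDA_reads (.head grammarPDA_reads
        ((h.reflTransGen hT hw' _ _).trans (.head grammarPDA_reads (.single grammarPDA_reads))))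

end Grammar

/-! ### Positions of the rows during a traversal -/

/-- The state of a traversal: the current node of every row, the nodes that have been left, and the
last node at which rows met. -/
structure TravState (N ι : Type*) where
  loc : ι → N
  left : Set N
  last : N

open Classical in
/-- The effect of an event. -/
noncomputable def Item.next {N A ι : Type*} (it : Item N A ι) (st : TravState N ι) :
    TravState N ι :=
  match it with
  | .edge R e => ⟨fun i => if i ∈ R then e.2.1 else st.loc i, insert e.1 st.left, st.last⟩
  | .node _ x => ⟨st.loc, st.left, x⟩

/-- The event is possible. An edge that leaves its source for the first time comes immediately after
the event at which the rows meet in this source, and nodes are not entered after they have been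
left. -/
def Item.Ok {N A ι : Type*} (it : Item N A ι) (st : TravState N ι) : Prop :=
  match it with
  | .edge R e => (Nonempty ι → R.Nonempty) ∧ (∀ i ∈ R, st.loc i = e.1) ∧
      (e.1 ∉ st.left → st.last = e.1) ∧ (st.last ∉ st.left → e.1 = st.last) ∧
      e.2.1 ∉ st.left ∧ e.2.1 ≠ e.1
  | .node R x => x ∉ st.left ∧ ∀ i, i ∈ R ↔ st.loc i = x

/-- All events are possible. -/
def ValidItems {N A ι : Type*} : List (Item N A ι) → TravState N ι → Prop
  | [], _ => True
  | it :: its, st => it.Ok st ∧ ValidItems its (it.next st)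

/-- The state after a list of events. -/
noncomputable def travAfter {N A ι : Type*} (its : List (Item N A ι)) (st : TravState N ι) :
    TravState N ι :=
  its.foldl (fun st it => it.next st) st

theorem validItems_append {N A ι : Type*} {l l' : List (Item N A ι)} {st : TravState N ι} :
    ValidItems (l ++ l') st ↔ ValidItems l st ∧ ValidItems l' (travAfter l st) := by
  induction l generalizing st with
  | nil => simp [ValidItems, travAfter]
  | cons it l ih => simp [ValidItems, ih, travAfter, and_assoc]

theorem travAfter_append {N A ι : Type*} (l l' : List (Item N A ι)) (st : TravState N ι) :
    travAfter (l ++ l') st = travAfter l' (travAfter l st) := by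
  simp [travAfter]

/-- A linearization is a valid traversal: the rows in `R`, all located at the source, are moved
along edges to the sink. -/
theorem Lin.validItems {N A ι : Type*} {T : SPTree N A} {s t : N} {R : Set ι}
    {l : List (Item N A ι)} (h : Lin T s t R l) (hn : (T.nodes s t).Nodup)
    (hR : Nonempty ι → R.Nonempty) (st : TravState N ι)
    (hs : ∀ i ∈ R, st.loc i = s)
    (hlast : (s ∉ st.left ∧ st.last = s) ∨ (s ∈ st.left ∧ st.last ∈ st.left))
    (hin : ∀ x ∈ T.inner, x ∉ st.left ∧ ∀ i, st.loc i ≠ x) (ht : t ∉ st.left) :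
    ValidItems l st ∧ (∀ i ∈ R, (travAfter l st).loc i = t) ∧
      (∀ i ∉ R, (travAfter l st).loc i = st.loc i) ∧ st.left ⊆ (travAfter l st).left ∧
      s ∈ (travAfter l st).left ∧ (∀ x ∈ (travAfter l st).left, x ∈ st.left ∨ x = s ∨ x ∈ T.inner) ∧
      (travAfter l st).last ∈ (travAfter l st).left := by
  induction h generalizing st with
  | leaf a s t R =>
    have hne : t ≠ s := by
      rintro rfl
      simp [SPTree.nodes, SPTree.inner] at hn
    refine ⟨⟨⟨hR, hs, ?_, ?_, ht, hne⟩, trivial⟩, ?_⟩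
    · intro h
      exact (hlast.resolve_right fun h' => h h'.1).2
    · intro h
      exact (hlast.resolve_right fun h' => h h'.2).2.symm
    · simp only [travAfter, Item.next, List.foldl_cons, List.foldl_nil]
      refine ⟨fun i hi => if_pos hi, fun i hi => if_neg hi, Set.subset_insert _ _,
        Set.mem_insert _ _, ?_, ?_⟩
      · rintro x (rfl | hx)
        · exact Or.inr (Or.inl rfl)
        · exact Or.inl hx
      · rcases hlast with h | h
        · exact Or.inl h.2
        · exact Or.inr h.2
  | ser T₁ T₂ s u t R l₁ l₂ h₁ h₂ ih₁ ih₂ =>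
    simp only [SPTree.nodes, SPTree.inner, List.cons_append, List.append_assoc] at hn
    have hn' := hn
    rw [List.nodup_cons, List.nodup_append] at hn'
    simp only [List.mem_append, List.mem_cons, List.nodup_cons, not_or] at hn'
    obtain ⟨⟨hs1, hsu, hs2, hst, -⟩, hn1, ⟨⟨hu2, hut, -⟩, hn2⟩, hdis⟩ := hn'
    have nd₁ : (T₁.nodes s u).Nodup := by
      refine hn.sublist ?_
      simp only [SPTree.nodes, List.cons_append]
      exact List.Sublist.cons_cons _ ((List.sublist_append_left [u] (T₂.inner ++
        [t])).append_left _)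
    have nd₂ : (T₂.nodes u t).Nodup := by
      refine hn.sublist ?_
      simp only [SPTree.nodes, List.cons_append]
      exact ((List.Sublist.refl _).trans (List.sublist_append_right T₁.inner _)).cons _
    have hin' : ∀ x, x ∈ T₁.inner ∨ x = u ∨ x ∈ T₂.inner → x ∉ st.left ∧ ∀ i, st.loc i ≠ x := by
      intro x hx
      exact hin x (by simpa [SPTree.inner] using hx)
    have hu := hin' u (Or.inr (Or.inl rfl))
    obtain ⟨v1, loc1, out1, sub1, s1, left1, last1⟩ :=
      ih₁ nd₁ hR st hs hlast (fun x hx => hin' x (Or.inl hx)) hu.1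
    set st₁ := travAfter l₁ st with hst₁
    have hul : u ∉ st₁.left := by
      intro h
      rcases left1 u h with h | h | h
      · exact hu.1 h
      · exact hsu h.symm
      · exact hdis u h u (Or.inl rfl) rfl
    obtain ⟨v2, loc2, out2, sub2, s2, left2, last2⟩ :=
      ih₂ nd₂ hR ⟨st₁.loc, st₁.left, u⟩ loc1 (Or.inl ⟨hul, rfl⟩) (by
        intro x hx
        have hx' := hin' x (Or.inr (Or.inr hx))
        refine ⟨fun h => ?_, fun i => ?_⟩
        · rcases left1 x h with h | h | h
          · exact hx'.1 h
          · exact hs2 (h ▸ hx)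
          · exact hdis x h x (Or.inr (Or.inl hx)) rfl
        · by_cases hi : i ∈ R
          · rw [loc1 i hi]
            rintro rfl
            exact hu2 hx
          · rw [out1 i hi]
            exact hx'.2 i) (by
        intro h
        rcases left1 t h with h | h | h
        · exact ht h
        · exact hst h.symm
        · exact hdis t h t (Or.inr (Or.inr (Or.inl rfl))) rfl)
    have hafter : travAfter (l₁ ++ .node R u :: l₂) st = travAfter l₂ ⟨st₁.loc, st₁.left, u⟩ := by
      rw [travAfter_append, ← hst₁]
      rfl
    rw [hafter, validItems_append, ← hst₁]
    refine ⟨⟨v1, ⟨hul, fun i => ⟨loc1 i, fun h => ?_⟩⟩, v2⟩, loc2, ?_, sub1.trans sub2, sub2 s1, ?_,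
      last2⟩
    · by_contra hi
      rw [out1 i hi] at h
      exact hu.2 i h
    · intro i hi
      rw [out2 i hi]
      exact out1 i hi
    · intro x hx
      simp only [SPTree.inner, List.mem_append, List.mem_cons]
      rcases left2 x hx with h | h | h
      · rcases left1 x h with h | h | h <;> simp [h]
      · simp [h]
      · simp [h]
  | par T₁ T₂ s t R₁ R₂ l₁ l₂ hR₁ hR₂ hd h₁ h₂ ih₁ ih₂ =>
    simp only [SPTree.nodes, SPTree.inner, List.cons_append, List.append_assoc] at hn
    have hn' := hn
    rw [List.nodup_cons, List.nodup_append] at hn'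
    simp only [List.mem_append, List.mem_cons, not_or] at hn'
    obtain ⟨⟨hs1, hs2, hst, -⟩, hn1, hn2, hdis⟩ := hn'
    have nd₁ : (T₁.nodes s t).Nodup := by
      refine hn.sublist ?_
      simp only [SPTree.nodes, List.cons_append]
      exact List.Sublist.cons_cons _ ((List.sublist_append_right T₂.inner [t]).append_left _)
    have nd₂ : (T₂.nodes s t).Nodup := by
      refine hn.sublist ?_
      simp only [SPTree.nodes, List.cons_append]
      exact List.Sublist.cons_cons _ (List.sublist_append_right T₁.inner _)
    have hin' : ∀ x, x ∈ T₁.inner ∨ x ∈ T₂.inner → x ∉ st.left ∧ ∀ i, st.loc i ≠ x := by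
      intro x hx
      exact hin x (by simpa [SPTree.inner] using hx)
    obtain ⟨v1, loc1, out1, sub1, s1, left1, last1⟩ :=
      ih₁ nd₁ (fun _ => hR₁) st (fun i hi => hs i (Or.inl hi)) hlast
        (fun x hx => hin' x (Or.inl hx)) ht
    set st₁ := travAfter l₁ st with hst₁
    obtain ⟨v2, loc2, out2, sub2, s2, left2, last2⟩ :=
      ih₂ nd₂ (fun _ => hR₂) st₁ (by
        intro i hi
        rw [out1 i fun h => Set.disjoint_left.1 hd h hi]
        exact hs i (Or.inr hi)) (Or.inr ⟨s1, last1⟩) (by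
        intro x hx
        have hx' := hin' x (Or.inr hx)
        refine ⟨fun h => ?_, fun i => ?_⟩
        · rcases left1 x h with h | h | h
          · exact hx'.1 h
          · exact hs2 (h ▸ hx)
          · exact hdis x h x (Or.inl hx) rfl
        · by_cases hi : i ∈ R₁
          · rw [loc1 i hi]
            rintro rfl
            rw [List.nodup_append] at hn2
            exact hn2.2.2 t hx t (by simp) rfl
          · rw [out1 i hi]
            exact hx'.2 i) (by
        intro h
        rcases left1 t h with h | h | h
        · exact ht h
        · exact hst h.symm
        · exact hdis t h t (Or.inr (Or.inl rfl)) rfl)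
    rw [travAfter_append, ← hst₁, validItems_append, ← hst₁]
    refine ⟨⟨v1, v2⟩, ?_, ?_, sub1.trans sub2, sub2 s1, ?_, last2⟩
    · rintro i (hi | hi)
      · rw [out2 i fun h => Set.disjoint_left.1 hd hi h]
        exact loc1 i hi
      · exact loc2 i hi
    · intro i hi
      rw [out2 i fun h => hi (Or.inr h)]
      exact out1 i fun h => hi (Or.inl h)
    · intro x hx
      simp only [SPTree.inner, List.mem_append]
      rcases left2 x hx with h | h | h
      · rcases left1 x h with h | h | h <;> simp [h]
      · simp [h]
      · simp [h]
  | parLeft T₁ T₂ s t R l h ih =>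
    have nd₁ : (T₁.nodes s t).Nodup := by
      refine hn.sublist ?_
      simp only [SPTree.nodes, SPTree.inner, List.cons_append, List.append_assoc]
      exact List.Sublist.cons_cons _ ((List.sublist_append_right T₂.inner [t]).append_left _)
    obtain ⟨v1, loc1, out1, sub1, s1, left1, last1⟩ := ih nd₁ hR st hs hlast
      (fun x hx => hin x (by simp [SPTree.inner, hx])) ht
    refine ⟨v1, loc1, out1, sub1, s1, fun x hx => ?_, last1⟩
    simp only [SPTree.inner, List.mem_append]
    rcases left1 x hx with h | h | h <;> simp [h]
  | parRight T₁ T₂ s t R l h ih =>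
    have nd₂ : (T₂.nodes s t).Nodup := by
      refine hn.sublist ?_
      simp only [SPTree.nodes, SPTree.inner, List.cons_append, List.append_assoc]
      exact List.Sublist.cons_cons _ (List.sublist_append_right T₁.inner _)
    obtain ⟨v1, loc1, out1, sub1, s1, left1, last1⟩ := ih nd₂ hR st hs hlast
      (fun x hx => hin x (by simp [SPTree.inner, hx])) ht
    refine ⟨v1, loc1, out1, sub1, s1, fun x hx => ?_, last1⟩
    simp only [SPTree.inner, List.mem_append]
    rcases left1 x hx with h | h | h <;> simp [h]

/-- The state before a traversal from the source `s`. -/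
def travInit {N : Type*} (ι : Type*) (s : N) : TravState N ι := ⟨fun _ => s, ∅, s⟩

theorem Lin.validItems_full {N A ι : Type*} {T : SPTree N A} {s t : N} {l : List (Item N A ι)}
    (h : Lin T s t Set.univ l) (hn : (T.nodes s t).Nodup) :
    ValidItems (fullItems s t l) (travInit ι s) ∧
      (∀ i, (travAfter (fullItems s t l) (travInit ι s)).loc i = t) ∧
      t ∉ (travAfter (fullItems s t l) (travInit ι s)).left ∧
      (travAfter (fullItems s t l) (travInit ι s)).last = t := by
  have hn' := hn
  simp only [SPTree.nodes, List.cons_append, List.nodup_cons, List.mem_append,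
    List.mem_singleton, not_or, List.nodup_append] at hn'
  obtain ⟨⟨hs, hst⟩, -, -, ht⟩ := hn'
  obtain ⟨v1, loc1, out1, sub1, s1, left1, last1⟩ := h.validItems hn
    (fun ⟨i⟩ => ⟨i, trivial⟩) (travInit ι s) (fun i _ => rfl) (Or.inl ⟨id, rfl⟩)
    (fun x hx => ⟨id, fun i h' => hs (by rw [show s = x from h']; exact hx)⟩) id
  have ht' : t ∉ (travAfter l (travInit ι s)).left := by
    intro h'
    rcases left1 t h' with h' | h' | h'
    · exact h'
    · exact hst h'.symm
    · exact ht t h' t rfl rfl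
  have hafter : travAfter (fullItems s t l) (travInit ι s) =
      ⟨(travAfter l (travInit ι s)).loc, (travAfter l (travInit ι s)).left, t⟩ := by
    rw [fullItems, travAfter_append]
    rfl
  rw [hafter]
  refine ⟨?_, fun i => loc1 i trivial, ht', rfl⟩
  rw [fullItems, validItems_append]
  refine ⟨⟨⟨id, fun i => ⟨fun _ => rfl, fun _ => trivial⟩⟩, v1⟩, ?_, trivial⟩
  exact ⟨ht', fun i => ⟨fun _ => loc1 i trivial, fun _ => trivial⟩⟩

theorem Lin.mem_edges {N A ι : Type*} {T : SPTree N A} {s t : N} {R : Set ι}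
    {l : List (Item N A ι)} (h : Lin T s t R l) :
    ∀ R' e, Item.edge R' e ∈ l → e ∈ T.edges s t := by
  induction h with
  | leaf a s t R => simp [SPTree.edges]
  | ser T₁ T₂ s u t R l₁ l₂ h₁ h₂ ih₁ ih₂ =>
    intro R' e he
    simp only [List.mem_append, List.mem_cons, reduceCtorEq, false_or] at he
    exact Multiset.mem_add.2 (he.imp (ih₁ R' e) (ih₂ R' e))
  | par T₁ T₂ s t R₁ R₂ l₁ l₂ hR₁ hR₂ hd h₁ h₂ ih₁ ih₂ =>
    intro R' e he
    exact Multiset.mem_add.2 ((List.mem_append.1 he).imp (ih₁ R' e) (ih₂ R' e))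
  | parLeft T₁ T₂ s t R l h ih =>
    exact fun R' e he => Multiset.mem_add.2 (Or.inl (ih R' e he))
  | parRight T₁ T₂ s t R l h ih =>
    exact fun R' e he => Multiset.mem_add.2 (Or.inr (ih R' e he))

/-- The state after `p` events. -/
noncomputable def travAt {N A ι : Type*} (F : List (Item N A ι)) (st : TravState N ι) (p : ℕ) :
    TravState N ι :=
  travAfter (F.take p) st

theorem travAt_succ {N A ι : Type*} {F : List (Item N A ι)} {st : TravState N ι} {p : ℕ}
    {it : Item N A ι} (h : F[p]? = some it) : travAt F st (p + 1) = it.next (travAt F st p) := by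
  rw [travAt, List.take_add_one, h, travAfter_append]
  rfl

theorem ValidItems.ok {N A ι : Type*} {F : List (Item N A ι)} {st : TravState N ι}
    (hF : ValidItems F st) {p : ℕ} {it : Item N A ι} (h : F[p]? = some it) :
    it.Ok (travAt F st p) := by
  obtain ⟨hp, h'⟩ := List.getElem?_eq_some_iff.1 h
  rw [← List.take_append_drop p F, validItems_append, List.drop_eq_getElem_cons hp, h'] at hF
  exact hF.2.1

/-! ### Register identifiers -/

theorem NRun.exists_states {α σ : Type*} {N : NFA α σ} {w : List α} {s s' : σ}
    (h : NRun N s w s') : ∃ c : ℕ → σ, c 0 = s ∧ c w.length = s' ∧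
      ∀ p a, w[p]? = some a → c (p + 1) ∈ N.step (c p) a := by
  induction w generalizing s with
  | nil => exact ⟨fun _ => s, rfl, h, by simp⟩
  | cons a w ih =>
    obtain ⟨t, ht, h⟩ := h
    obtain ⟨c, h0, h1, h2⟩ := ih h
    refine ⟨fun p => Nat.casesOn p s c, rfl, h1, ?_⟩
    rintro (_ | p) b hb
    · simp only [List.getElem?_cons_zero, Option.some.injEq] at hb
      subst hb
      change c 0 ∈ _
      rw [h0]
      exact ht
    · exact h2 p b (by simpa using hb)

/-- The relation between a traversal and a run of the NFA for register identifiers. `Seen` holds for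
the pairs of a node and an identifier such that, up to now, a row was at this node while this was
its current identifier. -/
structure RegInv {N : Type*} {m r k : ℕ} (st : TravState N (Row m r))
    (l : Row m r → PathIndex m r) (ι : Row m r → Option (Fin k)) (U : Set (Fin k))
    (Seen : N → Option (Fin k) → Prop) : Prop where
  cur : ∀ i, Seen (st.loc i) (ι i)
  unique : ∀ x ∈ st.left, ∀ o o', Seen x o → Seen x o' → o = o'
  present : ∀ x ∉ st.left, ∀ o, Seen x o → ∃ i, st.loc i = x ∧ ι i = o
  used : ∀ j, j ∈ U ↔ ∃ x ∈ st.left, Seen x (some j)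
  inj : ∀ x ∈ st.left, ∀ y ∈ st.left, ∀ j, Seen x (some j) → Seen y (some j) → x = y
  isLeft : ∀ x j, Seen x (some j) → j ∈ U → x ∈ st.left
  last : st.last ∉ st.left →
    (∀ i i', st.loc i = st.last → st.loc i' = st.last → ι i = ι i') ∧
    ∀ i i', st.loc i = st.last → l i' = l i → st.loc i' = st.last

/-- One item preserves the register invariant. -/
theorem RegInv.next {N A : Type*} {m r k : ℕ} {st : TravState N (Row m r)}
    {l : Row m r → PathIndex m r} {ι : Row m r → Option (Fin k)} {U : Set (Fin k)}
    {Seen : N → Option (Fin k) → Prop} (h : RegInv st l ι U Seen) {it : Item N A (Row m r)}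
    (hok : it.Ok st) {x : TraceLetter A m r k} (hx : Describes x it) {c : RegState m r k}
    (hc : RegTrans (.track l ι U) (.letter x) c) :
    ∃ l' ι' U', c = .track l' ι' U' ∧
      (∀ f i, x = .edge f → (f i).sym ≠ none → (f i).src = ι i ∧ (f i).tgt = ι' i) ∧
      RegInv (it.next st) l' ι' U'
        (fun y o => Seen y o ∨ ∃ i, (it.next st).loc i = y ∧ ι' i = o) := by
  classical
  cases hc with
  | node _ idx _ _ hidx =>
    cases it with
    | edge R e => exact hx.elim
    | node R y =>
      have hs : ∀ z o, (Seen z o ∨ ∃ i, st.loc i = z ∧ ι i = o) ↔ Seen z o := by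
        intro z o
        refine ⟨?_, Or.inl⟩
        rintro (h' | ⟨i, rfl, rfl⟩)
        · exact h'
        · exact h.cur i
      refine ⟨_, _, _, rfl, by simp, ?_⟩
      have hx' : Shares R idx := hx
      simp only [Item.next, hs]
      refine ⟨h.cur, h.unique, h.present, h.used, h.inj, h.isLeft, fun _ => ⟨?_, ?_⟩⟩
      · intro i i' hi hi'
        exact hidx i i' ((hx' i i').2 (Or.inr ⟨(hok.2 i).2 hi, (hok.2 i').2 hi'⟩))
      · intro i i' hi hi'
        rcases (hx' i' i).1 hi' with rfl | h'
        · exact hi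
        · exact (hok.2 i').1 h'.1
  | edge _ _ ι' _ U' f hsrc hι hι' hU hleave henter =>
    cases it with
    | node R y => exact hx.elim
    | edge R e =>
      obtain ⟨hin, hout, -⟩ := hx
      obtain ⟨hne, hloc, hlast, hlast', hent, hself⟩ := hok
      have hmem : ∀ i, (f i).sym ≠ none ↔ i ∈ R := by
        intro i
        refine ⟨fun h' => by_contra fun hi => h' (hout i hi), fun hi => ?_⟩
        rw [hin i hi]
        simp
      refine ⟨_, ι', U', rfl, ?_, ?_⟩
      · rintro g i hg hi
        cases hg
        exact ⟨hsrc i hi, (hι i hi).symm⟩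
      have hs : ∀ z o, (Seen z o ∨ ∃ i, ((Item.edge R e).next st).loc i = z ∧ ι' i = o) ↔
          Seen z o ∨ (z = e.2.1 ∧ ∃ i ∈ R, ι' i = o) := by
        intro z o
        refine ⟨?_, ?_⟩
        · rintro (h' | ⟨i, rfl, rfl⟩)
          · exact Or.inl h'
          · by_cases hi : i ∈ R
            · exact Or.inr ⟨if_pos hi, i, hi, rfl⟩
            · refine Or.inl ?_
              have := h.cur i
              simp only [Item.next, if_neg hi, hι' i (hout i hi)]
              exact this
        · rintro (h' | ⟨rfl, i, hi, rfl⟩)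
          · exact Or.inl h'
          · exact Or.inr ⟨i, if_pos hi, rfl⟩
      have hR : ∀ {z o}, Seen z o → z ∉ st.left → ∃ i ∈ R, True := by
        intro z o hz hzl
        obtain ⟨i, -⟩ := h.present z hzl o hz
        obtain ⟨i, hi⟩ := hne ⟨i⟩
        exact ⟨i, hi, trivial⟩
      -- When a node is left for the first time, all rows there have the same identifier.
      have huniq : ∀ o o', e.1 ∉ st.left → Seen e.1 o → Seen e.1 o' → o = o' := by
        intro o o' hl h1 h2
        obtain ⟨i, hi, rfl⟩ := h.present _ hl _ h1
        obtain ⟨i', hi', rfl⟩ := h.present _ hl _ h2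
        have hl' := hlast hl
        exact (h.last (hl' ▸ hl)).1 i i' (hi.trans hl'.symm) (hi'.trans hl'.symm)
      have hU' : ∀ j, j ∈ U' ↔ j ∈ U ∨ ∃ i ∈ R, ι i = some j := by
        intro j
        rw [hU]
        simp only [Set.mem_union, Set.mem_ofPred_eq, hmem]
      simp only [hs]
      have hleft : ((Item.edge R e).next st).left = insert e.1 st.left := rfl
      have hold : ∀ z ∈ insert e.1 st.left, ∀ o,
          (Seen z o ∨ (z = e.2.1 ∧ ∃ i ∈ R, ι' i = o)) → Seen z o := by
        rintro z hz o (h' | ⟨rfl, -⟩)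
        · exact h'
        · rcases hz with hz | hz
          · exact absurd hz hself
          · exact absurd hz hent
      have hseenU : ∀ j, Seen e.1 (some j) → j ∈ U' := by
        intro j hj
        rw [hU']
        by_cases hl : e.1 ∈ st.left
        · exact Or.inl ((h.used j).2 ⟨_, hl, hj⟩)
        · obtain ⟨i, hi, -⟩ := hR hj hl
          refine Or.inr ⟨i, hi, ?_⟩
          exact huniq _ _ hl (hloc i hi ▸ h.cur i) hj
      refine ⟨?_, ?_, ?_, ?_, ?_, ?_, ?_⟩
      · intro i
        by_cases hi : i ∈ R
        · exact Or.inr ⟨if_pos hi, i, hi, rfl⟩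
        · have := h.cur i
          rw [hι' i (hout i hi)]
          simp only [Item.next, if_neg hi]
          exact Or.inl this
      · intro z hz o o' h1 h2
        have h1 := hold z hz o h1
        have h2 := hold z hz o' h2
        by_cases hl : z ∈ st.left
        · exact h.unique z hl o o' h1 h2
        · have : z = e.1 := hz.resolve_right hl
          subst this
          exact huniq o o' hl h1 h2
      · intro z hz o h1
        rcases h1 with h1 | ⟨rfl, i, hi, rfl⟩
        · obtain ⟨i, rfl, rfl⟩ := h.present z (fun h' => hz (Or.inr h')) o h1
          have hi : i ∉ R := fun hi => hz (Or.inl (hloc i hi))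
          exact ⟨i, if_neg hi, hι' i (hout i hi)⟩
        · exact ⟨i, if_pos hi, rfl⟩
      · intro j
        rw [hU', hleft]
        constructor
        · rintro (hj | ⟨i, hi, hj⟩)
          · obtain ⟨z, hz, hj⟩ := (h.used j).1 hj
            exact ⟨z, Or.inr hz, Or.inl hj⟩
          · refine ⟨e.1, Or.inl rfl, Or.inl ?_⟩
            rw [← hj, ← hloc i hi]
            exact h.cur i
        · rintro ⟨z, hz, hj⟩
          have hj := hold z hz _ hj
          rcases hz with rfl | hz
          · exact (hU' j).1 (hseenU j hj)
          · exact Or.inl ((h.used j).2 ⟨z, hz, hj⟩)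
      · -- Distinct nodes that have been left have distinct identifiers.
        have hnew : ∀ z ∈ st.left, ∀ j, e.1 ∉ st.left → Seen e.1 (some j) → Seen z (some j) →
            False := by
          intro z hz j hl h1 h2
          exact hl (h.isLeft _ j h1 ((h.used j).2 ⟨z, hz, h2⟩))
        intro z hz y hy j h1 h2
        have h1 := hold z hz _ h1
        have h2 := hold y hy _ h2
        by_cases hzl : z ∈ st.left
        · by_cases hyl : y ∈ st.left
          · exact h.inj z hzl y hyl j h1 h2
          · obtain rfl : y = e.1 := hy.resolve_right hyl
            exact (hnew z hzl j hyl h2 h1).elim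
        · obtain rfl : z = e.1 := hz.resolve_right hzl
          by_cases hyl : y ∈ st.left
          · exact (hnew y hyl j hzl h1 h2).elim
          · exact (hy.resolve_right hyl).symm
      · intro z j hz hj
        rcases hz with hz | ⟨rfl, i, hi, hz⟩
        · by_cases hjU : j ∈ U
          · exact Or.inr (h.isLeft z j hz hjU)
          · obtain ⟨i, hi, hij⟩ := ((hU' j).1 hj).resolve_left hjU
            have hzl : z ∉ st.left := fun hzl => hjU ((h.used j).2 ⟨z, hzl, hz⟩)
            obtain ⟨i', rfl, hi'⟩ := h.present z hzl _ hz
            have h1 := hleave i j ((hmem i).2 hi) hij hjU i' hi'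
            have hl : e.1 ∉ st.left := by
              intro hl
              refine hjU ((h.used j).2 ⟨_, hl, ?_⟩)
              rw [← hij, ← hloc i hi]
              exact h.cur i
            have hl' := hlast hl
            have := (h.last (hl' ▸ hl)).2 i i' ((hloc i hi).trans hl'.symm) h1
            exact Or.inl (this.trans hl')
        · rw [hι i ((hmem i).2 hi)] at hz
          exact absurd hj (henter i j ((hmem i).2 hi) hz)
      · intro hl
        have hl₁ : st.last ∉ insert e.1 st.left := hl
        exact absurd (Or.inl (hlast' fun h' => hl₁ (Or.inr h')).symm) hl₁

/-- What an accepted trace tells about a graph with the set `E` of edges and the source `s`: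
`loc p i` is the node at which row `i` is after `p` letters, and `id` assigns to the nodes their
register identifiers. -/
structure IsTrace {N A : Type*} {m r k : ℕ} (E : Set (N × N × A)) (s : N)
    (id : N → Option (Fin k)) (W : List (TraceLetter A m r k)) (loc : ℕ → Row m r → N) : Prop where
  start : ∀ i, loc 0 i = s
  node : ∀ p idx, W[p]? = some (.node idx) → ∀ i, loc (p + 1) i = loc p i ∧
    ∀ i', idx i = idx i' → loc p i = loc p i'
  pad : ∀ p f i, W[p]? = some (.edge f) → (f i).sym = none → loc (p + 1) i = loc p i
  edge : ∀ p f i a, W[p]? = some (.edge f) → (f i).sym = some a →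
    (loc p i, loc (p + 1) i, a) ∈ E ∧ (f i).src = id (loc p i) ∧ (f i).tgt = id (loc (p + 1) i)
  meet : ∀ p f i i', W[p]? = some (.edge f) → (f i).sym ≠ none → (f i').sym ≠ none →
    (f i).idx = (f i').idx → loc p i = loc p i' ∧ loc (p + 1) i = loc (p + 1) i'
  inj : ∀ x y j, id x = some j → id y = some j → x = y

/-- The register identifiers of an accepted trace belong to the nodes of the graph, and distinct
nodes have distinct identifiers. -/
theorem exists_isTrace {N A : Type*} {m r k : ℕ} {T : SPTree N A} {s t : N}
    {its : List (Item N A (Row m r))} (hl : Lin T s t Set.univ its) (hn : (T.nodes s t).Nodup)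
    {W : List (TraceLetter A m r k)} (hW : List.Forall₂ Describes W (fullItems s t its))
    (hreg : Marked.wrap W ∈ (registerNFA A m r k).accepts) :
    ∃ (id : N → Option (Fin k)) (loc : ℕ → Row m r → N),
      IsTrace {e | e ∈ T.edges s t} s id W loc := by
  classical
  obtain ⟨hv, hend, htl, hlastt⟩ := hl.validItems_full hn
  set F := fullItems s t its with hF
  set tr : ℕ → TravState N (Row m r) := travAt F (travInit _ s) with htr
  obtain ⟨_, rfl, c', hc', hrun⟩ := (mem_accepts_iff_nRun _ _).1 hreg
  obtain ⟨t₀, ht₀, hrun⟩ := hrun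
  have ht₀' : RegTrans .start .left t₀ := ht₀
  cases ht₀' with
  | start l₀ j₀ =>
  obtain ⟨c, hc0, -, hstep⟩ := hrun.exists_states
  have hlen : W.length = F.length := hW.length_eq
  have hget : ∀ (p : ℕ) (x : TraceLetter A m r k), W[p]? = some x → ∃ it, F[p]? = some it ∧
    Describes x it := by
    intro p x hx
    obtain ⟨hp, rfl⟩ := List.getElem?_eq_some_iff.1 hx
    refine ⟨F[p]'(hlen ▸ hp), List.getElem?_eq_getElem _, ?_⟩
    exact List.forall₂_iff_get.1 hW |>.2 p hp (hlen ▸ hp)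
  have hstep' : ∀ (p : ℕ) (x : TraceLetter A m r k), W[p]? = some x → RegTrans (c p) (.letter x) (c
    (p + 1)) := by
    intro p x hx
    refine hstep p _ ?_
    have hp := (List.getElem?_eq_some_iff.1 hx).1
    change (W.map Marked.letter ++ [Marked.right])[p]? = _
    rw [List.getElem?_append_left (by simpa using hp), List.getElem?_map, hx]
    rfl
  let ident : RegState m r k → Row m r → Option (Fin k) := fun c i =>
    match c with
    | .track _ ι _ => ι i
    | _ => none
  let Seen : ℕ → N → Option (Fin k) → Prop := fun p y o =>
    ∃ q ≤ p, ∃ i, (tr q).loc i = y ∧ ident (c q) i = o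
  have hSeen : ∀ p, Seen (p + 1) = fun y o => Seen p y o ∨
      ∃ i, (tr (p + 1)).loc i = y ∧ ident (c (p + 1)) i = o := by
    intro p
    funext y o
    refine propext ⟨?_, ?_⟩
    · rintro ⟨q, hq, h⟩
      rcases Nat.le_succ_iff.1 hq with hq | rfl
      · exact Or.inl ⟨q, hq, h⟩
      · exact Or.inr h
    · rintro (⟨q, hq, h⟩ | h)
      · exact ⟨q, by omega, h⟩
      · exact ⟨p + 1, le_rfl, h⟩
  have hinv : ∀ p, p ≤ W.length →
      ∃ l ι U, c p = .track l ι U ∧ RegInv (tr p) l ι U (Seen p) := by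
    intro p
    induction p with
    | zero =>
      intro _
      refine ⟨_, _, _, hc0, ?_⟩
      have h0 : tr 0 = travInit _ s := rfl
      have hS : ∀ y o, Seen 0 y o ↔ Nonempty (Row m r) ∧ s = y ∧ j₀ = o := by
        intro y o
        constructor
        · rintro ⟨q, hq, i, h1, h2⟩
          obtain rfl : q = 0 := by omega
          rw [hc0] at h2
          exact ⟨⟨i⟩, h1, h2⟩
        · rintro ⟨⟨i⟩, h1, h2⟩
          exact ⟨0, le_rfl, i, h1, by rw [hc0]; exact h2⟩
      rw [h0]
      refine ⟨fun i => (hS _ _).2 ⟨⟨i⟩, rfl, rfl⟩, ?_, ?_, ?_, ?_, ?_, ?_⟩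
      · exact fun x hx => hx.elim
      · intro x _ o h
        obtain ⟨⟨i⟩, h1, h2⟩ := (hS _ _).1 h
        exact ⟨i, h1, h2⟩
      · exact fun j => ⟨fun h => h.elim, fun ⟨x, hx, _⟩ => hx.elim⟩
      · exact fun x hx => hx.elim
      · exact fun x j _ h => h.elim
      · exact fun _ => ⟨fun _ _ _ _ => rfl, fun _ _ _ _ => rfl⟩
    | succ p ih =>
      intro hp
      obtain ⟨l, ι, U, hcp, hI⟩ := ih (by omega)
      have hx : W[p]? = some W[p] := List.getElem?_eq_getElem _
      obtain ⟨it, hit, hd⟩ := hget p _ hx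
      have hs := hstep' p _ hx
      rw [hcp] at hs
      obtain ⟨l', ι', U', h1, -, h2⟩ := hI.next (hv.ok hit) hd hs
      refine ⟨l', ι', U', h1, ?_⟩
      rw [← travAt_succ hit] at h2
      rw [hSeen, h1]
      exact h2
  obtain ⟨lf, ιf, Uf, hcf, hIf⟩ := hinv W.length le_rfl
  have htrf : tr W.length = travAfter F (travInit _ s) := by
    rw [htr, travAt, hlen, List.take_length]
  rw [htrf] at hIf
  -- In the end the identifiers are a function of the nodes, and this function is injective.
  have hsink : ∀ x o, x ∉ (travAfter F (travInit _ s)).left → Seen W.length x o → x = t := by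
    intro x o hx h
    obtain ⟨i, hi, -⟩ := hIf.present x hx o h
    rw [← hi, hend i]
  have hfun : ∀ x o o', Seen W.length x o → Seen W.length x o' → o = o' := by
    intro x o o' h h'
    by_cases hx : x ∈ (travAfter F (travInit _ s)).left
    · exact hIf.unique x hx o o' h h'
    · obtain ⟨i, hi, rfl⟩ := hIf.present x hx o h
      obtain ⟨i', hi', rfl⟩ := hIf.present x hx o' h'
      have hxt := hsink x _ hx h
      refine (hIf.last (hlastt ▸ htl)).1 i i' ?_ ?_
      · rw [hi, hxt, hlastt]
      · rw [hi', hxt, hlastt]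
  have hinj : ∀ x y j, Seen W.length x (some j) → Seen W.length y (some j) → x = y := by
    intro x y j hx hy
    by_cases hxl : x ∈ (travAfter F (travInit _ s)).left
    · have hj := (hIf.used j).2 ⟨x, hxl, hx⟩
      exact hIf.inj x hxl y (hIf.isLeft y j hy hj) j hx hy
    · by_cases hyl : y ∈ (travAfter F (travInit _ s)).left
      · have hj := (hIf.used j).2 ⟨y, hyl, hy⟩
        exact absurd (hIf.isLeft x j hx hj) hxl
      · rw [hsink x _ hxl hx, hsink y _ hyl hy]
  let id : N → Option (Fin k) := fun x =>
    if h : ∃ o, Seen W.length x o then h.choose else none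
  have hid : ∀ x o, Seen W.length x o → id x = o := by
    intro x o h
    have h' : ∃ o, Seen W.length x o := ⟨o, h⟩
    simp only [id, dif_pos h']
    exact hfun x _ _ h'.choose_spec h
  have hidc : ∀ p ≤ W.length, ∀ i, id ((tr p).loc i) = ident (c p) i := by
    intro p hp i
    exact hid _ _ ⟨p, hp, i, rfl, rfl⟩
  refine ⟨id, fun p i => (tr p).loc i, ⟨fun i => rfl, ?_, ?_, ?_, ?_, ?_⟩⟩
  · intro p idx hp i
    obtain ⟨it, hit, hd⟩ := hget p _ hp
    have hok := hv.ok hit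
    cases it with
    | edge R e => exact hd.elim
    | node R x =>
      simp only [htr, travAt_succ hit]
      refine ⟨rfl, fun i' h => ?_⟩
      rcases (hd i i').1 h with rfl | ⟨h1, h2⟩
      · rfl
      · exact ((hok.2 i).1 h1).trans ((hok.2 i').1 h2).symm
  · intro p f i hp hi
    obtain ⟨it, hit, hd⟩ := hget p _ hp
    cases it with
    | node R x => exact hd.elim
    | edge R e =>
      simp only [htr, travAt_succ hit]
      refine if_neg fun h => ?_
      rw [hd.1 i h] at hi
      cases hi
  · intro p f i a hp hi
    obtain ⟨it, hit, hd⟩ := hget p _ hp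
    have hok := hv.ok hit
    have hplt := (List.getElem?_eq_some_iff.1 hp).1
    cases it with
    | node R x => exact hd.elim
    | edge R e =>
      have hiR : i ∈ R := by
        by_contra h
        rw [hd.2.1 i h] at hi
        cases hi
      have h1 : (tr p).loc i = e.1 := hok.2.1 i hiR
      have h2 : (tr (p + 1)).loc i = e.2.1 := by
        simp only [htr, travAt_succ hit]
        exact if_pos hiR
      have h3 : a = e.2.2 := by
        rw [hd.1 i hiR] at hi
        exact (Option.some.inj hi).symm
      refine ⟨?_, ?_⟩
      · have : (e.1, e.2.1, e.2.2) ∈ T.edges s t := by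
          have hmem : Item.edge R e ∈ F := List.mem_of_getElem? hit
          rw [hF, fullItems] at hmem
          simp only [List.cons_append, List.mem_cons, List.mem_append, List.not_mem_nil,
            reduceCtorEq, false_or, or_false] at hmem
          exact hl.mem_edges R e hmem
        rw [h1, h2, h3]
        exact this
      · rw [hidc p hplt.le, hidc (p + 1) hplt]
        obtain ⟨l, ι, U, hcp, hI⟩ := hinv p hplt.le
        have hs := hstep' p _ hp
        rw [hcp] at hs
        obtain ⟨l', ι', U', h4, h5, -⟩ := hI.next hok hd hs
        rw [hcp, h4]
        exact h5 f i rfl (by simp [hi])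
  · intro p f i i' hp hi hi' hidx
    obtain ⟨it, hit, hd⟩ := hget p _ hp
    have hok := hv.ok hit
    cases it with
    | node R x => exact hd.elim
    | edge R e =>
      have hR : ∀ i, (f i).sym ≠ none → i ∈ R := fun i h => by_contra fun h' => h (hd.2.1 i h')
      simp only [htr, travAt_succ hit]
      refine ⟨?_, ?_⟩
      · exact (hok.2.1 i (hR i hi)).trans (hok.2.1 i' (hR i' hi')).symm
      · exact (if_pos (hR i hi)).trans (if_pos (hR i' hi')).symm
  · intro x y j hx hy
    have seen : ∀ x, id x = some j → Seen W.length x (some j) := by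
      intro x hx
      by_cases h : ∃ o, Seen W.length x o
      · obtain ⟨o, ho⟩ := h
        rw [hid x o ho] at hx
        rwa [hx] at ho
      · simp only [id, dif_neg h] at hx
        cases hx
    exact hinj x y j (seen x hx) (seen y hy)

/-- Traces with respect to graphs of the grammar exist for all accepted words. -/
theorem exists_isTrace_of_mem_language {A V : Type*} [Finite A] [Finite V] {𝒢 : SPGG A V}
    {m r k : ℕ} {W : List (TraceLetter A m r k)} (hW : W ∈ (grammarPDA 𝒢 m r k).language)
    (hreg : Marked.wrap W ∈ (registerNFA A m r k).accepts) :
    ∃ H ∈ 𝒢.language, ∃ (id : H.Node → Option (Fin k)) (loc : ℕ → Row m r → H.Node),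
      IsTrace {e | e ∈ H.edges} H.source id W loc ∧ ∀ e ∈ H.edges, e.1 ≠ e.2.1 := by
  obtain ⟨T₀, its₀, h1, h2, h3⟩ := exists_lin_of_mem_language hW
  obtain ⟨H, hH, T, rfl, hE, hn⟩ := h1.exists_mem_language
  obtain ⟨its, h4, rfl⟩ := Lin.exists_of_map (s := H.source) (t := H.sink) _ h2 rfl rfl
  have h5 : List.Forall₂ Describes W (fullItems H.source H.sink its) := by
    have h6 : fullItems () () (its.map (Item.map fun _ => ())) =
        (fullItems H.source H.sink its).map (Item.map fun _ => ()) := by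
      simp [fullItems, Item.map]
    rw [h6, List.forall₂_map_right_iff] at h3
    exact h3.imp fun _ _ => (describes_map _ _ _).1
  obtain ⟨id, loc, h7⟩ := exists_isTrace h4 hn h5 hreg
  refine ⟨H, hH, id, loc, hE ▸ h7, fun e he heq => ?_⟩
  obtain ⟨rank, hrank⟩ := SPTree.exists_rank hn
  have := hrank e (hE ▸ he)
  rw [heq] at this
  exact lt_irrefl _ this

/-! ### Walks in series-parallel graphs -/

/-- `l` is the list of the edges of a walk from `x` to `y` with edges in `E`. -/
def IsWalk {N A : Type*} (E : Set (N × N × A)) : N → List (N × N × A) → N → Prop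
  | x, [], y => x = y
  | x, e :: l, y => e ∈ E ∧ e.1 = x ∧ IsWalk E e.2.1 l y

/-- The last node of a walk from `x`. -/
def walkEnd {N A : Type*} : N → List (N × N × A) → N
  | x, [] => x
  | _, e :: l => walkEnd e.2.1 l

section Walk

variable {N A : Type*} {E E' : Set (N × N × A)} {x y : N} {l l' : List (N × N × A)}

theorem isWalk_append :
    IsWalk E x (l ++ l') y ↔ ∃ z, IsWalk E x l z ∧ IsWalk E z l' y := by
  induction l generalizing x with
  | nil => simp [IsWalk]
  | cons e l ih =>
    simp only [List.cons_append, IsWalk, ih]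
    constructor
    · rintro ⟨h1, h2, z, h3, h4⟩; exact ⟨z, ⟨h1, h2, h3⟩, h4⟩
    · rintro ⟨z, ⟨h1, h2, h3⟩, h4⟩; exact ⟨h1, h2, z, h3, h4⟩

theorem IsWalk.walkEnd_eq (h : IsWalk E x l y) : walkEnd x l = y := by
  induction l generalizing x with
  | nil => exact h
  | cons e l ih => exact ih h.2.2

theorem walkEnd_append : walkEnd x (l ++ l') = walkEnd (walkEnd x l) l' := by
  induction l generalizing x with
  | nil => rfl
  | cons e l ih => exact ih

theorem IsWalk.mono (h : IsWalk E x l y) (hE : ∀ e ∈ l, e ∈ E → e ∈ E') : IsWalk E' x l y := by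
  induction l generalizing x with
  | nil => exact h
  | cons e l ih =>
    exact ⟨hE e (by simp) h.1, h.2.1, ih h.2.2 fun e he => hE e (List.mem_cons_of_mem _ he)⟩

theorem IsWalk.take (h : IsWalk E x l y) (j : ℕ) :
    IsWalk E x (l.take j) (walkEnd x (l.take j)) ∧
      IsWalk E (walkEnd x (l.take j)) (l.drop j) y := by
  have h' := h
  rw [← List.take_append_drop j l, isWalk_append] at h'
  obtain ⟨z, h1, h2⟩ := h'
  rw [h1.walkEnd_eq]
  exact ⟨h1, h2⟩

theorem IsWalk.rank_le {rank : N → ℕ} (hrank : ∀ e ∈ E, rank e.1 < rank e.2.1)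
    (h : IsWalk E x l y) : rank x + l.length ≤ rank y := by
  induction l generalizing x with
  | nil =>
    cases h
    simp
  | cons e l ih =>
    have h1 := ih h.2.2
    have h2 := hrank e h.1
    rw [h.2.1] at h2
    simp only [List.length_cons]
    omega

/-- A walk in an acyclic graph visits a node only once. -/
theorem IsWalk.take_injective {rank : N → ℕ} (hrank : ∀ e ∈ E, rank e.1 < rank e.2.1)
    (h : IsWalk E x l y) {i j : ℕ} (hi : i ≤ l.length) (hj : j ≤ l.length)
    (hij : walkEnd x (l.take i) = walkEnd x (l.take j)) : i = j := by
  have key : ∀ i j, i < j → j ≤ l.length → walkEnd x (l.take i) = walkEnd x (l.take j) → False := by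
    intro i j hlt hj hij
    have h1 := (h.take j).1
    have h2 := (h1.take i).2
    rw [List.take_take, min_eq_left hlt.le, hij] at h2
    have := h2.rank_le hrank
    simp only [List.length_drop, List.length_take] at this
    omega
  rcases lt_trichotomy i j with h' | h' | h'
  · exact (key i j h' hj hij).elim
  · exact h'
  · exact (key j i h' hi hij.symm).elim

end Walk

namespace SPTree

variable {N A : Type*}

theorem source_mem {T : SPTree N A} {s t : N} {e : N × N × A} (he : e ∈ T.edges s t) :
    e.1 ∈ s :: T.inner ∧ e.2.1 ∈ T.inner ++ [t] := by
  induction T generalizing s t with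
  | leaf a =>
    simp only [edges, Multiset.mem_singleton] at he
    subst he
    simp [inner]
  | ser T₁ u T₂ ih₁ ih₂ =>
    simp only [edges, Multiset.mem_add] at he
    simp only [inner, List.mem_cons, List.mem_append] at ih₁ ih₂ ⊢
    rcases he with he | he
    · have := ih₁ he; tauto
    · have := ih₂ he; tauto
  | par T₁ T₂ ih₁ ih₂ =>
    simp only [edges, Multiset.mem_add] at he
    simp only [inner, List.mem_cons, List.mem_append] at ih₁ ih₂ ⊢
    rcases he with he | he
    · have := ih₁ he; tauto
    · have := ih₂ he; tauto

/-- Every node lies on a walk from the source to the sink. -/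
theorem exists_walk (T : SPTree N A) (s t : N) {x : N} (hx : x ∈ T.nodes s t) :
    (∃ l, IsWalk {e | e ∈ T.edges s t} s l x) ∧ ∃ l, IsWalk {e | e ∈ T.edges s t} x l t := by
  have main : ∀ (T : SPTree N A) (s t : N), (∃ l, IsWalk {e | e ∈ T.edges s t} s l t) ∧
      ∀ x ∈ T.inner, (∃ l, IsWalk {e | e ∈ T.edges s t} s l x) ∧
        ∃ l, IsWalk {e | e ∈ T.edges s t} x l t := by
    intro T
    induction T with
    | leaf a =>
      intro s t
      exact ⟨⟨[(s, t, a)], by simp [IsWalk, edges]⟩, by simp [inner]⟩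
    | ser T₁ u T₂ ih₁ ih₂ =>
      intro s t
      obtain ⟨⟨l₁, h₁⟩, i₁⟩ := ih₁ s u
      obtain ⟨⟨l₂, h₂⟩, i₂⟩ := ih₂ u t
      have m₁ : ∀ {x l y}, IsWalk {e | e ∈ T₁.edges s u} x l y →
          IsWalk {e | e ∈ (ser T₁ u T₂).edges s t} x l y :=
        fun h => h.mono fun e _ he => Multiset.mem_add.2 (Or.inl he)
      have m₂ : ∀ {x l y}, IsWalk {e | e ∈ T₂.edges u t} x l y →
          IsWalk {e | e ∈ (ser T₁ u T₂).edges s t} x l y :=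
        fun h => h.mono fun e _ he => Multiset.mem_add.2 (Or.inr he)
      refine ⟨⟨_, isWalk_append.2 ⟨u, m₁ h₁, m₂ h₂⟩⟩, ?_⟩
      intro x hx
      simp only [inner, List.mem_append, List.mem_cons] at hx
      rcases hx with hx | rfl | hx
      · obtain ⟨⟨a, ha⟩, b, hb⟩ := i₁ x hx
        exact ⟨⟨_, m₁ ha⟩, _, isWalk_append.2 ⟨u, m₁ hb, m₂ h₂⟩⟩
      · exact ⟨⟨_, m₁ h₁⟩, _, m₂ h₂⟩
      · obtain ⟨⟨a, ha⟩, b, hb⟩ := i₂ x hx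
        exact ⟨⟨_, isWalk_append.2 ⟨u, m₁ h₁, m₂ ha⟩⟩, _, m₂ hb⟩
    | par T₁ T₂ ih₁ ih₂ =>
      intro s t
      obtain ⟨⟨l₁, h₁⟩, i₁⟩ := ih₁ s t
      obtain ⟨⟨l₂, h₂⟩, i₂⟩ := ih₂ s t
      have m₁ : ∀ {x l y}, IsWalk {e | e ∈ T₁.edges s t} x l y →
          IsWalk {e | e ∈ (par T₁ T₂).edges s t} x l y :=
        fun h => h.mono fun e _ he => Multiset.mem_add.2 (Or.inl he)
      have m₂ : ∀ {x l y}, IsWalk {e | e ∈ T₂.edges s t} x l y →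
          IsWalk {e | e ∈ (par T₁ T₂).edges s t} x l y :=
        fun h => h.mono fun e _ he => Multiset.mem_add.2 (Or.inr he)
      refine ⟨⟨_, m₁ h₁⟩, ?_⟩
      intro x hx
      simp only [inner, List.mem_append] at hx
      rcases hx with hx | hx
      · obtain ⟨⟨a, ha⟩, b, hb⟩ := i₁ x hx
        exact ⟨⟨_, m₁ ha⟩, _, m₁ hb⟩
      · obtain ⟨⟨a, ha⟩, b, hb⟩ := i₂ x hx
        exact ⟨⟨_, m₂ ha⟩, _, m₂ hb⟩
  simp only [nodes, List.cons_append, List.mem_cons, List.mem_append, List.not_mem_nil,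
    or_false] at hx
  rcases hx with rfl | hx | rfl
  · exact ⟨⟨[], rfl⟩, (main T _ t).1⟩
  · exact (main T s t).2 x hx
  · exact ⟨(main T s _).1, [], rfl⟩

end SPTree

/-- In a union of two sets of edges, a walk whose end has no outgoing edge stays in the first set
once it has reached a set `S` of nodes which edges of the first set do not leave, and from which
no other edges start. -/
theorem IsWalk.stays {N A : Type*} {E₁ E₂ : Set (N × N × A)} {S : Set N} {x t : N}
    {l : List (N × N × A)} (h : IsWalk (E₁ ∪ E₂) x l t) (hx : x ∈ S)
    (h₁ : ∀ e ∈ E₁, e.2.1 ∈ S) (h₂ : ∀ e ∈ E₂, e.1 ∉ S) : IsWalk E₁ x l t := by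
  induction l generalizing x with
  | nil => exact h
  | cons e l ih =>
    obtain ⟨he, rfl, h⟩ := h
    have he₁ : e ∈ E₁ := he.resolve_right fun he₂ => h₂ e he₂ hx
    exact ⟨he₁, rfl, ih h (h₁ e he₁)⟩

/-- The edge that row `i` takes in an event. -/
noncomputable def Item.rowEdge {N A ι : Type*} (i : ι) (it : Item N A ι) : Option (N × N × A) :=
  open Classical in
  match it with
  | .edge R e => if i ∈ R then some e else none
  | .node _ _ => none

@[simp]
theorem Item.rowEdge_node {N A ι : Type*} (i : ι) (R : Set ι) (x : N) :
    (Item.node R x : Item N A ι).rowEdge i = none := rfl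

theorem Item.rowEdge_of_mem {N A ι : Type*} {i : ι} {R : Set ι} (e : N × N × A) (hi : i ∈ R) :
    (Item.edge R e).rowEdge i = some e := if_pos hi

theorem Item.rowEdge_of_not_mem {N A ι : Type*} {i : ι} {R : Set ι} (e : N × N × A) (hi : i ∉ R) :
    (Item.edge R e).rowEdge i = none := if_neg hi

/-- The edges that row `i` takes. -/
noncomputable def rowEdges {N A ι : Type*} (i : ι) (its : List (Item N A ι)) : List (N × N × A) :=
  its.filterMap (Item.rowEdge i)

theorem rowEdges_append {N A ι : Type*} (i : ι) (l l' : List (Item N A ι)) :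
    rowEdges i (l ++ l') = rowEdges i l ++ rowEdges i l' := List.filterMap_append

theorem rowEdges_node {N A ι : Type*} (i : ι) (R : Set ι) (x : N) (l : List (Item N A ι)) :
    rowEdges i (.node R x :: l) = rowEdges i l := List.filterMap_cons_none rfl

theorem Lin.rowEdges_eq_nil {N A ι : Type*} {T : SPTree N A} {s t : N} {R : Set ι}
    {l : List (Item N A ι)} (h : Lin T s t R l) {i : ι} (hi : i ∉ R) : rowEdges i l = [] := by
  induction h with
  | leaf a s t R => exact List.filterMap_cons_none (Item.rowEdge_of_not_mem _ hi)
  | ser T₁ T₂ s u t R l₁ l₂ h₁ h₂ ih₁ ih₂ =>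
    rw [rowEdges_append, rowEdges_node, ih₁ hi, ih₂ hi, List.append_nil]
  | par T₁ T₂ s t R₁ R₂ l₁ l₂ hR₁ hR₂ hd h₁ h₂ ih₁ ih₂ =>
    rw [rowEdges_append, ih₁ fun h => hi (Or.inl h), ih₂ fun h => hi (Or.inr h), List.append_nil]
  | parLeft T₁ T₂ s t R l h ih => exact ih hi
  | parRight T₁ T₂ s t R l h ih => exact ih hi

/-- Any family of walks from the source to the sink is traversed by some linearization. In a
series composition each walk is cut at the middle node, in a parallel composition each walk stays
in one branch. -/
theorem exists_lin {N A ι : Type*} (T : SPTree N A) (s t : N) (hn : (T.nodes s t).Nodup)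
    (R : Set ι) (π : ι → List (N × N × A))
    (hπ : ∀ i ∈ R, IsWalk {e | e ∈ T.edges s t} s (π i) t) :
    ∃ l, Lin T s t R l ∧ ∀ i ∈ R, rowEdges i l = π i := by
  induction T generalizing s t R π with
  | leaf a =>
    refine ⟨_, .leaf a s t R, fun i hi => ?_⟩
    have hne : s ≠ t := by
      rintro rfl
      simp [SPTree.nodes, SPTree.inner] at hn
    have h := hπ i hi
    have hr : rowEdges i [Item.edge R (s, t, a)] = [(s, t, a)] := by
      exact List.filterMap_cons_some (Item.rowEdge_of_mem _ hi)
    rw [hr]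
    generalize π i = l at h
    rcases l with _ | ⟨e, _ | ⟨e', l⟩⟩
    · exact absurd h hne
    · have he : e = (s, t, a) := by simpa [SPTree.edges] using h.1
      rw [he]
    · have he : e = (s, t, a) := by simpa [SPTree.edges] using h.1
      have he' : e' = (s, t, a) := by simpa [SPTree.edges] using h.2.2.1
      have := h.2.2.2.1
      rw [he, he'] at this
      exact absurd this hne
  | ser T₁ u T₂ ih₁ ih₂ =>
    simp only [SPTree.nodes, SPTree.inner, List.cons_append, List.append_assoc] at hn
    have hn' := hn
    rw [List.nodup_cons, List.nodup_append] at hn'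
    simp only [List.mem_append, List.mem_cons, List.nodup_cons, not_or] at hn'
    obtain ⟨⟨hs1, hsu, hs2, hst, -⟩, hn1, ⟨⟨hu2, hut, -⟩, hn2⟩, hdis⟩ := hn'
    have nd₁ : (T₁.nodes s u).Nodup := by
      refine hn.sublist ?_
      simp only [SPTree.nodes, List.cons_append]
      exact List.Sublist.cons_cons _ ((List.sublist_append_left [u] (T₂.inner ++
        [t])).append_left _)
    have nd₂ : (T₂.nodes u t).Nodup := by
      refine hn.sublist ?_
      simp only [SPTree.nodes, List.cons_append]
      exact ((List.Sublist.refl _).trans (List.sublist_append_right T₁.inner _)).cons _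
    have src₁ : ∀ e ∈ T₁.edges s u, e.1 ∉ T₂.nodes u t := by
      intro e he h
      have h1 := (SPTree.source_mem he).1
      simp only [SPTree.nodes, List.cons_append, List.mem_cons, List.mem_append, List.not_mem_nil,
        or_false] at h h1
      rcases h1 with h1 | h1
      · rw [h1] at h
        tauto
      · exact hdis _ h1 _ (by simpa using h) rfl
    have src₂ : ∀ e ∈ T₂.edges u t, e.1 ∉ s :: T₁.inner := by
      intro e he h
      have h1 := (SPTree.source_mem he).1
      simp only [List.mem_cons] at h h1
      rcases h with h | h
      · rw [h] at h1
        tauto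
      · exact hdis _ h _ (by tauto) rfl
    have split : ∀ (l : List (N × N × A)) (x : N), x ∈ T₁.nodes s u →
        IsWalk {e | e ∈ (SPTree.ser T₁ u T₂).edges s t} x l t →
        ∃ l₁ l₂, l = l₁ ++ l₂ ∧ IsWalk {e | e ∈ T₁.edges s u} x l₁ u ∧
          IsWalk {e | e ∈ T₂.edges u t} u l₂ t := by
      intro l
      induction l with
      | nil =>
        intro x hx h
        have h' : x = t := h
        subst h'
        simp only [SPTree.nodes, List.cons_append, List.mem_cons, List.mem_append,
          List.not_mem_nil, or_false] at hx
        rcases hx with hx | hx | hx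
        · exact absurd hx.symm hst
        · exact absurd rfl (hdis _ hx _ (by simp))
        · exact absurd hx.symm hut
      | cons e l ih =>
        intro x hx h
        by_cases hxu : x = u
        · subst hxu
          refine ⟨[], _, rfl, rfl, ?_⟩
          refine IsWalk.stays (E₂ := {e | e ∈ T₁.edges s x}) (S := {y | y ∈ T₂.nodes x t}) ?_
            (by simp [SPTree.nodes]) (fun e he => (SPTree.mem_nodes_of_mem_edges he).2) src₁
          exact h.mono fun e _ he => (Multiset.mem_add.1 he).symm
        · obtain ⟨he, rfl, h⟩ := h
          have he₁ : e ∈ T₁.edges s u := by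
            refine (Multiset.mem_add.1 he).resolve_right fun he₂ => src₂ e he₂ ?_
            simp only [SPTree.nodes, List.cons_append, List.mem_cons, List.mem_append,
              List.not_mem_nil, or_false] at hx ⊢
            tauto
          obtain ⟨l₁, l₂, rfl, h1, h2⟩ := ih _ (SPTree.mem_nodes_of_mem_edges he₁).2 h
          exact ⟨e :: l₁, l₂, rfl, ⟨he₁, rfl, h1⟩, h2⟩
    have hsplit : ∀ i, ∃ l₁ l₂, i ∈ R → π i = l₁ ++ l₂ ∧ IsWalk {e | e ∈ T₁.edges s u} s l₁ u ∧
          IsWalk {e | e ∈ T₂.edges u t} u l₂ t := by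
      intro i
      by_cases hi : i ∈ R
      · obtain ⟨l₁, l₂, h⟩ := split (π i) s (by simp [SPTree.nodes]) (hπ i hi)
        exact ⟨l₁, l₂, fun _ => h⟩
      · exact ⟨[], [], fun h => absurd h hi⟩
    choose π₁ π₂ hsplit using hsplit
    obtain ⟨l₁, hl₁, hr₁⟩ := ih₁ s u nd₁ R π₁ fun i hi => (hsplit i hi).2.1
    obtain ⟨l₂, hl₂, hr₂⟩ := ih₂ u t nd₂ R π₂ fun i hi => (hsplit i hi).2.2
    refine ⟨_, .ser _ _ _ _ _ _ _ _ hl₁ hl₂, fun i hi => ?_⟩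
    rw [(hsplit i hi).1, ← hr₁ i hi, ← hr₂ i hi, rowEdges_append, rowEdges_node]
  | par T₁ T₂ ih₁ ih₂ =>
    classical
    simp only [SPTree.nodes, SPTree.inner, List.cons_append, List.append_assoc] at hn
    have hn' := hn
    rw [List.nodup_cons, List.nodup_append] at hn'
    simp only [List.mem_append, List.mem_cons, not_or] at hn'
    obtain ⟨⟨hs1, hs2, hst, -⟩, hn1, hn2, hdis⟩ := hn'
    have nd₁ : (T₁.nodes s t).Nodup := by
      refine hn.sublist ?_
      simp only [SPTree.nodes, List.cons_append]
      exact List.Sublist.cons_cons _ ((List.sublist_append_right T₂.inner [t]).append_left _)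
    have nd₂ : (T₂.nodes s t).Nodup := by
      refine hn.sublist ?_
      simp only [SPTree.nodes, List.cons_append]
      exact List.Sublist.cons_cons _ (List.sublist_append_right T₁.inner _)
    have ht2 : t ∉ T₂.inner := by
      rw [List.nodup_append] at hn2
      exact fun h => hn2.2.2 t h t (by simp) rfl
    have src₁ : ∀ e ∈ T₁.edges s t, e.1 ∉ T₂.inner ++ [t] := by
      intro e he h
      have h1 := (SPTree.source_mem he).1
      simp only [List.mem_cons, List.mem_append, List.not_mem_nil, or_false] at h h1
      rcases h1 with h1 | h1
      · rw [h1] at h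
        tauto
      · exact hdis _ h1 _ (by simpa using h) rfl
    have src₂ : ∀ e ∈ T₂.edges s t, e.1 ∉ T₁.inner ++ [t] := by
      intro e he h
      have h1 := (SPTree.source_mem he).1
      simp only [List.mem_cons, List.mem_append, List.not_mem_nil, or_false] at h h1
      rcases h with h | h
      · rcases h1 with h1 | h1
        · rw [h1] at h; exact hs1 h
        · exact hdis _ h _ (Or.inl h1) rfl
      · rw [h] at h1
        rcases h1 with h1 | h1
        · exact hst h1.symm
        · exact ht2 h1
    have split : ∀ l : List (N × N × A), IsWalk {e | e ∈ (SPTree.par T₁ T₂).edges s t} s l t →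
        IsWalk {e | e ∈ T₁.edges s t} s l t ∨ IsWalk {e | e ∈ T₂.edges s t} s l t := by
      intro l h
      rcases l with _ | ⟨e, l⟩
      · exact absurd h hst
      · obtain ⟨he, hes, h⟩ := h
        rcases Multiset.mem_add.1 he with he | he
        · refine Or.inl ⟨he, hes, ?_⟩
          refine IsWalk.stays (E₂ := {e | e ∈ T₂.edges s t}) (S := {y | y ∈ T₁.inner ++ [t]}) ?_
            (SPTree.source_mem he).2 (fun e he => (SPTree.source_mem he).2) src₂
          exact h.mono fun e _ he => Multiset.mem_add.1 he
        · refine Or.inr ⟨he, hes, ?_⟩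
          refine IsWalk.stays (E₂ := {e | e ∈ T₁.edges s t}) (S := {y | y ∈ T₂.inner ++ [t]}) ?_
            (SPTree.source_mem he).2 (fun e he => (SPTree.source_mem he).2) src₁
          exact h.mono fun e _ he => (Multiset.mem_add.1 he).symm
    set R₁ : Set ι := {i | i ∈ R ∧ IsWalk {e | e ∈ T₁.edges s t} s (π i) t} with hR₁
    set R₂ : Set ι := {i | i ∈ R ∧ ¬IsWalk {e | e ∈ T₁.edges s t} s (π i) t} with hR₂
    have hR : R = R₁ ∪ R₂ := by
      ext i
      simp only [hR₁, hR₂, Set.mem_union, Set.mem_ofPred_eq]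
      tauto
    have hd : Disjoint R₁ R₂ := Set.disjoint_left.2 fun i h h' => h'.2 h.2
    obtain ⟨l₁, hl₁, hr₁⟩ := ih₁ s t nd₁ R₁ π fun i hi => hi.2
    obtain ⟨l₂, hl₂, hr₂⟩ := ih₂ s t nd₂ R₂ π fun i hi => (split _ (hπ i hi.1)).resolve_left hi.2
    by_cases h₂ : R₂.Nonempty
    · by_cases h₁ : R₁.Nonempty
      · rw [hR]
        refine ⟨_, .par _ _ _ _ _ _ _ _ h₁ h₂ hd hl₁ hl₂, ?_⟩
        rintro i (hi | hi)
        · have h := hl₂.rowEdges_eq_nil (Set.disjoint_left.1 hd hi)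
          rw [← hr₁ i hi, rowEdges_append, h, List.append_nil]
        · have h := hl₁.rowEdges_eq_nil (Set.disjoint_right.1 hd hi)
          rw [← hr₂ i hi, rowEdges_append, h, List.nil_append]
      · rw [Set.not_nonempty_iff_eq_empty] at h₁
        rw [h₁, Set.empty_union] at hR
        rw [hR]
        exact ⟨_, .parRight _ _ _ _ _ _ hl₂, hr₂⟩
    · rw [Set.not_nonempty_iff_eq_empty] at h₂
      rw [h₂, Set.union_empty] at hR
      rw [hR]
      exact ⟨_, .parLeft _ _ _ _ _ _ hl₁, hr₁⟩

/-- The node at which rows meet in an event. -/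
def Item.name {N A ι : Type*} : Item N A ι → Option N
  | .edge _ _ => none
  | .node _ x => some x

theorem Lin.names_sublist {N A ι : Type*} {T : SPTree N A} {s t : N} {R : Set ι}
    {l : List (Item N A ι)} (h : Lin T s t R l) :
    (l.filterMap Item.name).Sublist T.inner := by
  induction h with
  | leaf a s t R => exact List.nil_sublist _
  | ser T₁ T₂ s u t R l₁ l₂ h₁ h₂ ih₁ ih₂ =>
    rw [List.filterMap_append, List.filterMap_cons_some (f := Item.name) (b := u) rfl]
    exact ih₁.append (ih₂.cons_cons _)
  | par T₁ T₂ s t R₁ R₂ l₁ l₂ hR₁ hR₂ hd h₁ h₂ ih₁ ih₂ =>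
    rw [List.filterMap_append]
    exact ih₁.append ih₂
  | parLeft T₁ T₂ s t R l h ih => exact ih.trans (List.sublist_append_left _ _)
  | parRight T₁ T₂ s t R l h ih => exact ih.trans (List.sublist_append_right _ _)

theorem Lin.exists_node {N A ι : Type*} {T : SPTree N A} {s t : N} {R : Set ι}
    {l : List (Item N A ι)} (h : Lin T s t R l) {i : ι} {e : N × N × A}
    (he : e ∈ rowEdges i l) : e.2.1 = t ∨ ∃ R', Item.node R' e.2.1 ∈ l ∧ i ∈ R' := by
  induction h with
  | leaf a s t R =>
    by_cases hi : i ∈ R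
    · have hr : rowEdges i [Item.edge R (s, t, a)] = [(s, t, a)] :=
        List.filterMap_cons_some (Item.rowEdge_of_mem _ hi)
      rw [hr, List.mem_singleton] at he
      rw [he]
      exact Or.inl rfl
    · rw [(Lin.leaf a s t R).rowEdges_eq_nil hi] at he
      cases he
  | ser T₁ T₂ s u t R l₁ l₂ h₁ h₂ ih₁ ih₂ =>
    by_cases hi : i ∈ R
    · rw [rowEdges_append, rowEdges_node, List.mem_append] at he
      rcases he with he | he
      · rcases ih₁ he with h | ⟨R', h, h'⟩
        · exact Or.inr ⟨R, by simp [h], hi⟩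
        · exact Or.inr ⟨R', by simp [h], h'⟩
      · rcases ih₂ he with h | ⟨R', h, h'⟩
        · exact Or.inl h
        · exact Or.inr ⟨R', by simp [h], h'⟩
    · rw [(Lin.ser T₁ T₂ s u t R l₁ l₂ h₁ h₂).rowEdges_eq_nil hi] at he
      cases he
  | par T₁ T₂ s t R₁ R₂ l₁ l₂ hR₁ hR₂ hd h₁ h₂ ih₁ ih₂ =>
    rw [rowEdges_append, List.mem_append] at he
    rcases he with he | he
    · exact (ih₁ he).imp id fun ⟨R', h, h'⟩ => ⟨R', by simp [h], h'⟩
    · exact (ih₂ he).imp id fun ⟨R', h, h'⟩ => ⟨R', by simp [h], h'⟩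
  | parLeft T₁ T₂ s t R l h ih => exact ih he
  | parRight T₁ T₂ s t R l h ih => exact ih he

/-! ### Words for families of walks -/

open Classical in
/-- Path indices such that exactly the rows in `R` share one. -/
noncomputable def shareIdx {m r : ℕ} (R : Set (Row m r)) (i : Row m r) : PathIndex m r :=
  if h : i ∈ R then finProdFinEquiv (Classical.choose (⟨i, h⟩ : ∃ j, j ∈ R))
  else finProdFinEquiv i

theorem shares_shareIdx {m r : ℕ} (R : Set (Row m r)) : Shares R (shareIdx R) := by
  intro i i'
  by_cases hi : i ∈ R <;> by_cases hi' : i' ∈ R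
  · simp [shareIdx, hi, hi']
  · have h := Classical.choose_spec (⟨i, hi⟩ : ∃ j, j ∈ R)
    simp only [shareIdx, hi, hi', dif_pos, dif_neg, not_false_eq_true,
      EmbeddingLike.apply_eq_iff_eq,
      and_false, or_false]
    exact ⟨fun h' => absurd (h' ▸ h) hi', fun h' => absurd (h' ▸ hi) hi'⟩
  · have h := Classical.choose_spec (⟨i', hi'⟩ : ∃ j, j ∈ R)
    simp only [shareIdx, hi, hi', dif_pos, dif_neg, not_false_eq_true,
      EmbeddingLike.apply_eq_iff_eq,
      false_and, or_false]
    exact ⟨fun h' => absurd (h' ▸ h) hi, fun h' => absurd (h' ▸ hi') hi⟩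
  · simp [shareIdx, hi, hi']

open Classical in
/-- The letter for an event. -/
noncomputable def Item.toLetter {N A : Type*} {m r k : ℕ} (id : N → Option (Fin k))
    (it : Item N A (Row m r)) : TraceLetter A m r k :=
  match it with
  | .edge R e => .edge fun i =>
      ⟨if i ∈ R then some e.2.2 else none, id e.1, id e.2.1, shareIdx R i⟩
  | .node R _ => .node (shareIdx R)

theorem describes_toLetter {N A : Type*} {m r k : ℕ} (id : N → Option (Fin k))
    (it : Item N A (Row m r)) : Describes (it.toLetter id) it := by
  cases it with
  | edge R e =>
    exact ⟨fun i hi => if_pos hi, fun i hi => if_neg hi, shares_shareIdx R⟩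
  | node R x => exact shares_shareIdx R

/-- A possible sequence of events is accepted by the NFA for register identifiers, if the
identifiers of distinct nodes are distinct. -/
theorem ValidItems.nRun {N A : Type*} {m r k : ℕ} {id : N → Option (Fin k)}
    (hid : ∀ x y j, id x = some j → id y = some j → x = y) {its : List (Item N A (Row m r))}
    {st : TravState N (Row m r)} (h : ValidItems its st) (l : Row m r → PathIndex m r)
    (hl : st.last ∉ st.left → ∀ i i', st.loc i = st.last → st.loc i' = st.last → l i = l i') :
    ∃ l' ι' U', NRun (registerNFA A m r k)
      (.track l (fun i => id (st.loc i)) {j | Nonempty (Row m r) ∧ ∃ x ∈ st.left, id x = some j})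
      (its.map fun it => Marked.letter (it.toLetter id)) (.track l' ι' U') := by
  classical
  induction its generalizing st l with
  | nil => exact ⟨_, _, _, rfl⟩
  | cons it its ih =>
    obtain ⟨hok, h⟩ := h
    cases it with
    | node R x =>
      have hl' : ∀ i i', i ∈ R → i' ∈ R → shareIdx R i = shareIdx R i' :=
        fun i i' hi hi' => (shares_shareIdx R i i').2 (Or.inr ⟨hi, hi'⟩)
      obtain ⟨l', ι', U', hrun⟩ := ih h (shareIdx R) fun _ i i' hi hi' =>
        hl' i i' ((hok.2 i).2 hi) ((hok.2 i').2 hi')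
      refine ⟨l', ι', U', _, RegTrans.node l (shareIdx R) _ _ ?_, hrun⟩
      intro i i' hi
      rcases (shares_shareIdx R i i').1 hi with rfl | ⟨h1, h2⟩
      · rfl
      · rw [(hok.2 i).1 h1, (hok.2 i').1 h2]
    | edge R e =>
      obtain ⟨hne, hloc, hlast, hlast', hent, hself⟩ := hok
      obtain ⟨l', ι', U', hrun⟩ := ih h l (by
        intro hlst
        have hlst' : st.last ∉ insert e.1 st.left := hlst
        exact absurd (Or.inl (hlast' fun h' => hlst' (Or.inr h')).symm) hlst')
      refine ⟨l', ι', U', _, ?_, hrun⟩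
      have hsym : ∀ i, (if i ∈ R then some e.2.2 else none) ≠ none ↔ i ∈ R := by
        intro i
        by_cases hi : i ∈ R <;> simp [hi]
      have hleft : ((Item.edge R e).next st).left = insert e.1 st.left := rfl
      refine RegTrans.edge _ _ _ _ _ _ ?_ ?_ ?_ ?_ ?_ ?_
      · intro i hi
        simp only [hsym] at hi
        simp only [hloc i hi]
      · intro i hi
        simp only [hsym] at hi
        simp only [Item.next, if_pos hi]
      · intro i hi
        have hi : i ∉ R := fun h => by simp [h] at hi
        simp only [Item.next, if_neg hi]
      · ext j
        simp only [hleft, Set.mem_ofPred_eq, Set.mem_insert_iff, Set.mem_union, hsym]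
        constructor
        · rintro ⟨hR, x, rfl | hx, hj⟩
          · obtain ⟨i, hi⟩ := hne hR
            exact Or.inr ⟨i, hi, (hloc i hi).symm ▸ hj⟩
          · exact Or.inl ⟨hR, x, hx, hj⟩
        · rintro (⟨hR, x, hx, hj⟩ | ⟨i, hi, hj⟩)
          · exact ⟨hR, x, Or.inr hx, hj⟩
          · exact ⟨⟨i⟩, e.1, Or.inl rfl, (hloc i hi) ▸ hj⟩
      · intro i j hi hj hU i' hi'
        simp only [hsym] at hi
        have hx : st.loc i' = st.loc i := hid _ _ j hi' hj
        have hl₁ : e.1 ∉ st.left := by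
          intro hl₁
          exact hU ⟨⟨i⟩, e.1, hl₁, (hloc i hi) ▸ hj⟩
        have := hlast hl₁
        exact hl (this ▸ hl₁) i' i (by rw [hx, hloc i hi, this]) (by rw [hloc i hi, this])
      · rintro i j hi hj ⟨-, x, hx, hxj⟩
        simp only [hsym] at hi
        have : x = e.2.1 := hid _ _ j hxj hj
        rcases hx with hx | hx
        · exact hself (this.symm.trans hx)
        · exact hent (this ▸ hx)

theorem walkEnd_rowEdges {N A ι : Type*} (i : ι) (its : List (Item N A ι)) (st : TravState N ι) :
    (travAfter its st).loc i = walkEnd (st.loc i) (rowEdges i its) := by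
  induction its generalizing st with
  | nil => rfl
  | cons it its ih =>
    have h : travAfter (it :: its) st = travAfter its (it.next st) := rfl
    rw [h, ih]
    cases it with
    | node R x =>
      rw [rowEdges_node]
      rfl
    | edge R e =>
      by_cases hi : i ∈ R
      · have hr : rowEdges i (Item.edge R e :: its) = e :: rowEdges i its :=
          List.filterMap_cons_some (Item.rowEdge_of_mem _ hi)
        rw [hr]
        simp only [Item.next, if_pos hi]
        rfl
      · have hr : rowEdges i (Item.edge R e :: its) = rowEdges i its :=
          List.filterMap_cons_none (Item.rowEdge_of_not_mem _ hi)
        rw [hr]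
        simp only [Item.next, if_neg hi]

theorem eq_of_getElem?_filterMap_nodup {α β : Type*} {f : α → Option β} {l : List α}
    (h : (l.filterMap f).Nodup) {p q : ℕ} {a b : α} {x : β} (hp : l[p]? = some a)
    (hq : l[q]? = some b) (ha : f a = some x) (hb : f b = some x) : p = q := by
  induction l generalizing p q with
  | nil => simp at hp
  | cons c l ih =>
    have hsub : (l.filterMap f).Nodup := by
      refine h.sublist ?_
      rw [List.filterMap_cons]
      split
      · exact List.Sublist.refl _
      · exact List.sublist_cons_self _ _
    have hout : ∀ (q : ℕ) b, l[q]? = some b → f b = some x → f c = some x → False := by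
      intro q b hq hb hc
      rw [List.filterMap_cons_some hc, List.nodup_cons] at h
      exact h.1 (List.mem_filterMap.2 ⟨b, List.mem_of_getElem? hq, hb⟩)
    rcases p with _ | p <;> rcases q with _ | q
    · rfl
    · simp only [List.getElem?_cons_zero, Option.some.injEq] at hp
      exact (hout q b (by simpa using hq) hb (hp ▸ ha)).elim
    · simp only [List.getElem?_cons_zero, Option.some.injEq] at hq
      exact (hout p a (by simpa using hp) ha (hq ▸ hb)).elim
    · exact congrArg Nat.succ (ih hsub (by simpa using hp) (by simpa using hq))

/-- The word `W` describes the walks `π i`: after `p` letters, row `i` has taken `τ p i` edges of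
its walk, and `P x` is the position of the letter at which the rows that visit `x` meet. -/
structure IsWord {N A : Type*} {m r k : ℕ} (s : N) (id : N → Option (Fin k))
    (π : Row m r → List (N × N × A)) (W : List (TraceLetter A m r k)) (τ : ℕ → Row m r → ℕ)
    (P : N → ℕ) : Prop where
  length_pos : 0 < W.length
  letter : ∀ p x, W[p]? = some x → ∀ i,
    (∃ idx, x = .node idx ∧ τ (p + 1) i = τ p i) ∨
    (∃ f, x = .edge f ∧ (f i).sym = none ∧ τ (p + 1) i = τ p i) ∨
    ∃ f e, x = .edge f ∧ (π i)[τ p i]? = some e ∧ (f i).sym = some e.2.2 ∧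
      (f i).src = id e.1 ∧ (f i).tgt = id e.2.1 ∧ τ (p + 1) i = τ p i + 1
  node : ∀ i j, j ≤ (π i).length → ∃ idx, W[P (walkEnd s ((π i).take j))]? = some (.node idx) ∧
    τ (P (walkEnd s ((π i).take j))) i = j ∧
    ∀ i' j', j' ≤ (π i').length → walkEnd s ((π i').take j') = walkEnd s ((π i).take j) →
      idx i' = idx i
  source : P s = 0

theorem exists_isWord {A V : Type*} [Finite A] [Finite V] {𝒢 : SPGG A V} {H : Graph A}
    (hH : H ∈ 𝒢.language) {m r k : ℕ} (id : H.Node → Option (Fin k))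
    (hid : ∀ x y j, id x = some j → id y = some j → x = y)
    (π : Row m r → List (H.Node × H.Node × A))
    (hπ : ∀ i, IsWalk {e | e ∈ H.edges} H.source (π i) H.sink) :
    ∃ (W : List (TraceLetter A m r k)) (τ : ℕ → Row m r → ℕ) (P : H.Node → ℕ),
      W ∈ (grammarPDA 𝒢 m r k).language ∧ Marked.wrap W ∈ (registerNFA A m r k).accepts ∧
      IsWord H.source id π W τ P := by
  classical
  obtain ⟨T, hT, hE, hn⟩ := exists_tree_of_mem_language hH
  rw [hE] at hπ
  obtain ⟨its, hl, hrow⟩ := exists_lin T H.source H.sink hn (Set.univ : Set (Row m r)) π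
    fun i _ => hπ i
  obtain ⟨rank, hrank⟩ := SPTree.exists_rank hn
  obtain ⟨hv, -⟩ := hl.validItems_full hn
  set F := fullItems H.source H.sink its with hF
  set W := F.map (Item.toLetter id) with hW
  have hdesc : List.Forall₂ Describes W F := by
    rw [hW, List.forall₂_map_left_iff]
    exact List.forall₂_same.2 fun it _ => describes_toLetter id it
  have hrowF : ∀ i, rowEdges i F = π i := by
    intro i
    rw [hF, fullItems, List.cons_append, rowEdges_node, rowEdges_append, rowEdges_node,
      hrow i trivial]
    exact List.append_nil _
  have hnames : (F.filterMap Item.name).Nodup := by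
    refine hn.sublist ?_
    rw [hF, fullItems, List.filterMap_append,
      List.filterMap_cons_some (f := Item.name) (b := H.source) rfl]
    exact (hl.names_sublist.cons_cons _).append_right [H.sink]
  -- the edges taken before position `p`
  have htake : ∀ p i, rowEdges i (F.take p) = (π i).take (rowEdges i (F.take p)).length := by
    intro p i
    have h := rowEdges_append i (F.take p) (F.drop p)
    rw [List.take_append_drop, hrowF] at h
    rw [h, List.take_left]
  have hloc : ∀ p i, (travAt F (travInit _ H.source) p).loc i =
      walkEnd H.source ((π i).take (rowEdges i (F.take p)).length) := by
    intro p i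
    rw [← htake]
    exact walkEnd_rowEdges i _ _
  have hsucc : ∀ p it, F[p]? = some it → ∀ i, rowEdges i (F.take (p + 1)) =
      rowEdges i (F.take p) ++ (it.rowEdge i).toList := by
    intro p it hp i
    rw [List.take_add_one, hp, rowEdges_append]
    cases h : it.rowEdge i <;> simp [rowEdges, h]
  have hfind : ∀ x R p, F[p]? = some (Item.node R x) →
      (F.findIdx fun it => decide (it.name = some x)) = p := by
    intro x R p hp
    have hex : ∃ it ∈ F, decide (it.name = some x) = true :=
      ⟨_, List.mem_of_getElem? hp, by simp [Item.name]⟩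
    have hlt := List.findIdx_lt_length_of_exists hex
    have hname := of_decide_eq_true (List.findIdx_getElem (w := hlt))
    exact eq_of_getElem?_filterMap_nodup hnames (List.getElem?_eq_getElem hlt) hp hname rfl
  have hrank' : ∀ e ∈ {e | e ∈ T.edges H.source H.sink}, rank e.1 < rank e.2.1 := hrank
  refine ⟨W, fun p i => (rowEdges i (F.take p)).length,
    fun x => F.findIdx fun it => decide (it.name = some x), mem_language_grammarPDA hl hT hdesc,
    ?_, ?_⟩
  · rw [mem_accepts_iff_nRun]
    have hshare : ∀ i i' : Row m r, shareIdx Set.univ i = shareIdx Set.univ i' :=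
      fun i i' => (shares_shareIdx Set.univ i i').2 (Or.inr ⟨trivial, trivial⟩)
    obtain ⟨l', ι', U', hrun⟩ := hv.nRun hid (shareIdx Set.univ) fun _ i i' _ _ => hshare i i'
    have h0 : {j | Nonempty (Row m r) ∧ ∃ x ∈ (travInit (Row m r) H.source).left,
        id x = some j} = ∅ := by
      ext j
      simp [travInit]
    rw [h0] at hrun
    refine ⟨.start, rfl, .done, rfl, ?_⟩
    change NRun _ _ (Marked.left :: (W.map Marked.letter ++ [Marked.right])) _
    refine ⟨_, RegTrans.start (shareIdx Set.univ) (id H.source), nRun_append.2 ⟨_, ?_, _,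
      RegTrans.done l' ι' U', rfl⟩⟩
    rw [hW, List.map_map]
    exact hrun
  · refine ⟨by simp [hW, hF, fullItems], ?_, ?_, ?_⟩
    · intro p x hx i
      rw [hW, List.getElem?_map, Option.map_eq_some_iff] at hx
      obtain ⟨it, hp, rfl⟩ := hx
      have h1 := hsucc p it hp i
      cases it with
      | node R y =>
        refine Or.inl ⟨_, rfl, ?_⟩
        simp only [h1, Item.rowEdge_node, Option.toList_none, List.append_nil]
      | edge R e =>
        right
        by_cases hi : i ∈ R
        · right
          rw [Item.rowEdge_of_mem e hi] at h1
          refine ⟨_, e, rfl, ?_, if_pos hi, rfl, rfl, by simp [h1]⟩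
          have h2 := htake (p + 1) i
          rw [h1] at h2
          have h3 : (π i)[(rowEdges i (F.take p)).length]? =
              (((π i).take (rowEdges i (F.take p) ++ [e]).length))[(rowEdges i
                (F.take p)).length]? := by
            rw [List.getElem?_take_of_lt (by simp)]
          simp only [Option.toList_some] at h2
          rw [h3, ← h2]
          simp
        · left
          rw [Item.rowEdge_of_not_mem e hi] at h1
          exact ⟨_, rfl, if_neg hi, by simp [h1]⟩
    · have hnode : ∀ (i : Row m r) (j : ℕ), j ≤ (π i).length →
          ∃ (R : Set (Row m r)) (p : ℕ), F[p]? = some (Item.node R (walkEnd H.source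
            ((π i).take j))) ∧ i ∈ R := by
        intro i j hj
        rcases List.eq_nil_or_concat ((π i).take j) with h | ⟨l, e, h⟩
        · rw [h]
          exact ⟨Set.univ, 0, rfl, trivial⟩
        · rw [List.concat_eq_append] at h
          have hend : walkEnd H.source ((π i).take j) = e.2.1 := by
            rw [h, walkEnd_append]
            rfl
          have he : e ∈ rowEdges i its := by
            rw [hrow i trivial]
            exact List.mem_of_mem_take (h ▸ (by simp) : e ∈ (π i).take j)
          rw [hend]
          rcases hl.exists_node he with h' | ⟨R', h', hi⟩
          · obtain ⟨p, hp⟩ := List.getElem?_of_mem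
              (by simp [hF, fullItems] : Item.node Set.univ H.sink ∈ F)
            rw [h']
            exact ⟨_, p, hp, trivial⟩
          · obtain ⟨p, hp⟩ := List.getElem?_of_mem
              (by simp [hF, fullItems, h'] : Item.node R' e.2.1 ∈ F)
            exact ⟨_, p, hp, hi⟩
      intro i j hj
      obtain ⟨R, p, hp, hi⟩ := hnode i j hj
      have hPp := hfind _ R p hp
      refine ⟨shareIdx R, ?_, ?_, ?_⟩
      · rw [hPp, hW, List.getElem?_map, hp]
        rfl
      · rw [hPp]
        have h1 := ((hv.ok hp).2 i).1 hi
        have h2 : walkEnd H.source ((π i).take (rowEdges i (F.take p)).length) =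
            walkEnd H.source ((π i).take j) := (hloc p i).symm.trans h1
        refine (hπ i).take_injective hrank' ?_ hj h2
        rw [← hrowF i]
        exact ((F.take_sublist p).filterMap _).length_le
      · intro i' j' hj' hx
        obtain ⟨R', p', hp', hi'⟩ := hnode i' j' hj'
        rw [hx] at hp'
        have hpp : p' = p := (hfind _ R' p' hp').symm.trans hPp
        rw [hpp, hp] at hp'
        simp only [Option.some.injEq, Item.node.injEq, and_true] at hp'
        exact (shares_shareIdx R i' i).2 (Or.inr ⟨hp' ▸ hi', hi⟩)
    · exact hfind _ _ 0 rfl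

theorem exists_rank_of_mem_language {A V : Type*} {𝒢 : SPGG A V} {H : Graph A}
    (hH : H ∈ 𝒢.language) : ∃ rank : H.Node → ℕ, ∀ e ∈ H.edges, rank e.1 < rank e.2.1 := by
  obtain ⟨T, -, hE, hn⟩ := exists_tree_of_mem_language hH
  rw [hE]
  exact SPTree.exists_rank hn

theorem ne_source_of_mem_language {A V : Type*} {𝒢 : SPGG A V} {H : Graph A}
    (hH : H ∈ 𝒢.language) {e : H.Node × H.Node × A} (he : e ∈ H.edges) : e.2.1 ≠ H.source := by
  obtain ⟨T, -, hE, hn⟩ := exists_tree_of_mem_language hH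
  rw [hE] at he
  exact SPTree.ne_source_of_mem_edges hn he

/-- The source, the sink and the end points of the edges lie on walks from the source to the
sink. -/
theorem exists_walk_of_mem_language {A V : Type*} {𝒢 : SPGG A V} {H : Graph A}
    (hH : H ∈ 𝒢.language) : ∃ S : Set H.Node, H.source ∈ S ∧
      (∀ e ∈ H.edges, e.1 ∈ S ∧ e.2.1 ∈ S) ∧
      ∀ x ∈ S, (∃ l, IsWalk {e | e ∈ H.edges} H.source l x) ∧
        ∃ l, IsWalk {e | e ∈ H.edges} x l H.sink := by
  obtain ⟨T, -, hE, -⟩ := exists_tree_of_mem_language hH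
  rw [hE]
  exact ⟨{x | x ∈ T.nodes H.source H.sink}, by simp [SPTree.nodes],
    fun e he => SPTree.mem_nodes_of_mem_edges he, fun x hx => T.exists_walk _ _ hx⟩

/-! ### Sweeps of two-way automata -/

/-- A cell of an execution, in its context: the path to which it belongs, its position in the word
and the letter of the trace at this position. -/
structure Event (A Q : Type*) (m r k : ℕ) where
  path : Fin (r + 1)
  pos : ℕ
  letter : TraceLetter A m r k
  cell : ExecCell Q m r k

section Events

variable {A Q : Type*} {m r k : ℕ}

/-- The gap between letters from which the event is reached; the gap `g` precedes the letter at
position `g`. -/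
def Event.gapBefore (ev : Event A Q m r k) : ℕ :=
  match segDir ev.path with
  | .fwd => ev.pos
  | .bwd => ev.pos + 1

/-- The gap between letters that follows the event. -/
def Event.gapAfter (ev : Event A Q m r k) : ℕ :=
  match segDir ev.path with
  | .fwd => ev.pos + 1
  | .bwd => ev.pos

/-- The events of machine `n` on its path `h`, in the order in which the path is followed. -/
def pathEvents (w : List (Letter A Q m r k)) (n : Fin m) (h : Fin (r + 1)) :
    List (Event A Q m r k) :=
  let l := w.zipIdx.map fun x => (⟨h, x.2, x.1.1, x.1.2 (n, h)⟩ : Event A Q m r k)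
  match segDir h with
  | .fwd => l
  | .bwd => l.reverse

/-- The events of machine `n` on the paths after path `h`. -/
def laterEvents (w : List (Letter A Q m r k)) (n : Fin m) (h : Fin (r + 1)) :
    List (Event A Q m r k) :=
  ((List.finRange (r + 1)).drop (h.val + 1)).flatMap (pathEvents w n)

/-- The events of machine `n`, in the order of the execution. -/
def events (w : List (Letter A Q m r k)) (n : Fin m) : List (Event A Q m r k) :=
  (List.finRange (r + 1)).flatMap (pathEvents w n)

/-- The events in `l` in which the machine is active. -/
def activeOnly (l : List (Event A Q m r k)) : List (Event A Q m r k) :=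
  l.filter fun ev => ev.cell.block.isSome

/-- The position of the head when, in a pass in direction `d`, it has passed `j` of the `L` letters
between the end markers. -/
def headPos (d : Dir) (L j : ℕ) : ℤ :=
  match d with
  | .fwd => j + 1
  | .bwd => L - j

/-- The gap that is reached when `j` of `L` letters have been passed in direction `d`. -/
def gapAt (d : Dir) (L j : ℕ) : ℕ :=
  match d with
  | .fwd => j
  | .bwd => L - j

variable {w : List (Letter A Q m r k)} {n : Fin m} {h h' : Fin (r + 1)}

theorem activeOnly_append (l l' : List (Event A Q m r k)) :
    activeOnly (l ++ l') = activeOnly l ++ activeOnly l' := List.filter_append _ _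

theorem activeOnly_eq_nil {l : List (Event A Q m r k)} :
    activeOnly l = [] ↔ ∀ ev ∈ l, ev.cell.block = none := by
  simp [activeOnly, List.filter_eq_nil_iff]

theorem wrap_getElem?_letter (w : List (Letter A Q m r k)) (p : ℕ) :
    (Marked.wrap w)[p + 1]? = if p < w.length then (w[p]?).map .letter else
      if p = w.length then some .right else none := by
  change (Marked.left :: (w.map Marked.letter ++ [Marked.right]))[p + 1]? = _
  rw [List.getElem?_cons_succ]
  split_ifs with h1 h2
  · rw [List.getElem?_append_left (by simpa using h1), List.getElem?_map]
  · subst h2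
    rw [List.getElem?_append_right (by simp)]
    simp
  · rw [List.getElem?_eq_none]
    simp only [List.length_append, List.length_map, List.length_singleton]
    omega

theorem wrap_getElem?_zero (w : List (Letter A Q m r k)) : (Marked.wrap w)[0]? = some .left := rfl

theorem length_wrap (w : List (Letter A Q m r k)) : (Marked.wrap w).length = w.length + 2 := by
  change (Marked.left :: (w.map Marked.letter ++ [Marked.right])).length = _
  simp

theorem length_pathEvents : (pathEvents w n h).length = w.length := by
  rw [pathEvents]
  cases segDir h <;> simp

theorem wrap_headPos_length (d : Dir) :
    (Marked.wrap w)[(headPos d w.length w.length).toNat]? = some (endMarker d) := by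
  cases d
  · change (Marked.wrap w)[((w.length : ℤ) + 1).toNat]? = _
    have h1 : ((w.length : ℤ) + 1).toNat = w.length + 1 := by omega
    rw [h1, wrap_getElem?_letter]
    simp [endMarker]
  · change (Marked.wrap w)[((w.length : ℤ) - w.length).toNat]? = _
    rw [sub_self]
    rfl

theorem pathEvents_spec {j : ℕ} (hj : j < w.length) :
    ∃ ev e, (pathEvents w n h)[j]? = some ev ∧
      (Marked.wrap w)[(headPos (segDir h) w.length j).toNat]? = some (.letter (ev.letter, e)) ∧
      w[ev.pos]? = some (ev.letter, e) ∧ e (n, h) = ev.cell ∧ ev.path = h ∧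
      ev.gapBefore = gapAt (segDir h) w.length j ∧
      ev.gapAfter = gapAt (segDir h) w.length (j + 1) := by
  cases hd : segDir h
  · refine ⟨⟨h, j, w[j].1, w[j].2 (n, h)⟩, w[j].2, ?_, ?_, List.getElem?_eq_getElem _, rfl, rfl,
      ?_, ?_⟩
    · simp [pathEvents, hd, List.getElem?_eq_getElem hj]
    · have h1 : (headPos .fwd w.length j).toNat = j + 1 := by
        simp only [headPos]
        omega
      rw [h1, wrap_getElem?_letter, if_pos hj, List.getElem?_eq_getElem hj]
      rfl
    · simp [Event.gapBefore, hd, gapAt]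
    · simp [Event.gapAfter, hd, gapAt]
  · have hp : w.length - 1 - j < w.length := by omega
    refine ⟨⟨h, w.length - 1 - j, w[w.length - 1 - j].1, w[w.length - 1 - j].2 (n, h)⟩,
      w[w.length - 1 - j].2, ?_, ?_, List.getElem?_eq_getElem _, rfl, rfl, ?_, ?_⟩
    · simp only [pathEvents, hd]
      rw [List.getElem?_reverse (by simpa using hj)]
      simp [List.getElem?_eq_getElem hp]
    · have h1 : (headPos .bwd w.length j).toNat = w.length - 1 - j + 1 := by
        simp only [headPos]
        omega
      rw [h1, wrap_getElem?_letter, if_pos hp, List.getElem?_eq_getElem hp]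
      rfl
    · simp only [Event.gapBefore, hd, gapAt]
      omega
    · simp only [Event.gapAfter, hd, gapAt]
      omega

theorem events_eq : events w n = pathEvents w n 0 ++ laterEvents w n 0 := by
  rw [events, laterEvents]
  conv_lhs => rw [List.finRange_succ]
  rw [List.finRange_succ]
  rfl

theorem laterEvents_eq (hh : h'.val = h.val + 1) :
    laterEvents w n h = pathEvents w n h' ++ laterEvents w n h' := by
  have h1 : (List.finRange (r + 1)).drop (h.val + 1) =
      h' :: (List.finRange (r + 1)).drop (h'.val + 1) := by
    have hr := h'.isLt
    rw [← hh, List.drop_eq_getElem_cons (by simp; omega)]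
    simp
  rw [laterEvents, h1, List.flatMap_cons]
  rfl

theorem laterEvents_last : laterEvents w n (Fin.last r) = [] := by
  rw [laterEvents, List.drop_eq_nil_of_le (by simp), List.flatMap_nil]

theorem segDir_succ (hh : h'.val = h.val + 1) :
    (segDir h = .fwd ∧ segDir h' = .bwd) ∨ (segDir h = .bwd ∧ segDir h' = .fwd) := by
  simp only [segDir, hh]
  rcases Nat.mod_two_eq_zero_or_one h.val with h1 | h1
  · exact Or.inl ⟨if_pos h1, if_neg (by omega)⟩
  · exact Or.inr ⟨if_neg (by omega), if_pos (by omega)⟩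

theorem segDir_zero : segDir (0 : Fin (r + 1)) = .fwd := rfl

/-- The number by which the head moves. -/
def Dir.delta : Dir → ℤ
  | .fwd => 1
  | .bwd => -1

theorem TwoNFA.step_iff {α σ : Type*} {N : TwoNFA α σ} {u : List α} {q q' : σ} {i i' : ℤ} :
    N.Step u (q, i) (q', i') ↔ ∃ a d, 0 ≤ i ∧ u[i.toNat]? = some a ∧ (q, a, q', d) ∈ N.δ ∧
      i' = i + d.delta := by
  refine exists_congr fun a => exists_congr fun d => and_congr_right fun _ => and_congr_right
    fun _ => and_congr_right fun _ => ?_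
  cases d <;> rfl

theorem headPos_succ (d : Dir) (L j : ℕ) : headPos d L (j + 1) = headPos d L j + d.delta := by
  cases d <;> simp only [headPos, Dir.delta] <;> push_cast <;> ring

theorem headPos_turn (hh : h'.val = h.val + 1) {L j : ℕ} (hj : j ≤ L) :
    headPos (segDir h') L (L - j) = headPos (segDir h) L j + (segDir h').delta := by
  rcases segDir_succ hh with ⟨h1, h2⟩ | ⟨h1, h2⟩ <;> rw [h1, h2] <;>
    simp only [headPos, Dir.delta] <;> omega

theorem gapAt_turn (hh : h'.val = h.val + 1) {L j : ℕ} (hj : j ≤ L) :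
    gapAt (segDir h') L (L - j) = gapAt (segDir h) L j := by
  rcases segDir_succ hh with ⟨h1, h2⟩ | ⟨h1, h2⟩ <;> rw [h1, h2] <;>
    simp only [gapAt]
  omega

theorem headPos_nonneg (d : Dir) {L j : ℕ} (hj : j ≤ L) : 0 ≤ headPos d L j ∧
    headPos d L j ≤ L + 1 := by
  cases d <;> simp only [headPos] <;> omega

end Events

/-- Rows and states along a list of events: every event is reached at the gap at which the preceding
one ends, and processes its letter. -/
def TrackChain {A Q : Type*} {m r k : ℕ} (M : Machine A Q) :
    ℕ × Row m r × Q → List (Event A Q m r k) → ℕ × Row m r × Q → Prop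
  | x, [], y => x = y
  | x, ev :: l, y => ev.gapBefore = x.1 ∧
      Processes M (segDir ev.path) ev.letter x.2.1 x.2.2 ev.cell ∧
      TrackChain M (ev.gapAfter, ev.cell.row, ev.cell.state) l y

/-- The positions at which machine `n` is active on its path `h`. -/
def activeSet {A Q : Type*} {m r k : ℕ} (w : List (Letter A Q m r k)) (n : Fin m)
    (h : Fin (r + 1)) : Set ℕ :=
  {p | ∃ x, w[p]? = some x ∧ (x.2 (n, h)).block ≠ none}

/-- The `j`-th event on path `h` is active. -/
def EventActive {A Q : Type*} {m r k : ℕ} (w : List (Letter A Q m r k)) (n : Fin m)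
    (h : Fin (r + 1)) (j : ℕ) : Prop :=
  ∃ ev, (pathEvents w n h)[j]? = some ev ∧ ev.cell.block ≠ none

section Exec

variable {A Q : Type*} {m r k : ℕ} {w : List (Letter A Q m r k)} {n : Fin m} {h h' : Fin (r + 1)}

theorem eventActive_iff {j : ℕ} (hj : j < w.length) :
    EventActive w n h j ↔ (match segDir h with
      | .fwd => j
      | .bwd => w.length - 1 - j) ∈ activeSet w n h := by
  obtain ⟨ev, e, h1, -, h3, h4, h5, h6, -⟩ := pathEvents_spec (n := n) (h := h) hj
  have hpos : (match segDir h with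
      | .fwd => j
      | .bwd => w.length - 1 - j) = ev.pos := by
    rw [Event.gapBefore, h5] at h6
    revert h6
    cases segDir h <;> simp only [gapAt] <;> intro h6
    · exact h6.symm
    · omega
  rw [hpos]
  constructor
  · rintro ⟨ev', h1', hb⟩
    rw [h1] at h1'
    cases h1'
    exact ⟨_, h3, by simpa only [h4] using hb⟩
  · rintro ⟨x, hx, hb⟩
    rw [h3] at hx
    cases hx
    exact ⟨ev, h1, by rw [← h4]; exact hb⟩

theorem EventActive.lt {j : ℕ} (hj : EventActive w n h j) : j < w.length := by
  obtain ⟨ev, h1, -⟩ := hj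
  rw [← length_pathEvents (n := n) (h := h)]
  exact (List.getElem?_eq_some_iff.1 h1).1

theorem EventActive.of_between (hc : (activeSet w n h).OrdConnected) {i j l : ℕ}
    (hi : EventActive w n h i) (hl : EventActive w n h l) (hij : i ≤ j) (hjl : j ≤ l) :
    EventActive w n h j := by
  have hil := hi.lt
  have hll := hl.lt
  rw [eventActive_iff hil] at hi
  rw [eventActive_iff hll] at hl
  rw [eventActive_iff (by omega)]
  revert hi hl
  cases segDir h <;> intro hi hl
  · exact hc.out hi hl ⟨hij, hjl⟩
  · exact hc.out hl hi ⟨Nat.sub_le_sub_left hjl _, Nat.sub_le_sub_left hij _⟩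

theorem active_headPos {j : ℕ} (hj : j ≤ w.length) {x : Marked (Letter A Q m r k)}
    (hx : (Marked.wrap w)[(headPos (segDir h) w.length j).toNat]? = some x) :
    Active n h x ↔ EventActive w n h j := by
  rcases hj.eq_or_lt with rfl | hj
  · rw [wrap_headPos_length] at hx
    cases hx
    refine iff_of_false ?_ fun h => (lt_irrefl _ h.lt)
    cases segDir h <;> exact id
  · obtain ⟨ev, e, h1, h2, h3, h4, -⟩ := pathEvents_spec (n := n) (h := h) hj
    rw [h2] at hx
    cases hx
    change (e (n, h)).block ≠ none ↔ _
    rw [h4]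
    refine ⟨fun h => ⟨ev, h1, h⟩, ?_⟩
    rintro ⟨ev', h1', hb⟩
    rw [h1] at h1'
    cases h1'
    exact hb

theorem activeOnly_drop_eq_nil {j : ℕ} (hj : ∀ l, j ≤ l → ¬EventActive w n h l) :
    activeOnly ((pathEvents w n h).drop j) = [] := by
  rw [activeOnly_eq_nil]
  intro ev hev
  obtain ⟨l, hl⟩ := List.getElem?_of_mem hev
  rw [List.getElem?_drop] at hl
  by_contra hb
  exact hj _ (Nat.le_add_right j l) ⟨ev, hl, hb⟩

theorem activeOnly_take_eq_nil {j : ℕ} (hj : ∀ l, l < j → ¬EventActive w n h l) :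
    activeOnly ((pathEvents w n h).take j) = [] := by
  rw [activeOnly_eq_nil]
  intro ev hev
  obtain ⟨l, hl⟩ := List.getElem?_of_mem hev
  rw [List.getElem?_take] at hl
  split_ifs at hl with hlj
  by_contra hb
  exact hj _ hlj ⟨ev, hl, hb⟩

theorem activeOnly_drop_eq {j : ℕ} (hj : ∀ l, l < j → ¬EventActive w n h l) :
    activeOnly ((pathEvents w n h).drop j) = activeOnly (pathEvents w n h) := by
  conv_rhs => rw [← List.take_append_drop j (pathEvents w n h), activeOnly_append,
    activeOnly_take_eq_nil hj, List.nil_append]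

theorem activeOnly_drop_of_active {j : ℕ} {ev : Event A Q m r k}
    (hev : (pathEvents w n h)[j]? = some ev) (hb : ev.cell.block ≠ none) :
    activeOnly ((pathEvents w n h).drop j) = ev :: activeOnly ((pathEvents w n h).drop
      (j + 1)) := by
  obtain ⟨hj, hj'⟩ := List.getElem?_eq_some_iff.1 hev
  rw [List.drop_eq_getElem_cons hj, hj', activeOnly, List.filter_cons_of_pos]
  · rfl
  · exact Option.isSome_iff_ne_none.2 hb

/-- What the configurations that lead to an exit from the word tell about the rest of the
execution. -/
def ExecGood (M : Machine A Q) (w : List (Letter A Q m r k)) (n : Fin m) :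
    ExecState Q m r → ℤ → Prop
  | .scan φ, i => ∀ p ≤ w.length, (i = p + 1 ∨ (i = 0 ∧ p = 0)) →
      (∀ h, match φ h with
        | .before => {q | p ≤ q ∧ q ∈ activeSet w n h}.Nonempty ∧
            {q | p ≤ q ∧ q ∈ activeSet w n h}.OrdConnected
        | .during => ∀ q ∈ activeSet w n h, ∀ q', p ≤ q' → q' ≤ q → q' ∈ activeSet w n h
        | .after => ∀ q ∈ activeSet w n h, q < p) ∧
      ((∀ h, (activeSet w n h).OrdConnected) →
        ∃ i y, TrackChain M (0, i, M.start) (activeOnly (events w n)) y)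
  | .rewind, i => 0 ≤ i → i ≤ w.length → (∀ h, (activeSet w n h).OrdConnected) →
      ∃ i y, TrackChain M (0, i, M.start) (activeOnly (events w n)) y
  | .sim h q i s, pos => ∀ j ≤ w.length, pos = headPos (segDir h) w.length j →
      (∀ h, (activeSet w n h).OrdConnected) →
      (if s then 1 ≤ j ∧ EventActive w n h (j - 1) else j = 0 ∨ ¬EventActive w n h (j - 1)) →
      (s = false → ∀ l < j, ¬EventActive w n h l) ∧
      ∃ y, TrackChain M (gapAt (segDir h) w.length j, i, q)
        (activeOnly ((pathEvents w n h).drop j) ++ activeOnly (laterEvents w n h)) y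
  | .done, _ => True

theorem ExecGood.of_reflTransGen {M : Machine A Q} {c c' : ExecState Q m r × ℤ}
    (hr : Relation.ReflTransGen ((execTwoNFA M r k n).Step (Marked.wrap w)) c c')
    (hend : c'.2 = -1 ∨ c'.2 = (Marked.wrap w).length) : ExecGood M w n c.1 c.2 := by
  rw [length_wrap] at hend
  induction hr using Relation.ReflTransGen.head_induction_on with
  | refl =>
    obtain ⟨s, i⟩ := c'
    simp only at hend
    cases s with
    | scan φ =>
      intro p hp hi
      push_cast at hend
      omega
    | rewind =>
      intro h0 h1
      push_cast at hend
      omega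
    | sim h q i' s =>
      intro j hj hpos
      have := headPos_nonneg (segDir h) hj
      push_cast at hend
      omega
    | done => trivial
  | head hstep hrest ih =>
    rename_i c c₁
    obtain ⟨s, i⟩ := c
    obtain ⟨s₁, i₁⟩ := c₁
    rw [TwoNFA.step_iff] at hstep
    obtain ⟨a, d, hi0, hget, htr, rfl⟩ := hstep
    have htr' : ExecTrans M n s a s₁ d := htr
    clear htr
    cases htr' with
    | scanLeft φ =>
      intro p hp hi
      have hi' : i = 0 ∧ p = 0 := by
        rcases hi with hi | hi
        · have h1 : i.toNat = p + 1 := by omega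
          rw [h1, wrap_getElem?_letter] at hget
          split_ifs at hget
          · cases hw : w[p]? <;> simp [hw] at hget
          · simp at hget
        · exact hi
      exact ih p hp (Or.inl (by simp [hi', Dir.delta]))
    | scanLetter φ φ' x hφ =>
      intro p hp hi
      have hi' : i = p + 1 := by
        rcases hi with hi | ⟨rfl, rfl⟩
        · exact hi
        · rw [Int.toNat_zero, wrap_getElem?_zero] at hget
          simp at hget
      have h1 : i.toNat = p + 1 := by omega
      rw [h1, wrap_getElem?_letter] at hget
      have hpx : w[p]? = some x := by
        split_ifs at hget with h2
        · simpa using hget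
        · simp at hget
      have hlt := (List.getElem?_eq_some_iff.1 hpx).1
      obtain ⟨ih1, ih2⟩ := ih (p + 1) hlt (Or.inl (by simp [hi', Dir.delta]))
      refine ⟨fun h => ?_, ih2⟩
      have hact : Active n h (.letter x) ↔ p ∈ activeSet w n h := by
        constructor
        · exact fun hb => ⟨x, hpx, hb⟩
        · rintro ⟨y, hy, hb⟩
          rw [hpx] at hy
          cases hy
          exact hb
      have ih1 := ih1 h
      have hφ := hφ h
      rw [hact] at hφ
      generalize φ h = a at hφ
      generalize φ' h = b at hφ ih1
      cases hφ with
      | wait _ hn =>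
        have hset : {q | p ≤ q ∧ q ∈ activeSet w n h} = {q | p + 1 ≤ q ∧ q ∈ activeSet w n h} := by
          ext q
          simp only [Set.mem_ofPred_eq]
          constructor
          · rintro ⟨h1, h2⟩
            refine ⟨?_, h2⟩
            rcases h1.eq_or_lt with rfl | h1
            · exact absurd h2 hn
            · exact h1
          · rintro ⟨h1, h2⟩
            exact ⟨by omega, h2⟩
        simp only at ih1 ⊢
        rw [hset]
        exact ih1
      | begin _ ha =>
        refine ⟨⟨p, le_rfl, ha⟩, ⟨?_⟩⟩
        rintro a ⟨hpa, ha'⟩ c ⟨hpc, hc'⟩ b ⟨hab, hbc⟩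
        refine ⟨hpa.trans hab, ?_⟩
        rcases (hpa.trans hab).eq_or_lt with rfl | h1
        · exact ha
        · exact ih1 c hc' b h1 hbc
      | stay _ ha =>
        intro q hq q' h1 h2
        rcases h1.eq_or_lt with rfl | h1
        · exact ha
        · exact ih1 q hq q' h1 h2
      | finish _ hn =>
        intro q hq q' h1 h2
        have h3 := ih1 q hq
        rcases (h1.trans h2).eq_or_lt with rfl | h4
        · exact absurd hq hn
        · omega
      | rest _ hn =>
        intro q hq
        have h3 := ih1 q hq
        rcases eq_or_ne q p with rfl | h4
        · exact absurd hq hn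
        · omega
    | scanRight φ hφ =>
      intro p hp hi
      have hpL : p = w.length ∧ i = w.length + 1 := by
        rcases hi with hi | ⟨rfl, rfl⟩
        · have h1 : i.toNat = p + 1 := by omega
          rw [h1, wrap_getElem?_letter] at hget
          split_ifs at hget with h2 h3
          · cases hw : w[p]? <;> simp [hw] at hget
          · exact ⟨h3, by omega⟩
        · rw [Int.toNat_zero, wrap_getElem?_zero] at hget
          simp at hget
      refine ⟨fun h => ?_, ih (by simp [hpL, Dir.delta]) (by simp [hpL, Dir.delta])⟩
      have hlt : ∀ q ∈ activeSet w n h, q < p := by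
        rintro q ⟨x, hx, -⟩
        rw [hpL.1]
        exact (List.getElem?_eq_some_iff.1 hx).1
      have hφ := hφ h
      generalize φ h = b at hφ
      cases b with
      | before => exact absurd rfl hφ
      | during =>
        intro q hq q' h1 h2
        have := hlt q hq
        omega
      | after => exact hlt
    | rewind x =>
      intro h0 h1 hconv
      have hi1 : 0 < i := by
        rcases h0.eq_or_lt with rfl | h2
        · rw [Int.toNat_zero, wrap_getElem?_zero] at hget
          simp at hget
        · exact h2
      exact ih (by simp [Dir.delta]; omega) (by simp [Dir.delta]; omega) hconv
    | begin i' =>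
      intro h0 h1 hconv
      have hi1 : i = 0 := by
        by_contra hne
        have h2 : i.toNat = (i.toNat - 1) + 1 := by omega
        rw [h2, wrap_getElem?_letter] at hget
        split_ifs at hget
        · cases hw : w[i.toNat - 1]? <;> simp [hw] at hget
        · simp at hget
      obtain ⟨-, y, hy⟩ := ih 0 (Nat.zero_le _) (by simp [hi1, segDir_zero, headPos,
        Dir.delta]) hconv
        (by simp)
      refine ⟨i', y, ?_⟩
      rw [events_eq, activeOnly_append]
      exact hy
    | move h q i' s b e hact hc =>
      intro j hj hpos hconv hs
      subst hpos
      rw [active_headPos hj hget] at hact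
      have hjL := hact.lt
      obtain ⟨ev, e', h1, h2, h3, h4, h5, h6, h7⟩ := pathEvents_spec (n := n) (h := h) hjL
      rw [h2] at hget
      simp only [Option.some.injEq, Marked.letter.injEq, Prod.mk.injEq] at hget
      obtain ⟨rfl, rfl⟩ := hget
      have hb : ev.cell.block ≠ none := by
        obtain ⟨ev', h1', hb⟩ := hact
        rw [h1] at h1'
        cases h1'
        exact hb
      obtain ⟨-, y, hy⟩ := ih (j + 1) hjL (by rw [headPos_succ]) hconv (by simpa using hact)
      refine ⟨?_, y, ?_⟩
      · rintro rfl l hl hact'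
        simp only [Bool.false_eq_true, if_false] at hs
        rcases hs with rfl | hs
        · omega
        · exact hs (hact'.of_between (hconv h) hact (by omega) (by omega))
      · rw [activeOnly_drop_of_active h1 hb]
        rw [h4] at hy hc
        rw [← h7] at hy
        refine ⟨h6, ?_, hy⟩
        rw [h5]
        exact hc
    | turn h h' q i' x hh hx hx' =>
      intro j hj hpos hconv hs
      subst hpos
      rw [active_headPos hj hget] at hx
      simp only [if_true] at hs
      refine ⟨by simp, ?_⟩
      have hact' : w.length - j = 0 ∨ ¬EventActive w n h' (w.length - j - 1) := by
        rcases hj.eq_or_lt with rfl | hjL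
        · exact Or.inl (by omega)
        · right
          have hpos : headPos (segDir h) w.length j =
              headPos (segDir h') w.length (w.length - j - 1) := by
            rcases segDir_succ hh with ⟨e1, e2⟩ | ⟨e1, e2⟩ <;> rw [e1, e2] <;>
              simp only [headPos] <;> omega
          rw [hpos] at hget
          rwa [active_headPos (by omega) hget] at hx'
      obtain ⟨h1, y, hy⟩ := ih (w.length - j) (by omega) (by rw [headPos_turn hh hj]) hconv
        (by simpa using hact')
      refine ⟨y, ?_⟩
      rw [activeOnly_drop_eq_nil, laterEvents_eq hh, activeOnly_append, List.nil_append,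
        ← gapAt_turn hh hj]
      · rw [activeOnly_drop_eq (h1 rfl)] at hy
        exact hy
      · intro l hl hact
        exact hx (hs.2.of_between (hconv h) hact (by omega) hl)
    | finish q i' x hx =>
      intro j hj hpos hconv hs
      subst hpos
      rw [active_headPos hj hget] at hx
      simp only [if_true] at hs
      refine ⟨by simp, (gapAt (segDir (Fin.last r)) w.length j, i', q), ?_⟩
      rw [activeOnly_drop_eq_nil, laterEvents_last]
      · rfl
      · intro l hl hact
        exact hx (hs.2.of_between (hconv _) hact (by omega) hl)
    | done x => trivial

theorem exists_trackChain_of_mem_language {M : Machine A Q}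
    (hw : w ∈ (execTwoNFA M r k n).language) :
    (∀ h, (activeSet w n h).Nonempty ∧ (activeSet w n h).OrdConnected) ∧
      ∃ i y, TrackChain M (0, i, M.start) (activeOnly (events w n)) y := by
  obtain ⟨q, -, i, hi, hr⟩ := hw
  have hg : ExecGood M w n (.scan fun _ => .before) 0 := ExecGood.of_reflTransGen hr hi
  obtain ⟨h1, h2⟩ := hg 0 (Nat.zero_le _) (Or.inr ⟨rfl, rfl⟩)
  have h3 : ∀ h, (activeSet w n h).Nonempty ∧ (activeSet w n h).OrdConnected := by
    intro h
    have h4 := h1 h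
    simpa using h4
  exact ⟨h3, h2 fun h => (h3 h).2⟩

theorem gapAt_injective (d : Dir) {L i j : ℕ} (hi : i ≤ L) (hj : j ≤ L)
    (hij : gapAt d L i = gapAt d L j) : i = j := by
  cases d <;> simp only [gapAt] at hij <;> omega

/-- The first active event after `j` events of path `h`. -/
theorem exists_of_activeOnly_drop_eq_cons {j : ℕ} {ev : Event A Q m r k}
    {l : List (Event A Q m r k)} (hl : activeOnly ((pathEvents w n h).drop j) = ev :: l) :
    ∃ i, j ≤ i ∧ (pathEvents w n h)[i]? = some ev ∧ ev.cell.block ≠ none ∧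
      (∀ i', j ≤ i' → i' < i → ¬EventActive w n h i') ∧
      l = activeOnly ((pathEvents w n h).drop (i + 1)) := by
  classical
  have hex : ∃ i, j ≤ i ∧ EventActive w n h i := by
    by_contra hne
    rw [activeOnly_drop_eq_nil fun i hi hact => hne ⟨i, hi, hact⟩] at hl
    cases hl
  obtain ⟨hji, ev', hev', hb⟩ := Nat.find_spec hex
  have hmin : ∀ i', j ≤ i' → i' < Nat.find hex → ¬EventActive w n h i' :=
    fun i' h1 h2 h3 => Nat.find_min hex h2 ⟨h1, h3⟩
  have hdrop : activeOnly ((pathEvents w n h).drop j) =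
      activeOnly ((pathEvents w n h).drop (Nat.find hex)) := by
    have h1 : (pathEvents w n h).drop (Nat.find hex) =
        ((pathEvents w n h).drop j).drop (Nat.find hex - j) := by
      rw [List.drop_drop]
      congr 1
      omega
    rw [h1]
    conv_lhs => rw [← List.take_append_drop (Nat.find hex - j) ((pathEvents w n h).drop j),
      activeOnly_append]
    refine (congrArg (· ++ _) (activeOnly_eq_nil.2 ?_)).trans (List.nil_append _)
    intro ev'' hev''
    obtain ⟨l, hl⟩ := List.getElem?_of_mem hev''
    rw [List.getElem?_take] at hl
    split_ifs at hl with h2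
    rw [List.getElem?_drop] at hl
    by_contra hb'
    exact hmin (j + l) (by omega) (by omega) ⟨_, hl, hb'⟩
  rw [hdrop, activeOnly_drop_of_active hev' hb, List.cons.injEq] at hl
  obtain ⟨rfl, rfl⟩ := hl
  exact ⟨_, hji, hev', hb, hmin, rfl⟩

/-- The word is left from the configuration `c`. -/
def ExecExits (M : Machine A Q) (w : List (Letter A Q m r k)) (n : Fin m)
    (c : ExecState Q m r × ℤ) : Prop :=
  ∃ q, Relation.ReflTransGen ((execTwoNFA M r k n).Step (Marked.wrap w)) c
    (q, ((Marked.wrap w).length : ℤ))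

theorem ExecExits.head {M : Machine A Q} {q q' : ExecState Q m r} {i : ℤ}
    {a : Marked (Letter A Q m r k)} {d : Dir} (hi : 0 ≤ i)
    (ha : (Marked.wrap w)[i.toNat]? = some a) (ht : ExecTrans M n q a q' d)
    (hx : ExecExits M w n (q', i + d.delta)) : ExecExits M w n (q, i) := by
  obtain ⟨s, hs⟩ := hx
  exact ⟨s, .head (TwoNFA.step_iff.2 ⟨a, d, hi, ha, ht, rfl⟩) hs⟩

theorem execExits_done (M : Machine A Q) {i : ℤ} (h0 : 0 ≤ i) (hi : i ≤ w.length + 2) :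
    ExecExits M w n (.done, i) := by
  obtain ⟨j, hj⟩ : ∃ j : ℕ, i = w.length + 2 - j := ⟨(w.length + 2 - i).toNat, by omega⟩
  induction j generalizing i with
  | zero => exact ⟨.done, by rw [length_wrap, hj]; simp; exact .refl⟩
  | succ j ih =>
    have hlt : i.toNat < (Marked.wrap w).length := by
      rw [length_wrap]
      omega
    refine .head h0 (List.getElem?_eq_getElem hlt) (.done _) (ih ?_ ?_ ?_) <;>
      simp only [Dir.delta] <;> omega

theorem execExits_sim {M : Machine A Q} {l : List (Event A Q m r k)}
    {y : ℕ × Row m r × Q} (hne : ∀ h, (activeSet w n h).Nonempty) {h : Fin (r + 1)} {q : Q}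
      {i : Row m r} {s : Bool}
    {j : ℕ} (hj : j ≤ w.length) (hs : s = false → ∀ l < j, ¬EventActive w n h l)
    (hl : activeOnly ((pathEvents w n h).drop j) ++ activeOnly (laterEvents w n h) = l)
    (hc : TrackChain M (gapAt (segDir h) w.length j, i, q) l y) :
    ExecExits M w n (.sim h q i s, headPos (segDir h) w.length j) := by
  have hne' : ∀ h, activeOnly (pathEvents w n h) ≠ [] := by
    intro h hnil
    obtain ⟨p, x, hx, hb⟩ := hne h
    rw [activeOnly_eq_nil] at hnil
    have hmem : (⟨h, p, x.1, x.2 (n, h)⟩ : Event A Q m r k) ∈ pathEvents w n h := by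
      have h1 : (⟨h, p, x.1, x.2 (n, h)⟩ : Event A Q m r k) ∈
          w.zipIdx.map fun x => (⟨h, x.2, x.1.1, x.1.2 (n, h)⟩ : Event A Q m r k) :=
        List.mem_map.2 ⟨(x, p), List.mem_zipIdx_iff_getElem?.2 hx, rfl⟩
      rw [pathEvents]
      cases segDir h
      · exact h1
      · exact List.mem_reverse.2 h1
    exact hb (hnil _ hmem)
  induction l generalizing h q i s j with
  | nil =>
    obtain ⟨h1, h2⟩ := List.append_eq_nil_iff.1 hl
    have hlast : h = Fin.last r := by
      by_contra hlast
      have hlt : h.val < r := lt_of_le_of_ne (Nat.lt_succ_iff.1 h.isLt) fun h' => hlast (Fin.ext h')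
      rw [laterEvents_eq (h' := ⟨h.val + 1, by omega⟩) rfl, activeOnly_append,
        List.append_eq_nil_iff] at h2
      exact hne' _ h2.1
    subst hlast
    have hs' : s = true := by
      by_contra hs'
      rw [activeOnly_drop_eq (hs (by simpa using hs'))] at h1
      exact hne' _ h1
    subst hs'
    obtain ⟨b1, b2⟩ := headPos_nonneg (segDir (Fin.last r)) hj
    have hlt : (headPos (segDir (Fin.last r)) w.length j).toNat < (Marked.wrap w).length := by
      rw [length_wrap]
      omega
    refine .head b1 (List.getElem?_eq_getElem hlt) (.finish q i _ ?_) (execExits_done M ?_ ?_)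
    · rw [active_headPos hj (List.getElem?_eq_getElem hlt)]
      rintro ⟨ev, hev, hb⟩
      rw [activeOnly_drop_of_active hev hb] at h1
      cases h1
    all_goals
      simp only [Dir.delta]
      omega
  | cons ev l ih =>
    have hmove : ∀ {h : Fin (r + 1)} {j : ℕ} {s : Bool} {l' : List (Event A Q m r k)},
        j ≤ w.length → activeOnly ((pathEvents w n h).drop j) = ev :: l' →
        l' ++ activeOnly (laterEvents w n h) = l → ev.gapBefore = gapAt (segDir h) w.length j →
        ExecExits M w n (.sim h q i s, headPos (segDir h) w.length j) := by
      intro h j s l' hj hl' hl hgap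
      obtain ⟨i', hji, hev, hb, -, rfl⟩ := exists_of_activeOnly_drop_eq_cons hl'
      have hiL : i' < w.length := by
        rw [← length_pathEvents (n := n) (h := h)]
        exact (List.getElem?_eq_some_iff.1 hev).1
      obtain ⟨ev', e, h1, h2, h3, h4, h5, h6, h7⟩ := pathEvents_spec (n := n) (h := h) hiL
      rw [hev] at h1
      cases h1
      have hij : i' = j := gapAt_injective _ hiL.le hj (h6.symm.trans hgap)
      subst hij
      obtain ⟨-, hc2, hc3⟩ := hc
      rw [h5, ← h4] at hc2
      rw [h7, ← h4] at hc3
      refine .head (headPos_nonneg _ hj).1 h2 (.move h q i s ev.letter e ?_ hc2) ?_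
      · change (e (n, h)).block ≠ none
        rw [h4]
        exact hb
      · rw [← headPos_succ]
        exact ih hiL (by simp) hl hc3
    cases hd : activeOnly ((pathEvents w n h).drop j) with
    | cons ev' l' =>
      rw [hd, List.cons_append, List.cons.injEq] at hl
      obtain ⟨rfl, hl⟩ := hl
      exact hmove hj hd hl hc.1
    | nil =>
      have hs' : s = true := by
        by_contra hs'
        rw [activeOnly_drop_eq (hs (by simpa using hs'))] at hd
        exact hne' _ hd
      subst hs'
      rw [hd, List.nil_append] at hl
      have hlt : h.val < r := by
        by_contra hlt
        have hlast : h = Fin.last r := Fin.ext (by simp only [Fin.val_last]; omega)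
        rw [hlast, laterEvents_last] at hl
        cases hl
      have hh : (⟨h.val + 1, by omega⟩ : Fin (r + 1)).val = h.val + 1 := rfl
      generalize (⟨h.val + 1, by omega⟩ : Fin (r + 1)) = h' at hh
      rw [laterEvents_eq hh, activeOnly_append] at hl
      cases hd' : activeOnly (pathEvents w n h') with
      | nil => exact (hne' _ hd').elim
      | cons ev' l' =>
        rw [hd', List.cons_append, List.cons.injEq] at hl
        obtain ⟨rfl, hl⟩ := hl
        obtain ⟨i', -, hev, hb, hmin, -⟩ :=
          exists_of_activeOnly_drop_eq_cons (j := 0) (by simpa using hd')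
        have hiL : i' < w.length := by
          rw [← length_pathEvents (n := n) (h := h')]
          exact (List.getElem?_eq_some_iff.1 hev).1
        obtain ⟨ev₁, e, h1, h2, h3, h4, h5, h6, h7⟩ := pathEvents_spec (n := n) (h := h') hiL
        rw [hev] at h1
        cases h1
        have hgap := hc.1
        simp only at hgap
        rw [← gapAt_turn hh hj] at hgap
        have hij : i' = w.length - j := gapAt_injective _ hiL.le (by omega) (h6.symm.trans hgap)
        subst hij
        obtain ⟨b1, b2⟩ := headPos_nonneg (segDir h) hj
        have hlt : (headPos (segDir h) w.length j).toNat < (Marked.wrap w).length := by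
          rw [length_wrap]
          omega
        refine .head b1 (List.getElem?_eq_getElem hlt) (.turn h h' q i _ hh ?_ ?_) ?_
        · rw [active_headPos hj (List.getElem?_eq_getElem hlt)]
          rintro ⟨ev, hev, hb⟩
          rw [activeOnly_drop_of_active hev hb] at hd
          cases hd
        · have hpos : headPos (segDir h) w.length j =
              headPos (segDir h') w.length (w.length - j - 1) ∧ j ≠ w.length ∨ j = w.length := by
            by_cases hjL : j = w.length
            · exact Or.inr hjL
            · refine Or.inl ⟨?_, hjL⟩
              rcases segDir_succ hh with ⟨e1, e2⟩ | ⟨e1, e2⟩ <;> rw [e1, e2] <;>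
                simp only [headPos] <;> omega
          have hget := List.getElem?_eq_getElem hlt
          revert hget
          generalize (Marked.wrap w)[(headPos (segDir h) w.length j).toNat] = x
          intro hget
          rcases hpos with ⟨hpos, hjL⟩ | rfl
          · rw [hpos] at hget
            rw [active_headPos (by omega) hget]
            exact hmin _ (Nat.zero_le _) (by omega)
          · rw [wrap_headPos_length] at hget
            cases hget
            cases segDir h <;> exact id
        · rw [← headPos_turn hh hj]
          refine hmove (by omega) ?_ hl hgap
          rw [activeOnly_drop_eq fun l hl => hmin l (Nat.zero_le _) hl]
          exact hd'

theorem mem_language_execTwoNFA {M : Machine A Q} {i : Row m r} {y : ℕ × Row m r × Q}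
    (hact : ∀ h, (activeSet w n h).Nonempty ∧ (activeSet w n h).OrdConnected)
    (hc : TrackChain M (0, i, M.start) (activeOnly (events w n)) y) :
    w ∈ (execTwoNFA M r k n).language := by
  classical
  suffices hx : ExecExits M w n (.scan fun _ => .before, 0) by
    obtain ⟨q, hq⟩ := hx
    exact ⟨q, trivial, _, Or.inr rfl, hq⟩
  have hsim : ExecExits M w n (.sim 0 M.start i false, 1) := by
    have h1 := execExits_sim (M := M) (y := y) (fun h => (hact h).1) (h := 0) (q := M.start) (i :=
      i)
      (s := false) (j := 0) (Nat.zero_le _) (by simp) (by rw [← activeOnly_append, List.drop_zero,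
        ← events_eq]) hc
    simpa [segDir_zero, headPos] using h1
  have hrew : ∀ p ≤ w.length, ExecExits M w n (.rewind, (p : ℤ)) := by
    intro p hp
    induction p with
    | zero => exact .head le_rfl rfl (.begin i) hsim
    | succ p ih =>
      refine .head (by omega) (a := .letter (w[p]'hp)) ?_ (.rewind _) ?_
      · have h1 : ((p + 1 : ℕ) : ℤ).toNat = p + 1 := rfl
        rw [h1, wrap_getElem?_letter, if_pos (Nat.lt_of_succ_le hp), List.getElem?_eq_getElem hp]
        rfl
      · have h1 : ((p + 1 : ℕ) : ℤ) + Dir.bwd.delta = p := by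
          simp [Dir.delta]
        rw [h1]
        exact ih (by omega)
  -- the phases after `p` letters
  let φ : ℕ → Fin (r + 1) → Phase := fun p h =>
    if ∃ q ∈ activeSet w n h, q + 1 = p then .during
    else if ∃ q ∈ activeSet w n h, q < p then .after else .before
  have hφ : ∀ p h, PhaseNext (φ p h) (p ∈ activeSet w n h) (φ (p + 1) h) := by
    intro p h
    by_cases hp : p ∈ activeSet w n h
    · have h1 : φ (p + 1) h = .during := if_pos ⟨p, hp, rfl⟩
      rw [h1]
      by_cases h2 : ∃ q ∈ activeSet w n h, q + 1 = p
      · have h3 : φ p h = .during := if_pos h2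
        rw [h3]
        exact .stay _ hp
      · have h3 : φ p h = .before := by
          refine (if_neg h2).trans (if_neg ?_)
          rintro ⟨q, hq, hqp⟩
          exact h2 ⟨p - 1, (hact h).2.out hq hp ⟨by omega, by omega⟩, by omega⟩
        rw [h3]
        exact .begin _ hp
    · have h1 : ¬∃ q ∈ activeSet w n h, q + 1 = p + 1 := by
        rintro ⟨q, hq, hqp⟩
        rw [Nat.succ_injective hqp] at hq
        exact hp hq
      by_cases h2 : ∃ q ∈ activeSet w n h, q < p
      · have h3 : φ (p + 1) h = .after :=
          (if_neg h1).trans (if_pos (by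
            obtain ⟨q, hq, hqp⟩ := h2
            exact ⟨q, hq, by omega⟩))
        rw [h3]
        by_cases h4 : ∃ q ∈ activeSet w n h, q + 1 = p
        · have h5 : φ p h = .during := if_pos h4
          rw [h5]
          exact .finish _ hp
        · have h5 : φ p h = .after := (if_neg h4).trans (if_pos h2)
          rw [h5]
          exact .rest _ hp
      · have h3 : φ (p + 1) h = .before := by
          refine (if_neg h1).trans (if_neg ?_)
          rintro ⟨q, hq, hqp⟩
          rcases (Nat.lt_succ_iff.1 hqp).eq_or_lt with rfl | h4
          · exact hp hq
          · exact h2 ⟨q, hq, h4⟩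
        have h5 : φ p h = .before := by
          refine (if_neg ?_).trans (if_neg h2)
          rintro ⟨q, hq, hqp⟩
          exact h2 ⟨q, hq, by omega⟩
        rw [h3, h5]
        exact .wait _ hp
  have hscan : ∀ j ≤ w.length, ExecExits M w n (.scan (φ (w.length - j)),
    (w.length - j : ℕ) + 1) := by
    intro j
    induction j with
    | zero =>
      intro _
      refine .head (by omega) (a := .right) ?_ (.scanRight _ ?_) ?_
      · have h1 : (((w.length - 0 : ℕ) : ℤ) + 1).toNat = w.length + 1 := by omega
        rw [h1, wrap_getElem?_letter]
        simp
      · intro h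
        obtain ⟨p, x, hx, hb⟩ := (hact h).1
        have hp : ∃ q ∈ activeSet w n h, q < w.length - 0 :=
          ⟨p, ⟨x, hx, hb⟩, (List.getElem?_eq_some_iff.1 hx).1⟩
        change (if _ then _ else if _ then _ else _) ≠ _
        rw [if_pos hp]
        split_ifs <;> simp
      · have h1 : (((w.length - 0 : ℕ) : ℤ) + 1) + Dir.bwd.delta = (w.length : ℕ) := by
          simp [Dir.delta]
        rw [h1]
        exact hrew _ le_rfl
    | succ j ih =>
      intro hj
      have hp : w.length - (j + 1) < w.length := by omega
      refine .head (by omega) (a := .letter (w[w.length - (j + 1)]'hp)) ?_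
        (.scanLetter _ (φ (w.length - j)) _ fun h => ?_) ?_
      · have h1 : (((w.length - (j + 1) : ℕ) : ℤ) + 1).toNat = w.length - (j + 1) + 1 := by omega
        rw [h1, wrap_getElem?_letter, if_pos hp, List.getElem?_eq_getElem hp]
        rfl
      · have h1 : Active n h (.letter (w[w.length - (j + 1)]'hp)) =
            (w.length - (j + 1) ∈ activeSet w n h) := by
          refine propext ⟨fun h' => ⟨_, List.getElem?_eq_getElem hp, h'⟩, ?_⟩
          rintro ⟨x, hx, hb⟩
          rw [List.getElem?_eq_getElem hp] at hx
          cases hx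
          exact hb
        rw [h1]
        have h2 := hφ (w.length - (j + 1)) h
        have h3 : w.length - (j + 1) + 1 = w.length - j := by omega
        rwa [h3] at h2
      · have h1 : (((w.length - (j + 1) : ℕ) : ℤ) + 1) + Dir.fwd.delta =
            ((w.length - j : ℕ) : ℤ) + 1 := by
          simp only [Dir.delta]
          omega
        rw [h1]
        exact ih (by omega)
  refine .head le_rfl rfl (.scanLeft _) ?_
  have h1 := hscan w.length le_rfl
  rw [Nat.sub_self] at h1
  have h2 : φ 0 = fun _ => .before := by
    funext h
    exact (if_neg (by simp)).trans (if_neg (by simp))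
  rw [h2] at h1
  simpa [Dir.delta] using h1

end Exec

/-! ### The automaton for read-write consistency -/

/-- The memory along a list of events. -/
def RWChain {A Q : Type*} {m r k : ℕ} :
    RWMemory m r k → List (Event A Q m r k) → RWMemory m r k → Prop
  | s, [], s' => s = s'
  | s, ev :: l, s' => ∃ s₁, RWStep (segDir ev.path) ev.letter ev.cell s s₁ ∧ RWChain s₁ l s'

/-- The machines from number `n` on can be processed, with the assumption `a` and the guarantee `g`
collected from the machines before. -/
def RWRest {A Q : Type*} {m r k : ℕ} (w : List (Letter A Q m r k)) (n : ℕ)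
    (a g : BlockMap m r k) : Prop :=
  ∃ f : ℕ → BlockMap m r k × BlockMap m r k, f n = (a, g) ∧
    (∀ n' : Fin m, n ≤ n' → ∃ s, RWChain ⟨none, fun _ => false, (f n').1, (f n').2⟩
      (events w n') s ∧ f (n' + 1) = (s.assumption, s.close)) ∧
    Discharged (f m).1 (f m).2

section RW

variable {A Q : Type*} {m r k : ℕ} {w : List (Letter A Q m r k)} {n : Fin m} {h h' : Fin (r + 1)}

theorem rwChain_append {l l' : List (Event A Q m r k)} {s s' : RWMemory m r k} :
    RWChain s (l ++ l') s' ↔ ∃ s₁, RWChain s l s₁ ∧ RWChain s₁ l' s' := by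
  induction l generalizing s with
  | nil => simp [RWChain]
  | cons ev l ih =>
    simp only [List.cons_append, RWChain, ih]
    constructor
    · rintro ⟨s₁, h1, s₂, h2, h3⟩
      exact ⟨s₂, ⟨s₁, h1, h2⟩, h3⟩
    · rintro ⟨s₂, ⟨s₁, h1, h2⟩, h3⟩
      exact ⟨s₁, h1, s₂, h2, h3⟩

theorem rwChain_activeOnly {l : List (Event A Q m r k)} {s s' : RWMemory m r k} :
    RWChain s (activeOnly l) s' ↔ RWChain s l s' := by
  induction l generalizing s with
  | nil => rfl
  | cons ev l ih =>
    cases hb : ev.cell.block with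
    | none =>
      rw [activeOnly, List.filter_cons_of_neg (by simp [hb])]
      change RWChain s (activeOnly l) s' ↔ _
      rw [ih]
      constructor
      · exact fun h => ⟨s, .idle s hb, h⟩
      · rintro ⟨s₁, h1, h2⟩
        rcases h1 with _ | ⟨b, β', hc, hs, hop⟩ | ⟨b, β, β', hc, hs, hfresh, hop⟩
        · exact h2
        · simp [hb] at hc
        · simp [hb] at hc
    | some b =>
      rw [activeOnly, List.filter_cons_of_pos (by simp [hb])]
      change (∃ s₁, _ ∧ RWChain s₁ (activeOnly l) s') ↔ _
      simp only [ih]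
      rfl

theorem RWRest.cons {a g : BlockMap m r k} {s : RWMemory m r k}
    (hs : RWChain ⟨none, fun _ => false, a, g⟩ (events w n) s)
    (hr : RWRest w (n + 1) s.assumption s.close) : RWRest w n a g := by
  obtain ⟨f, h1, h2, h3⟩ := hr
  have hne : ∀ {n' : ℕ}, n.val < n' → Function.update f n (a, g) n' = f n' :=
    fun hn' => Function.update_of_ne hn'.ne' _ _
  refine ⟨Function.update f n (a, g), Function.update_self .., fun n' hn' => ?_, ?_⟩
  · rw [hne (Nat.lt_succ_of_le hn')]
    rcases hn'.eq_or_lt with h4 | h4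
    · have h5 : n' = n := Fin.ext h4.symm
      subst h5
      refine ⟨s, ?_, h1⟩
      rw [Function.update_self]
      exact hs
    · have h5 := h2 n' h4
      rw [← hne h4] at h5
      exact h5
  · rw [hne n.isLt]
    exact h3

/-- What the configurations that lead to acceptance tell about the rest of the word. -/
def RWGood (w : List (Letter A Q m r k)) : RWState m r k → ℤ → Prop
  | .start, i => i = 0 → RWRest w 0 (fun _ => none) (fun _ => none)
  | .sweep n h s, i => ∀ j ≤ w.length, i = headPos (segDir h) w.length j →
      ∃ s', RWChain s ((pathEvents w n h).drop j ++ laterEvents w n h) s' ∧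
        RWRest w (n + 1) s'.assumption s'.close
  | .rewind n a g, i => 0 ≤ i → i ≤ w.length → RWRest w n a g
  | .done, _ => True

theorem wrap_headPos_ne {d d' : Dir} {j : ℕ} (hj : j ≤ w.length)
    (hw : (Marked.wrap w)[(headPos d w.length j).toNat]? = some (endMarker d')) (hd : d = d') :
    j = w.length := by
  subst hd
  by_contra hne
  have hget : ∃ x, (Marked.wrap w)[(headPos d w.length j).toNat]? = some (.letter x) := by
    have hp : ∃ p < w.length, (headPos d w.length j).toNat = p + 1 := by
      cases d <;> simp only [headPos]
      · exact ⟨j, by omega, by omega⟩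
      · exact ⟨w.length - 1 - j, by omega, by omega⟩
    obtain ⟨p, hp, h1⟩ := hp
    rw [h1, wrap_getElem?_letter, if_pos hp, List.getElem?_eq_getElem hp]
    exact ⟨_, rfl⟩
  obtain ⟨x, hx⟩ := hget
  rw [hx] at hw
  cases d <;> simp [endMarker] at hw

theorem RWGood.of_reflTransGen {c c' : RWState m r k × ℤ}
    (hr : Relation.ReflTransGen ((rwTwoNFA A Q m r k).Step (Marked.wrap w)) c c')
    (hend : c'.1 = .done) : RWGood w c.1 c.2 := by
  induction hr using Relation.ReflTransGen.head_induction_on with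
  | refl =>
    rw [hend]
    trivial
  | head hstep hrest ih =>
    rename_i c c₁
    obtain ⟨s, i⟩ := c
    obtain ⟨s₁, i₁⟩ := c₁
    rw [TwoNFA.step_iff] at hstep
    obtain ⟨a, d, hi0, hget, htr, rfl⟩ := hstep
    have htr' : RWTrans s a s₁ d := htr
    clear htr
    cases htr' with
    | start n hn =>
      rintro rfl
      obtain ⟨s', h1, h2⟩ := ih 0 (Nat.zero_le _) (by simp [headPos, segDir_zero, Dir.delta])
      rw [← hn]
      rw [List.drop_zero, ← events_eq] at h1
      exact h2.cons h1
    | startEmpty hm =>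
      intro _
      subst hm
      exact ⟨fun _ => (fun _ => none, fun _ => none), rfl, fun n => n.elim0,
        fun b β hb => by cases hb⟩
    | letter n h s s' b e hs =>
      intro j hj hpos
      subst hpos
      have hjL : j < w.length := by
        rcases hj.eq_or_lt with rfl | hjL
        · rw [wrap_headPos_length] at hget
          cases hd : segDir h <;> simp [hd, endMarker] at hget
        · exact hjL
      obtain ⟨ev, e', h1, h2, h3, h4, h5, -⟩ := pathEvents_spec (n := n) (h := h) hjL
      rw [h2] at hget
      simp only [Option.some.injEq, Marked.letter.injEq, Prod.mk.injEq] at hget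
      obtain ⟨rfl, rfl⟩ := hget
      obtain ⟨s₂, h6, h7⟩ := ih (j + 1) hjL (by rw [headPos_succ])
      refine ⟨s₂, ?_, h7⟩
      obtain ⟨hj', hj''⟩ := List.getElem?_eq_some_iff.1 h1
      rw [List.drop_eq_getElem_cons hj', hj'']
      refine ⟨s', ?_, h6⟩
      rw [h5, ← h4]
      exact hs
    | nextPath n h h' s hh =>
      intro j hj hpos
      subst hpos
      have hjL := wrap_headPos_ne hj hget rfl
      subst hjL
      obtain ⟨s₂, h6, h7⟩ := ih 0 (Nat.zero_le _) (by
        have h1 := headPos_turn hh (le_refl w.length)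
        rw [Nat.sub_self] at h1
        exact h1.symm)
      refine ⟨s₂, ?_, h7⟩
      rw [List.drop_eq_nil_of_le length_pathEvents.le, List.nil_append, laterEvents_eq hh]
      exact h6
    | nextMachineRight n n' s hn hd =>
      intro j hj hpos
      subst hpos
      rw [hd] at hget
      have hjL := wrap_headPos_ne (d' := .fwd) hj hget rfl
      subst hjL
      refine ⟨s, ?_, ?_⟩
      · rw [List.drop_eq_nil_of_le length_pathEvents.le, laterEvents_last]
        exact rfl
      · rw [← hn]
        refine ih ?_ ?_ <;> simp only [hd, headPos, Dir.delta] <;> omega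
    | rewind n x a g =>
      intro h0 h1
      have hi1 : 0 < i := by
        rcases h0.eq_or_lt with rfl | h2
        · rw [Int.toNat_zero, wrap_getElem?_zero] at hget
          simp at hget
        · exact h2
      exact ih (by simp [Dir.delta]; omega) (by simp [Dir.delta]; omega)
    | rewound n a g =>
      intro h0 h1
      have hi1 : i = 0 := by
        by_contra hne
        have h2 : i.toNat = (i.toNat - 1) + 1 := by omega
        rw [h2, wrap_getElem?_letter] at hget
        split_ifs at hget
        · cases hw : w[i.toNat - 1]? <;> simp [hw] at hget
        · simp at hget
      obtain ⟨s', h1, h2⟩ := ih 0 (Nat.zero_le _) (by simp [hi1, headPos, segDir_zero, Dir.delta])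
      rw [List.drop_zero, ← events_eq] at h1
      exact h2.cons h1
    | nextMachineLeft n n' s hn hd =>
      intro j hj hpos
      subst hpos
      rw [hd] at hget
      have hjL := wrap_headPos_ne (d' := .bwd) hj hget rfl
      subst hjL
      refine ⟨s, ?_, ?_⟩
      · rw [List.drop_eq_nil_of_le length_pathEvents.le, laterEvents_last]
        exact rfl
      · obtain ⟨s', h1, h2⟩ := ih 0 (Nat.zero_le _) (by
          simp [hd, headPos, segDir_zero, Dir.delta])
        rw [List.drop_zero, ← events_eq] at h1
        rw [← hn]
        exact h2.cons h1
    | finish n s hn hs =>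
      intro j hj hpos
      subst hpos
      have hjL := wrap_headPos_ne hj hget rfl
      subst hjL
      refine ⟨s, ?_, fun _ => (s.assumption, s.close), rfl, fun n' hn' => ?_, hs⟩
      · rw [List.drop_eq_nil_of_le length_pathEvents.le, laterEvents_last]
        exact rfl
      · have := n'.isLt
        omega
    | done x => trivial

/-- The word can be accepted from the configuration `c`. -/
def RWExits (w : List (Letter A Q m r k)) (c : RWState m r k × ℤ) : Prop :=
  Relation.ReflTransGen ((rwTwoNFA A Q m r k).Step (Marked.wrap w)) c
    (.done, ((Marked.wrap w).length : ℤ))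

theorem RWExits.head {q q' : RWState m r k} {i : ℤ}
    {a : Marked (Letter A Q m r k)} {d : Dir} (hi : 0 ≤ i)
    (ha : (Marked.wrap w)[i.toNat]? = some a) (ht : RWTrans q a q' d)
    (hx : RWExits w (q', i + d.delta)) : RWExits w (q, i) :=
  Relation.ReflTransGen.head (TwoNFA.step_iff.2 ⟨a, d, hi, ha, ht, rfl⟩) hx

theorem rwExits_done {i : ℤ} (h0 : 0 ≤ i) (hi : i ≤ w.length + 2) : RWExits w (.done, i) := by
  obtain ⟨j, hj⟩ : ∃ j : ℕ, i = w.length + 2 - j := ⟨(w.length + 2 - i).toNat, by omega⟩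
  induction j generalizing i with
  | zero => rw [RWExits, length_wrap, hj]; simp; exact .refl
  | succ j ih =>
    have hlt : i.toNat < (Marked.wrap w).length := by
      rw [length_wrap]
      omega
    refine .head h0 (List.getElem?_eq_getElem hlt) (.done _) (ih ?_ ?_ ?_) <;>
      simp only [Dir.delta] <;> omega

theorem rwExits_path {s s' : RWMemory m r k} {l : List (Event A Q m r k)} {j : ℕ}
    (hj : j ≤ w.length)
    (hl : (pathEvents w n h).drop j = l) (hs : RWChain s l s')
    (hx : RWExits w (.sweep n h s', headPos (segDir h) w.length w.length)) :
    RWExits w (.sweep n h s, headPos (segDir h) w.length j) := by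
  induction l generalizing s j with
  | nil =>
    have hjL : j = w.length := by
      rw [List.drop_eq_nil_iff, length_pathEvents] at hl
      omega
    have h1 : s = s' := hs
    rw [hjL, h1]
    exact hx
  | cons ev l ih =>
    have hjL : j < w.length := by
      by_contra hjL
      rw [List.drop_eq_nil_of_le (by rw [length_pathEvents]; omega)] at hl
      cases hl
    obtain ⟨ev', e, h1, h2, h3, h4, h5, -⟩ := pathEvents_spec (n := n) (h := h) hjL
    obtain ⟨hj', hj''⟩ := List.getElem?_eq_some_iff.1 h1
    rw [List.drop_eq_getElem_cons hj', hj'', List.cons.injEq] at hl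
    obtain ⟨rfl, hl⟩ := hl
    obtain ⟨s₁, hs₁, hs⟩ := hs
    rw [h5, ← h4] at hs₁
    refine .head (headPos_nonneg _ hj).1 h2 (.letter n h s s₁ _ e hs₁) ?_
    rw [← headPos_succ]
    exact ih hjL hl hs

theorem rwExits_paths {s s' : RWMemory m r k}
    (hs : RWChain s (pathEvents w n h ++ laterEvents w n h) s')
    (hx : RWExits w (.sweep n (Fin.last r) s', headPos (segDir (Fin.last r)) w.length w.length)) :
    RWExits w (.sweep n h s, headPos (segDir h) w.length 0) := by
  obtain ⟨d, hd⟩ : ∃ d, h.val + d = r := ⟨r - h.val, by omega⟩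
  induction d generalizing h s with
  | zero =>
    have hlast : h = Fin.last r := Fin.ext hd
    subst hlast
    rw [laterEvents_last, List.append_nil] at hs
    exact rwExits_path (Nat.zero_le _) rfl hs hx
  | succ d ih =>
    have hh : (⟨h.val + 1, by omega⟩ : Fin (r + 1)).val = h.val + 1 := rfl
    generalize (⟨h.val + 1, by omega⟩ : Fin (r + 1)) = h' at hh
    rw [laterEvents_eq hh, rwChain_append] at hs
    obtain ⟨s₁, h1, h2⟩ := hs
    refine rwExits_path (Nat.zero_le _) rfl h1 ?_
    refine .head (headPos_nonneg _ le_rfl).1 (wrap_headPos_length _) (.nextPath n h h' s₁ hh) ?_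
    have h3 := headPos_turn hh (le_refl w.length)
    rw [Nat.sub_self] at h3
    rw [← h3]
    exact ih h2 (by omega)

theorem rwExits_machine {a g : BlockMap m r k} (hr : RWRest w n a g) :
    RWExits w (.sweep n 0 ⟨none, fun _ => false, a, g⟩, 1) := by
  obtain ⟨f, h1, h2, h3⟩ := hr
  obtain ⟨d, hd⟩ : ∃ d, n.val + d + 1 = m := ⟨m - n.val - 1, by omega⟩
  have hpos : (1 : ℤ) = headPos (segDir (0 : Fin (r + 1))) w.length 0 := rfl
  induction d generalizing n a g with
  | zero =>
    obtain ⟨s, hs, hs'⟩ := h2 n le_rfl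
    rw [h1, events_eq] at hs
    rw [hpos]
    refine rwExits_paths hs ?_
    have hm : n.val + 1 = m := hd
    refine .head (headPos_nonneg _ le_rfl).1 (wrap_headPos_length _) (.finish n s hm ?_)
      (rwExits_done ?_ ?_)
    · rw [hm] at hs'
      rw [hs'] at h3
      exact h3
    all_goals
      have := headPos_nonneg (segDir (Fin.last r)) (le_refl w.length)
      simp only [Dir.delta]
      omega
  | succ d ih =>
    obtain ⟨s, hs, hs'⟩ := h2 n le_rfl
    rw [h1, events_eq] at hs
    rw [hpos]
    refine rwExits_paths hs ?_
    have hn : (⟨n.val + 1, by omega⟩ : Fin m).val = n.val + 1 := rfl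
    generalize (⟨n.val + 1, by omega⟩ : Fin m) = n' at hn
    have hnext := ih (n := n') (a := s.assumption) (g := s.close) (by rw [hn]; exact hs')
      (fun n'' hn'' => h2 n'' (by omega)) (by omega)
    have h0 := headPos_nonneg (segDir (Fin.last r)) (le_refl w.length)
    have hend := wrap_headPos_length (w := w) (segDir (Fin.last r))
    cases hlast : segDir (Fin.last r) with
    | bwd =>
      rw [hlast] at h0 hend
      refine .head h0.1 hend (.nextMachineLeft n n' s hn hlast) ?_
      simpa [headPos, Dir.delta] using hnext
    | fwd =>
      rw [hlast] at h0 hend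
      refine .head h0.1 hend (.nextMachineRight n n' s hn hlast) ?_
      have hrew : ∀ p ≤ w.length, RWExits w (.rewind n' s.assumption s.close, (p : ℤ)) := by
        intro p hp
        induction p with
        | zero => exact .head le_rfl rfl (.rewound n' _ _) hnext
        | succ p ihp =>
          refine .head (by omega) (a := .letter (w[p]'hp)) ?_ (.rewind n' _ _ _) ?_
          · have h1 : ((p + 1 : ℕ) : ℤ).toNat = p + 1 := rfl
            rw [h1, wrap_getElem?_letter, if_pos (Nat.lt_of_succ_le hp),
              List.getElem?_eq_getElem hp]
            rfl
          · have h1 : ((p + 1 : ℕ) : ℤ) + Dir.bwd.delta = p := by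
              simp [Dir.delta]
            rw [h1]
            exact ihp (by omega)
      have h4 := hrew w.length le_rfl
      simpa [headPos, Dir.delta] using h4

theorem mem_language_rwTwoNFA :
    w ∈ (rwTwoNFA A Q m r k).language ↔ RWRest w 0 (fun _ => none) (fun _ => none) := by
  constructor
  · rintro ⟨q, hq, i, -, hr⟩
    exact RWGood.of_reflTransGen hr hq rfl
  · intro hr
    refine ⟨.done, rfl, _, Or.inr rfl, ?_⟩
    rcases Nat.eq_zero_or_pos m with hm | hm
    · exact RWExits.head le_rfl rfl (.startEmpty hm) (rwExits_done (by simp [Dir.delta])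
        (by simp [Dir.delta]; omega))
    · exact RWExits.head le_rfl rfl (.start ⟨0, hm⟩ rfl) (rwExits_machine hr)

end RW

/-! ### Blocks -/

/-- The register operations along a list of events. -/
def OpsChain {A Q : Type*} {m r k : ℕ} : Valuation k → List (Event A Q m r k) → Valuation k → Prop
  | β, [], β' => β = β'
  | β, ev :: l, β' => ∃ β₁, Operates (segDir ev.path) ev.letter ev.cell β β₁ ∧ OpsChain β₁ l β'

/-- The events of block `b`. -/
noncomputable def ofBlock {A Q : Type*} {m r k : ℕ} (b : Fin (blockBound m r k))
    (l : List (Event A Q m r k)) : List (Event A Q m r k) :=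
  l.filter fun ev => ev.cell.block = some b

/-- Block numbers are nondecreasing. -/
def BlocksSorted {A Q : Type*} {m r k : ℕ} (l : List (Event A Q m r k)) : Prop :=
  l.Pairwise fun ev ev' => ∀ b b', ev.cell.block = some b → ev'.cell.block = some b' → b ≤ b'

/-- Read-write consistency: `V b` and `V' b` are the valuations at the beginning and at the end of
block `b`. -/
structure BlocksConsistent {A Q : Type*} {m r k : ℕ} (E : Fin m → List (Event A Q m r k))
    (V V' : Fin (blockBound m r k) → Valuation k) : Prop where
  sorted : ∀ n, BlocksSorted (E n)
  owner : ∀ n n' b, ofBlock b (E n) ≠ [] → ofBlock b (E n') ≠ [] → n = n'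
  ops : ∀ n b, ofBlock b (E n) ≠ [] → OpsChain (V b) (ofBlock b (E n)) (V' b)
  discharged : ∀ n b, ofBlock b (E n) ≠ [] → (b.val = 0 ∧ V b = fun _ => false) ∨
    ∃ b' n', b'.val + 1 = b.val ∧ ofBlock b' (E n') ≠ [] ∧ V' b' = V b

section Blocks

variable {A Q : Type*} {m r k : ℕ} {l : List (Event A Q m r k)} {b : Fin (blockBound m r k)}
  {ev : Event A Q m r k}

theorem ofBlock_cons_of_eq (h : ev.cell.block = some b) :
    ofBlock b (ev :: l) = ev :: ofBlock b l := List.filter_cons_of_pos (by simpa using h)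

theorem ofBlock_cons_of_ne (h : ev.cell.block ≠ some b) : ofBlock b (ev :: l) = ofBlock b l :=
  List.filter_cons_of_neg (by simpa using h)

theorem ofBlock_ne_nil : ofBlock b l ≠ [] ↔ ∃ ev ∈ l, ev.cell.block = some b := by
  rw [Ne, ofBlock, List.filter_eq_nil_iff]
  push Not
  simp

theorem RWMemory.close_of_eq {s : RWMemory m r k} (h : s.block = some b) : s.close b =
    some s.val := by
  simp [RWMemory.close, h]

theorem RWMemory.close_of_ne {s : RWMemory m r k} (h : s.block ≠ some b) :
    s.close b = s.guarantee b := by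
  obtain ⟨b', β, a, g⟩ := s
  cases b' with
  | none => rfl
  | some b' =>
    refine Function.update_of_ne ?_ _ _
    rintro rfl
    exact h rfl

/-- The memory after a list of events records the blocks of this list. -/
theorem RWChain.spec {s s' : RWMemory m r k} (h : RWChain s l s')
    (hl : ∀ ev ∈ l, ev.cell.block ≠ none)
    (hs : ∀ b, s.block = some b → s.assumption b ≠ none) :
    BlocksSorted l ∧
    (∀ ev ∈ l, ∀ b b', s.block = some b → ev.cell.block = some b' → b ≤ b') ∧
    (∀ b, ofBlock b l ≠ [] → s.block = some b ∨ s.assumption b = none) ∧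
    (∀ b β, s.assumption b = some β → s'.assumption b = some β) ∧
    (∀ b, s.block = some b → ∃ β', OpsChain s.val (ofBlock b l) β' ∧ s'.close b = some β') ∧
    (∀ b, s.block ≠ some b → ofBlock b l ≠ [] → ∃ β β', s'.assumption b = some β ∧
      OpsChain β (ofBlock b l) β' ∧ s'.close b = some β') ∧
    (∀ b, s.block ≠ some b → ofBlock b l = [] →
      s'.assumption b = s.assumption b ∧ s'.close b = s.close b) := by
  induction l generalizing s with
  | nil =>
    have h' : s = s' := h
    subst h'
    refine ⟨List.Pairwise.nil, by simp, fun b hb => absurd rfl hb, fun b β h => h,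
      fun b hb => ⟨_, rfl, RWMemory.close_of_eq hb⟩, fun b _ hb => absurd rfl hb,
      fun b _ _ => ⟨rfl, rfl⟩⟩
  | cons ev l ih =>
    obtain ⟨s₁, h1, h2⟩ := h
    have hl' : ∀ ev ∈ l, ev.cell.block ≠ none := fun e he => hl e (List.mem_cons_of_mem _ he)
    rcases h1 with hb | ⟨b, β', hc, hsb, hop⟩ | ⟨b, β, β', hc, hsb, hfresh, hop⟩
    · exact absurd hb (hl ev (by simp))
    · obtain ⟨i1, i2, i3, i4, i5, i6, i7⟩ := ih h2 hl' hs
      refine ⟨List.Pairwise.cons ?_ i1, ?_, ?_, i4, ?_, ?_, ?_⟩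
      · intro e he b₁ b₂ hb₁ hb₂
        rw [hc, Option.some.injEq] at hb₁
        subst hb₁
        exact i2 e he _ _ hsb hb₂
      · intro e he b₁ b₂ hb₁ hb₂
        rcases List.mem_cons.1 he with rfl | he
        · rw [hc, Option.some.injEq] at hb₂
          rw [hsb, Option.some.injEq] at hb₁
          rw [← hb₁, ← hb₂]
        · exact i2 e he _ _ hb₁ hb₂
      · intro b' hb'
        by_cases hbb : b = b'
        · exact Or.inl (hbb ▸ hsb)
        · rw [ofBlock_cons_of_ne (by rw [hc]; simpa using hbb)] at hb'
          exact i3 b' hb'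
      · intro b' hb'
        rw [hsb, Option.some.injEq] at hb'
        subst hb'
        obtain ⟨β₂, h3, h4⟩ := i5 b hsb
        rw [ofBlock_cons_of_eq hc]
        exact ⟨β₂, ⟨β', hop, h3⟩, h4⟩
      · intro b' hb' hne
        have hcb : ev.cell.block ≠ some b' := by
          rw [hc, ← hsb]
          exact hb'
        rw [ofBlock_cons_of_ne hcb] at hne ⊢
        exact i6 b' hb' hne
      · intro b' hb' hnil
        have hcb : ev.cell.block ≠ some b' := by
          rw [hc, ← hsb]
          exact hb'
        rw [ofBlock_cons_of_ne hcb] at hnil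
        obtain ⟨h3, h4⟩ := i7 b' hb' hnil
        refine ⟨h3, ?_⟩
        rw [h4, RWMemory.close_of_ne (s := s) hb']
        exact RWMemory.close_of_ne hb'
    · obtain ⟨i1, i2, i3, i4, i5, i6, i7⟩ := ih h2 hl' (by
        rintro b' hb'
        simp only [Option.some.injEq] at hb'
        subst hb'
        simp)
      simp only [Option.some.injEq] at i2 i3 i5 i6 i7
      refine ⟨List.Pairwise.cons ?_ i1, ?_, ?_, ?_, ?_, ?_, ?_⟩
      · intro e he b₁ b₂ hb₁ hb₂
        rw [hc, Option.some.injEq] at hb₁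
        exact i2 e he _ _ hb₁ hb₂
      · intro e he b₁ b₂ hb₁ hb₂
        have hlt := hsb _ hb₁
        rcases List.mem_cons.1 he with rfl | he
        · rw [hc, Option.some.injEq] at hb₂
          exact hb₂ ▸ hlt.le
        · exact hlt.le.trans (i2 e he _ _ rfl hb₂)
      · intro b' hb'
        by_cases hbb : b = b'
        · exact Or.inr (hbb ▸ hfresh)
        · rw [ofBlock_cons_of_ne (by rw [hc]; simpa using hbb)] at hb'
          have h3 := (i3 b' hb').resolve_left hbb
          rw [Function.update_of_ne (Ne.symm hbb)] at h3
          exact Or.inr h3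
      · intro b' β₁ hb'
        refine i4 b' β₁ ?_
        change Function.update s.assumption b (some β) b' = _
        rw [Function.update_of_ne]
        · exact hb'
        · rintro rfl
          rw [hfresh] at hb'
          cases hb'
      · intro b' hb'
        have hlt := hsb _ hb'
        have hnil : ofBlock b' (ev :: l) = [] := by
          by_contra hne
          obtain ⟨e, he, heb⟩ := ofBlock_ne_nil.1 hne
          rcases List.mem_cons.1 he with rfl | he
          · rw [hc, Option.some.injEq] at heb
            exact hlt.ne' heb
          · exact absurd (i2 e he _ _ rfl heb) (not_le.2 hlt)
        have hcb : ev.cell.block ≠ some b' := by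
          rw [hc]
          simpa using hlt.ne'
        refine ⟨s.val, by rw [hnil]; rfl, ?_⟩
        rw [ofBlock_cons_of_ne hcb] at hnil
        rw [(i7 b' (by simpa using hlt.ne') hnil).2, RWMemory.close_of_ne (by simpa using hlt.ne')]
        exact RWMemory.close_of_eq hb'
      · intro b' hb' hne
        by_cases hbb : b = b'
        · subst hbb
          obtain ⟨β₂, h3, h4⟩ := i5 b rfl
          refine ⟨β, β₂, i4 b β (by simp), ?_, h4⟩
          rw [ofBlock_cons_of_eq hc]
          exact ⟨β', hop, h3⟩
        · have hcb : ev.cell.block ≠ some b' := by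
            rw [hc]
            simpa using hbb
          rw [ofBlock_cons_of_ne hcb] at hne ⊢
          exact i6 b' (by simpa using hbb) hne
      · intro b' hb' hnil
        have hbb : b ≠ b' := by
          rintro rfl
          rw [ofBlock_cons_of_eq hc] at hnil
          cases hnil
        have hcb : ev.cell.block ≠ some b' := by
          rw [hc]
          simpa using hbb
        rw [ofBlock_cons_of_ne hcb] at hnil
        obtain ⟨h3, h4⟩ := i7 b' (by simpa using hbb) hnil
        rw [Function.update_of_ne (Ne.symm hbb)] at h3
        refine ⟨h3, ?_⟩
        rw [h4, RWMemory.close_of_ne (by simpa using hbb)]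

theorem blocksConsistent_of_rwRest {w : List (Letter A Q m r k)}
    (h : RWRest w 0 (fun _ => none) (fun _ => none)) :
    ∃ V V', BlocksConsistent (fun n => activeOnly (events w n)) V V' := by
  obtain ⟨f, hf0, hf, hd⟩ := h
  have hact : ∀ n, ∀ ev ∈ activeOnly (events w n), ev.cell.block ≠ none := by
    intro n ev hev
    exact Option.isSome_iff_ne_none.1 (List.mem_filter.1 hev).2
  have key : ∀ j ≤ m, (∀ b, (f j).1 b = none ∨ ∃ n : Fin m, n.val < j ∧
        ofBlock b (activeOnly (events w n)) ≠ []) ∧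
      (∀ b, (f j).2 b = none ∨ ∃ n : Fin m, n.val < j ∧
        ofBlock b (activeOnly (events w n)) ≠ []) ∧
      ∀ n : Fin m, n.val < j → BlocksSorted (activeOnly (events w n)) ∧
        (∀ n' : Fin m, n'.val < j → ∀ b, ofBlock b (activeOnly (events w n)) ≠ [] →
          ofBlock b (activeOnly (events w n')) ≠ [] → n = n') ∧
        ∀ b, ofBlock b (activeOnly (events w n)) ≠ [] → ∃ β β', (f j).1 b = some β ∧
          (f j).2 b = some β' ∧ OpsChain β (ofBlock b (activeOnly (events w n))) β' := by
    intro j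
    induction j with
    | zero => simp [hf0]
    | succ j ih =>
      intro hj
      obtain ⟨ih1, ih2, ih3⟩ := ih (by omega)
      obtain ⟨s, hs, hfs⟩ := hf ⟨j, hj⟩ (Nat.zero_le _)
      simp only at hs hfs
      rw [← rwChain_activeOnly] at hs
      obtain ⟨s1, -, s3, s4, -, s6, s7⟩ := hs.spec (hact _) (by simp)
      simp only [reduceCtorEq, false_or, ne_eq, not_false_eq_true, true_implies] at s3 s6 s7
      have hclose : ∀ b, (⟨none, fun _ => false, (f j).1, (f j).2⟩ : RWMemory m r k).close b =
          (f j).2 b := fun b => rfl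
      simp only [hclose] at s7
      rw [hfs]
      have old : ∀ n : Fin m, n.val < j → ∀ b, ofBlock b (activeOnly (events w n)) ≠ [] →
          ofBlock b (activeOnly (events w ⟨j, hj⟩)) = [] := by
        intro n hn b hb
        by_contra hne
        obtain ⟨β, β', h1, -⟩ := (ih3 n hn).2.2 b hb
        rw [s3 b hne] at h1
        cases h1
      refine ⟨?_, ?_, ?_⟩
      · intro b
        by_cases hb : ofBlock b (activeOnly (events w ⟨j, hj⟩)) = []
        · simp only [(s7 b hb).1]
          exact (ih1 b).imp_right fun ⟨n, hn, hne⟩ => ⟨n, by omega, hne⟩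
        · exact Or.inr ⟨⟨j, hj⟩, Nat.lt_succ_self j, hb⟩
      · intro b
        by_cases hb : ofBlock b (activeOnly (events w ⟨j, hj⟩)) = []
        · simp only [(s7 b hb).2]
          exact (ih2 b).imp_right fun ⟨n, hn, hne⟩ => ⟨n, by omega, hne⟩
        · exact Or.inr ⟨⟨j, hj⟩, Nat.lt_succ_self j, hb⟩
      · intro n hn
        rcases (Nat.lt_succ_iff.1 hn).eq_or_lt with hn | hn
        · have hn' : n = ⟨j, hj⟩ := Fin.ext hn
          subst hn'
          refine ⟨s1, ?_, fun b hb => ?_⟩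
          · intro n' hn' b hb hb'
            rcases (Nat.lt_succ_iff.1 hn').eq_or_lt with hn' | hn'
            · exact Fin.ext hn'.symm
            · exact absurd (old n' hn' b hb') hb
          · obtain ⟨β, β', h1, h2, h3⟩ := s6 b hb
            exact ⟨β, β', h1, h3, h2⟩
        · obtain ⟨j1, j2, j3⟩ := ih3 n hn
          refine ⟨j1, ?_, fun b hb => ?_⟩
          · intro n' hn' b hb hb'
            rcases (Nat.lt_succ_iff.1 hn').eq_or_lt with hn' | hn'
            · have hn'' : n' = ⟨j, hj⟩ := Fin.ext hn'
              subst hn''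
              exact absurd (old n hn b hb) hb'
            · exact j2 n' hn' b hb hb'
          · obtain ⟨β, β', h1, h2, h3⟩ := j3 b hb
            have h4 := old n hn b hb
            refine ⟨β, β', ?_, ?_, h3⟩
            · simp only [(s7 b h4).1, h1]
            · simp only [(s7 b h4).2, h2]
  obtain ⟨k1, k2, k3⟩ := key m le_rfl
  refine ⟨fun b => ((f m).1 b).getD fun _ => false, fun b => ((f m).2 b).getD fun _ => false, ?_⟩
  refine ⟨fun n => (k3 n n.isLt).1, fun n n' b h h' => (k3 n n.isLt).2.1 n' n'.isLt b h h', ?_, ?_⟩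
  · intro n b hb
    obtain ⟨β, β', h1, h2, h3⟩ := (k3 n n.isLt).2.2 b hb
    rw [h1, h2]
    exact h3
  · intro n b hb
    obtain ⟨β, β', h1, h2, h3⟩ := (k3 n n.isLt).2.2 b hb
    rw [h1]
    refine (hd b β h1).imp_right ?_
    rintro ⟨b', hb', hg⟩
    have h4 := k2 b'
    rw [hg] at h4
    obtain ⟨n', hn', hne⟩ := h4.resolve_left (by simp)
    exact ⟨b', n', hb', hne, by rw [hg]⟩

/-- A list of events whose blocks are consistent can be processed. -/
theorem exists_rwChain {V V' : Fin (blockBound m r k) → Valuation k} (s : RWMemory m r k)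
    (hl : ∀ ev ∈ l, ev.cell.block ≠ none) (hsort : BlocksSorted l)
    (hle : ∀ ev ∈ l, ∀ b b', s.block = some b → ev.cell.block = some b' → b ≤ b')
    (hcur : ∀ b, s.block = some b → OpsChain s.val (ofBlock b l) (V' b))
    (hfresh : ∀ b, s.block ≠ some b → ofBlock b l ≠ [] → s.assumption b = none ∧
      OpsChain (V b) (ofBlock b l) (V' b)) :
    ∃ s', RWChain s l s' ∧
      (∀ b, (s.block ≠ some b ∧ ofBlock b l ≠ [] → s'.assumption b = some (V b)) ∧
        (¬(s.block ≠ some b ∧ ofBlock b l ≠ []) → s'.assumption b = s.assumption b)) ∧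
      ∀ b, (s.block = some b ∨ ofBlock b l ≠ [] → s'.close b = some (V' b)) ∧
        (¬(s.block = some b ∨ ofBlock b l ≠ []) → s'.close b = s.close b) := by
  induction l generalizing s with
  | nil =>
    refine ⟨s, rfl, fun b => ⟨fun h => absurd rfl h.2, fun _ => rfl⟩, fun b => ⟨fun h => ?_,
      fun _ => rfl⟩⟩
    have hb := h.resolve_right fun h => h rfl
    have h1 : s.val = V' b := hcur b hb
    rw [RWMemory.close_of_eq hb, h1]
  | cons ev l ih =>
    have hl' : ∀ ev ∈ l, ev.cell.block ≠ none := fun e he => hl e (List.mem_cons_of_mem _ he)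
    obtain ⟨hsort1, hsort2⟩ := List.pairwise_cons.1 hsort
    obtain ⟨b, hb⟩ := Option.ne_none_iff_exists'.1 (hl ev (by simp))
    have hne : ∀ b', b' ≠ b → ofBlock b' (ev :: l) = ofBlock b' l := fun b' hb' =>
      ofBlock_cons_of_ne (by rw [hb]; simpa using hb'.symm)
    have heq : ofBlock b (ev :: l) = ev :: ofBlock b l := ofBlock_cons_of_eq hb
    by_cases hsb : s.block = some b
    · have h1 := hcur b hsb
      rw [heq] at h1
      obtain ⟨β', hop, h1⟩ := h1
      obtain ⟨s', i1, i2, i3⟩ := ih { s with val := β' } hl' hsort2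
        (fun e he => hle e (List.mem_cons_of_mem _ he))
        (by
          intro b' hb'
          rw [hsb, Option.some.injEq] at hb'
          subst hb'
          exact h1)
        (by
          intro b' hb' hb''
          have hbb : b' ≠ b := by
            rintro rfl
            exact hb' hsb
          rw [← hne b' hbb] at hb'' ⊢
          exact hfresh b' hb' hb'')
      refine ⟨s', ⟨_, .continue s b β' hb hsb hop, i1⟩, fun b' => ?_, fun b' => ?_⟩
      · by_cases hbb : b' = b
        · subst hbb
          have h2 := i2 b'
          simp only [hsb, ne_eq, not_true_eq_false, false_and, false_implies, not_false_eq_true,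
            true_implies, true_and] at h2 ⊢
          exact h2
        · rw [hne b' hbb]
          exact i2 b'
      · by_cases hbb : b' = b
        · subst hbb
          have h2 := i3 b'
          simp only [hsb, true_or, true_implies, not_true_eq_false, false_implies, and_true] at h2 ⊢
          exact h2
        · rw [hne b' hbb]
          refine ⟨(i3 b').1, fun h => ?_⟩
          rw [(i3 b').2 h, RWMemory.close_of_ne (s := s) fun h' => h (Or.inl h')]
          exact RWMemory.close_of_ne fun h' => h (Or.inl h')
    · obtain ⟨hnone, h1⟩ := hfresh b hsb (by rw [heq]; simp)
      rw [heq] at h1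
      obtain ⟨β', hop, h1⟩ := h1
      obtain ⟨s', i1, i2, i3⟩ := ih ⟨some b, β', Function.update s.assumption b (some (V b)),
        s.close⟩
        hl' hsort2
        (by
          intro e he b₁ b₂ hb₁ hb₂
          simp only [Option.some.injEq] at hb₁
          subst hb₁
          exact hsort1 e he _ _ hb hb₂)
        (by
          intro b' hb'
          simp only [Option.some.injEq] at hb'
          subst hb'
          exact h1)
        (by
          intro b' hb' hb''
          have hbb : b' ≠ b := by
            rintro rfl
            exact hb' rfl
          by_cases hsb' : s.block = some b'
          · obtain ⟨e, he, heb⟩ := ofBlock_ne_nil.1 hb''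
            exact absurd (le_antisymm (hle ev (by simp) _ _ hsb' hb) (hsort1 e he _ _ hb heb)) hbb
          · rw [← hne b' hbb] at hb'' ⊢
            obtain ⟨h2, h3⟩ := hfresh b' hsb' hb''
            exact ⟨(Function.update_of_ne hbb _ _).trans h2, h3⟩)
      simp only [Option.some.injEq] at i2 i3
      have hlt : ∀ b', s.block = some b' → b' < b := fun b' hb' =>
        lt_of_le_of_ne (hle ev (by simp) _ _ hb' hb) (by rintro rfl; exact hsb hb')
      refine ⟨s', ⟨_, .new s b (V b) β' hb hlt hnone hop, i1⟩, fun b' => ?_, fun b' => ?_⟩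
      · by_cases hbb : b' = b
        · subst hbb
          have h2 := (i2 b').2 (by simp)
          rw [heq]
          refine ⟨fun _ => by rw [h2]; simp, fun h => absurd ⟨hsb, by simp⟩ h⟩
        · rw [hne b' hbb]
          refine ⟨fun h => (i2 b').1 ⟨by simpa using Ne.symm hbb, h.2⟩, fun h => ?_⟩
          have h4 : ofBlock b' l = [] := by
            by_contra h4
            by_cases hsb' : s.block = some b'
            · obtain ⟨e, he, heb⟩ := ofBlock_ne_nil.1 h4
              exact absurd (le_antisymm (hle ev (by simp) _ _ hsb' hb) (hsort1 e he _ _ hb heb)) hbb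
            · exact h ⟨hsb', h4⟩
          rw [(i2 b').2 fun h5 => h5.2 h4, Function.update_of_ne hbb]
      · by_cases hbb : b' = b
        · subst hbb
          rw [heq]
          exact ⟨fun _ => (i3 b').1 (Or.inl rfl), fun h => absurd (Or.inr (by simp)) h⟩
        · rw [hne b' hbb]
          have hupd : (⟨some b, β', Function.update s.assumption b (some (V b)), s.close⟩ :
              RWMemory m r k).close b' = s.close b' :=
            RWMemory.close_of_ne (by simpa using Ne.symm hbb)
          by_cases h4 : ofBlock b' l = []
          · have h5 := (i3 b').2 (by
              rintro (h6 | h6)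
              · exact hbb h6.symm
              · exact h6 h4)
            rw [hupd] at h5
            refine ⟨fun h => ?_, fun _ => h5⟩
            have hsb' := h.resolve_right fun h => h h4
            have h6 := hcur b' hsb'
            rw [hne b' hbb, h4] at h6
            have h7 : s.val = V' b' := h6
            rw [h5, RWMemory.close_of_eq hsb', h7]
          · exact ⟨fun _ => (i3 b').1 (Or.inr h4), fun h => absurd (Or.inr h4) h⟩

theorem BlocksConsistent.rwRest {w : List (Letter A Q m r k)}
    {V V' : Fin (blockBound m r k) → Valuation k}
    (h : BlocksConsistent (fun n => activeOnly (events w n)) V V') :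
    RWRest w 0 (fun _ => none) (fun _ => none) := by
  classical
  let occ : ℕ → Fin (blockBound m r k) → Prop := fun j b =>
    ∃ n : Fin m, n.val < j ∧ ofBlock b (activeOnly (events w n)) ≠ []
  refine ⟨fun j => (fun b => if occ j b then some (V b) else none,
    fun b => if occ j b then some (V' b) else none), ?_, fun n _ => ?_, ?_⟩
  · simp [occ]
  · obtain ⟨s', h1, h2, h3⟩ := exists_rwChain (V := V) (V' := V') (l := activeOnly (events w n))
      ⟨none, fun _ => false, fun b => if occ n b then some (V b) else none,
        fun b => if occ n b then some (V' b) else none⟩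
      (fun ev hev => Option.isSome_iff_ne_none.1 (List.mem_filter.1 hev).2) (h.sorted n)
      (by simp) (by simp) (by
        intro b _ hb
        refine ⟨if_neg ?_, h.ops n b hb⟩
        rintro ⟨n', hn', hb'⟩
        rw [h.owner n' n b hb' hb] at hn'
        exact lt_irrefl _ hn')
    rw [rwChain_activeOnly] at h1
    refine ⟨s', h1, ?_⟩
    have hocc : ∀ b, occ (n + 1) b ↔ ofBlock b (activeOnly (events w n)) ≠ [] ∨ occ n b := by
      intro b
      constructor
      · rintro ⟨n', hn', hb⟩
        rcases (Nat.lt_succ_iff.1 hn').eq_or_lt with h4 | h4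
        · rw [Fin.ext h4] at hb
          exact Or.inl hb
        · exact Or.inr ⟨n', h4, hb⟩
      · rintro (hb | ⟨n', hn', hb⟩)
        · exact ⟨n, Nat.lt_succ_self _, hb⟩
        · exact ⟨n', by omega, hb⟩
    simp only [reduceCtorEq, ne_eq, not_false_eq_true, true_and, false_or] at h2 h3
    refine Prod.ext (funext fun b => ?_) (funext fun b => ?_)
    · simp only [hocc]
      by_cases hb : ofBlock b (activeOnly (events w n)) = []
      · rw [(h2 b).2 (by simpa using hb)]
        simp [hb]
      · rw [(h2 b).1 hb]
        simp [hb]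
    · simp only [hocc]
      by_cases hb : ofBlock b (activeOnly (events w n)) = []
      · rw [(h3 b).2 (by simpa using hb)]
        simp [hb, RWMemory.close]
      · rw [(h3 b).1 hb]
        simp [hb]
  · intro b β hβ
    simp only at hβ ⊢
    split_ifs at hβ with hb
    obtain ⟨n, -, hb⟩ := hb
    simp only [Option.some.injEq] at hβ
    subst hβ
    refine (h.discharged n b hb).imp_right ?_
    rintro ⟨b', n', hb', hne, hV⟩
    exact ⟨b', hb', by rw [if_pos ⟨n', n'.isLt, hne⟩, hV]⟩

end Blocks

/-! ### Runs -/

/-- A configuration given by the node and the state of every machine. -/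
structure FConfig (N Q : Type*) (m : ℕ) where
  loc : Fin m → N
  st : Fin m → Q
  β : N → Bool

/-- Machine `n` moves along the edge `e`. -/
def FStep {A Q : Type*} {m : ℕ} {G : Graph (A × Dir)} (M : Machine A Q) (κ : G.Node → Bool)
    (n : Fin m) (e : G.Node × G.Node × (A × Dir)) (a b : FConfig G.Node Q m) : Prop :=
  open Classical in
  e ∈ G.edges ∧ a.loc n = e.1 ∧ ∃ (q' : Q) (b' : Bool),
    (κ e.1 = true → (a.st n, e.2.2, a.β e.1, q', b') ∈ M.δ) ∧
    (κ e.1 = false → b' = false ∧ (a.st n, e.2.2, false, q', false) ∈ M.δ) ∧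
    b = ⟨Function.update a.loc n e.2.1, Function.update a.st n q', Function.update a.β e.1 b'⟩

/-- The system of machines as an automaton that reads moves. -/
def moveNFA {A Q : Type*} (m : ℕ) {G : Graph (A × Dir)} (M : Machine A Q) (κ : G.Node → Bool) :
    NFA (Fin m × G.Node × G.Node × (A × Dir)) (FConfig G.Node Q m) where
  step a x := {b | FStep M κ x.1 x.2 a b}
  start := {⟨fun _ => G.source, fun _ => M.start, fun _ => false⟩}
  accept := Set.univ

/-- The directions in which machine `n` moves. -/
def moveDirs {A N : Type*} {m : ℕ} (tr : List (Fin m × N × N × (A × Dir))) (n : Fin m) : List Dir :=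
  (tr.filter fun x => x.1 = n).map fun x => x.2.2.2.2

section Config

variable {A Q : Type*} {m : ℕ} {G : Graph (A × Dir)} {M : Machine A Q} {κ : G.Node → Bool}

/-- The configuration in which machine `n` is at `a.loc n` in state `a.st n`. -/
def FConfig.toConfig (a : FConfig G.Node Q m) : Config Q m G where
  μ x := {y | a.loc y.1 = x ∧ a.st y.1 = y.2}
  β := a.β
  located n := ⟨(a.loc n, a.st n), ⟨rfl, rfl⟩, fun _ hx => Prod.ext hx.1.symm hx.2.symm⟩

theorem Config.exists_fConfig (γ : Config Q m G) : ∃ a : FConfig G.Node Q m, γ = a.toConfig := by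
  choose f hf hf' using γ.located
  refine ⟨⟨fun n => (f n).1, fun n => (f n).2, γ.β⟩, ?_⟩
  obtain ⟨μ, β, hl⟩ := γ
  have hμ : μ = fun x => {y | (f y.1).1 = x ∧ (f y.1).2 = y.2} := by
    funext x
    ext ⟨n, q⟩
    constructor
    · intro h
      have h1 := hf' n (x, q) h
      exact ⟨(congrArg Prod.fst h1).symm, (congrArg Prod.snd h1).symm⟩
    · rintro ⟨h1, h2⟩
      have h3 := hf n
      simp only at h1 h2 h3
      rw [h1, h2] at h3
      exact h3
  simp only [FConfig.toConfig]
  congr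

theorem FStep.step {n : Fin m} {e : G.Node × G.Node × (A × Dir)} {a b : FConfig G.Node Q m}
    (h : FStep M κ n e a b) (he : e.1 ≠ e.2.1) : Step M κ n e a.toConfig b.toConfig := by
  classical
  obtain ⟨h1, h2, q', b', h3, h4, rfl⟩ := h
  refine ⟨h1, a.st n, q', b', ⟨h2, rfl⟩, h3, h4, ?_, ?_, ?_, ?_, ?_⟩
  · ext ⟨j, q⟩
    simp only [FConfig.toConfig, Set.mem_ofPred_eq, Set.mem_sdiff, Set.mem_singleton_iff,
      Prod.mk.injEq]
    by_cases hj : j = n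
    · subst hj
      simp only [Function.update_self, true_and]
      constructor
      · exact fun h => absurd h.1.symm he
      · exact fun h => absurd h.1.2.symm h.2
    · simp [hj]
  · ext ⟨j, q⟩
    simp only [FConfig.toConfig, Set.mem_ofPred_eq, Set.mem_union, Set.mem_singleton_iff,
      Prod.mk.injEq]
    by_cases hj : j = n
    · subst hj
      simp only [Function.update_self, true_and, h2]
      constructor
      · exact fun h => Or.inr h.symm
      · rintro (h | h)
        · exact absurd h.1 he
        · exact h.symm
    · simp [hj]
  · intro x hx hx'
    ext ⟨j, q⟩
    simp only [FConfig.toConfig, Set.mem_ofPred_eq]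
    by_cases hj : j = n
    · subst hj
      simp only [Function.update_self, h2]
      exact iff_of_false (fun h => hx' h.1.symm) fun h => hx h.1.symm
    · simp [Function.update_of_ne hj]
  · exact Function.update_self e.1 b' a.β
  · exact fun x hx => Function.update_of_ne (f := a.β) hx _

theorem exists_fStep_of_step {n : Fin m} {e : G.Node × G.Node × (A × Dir)} {a : FConfig G.Node Q m}
    {γ : Config Q m G} (h : Step M κ n e a.toConfig γ) :
    ∃ b, FStep M κ n e a b ∧ γ = b.toConfig := by
  classical
  obtain ⟨h1, q, q', b', h2, h3, h4, h5, h6, h7, h8, h9⟩ := h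
  obtain ⟨h2, hq⟩ := h2
  simp only at h2 hq
  subst hq
  obtain ⟨b, rfl⟩ := γ.exists_fConfig
  refine ⟨b, ⟨h1, h2, q', b', h3, h4, ?_⟩, rfl⟩
  have hn : b.loc n = e.2.1 ∧ b.st n = q' := by
    have : (n, q') ∈ b.toConfig.μ e.2.1 := by
      rw [h6]
      exact Or.inr rfl
    exact this
  have hj : ∀ j, j ≠ n → b.loc j = a.loc j ∧ b.st j = a.st j := by
    intro j hj
    have ha : (j, a.st j) ∈ a.toConfig.μ (a.loc j) := ⟨rfl, rfl⟩
    have : (j, a.st j) ∈ b.toConfig.μ (a.loc j) := by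
      by_cases hx : a.loc j = e.1
      · rw [hx] at ha ⊢
        rw [h5]
        refine ⟨ha, fun h => hj ?_⟩
        exact congrArg Prod.fst (Set.mem_singleton_iff.1 h)
      · by_cases hx' : a.loc j = e.2.1
        · rw [hx'] at ha ⊢
          rw [h6]
          exact Or.inl ha
        · rw [h7 _ hx hx']
          exact ha
    exact this
  obtain ⟨l, s, β⟩ := b
  simp only at hn hj
  have e1 : l = Function.update a.loc n e.2.1 := by
    funext j
    by_cases hjn : j = n
    · rw [hjn, Function.update_self]
      exact hn.1
    · rw [Function.update_of_ne hjn]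
      exact (hj j hjn).1
  have e2 : s = Function.update a.st n q' := by
    funext j
    by_cases hjn : j = n
    · rw [hjn, Function.update_self]
      exact hn.2
    · rw [Function.update_of_ne hjn]
      exact (hj j hjn).2
  have e3 : β = Function.update a.β e.1 b' := by
    funext x
    by_cases hx : x = e.1
    · rw [hx, Function.update_self]
      exact h8
    · rw [Function.update_of_ne hx]
      exact h9 x hx
  rw [e1, e2, e3]

theorem initial_toConfig {a : FConfig G.Node Q m} :
    a.toConfig.IsInitial M ↔ a ∈ (moveNFA m M κ).start := by
  constructor
  · rintro ⟨h1, -, h3⟩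
    have key : ∀ n, a.loc n = G.source ∧ a.st n = M.start := by
      intro n
      have h4 : (n, M.start) ∈ a.toConfig.μ G.source := by
        rw [h1]
        rfl
      exact h4
    obtain ⟨l, s, β⟩ := a
    have e1 : l = fun _ => G.source := funext fun n => (key n).1
    have e2 : s = fun _ => M.start := funext fun n => (key n).2
    have e3 : β = fun _ => false := funext h3
    rw [e1, e2, e3]
    rfl
  · intro ha
    rw [Set.mem_singleton_iff.1 ha]
    refine ⟨?_, ?_, fun _ => rfl⟩
    · ext ⟨n, q⟩
      exact ⟨fun h => h.2.symm, fun h => ⟨rfl, Eq.symm h⟩⟩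
    · intro x hx
      ext ⟨n, q⟩
      exact iff_of_false (fun h => hx h.1.symm) id

theorem reversals_cons_cons (d d' : Dir) (l : List Dir) :
    reversals (d :: d' :: l) = (open Classical in if d ≠ d' then 1 else 0) + reversals
      (d' :: l) := by
  classical
  simp only [reversals, List.tail_cons, List.zip_cons_cons, List.countP_cons]
  rw [add_comm]
  congr 1
  simp

/-- Every list of moves comes from a run. -/
theorem exists_run {tr : List (Fin m × G.Node × G.Node × (A × Dir))} {a b : FConfig G.Node Q m}
    (ha : a ∈ (moveNFA m M κ).start) (h : NRun (moveNFA m M κ) a tr b)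
    (hne : ∀ e ∈ G.edges, e.1 ≠ e.2.1) :
    ∃ ρ : Run M m G κ, ρ.config (Fin.last ρ.length) = b.toConfig ∧
      ∀ n, ρ.directions n = moveDirs tr n := by
  obtain ⟨c, h0, h1, hstep⟩ := h.exists_states
  have hs : ∀ l : Fin tr.length, FStep M κ (tr.get l).1 (tr.get l).2 (c l) (c (l + 1)) := fun l =>
    hstep l _ (List.getElem?_eq_getElem l.isLt)
  refine ⟨⟨tr.length, fun l => (c l).toConfig, fun l => (tr.get l).1, fun l => (tr.get l).2, ?_,
    fun l => (hs l).step (hne _ (hs l).1)⟩, ?_, ?_⟩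
  · change (c 0).toConfig.IsInitial M
    rw [h0]
    exact initial_toConfig.2 ha
  · simp [h1]
  · intro n
    simp only [Run.directions, moveDirs]
    conv_rhs => rw [← List.map_get_finRange tr, List.filter_map, List.map_map]
    rfl

theorem reversals_le_append (l l' : List Dir) : reversals l ≤ reversals (l ++ l') := by
  classical
  induction l with
  | nil => simp [reversals]
  | cons d l ih =>
    rcases l with _ | ⟨d', l⟩
    · simp [reversals]
    · rw [List.cons_append, List.cons_append, reversals_cons_cons, reversals_cons_cons]
      exact Nat.add_le_add_left ih _

/-- The moves of a run up to some configuration. -/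
theorem exists_moves_of_run (ρ : Run M m G κ) (i : Fin (ρ.length + 1))
    {r : ℕ} (hr : ρ.ReversalBounded r) :
    ∃ a ∈ (moveNFA m M κ).start, ∃ tr b, NRun (moveNFA m M κ) a tr b ∧ ρ.config i = b.toConfig ∧
      ∀ n, reversals (moveDirs tr n) ≤ r := by
  obtain ⟨a, ha⟩ := (ρ.config 0).exists_fConfig
  have hinit := ρ.init
  rw [ha] at hinit
  have key : ∀ (i : ℕ) (hi : i < ρ.length + 1), ∃ b, NRun (moveNFA m M κ) a
      (((List.finRange ρ.length).take i).map fun l => (ρ.mover l, ρ.edge l)) b ∧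
      ρ.config ⟨i, hi⟩ = b.toConfig := by
    intro i
    induction i with
    | zero => exact fun _ => ⟨a, rfl, ha⟩
    | succ i ih =>
      intro hi
      obtain ⟨b, h1, h2⟩ := ih (by omega)
      have h3 := ρ.step ⟨i, by omega⟩
      have h4 : (⟨i, by omega⟩ : Fin ρ.length).castSucc = ⟨i, by omega⟩ := rfl
      rw [h4, h2] at h3
      obtain ⟨b', h5, h6⟩ := exists_fStep_of_step h3
      refine ⟨b', ?_, h6⟩
      rw [List.take_add_one, List.getElem?_eq_getElem (by simp; omega), List.map_append,
        nRun_append]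
      rw [List.getElem_finRange]
      exact ⟨b, h1, b', h5, rfl⟩
  obtain ⟨b, h1, h2⟩ := key i i.isLt
  refine ⟨a, initial_toConfig.1 hinit, _, b, h1, h2, fun n => le_trans ?_ (hr n)⟩
  have h3 : ρ.directions n =
      moveDirs (((List.finRange ρ.length).take i).map fun l => (ρ.mover l, ρ.edge l)) n ++
      moveDirs (((List.finRange ρ.length).drop i).map fun l => (ρ.mover l, ρ.edge l)) n := by
    rw [moveDirs, moveDirs, ← List.map_append, ← List.filter_append, ← List.map_append,
      List.take_append_drop, List.filter_map, List.map_map]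
    rfl
  rw [h3]
  exact reversals_le_append _ _

/-- A machine that follows its paths one after the other turns at most `r` times. -/
theorem reversals_segDir_le {r : ℕ} (l : List (Fin (r + 1))) (hl : l.Pairwise (· ≤ ·)) :
    reversals (l.map segDir) ≤ r := by
  classical
  have key : ∀ (l : List (Fin (r + 1))) (h : Fin (r + 1)), (h :: l).Pairwise (· ≤ ·) →
      reversals ((h :: l).map segDir) + h ≤ r := by
    intro l
    induction l with
    | nil =>
      intro h _
      have := h.isLt
      simp only [reversals, List.map_cons, List.map_nil, List.tail_cons, List.zip_nil_right,
        List.countP_nil]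
      omega
    | cons h' l ih =>
      intro h hl
      obtain ⟨h1, h2⟩ := List.pairwise_cons.1 hl
      have h3 := ih h' h2
      have h4 : h ≤ h' := h1 h' (by simp)
      rw [List.map_cons, List.map_cons, reversals_cons_cons]
      rw [List.map_cons] at h3
      have h5 : (if segDir h ≠ segDir h' then 1 else 0) + h.val ≤ h'.val := by
        split_ifs with h5
        · have h6 : h.val ≠ h'.val := fun h6 => h5 (by rw [Fin.ext h6])
          have : h.val ≤ h'.val := h4
          omega
        · simpa using h4
      omega
  cases l with
  | nil => simp [reversals]
  | cons h l => exact (Nat.le_add_right _ _).trans (key l h hl)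

end Config

/-! ### From accepted words to runs -/

/-- The events of machine `n` in a list of events of all machines. -/
def eventsOf {A Q : Type*} {m r k : ℕ} (l : List (Fin m × Event A Q m r k)) (n : Fin m) :
    List (Event A Q m r k) :=
  (l.filter fun x => x.1 = n).map Prod.snd

section Sound

variable {A Q : Type*} {m r k : ℕ} {H : Graph A} {M : Machine A Q} {w : List (Letter A Q m r k)}
  {id : H.Node → Option (Fin k)} {loc : ℕ → Row m r → H.Node}

theorem eventsOf_cons_self (n : Fin m) (ev : Event A Q m r k) (l : List (Fin m × Event A Q m r k)) :
    eventsOf ((n, ev) :: l) n = ev :: eventsOf l n := by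
  rw [eventsOf, List.filter_cons_of_pos (by simp)]
  rfl

theorem eventsOf_cons_of_ne {n n' : Fin m} (h : n ≠ n') (ev : Event A Q m r k)
    (l : List (Fin m × Event A Q m r k)) : eventsOf ((n, ev) :: l) n' = eventsOf l n' := by
  rw [eventsOf, List.filter_cons_of_neg (by simpa using h)]
  rfl

theorem moveDirs_append {N : Type*} (tr tr' : List (Fin m × N × N × (A × Dir))) (n : Fin m) :
    moveDirs (tr ++ tr') n = moveDirs tr n ++ moveDirs tr' n := by
  simp [moveDirs]

/-- An event is simulated by at most one move. -/
theorem exists_move (hT : IsTrace {e | e ∈ H.edges} H.source id (w.map Prod.fst) loc)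
    (n : Fin m) {ev : Event A Q m r k} {e : ExecLetter Q m r k} (hev : w[ev.pos]? = some
      (ev.letter, e))
    {a : FConfig H.Node Q m} {i : Row m r}
    (ha : loc ev.gapBefore i = a.loc n) (hp : Processes M (segDir ev.path) ev.letter i
      (a.st n) ev.cell)
    {V V' : Valuation k} (hop : Operates (segDir ev.path) ev.letter ev.cell V V')
    (hβ : ∀ x, a.β x = match id x with
      | some j => V j
      | none => false) :
    ∃ tr b, NRun (moveNFA m (G := H.symmClosure) M fun x => (id x).isSome) a tr b ∧
      (b.loc n = loc ev.gapAfter ev.cell.row ∧ b.st n = ev.cell.state) ∧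
      (∀ n', n' ≠ n → b.loc n' = a.loc n' ∧ b.st n' = a.st n' ∧ moveDirs tr n' = []) ∧
      (∀ x, b.β x = match id x with
        | some j => V' j
        | none => false) ∧
      (moveDirs tr n = [] ∨ moveDirs tr n = [segDir ev.path]) := by
  classical
  have hW : (w.map Prod.fst)[ev.pos]? = some ev.letter := by
    rw [List.getElem?_map, hev]
    rfl
  obtain ⟨h, p, x, c⟩ := ev
  simp only at hW hp hop ⊢
  cases x with
  | node idx =>
    obtain ⟨h1, h2⟩ := hp
    have h3 : V' = V := hop
    subst h3
    refine ⟨[], a, rfl, ⟨?_, h2.symm⟩, fun n' _ => ⟨rfl, rfl, rfl⟩, hβ, Or.inl rfl⟩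
    rw [← ha]
    have h4 := hT.node p idx hW
    simp only [Event.gapBefore, Event.gapAfter]
    cases segDir h
    · simp only
      rw [(h4 c.row).1, (h4 c.row).2 i h1]
    · simp only
      rw [(h4 i).1, (h4 c.row).2 i h1]
  | edge f =>
    obtain ⟨rfl, h2⟩ := hp
    cases hsym : (f c.row).sym with
    | none =>
      simp only [hsym] at h2
      have h3 : V' = V := by
        simp only [Operates, hsym] at hop
        exact hop
      subst h3
      refine ⟨[], a, rfl, ⟨?_, h2.symm⟩, fun n' _ => ⟨rfl, rfl, rfl⟩, hβ, Or.inl rfl⟩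
      rw [← ha]
      have h4 := hT.pad p f c.row hW hsym
      simp only [Event.gapBefore, Event.gapAfter]
      cases segDir h
      · exact h4.symm
      · exact h4
    | some σ =>
      simp only [hsym] at h2
      obtain ⟨h2, h3⟩ := h2
      obtain ⟨h4, h5, h6⟩ := hT.edge p f c.row σ hW hsym
      set g := (⟨h, p, .edge f, c⟩ : Event A Q m r k).gapBefore with hg
      set g' := (⟨h, p, .edge f, c⟩ : Event A Q m r k).gapAfter with hg'
      have hedge : (loc g c.row, loc g' c.row, (σ, segDir h)) ∈ H.symmClosure.edges := by
        refine Multiset.mem_add.2 ?_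
        simp only [hg, hg', Event.gapBefore, Event.gapAfter]
        cases segDir h
        · exact Or.inl (Multiset.mem_map.2 ⟨_, h4, rfl⟩)
        · exact Or.inr (Multiset.mem_map.2 ⟨_, h4, rfl⟩)
      have hreg : (f c.row).reg (segDir h) = id (loc g c.row) := by
        simp only [hg, Event.gapBefore, TraceCell.reg]
        cases segDir h
        · exact h5
        · exact h6
      have hβg := hβ (loc g c.row)
      simp only [Operates, hsym, hreg] at hop
      rw [hreg] at h3
      refine ⟨[(n, loc g c.row, loc g' c.row, (σ, segDir h))],
        ⟨Function.update a.loc n (loc g' c.row), Function.update a.st n c.state,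
          Function.update a.β (loc g c.row) c.write⟩,
        ⟨_, ⟨hedge, ha.symm, c.state, c.write, ?_, ?_, rfl⟩, rfl⟩,
        ⟨Function.update_self .., Function.update_self ..⟩, ?_, ?_, ?_⟩
      · intro hκ
        obtain ⟨j, hj⟩ := Option.isSome_iff_exists.1 hκ
        rw [hj] at hop hβg
        simp only at hop hβg ⊢
        rw [hβg, ← hop.1]
        exact h2
      · intro hκ
        have hj : id (loc g c.row) = none := Option.isNone_iff_eq_none.1 (by simpa using hκ)
        obtain ⟨h7, h8⟩ := h3 hj
        rw [h7, h8] at h2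
        exact ⟨h8, h2⟩
      · intro n' hn'
        refine ⟨Function.update_of_ne hn' .., Function.update_of_ne hn' .., ?_⟩
        simp [moveDirs, hn'.symm]
      · have key : ∀ x : H.Node, Function.update a.β (loc g c.row) c.write x = match id x with
            | some j => V' j
            | none => false := by
          intro x
          by_cases hx : x = loc g c.row
          · subst hx
            rw [Function.update_self]
            cases hj : id (loc g c.row) with
            | none => exact (h3 hj).2
            | some j =>
              rw [hj] at hop
              simp only at hop
              rw [hop.2]
              simp
          · rw [Function.update_of_ne hx, hβ x]
            cases hj : id x with
            | none => rfl
            | some j =>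
              cases hj' : id (loc g c.row) with
              | none =>
                rw [hj'] at hop
                simp only at hop
                rw [hop]
              | some j' =>
                rw [hj'] at hop
                simp only at hop
                have hne : j ≠ j' := by
                  rintro rfl
                  exact hx (hT.inj _ _ _ hj hj')
                simp only [hop.2, Function.update_of_ne hne]
        exact key
      · right
        simp [moveDirs]

/-- The machines can make the moves described by a list of their events. -/
theorem exists_moves (hT : IsTrace {e | e ∈ H.edges} H.source id (w.map Prod.fst) loc)
    {l : List (Fin m × Event A Q m r k)} (hl : ∀ x ∈ l, ∃ e, w[x.2.pos]? = some (x.2.letter, e))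
    {a : FConfig H.Node Q m} {y : Fin m → ℕ × Row m r × Q} {V V' : Valuation k}
    (htrack : ∀ n, ∃ g i, loc g i = a.loc n ∧ TrackChain M (g, i, a.st n) (eventsOf l n) (y n))
    (hops : OpsChain V (l.map Prod.snd) V')
    (hβ : ∀ x, a.β x = match id x with
      | some j => V j
      | none => false) :
    ∃ tr b, NRun (moveNFA m (G := H.symmClosure) M fun x => (id x).isSome) a tr b ∧
      (∀ n, b.loc n = loc (y n).1 (y n).2.1 ∧ b.st n = (y n).2.2) ∧
      ∀ n, ∃ hs : List (Fin (r + 1)), hs.Sublist ((eventsOf l n).map Event.path) ∧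
        moveDirs tr n = hs.map segDir := by
  induction l generalizing a V with
  | nil =>
    refine ⟨[], a, rfl, fun n => ?_, fun n => ⟨[], List.nil_sublist _, rfl⟩⟩
    obtain ⟨g, i, h1, h2⟩ := htrack n
    have h3 : (g, i, a.st n) = y n := h2
    rw [← h3]
    exact ⟨h1.symm, rfl⟩
  | cons x l ih =>
    obtain ⟨n, ev⟩ := x
    obtain ⟨e, hev⟩ := hl (n, ev) (by simp)
    obtain ⟨V₁, hop, hops⟩ := hops
    obtain ⟨g, i, h1, h2⟩ := htrack n
    rw [eventsOf_cons_self] at h2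
    obtain ⟨h3, h4, h5⟩ := h2
    simp only at h3
    subst h3
    obtain ⟨tr, b, k1, k2, k3, k4, k5⟩ := exists_move hT n hev h1 h4 hop hβ
    obtain ⟨tr', b', j1, j2, j3⟩ := ih (fun x hx => hl x (List.mem_cons_of_mem _ hx)) (a := b)
      (by
        intro n'
        by_cases hn : n' = n
        · subst hn
          refine ⟨_, _, k2.1.symm, ?_⟩
          rw [k2.2]
          exact h5
        · obtain ⟨g', i', h6, h7⟩ := htrack n'
          obtain ⟨e1, e2, -⟩ := k3 n' hn
          rw [eventsOf_cons_of_ne (Ne.symm hn)] at h7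
          exact ⟨g', i', by rw [e1]; exact h6, by rw [e2]; exact h7⟩) hops k4
    refine ⟨tr ++ tr', b', nRun_append.2 ⟨b, k1, j1⟩, j2, fun n' => ?_⟩
    obtain ⟨hs, h6, h7⟩ := j3 n'
    rw [moveDirs_append, h7]
    by_cases hn : n' = n
    · subst hn
      rw [eventsOf_cons_self]
      rcases k5 with k5 | k5
      · exact ⟨hs, h6.cons _, by rw [k5]; rfl⟩
      · exact ⟨ev.path :: hs, h6.cons_cons _, by rw [k5]; rfl⟩
    · rw [eventsOf_cons_of_ne (Ne.symm hn), (k3 n' hn).2.2]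
      exact ⟨hs, h6, rfl⟩

end Sound

/-! ### Interleaving of the blocks -/

theorem flatMap_eq_of_unique {α β : Type*} {l : List α} (hl : l.Nodup) {f : α → List β} {a : α}
    (ha : a ∈ l) (hf : ∀ b, b ≠ a → f b = []) : l.flatMap f = f a := by
  have hnil : ∀ l : List α, a ∉ l → l.flatMap f = [] := by
    intro l hl
    rw [List.flatMap_eq_nil_iff]
    intro b hb
    exact hf b (by rintro rfl; exact hl hb)
  obtain ⟨s, t, rfl⟩ := List.append_of_mem ha
  rw [List.nodup_append, List.nodup_cons] at hl
  have hs : a ∉ s := fun h => hl.2.2 a h a (by simp) rfl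
  rw [List.flatMap_append, List.flatMap_cons, hnil s hs, hnil t hl.2.1.1]
  simp

section Interleave

variable {A Q : Type*} {m r k : ℕ}

theorem flatMap_ofBlock {l : List (Event A Q m r k)} (hl : ∀ ev ∈ l, ev.cell.block ≠ none)
    (hs : BlocksSorted l) : (List.finRange (blockBound m r k)).flatMap (fun b => ofBlock b l) =
      l := by
  induction l with
  | nil => simp [ofBlock]
  | cons ev l ih =>
    obtain ⟨h1, h2⟩ := List.pairwise_cons.1 hs
    have ih := ih (fun e he => hl e (List.mem_cons_of_mem _ he)) h2
    obtain ⟨b, hb⟩ := Option.ne_none_iff_exists'.1 (hl ev (by simp))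
    obtain ⟨s, t, hst⟩ := List.append_of_mem (List.mem_finRange b)
    have hlt := List.pairwise_lt_finRange (blockBound m r k)
    rw [hst, List.pairwise_append, List.pairwise_cons] at hlt
    rw [hst, List.flatMap_append, List.flatMap_cons] at ih ⊢
    have hne : ∀ b', b' ≠ b → ofBlock b' (ev :: l) = ofBlock b' l := fun b' hb' =>
      ofBlock_cons_of_ne (by rw [hb]; simpa using hb'.symm)
    have hs1 : s.flatMap (fun b => ofBlock b (ev :: l)) = s.flatMap fun b => ofBlock b l :=
      List.flatMap_congr fun b' hb' => hne b' (hlt.2.2 b' hb' b (by simp)).ne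
    have hs2 : s.flatMap (fun b => ofBlock b l) = [] := by
      rw [List.flatMap_eq_nil_iff]
      intro b' hb'
      by_contra hcon
      obtain ⟨e, he, heb⟩ := ofBlock_ne_nil.1 hcon
      exact absurd (h1 e he _ _ hb heb) (not_le.2 (hlt.2.2 b' hb' b (by simp)))
    have ht : t.flatMap (fun b => ofBlock b (ev :: l)) = t.flatMap fun b => ofBlock b l :=
      List.flatMap_congr fun b' hb' => hne b' (hlt.2.1.1 b' hb').ne'
    rw [hs1, hs2, ht, ofBlock_cons_of_eq hb]
    rw [hs2] at ih
    conv_rhs => rw [← ih]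
    simp

theorem opsChain_append {l l' : List (Event A Q m r k)} {V V' : Valuation k} :
    OpsChain V (l ++ l') V' ↔ ∃ V₁, OpsChain V l V₁ ∧ OpsChain V₁ l' V' := by
  induction l generalizing V with
  | nil => simp [OpsChain]
  | cons ev l ih =>
    simp only [List.cons_append, OpsChain, ih]
    constructor
    · rintro ⟨s₁, h1, s₂, h2, h3⟩
      exact ⟨s₂, ⟨s₁, h1, h2⟩, h3⟩
    · rintro ⟨s₂, ⟨s₁, h1, h2⟩, h3⟩
      exact ⟨s₁, h1, s₂, h2, h3⟩

/-- If the blocks are consistent then the events can be ordered block by block. A block that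
occurs begins with the valuation at the end of the preceding one, which occurs too, and blocks that
do not occur contribute no events. -/
theorem BlocksConsistent.exists_interleaving {E : Fin m → List (Event A Q m r k)}
    {V V' : Fin (blockBound m r k) → Valuation k} (h : BlocksConsistent E V V')
    (hE : ∀ n, ∀ ev ∈ E n, ev.cell.block ≠ none) :
    ∃ l : List (Fin m × Event A Q m r k), (∀ n, eventsOf l n = E n) ∧
      ∃ U, OpsChain (fun _ => false) (l.map Prod.snd) U := by
  classical
  let part : Fin (blockBound m r k) → List (Fin m × Event A Q m r k) := fun b =>
    (List.finRange m).flatMap fun n => (ofBlock b (E n)).map (Prod.mk n)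
  refine ⟨(List.finRange (blockBound m r k)).flatMap part, fun n => ?_, ?_⟩
  · have h1 : ∀ b, eventsOf (part b) n = ofBlock b (E n) := by
      intro b
      have h2 : ∀ n', eventsOf ((ofBlock b (E n')).map (Prod.mk n')) n =
          if n' = n then ofBlock b (E n') else [] := by
        intro n'
        split_ifs with hn
        · rw [eventsOf, List.filter_eq_self.2 (by simp [hn]), List.map_map]
          exact List.map_id _
        · rw [eventsOf, List.filter_eq_nil_iff.2 (by simp [hn]), List.map_nil]
      have h3 : eventsOf (part b) n =
          (List.finRange m).flatMap fun n' => if n' = n then ofBlock b (E n') else [] := by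
        rw [eventsOf, List.filter_flatMap, List.map_flatMap]
        exact List.flatMap_congr fun n' _ => h2 n'
      rw [h3, flatMap_eq_of_unique (List.nodup_finRange m) (List.mem_finRange n)
        fun n' hn' => if_neg hn', if_pos rfl]
    rw [eventsOf, List.filter_flatMap, List.map_flatMap]
    conv_rhs => rw [← flatMap_ofBlock (hE n) (h.sorted n)]
    exact List.flatMap_congr fun b _ => h1 b
  · have hpart : ∀ b, (part b).map Prod.snd = (List.finRange m).flatMap fun n => ofBlock b
      (E n) := by
      intro b
      rw [List.map_flatMap]
      refine List.flatMap_congr fun n _ => ?_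
      rw [List.map_map]
      exact List.map_id _
    have hocc : ∀ b n, ofBlock b (E n) ≠ [] → (part b).map Prod.snd = ofBlock b (E n) := by
      intro b n hb
      rw [hpart b]
      refine flatMap_eq_of_unique (List.nodup_finRange m) (List.mem_finRange n) fun n' hn' => ?_
      by_contra hb'
      exact hn' (h.owner n' n b hb' hb)
    -- `U` is the valuation after the first `j` blocks; it is the assumption of block `j`, if it occurs.
    have key : ∀ j ≤ blockBound m r k, ∃ U,
        OpsChain (fun _ => false) ((((List.finRange (blockBound m r k)).take j).flatMap part).map
          Prod.snd) U ∧ ∀ b n, b.val = j → ofBlock b (E n) ≠ [] → V b = U := by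
      intro j
      induction j with
      | zero =>
        intro _
        refine ⟨_, rfl, fun b n hb hne => ?_⟩
        rcases h.discharged n b hne with h1 | ⟨b', n', h1, -⟩
        · exact h1.2
        · omega
      | succ j ih =>
        intro hj
        obtain ⟨U, h1, h2⟩ := ih (by omega)
        have htake : (List.finRange (blockBound m r k)).take (j + 1) =
            (List.finRange (blockBound m r k)).take j ++ [⟨j, hj⟩] := by
          rw [List.take_add_one, List.getElem?_eq_getElem (by simpa using hj)]
          simp
        rw [htake, List.flatMap_append, List.map_append]
        by_cases hb : ∃ n, ofBlock ⟨j, hj⟩ (E n) ≠ []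
        · obtain ⟨n, hb⟩ := hb
          refine ⟨V' ⟨j, hj⟩, opsChain_append.2 ⟨U, h1, ?_⟩, ?_⟩
          · rw [List.flatMap_singleton, hocc _ n hb, ← h2 ⟨j, hj⟩ n rfl hb]
            exact h.ops n _ hb
          · intro b n' hbj hne
            rcases h.discharged n' b hne with h3 | ⟨b', n'', h3, -, h4⟩
            · omega
            · have h5 : b' = ⟨j, hj⟩ := Fin.ext (by simp only; omega)
              rw [← h4, h5]
        · push Not at hb
          refine ⟨U, opsChain_append.2 ⟨U, h1, ?_⟩, ?_⟩
          · rw [List.flatMap_singleton, hpart, List.flatMap_eq_nil_iff.2 fun n _ => hb n]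
            rfl
          · intro b n' hbj hne
            rcases h.discharged n' b hne with h3 | ⟨b', n'', h3, h4, -⟩
            · omega
            · have h5 : b' = ⟨j, hj⟩ := Fin.ext (by simp only; omega)
              rw [h5] at h4
              exact absurd (hb n'') h4
    obtain ⟨U, hU, -⟩ := key _ le_rfl
    rw [List.take_of_length_le (by simp)] at hU
    exact ⟨U, hU⟩

end Interleave

/-! ### The automaton for configuration properties -/

section Property

variable {A Q : Type*} {m r k : ℕ}

theorem ConfigProp.Holds.mono {val val' : (Q → ℕ) → Prop} {F : ConfigProp Q} (h : F.Holds val)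
    (hv : ∀ S ∈ F.atoms, val S → val' S) : F.Holds val' := by
  induction F with
  | atom S => exact hv S (by simp [ConfigProp.atoms]) h
  | and F F' ih ih' =>
    exact ⟨ih h.1 fun S hS => hv S (List.mem_append_left _ hS),
      ih' h.2 fun S hS => hv S (List.mem_append_right _ hS)⟩
  | or F F' ih ih' =>
    exact h.imp (fun h => ih h fun S hS => hv S (List.mem_append_left _ hS))
      fun h => ih' h fun S hS => hv S (List.mem_append_right _ hS)

theorem nRun_propertyNFA {F : ConfigProp Q} (l : List (Marked (Letter A Q m r k)))
    (c : Marked (Letter A Q m r k)) (X : Set {S // S ∈ F.atoms}) :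
    ∃ c₁, ∀ s, NRun (propertyNFA A m r k F) (some (c, X)) l s ↔ s = some (c₁, X ∪
      {S | ∃ (i : ℕ) (c' c'' : Marked (Letter A Q m r k)), (c :: l)[i]? = some c' ∧
        (c :: l)[i + 1]? = some c'' ∧ NodeProperty S.1 c' c''}) := by
  induction l generalizing c X with
  | nil =>
    refine ⟨c, fun s => ?_⟩
    simp only [List.getElem?_cons_succ, List.getElem?_nil, reduceCtorEq, false_and, and_false,
      exists_false, Set.ofPred_false, Set.union_empty]
    exact eq_comm
  | cons a l ih =>
    obtain ⟨c₁, h⟩ := ih a (X ∪ {S | NodeProperty S.1 c a})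
    refine ⟨c₁, fun s => ?_⟩
    have h1 : NRun (propertyNFA A m r k F) (some (c, X)) (a :: l) s ↔
        NRun (propertyNFA A m r k F) (some (a, X ∪ {S | NodeProperty S.1 c a})) l s := by
      constructor
      · rintro ⟨s', hs', hs⟩
        rw [← Set.mem_singleton_iff.1 hs']
        exact hs
      · exact fun hs => ⟨_, rfl, hs⟩
    rw [h1, h, Set.union_assoc]
    have h2 : ({S | NodeProperty S.1 c a} : Set {S // S ∈ F.atoms}) ∪
        {S | ∃ (i : ℕ) (c' c'' : Marked (Letter A Q m r k)), (a :: l)[i]? = some c' ∧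
          (a :: l)[i + 1]? = some c'' ∧ NodeProperty S.1 c' c''} =
        {S | ∃ (i : ℕ) (c' c'' : Marked (Letter A Q m r k)), (c :: a :: l)[i]? = some c' ∧
          (c :: a :: l)[i + 1]? = some c'' ∧ NodeProperty S.1 c' c''} := by
      ext S
      constructor
      · rintro (hS | ⟨i, c', c'', h3, h4, h5⟩)
        · exact ⟨0, c, a, rfl, rfl, hS⟩
        · exact ⟨i + 1, c', c'', h3, h4, h5⟩
      · rintro ⟨_ | i, c', c'', h3, h4, h5⟩
        · cases h3
          cases h4
          exact Or.inl h5
        · exact Or.inr ⟨i, c', c'', h3, h4, h5⟩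
    rw [h2]

theorem mem_accepts_propertyNFA {F : ConfigProp Q} {w : List (Letter A Q m r k)} :
    Marked.wrap w ∈ (propertyNFA A m r k F).accepts ↔ F.Holds fun S =>
      ∃ (i : ℕ) (c' c'' : Marked (Letter A Q m r k)), (Marked.wrap w)[i]? = some c' ∧
        (Marked.wrap w)[i + 1]? = some c'' ∧ NodeProperty S c' c'' := by
  have hw : Marked.wrap w = Marked.left :: (w.map Marked.letter ++ [Marked.right]) := rfl
  rw [mem_accepts_iff_nRun, hw]
  obtain ⟨c₁, h⟩ := nRun_propertyNFA (F := F) (w.map Marked.letter ++ [Marked.right])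
    Marked.left ∅
  constructor
  · rintro ⟨s, hs, s', ⟨c, X, rfl, hX⟩, s₁, h1, h2⟩
    rw [Set.mem_singleton_iff.1 hs] at h1
    rw [Set.mem_singleton_iff.1 h1, h] at h2
    simp only [Option.some.injEq, Prod.mk.injEq, Set.empty_union] at h2
    rw [h2.2] at hX
    refine hX.mono ?_
    rintro S _ ⟨_, hS⟩
    exact hS
  · intro hF
    refine ⟨none, rfl, _, ⟨_, _, rfl, ?_⟩, some (.left, ∅), rfl, (h _).2 rfl⟩
    exact hF.mono fun S hS hval => ⟨hS, Or.inr hval⟩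

end Property

/-! ### Soundness -/

section Sound

variable {A Q : Type*} {m r k : ℕ} {M : Machine A Q} {w : List (Letter A Q m r k)} {n : Fin m}

theorem TrackChain.eq_of_getLast {x y : ℕ × Row m r × Q} {l : List (Event A Q m r k)}
    {ev : Event A Q m r k} (h : TrackChain M x (l ++ [ev]) y) :
    y = (ev.gapAfter, ev.cell.row, ev.cell.state) := by
  induction l generalizing x with
  | nil => exact h.2.2.symm
  | cons e l ih => exact ih h.2.2

/-- The place where a machine reaches the end of its last path is the one at which it stops. -/
theorem TrackChain.eq_of_endsBetween {x y : ℕ × Row m r × Q}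
    (h : TrackChain M x (activeOnly (events w n)) y)
    (hc : (activeSet w n (Fin.last r)).OrdConnected) {g : ℕ} {c' c'' : Marked (Letter A Q m r k)}
    (hc' : (Marked.wrap w)[g]? = some c') (hc'' : (Marked.wrap w)[g + 1]? = some c'')
    {i : Row m r} {q : Q} (he : EndsBetween c' c'' n i q) : y = (g, i, q) := by
  have hg : g + 1 < w.length + 2 := by
    rw [← length_wrap]
    exact (List.getElem?_eq_some_iff.1 hc'').1
  -- the last letter that the machine processes
  have key : ∃ j, ∃ x : Letter A Q m r k, j < w.length ∧
      gapAt (segDir (Fin.last r)) w.length (j + 1) = g ∧ ¬EventActive w n (Fin.last r) (j + 1) ∧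
      (Marked.wrap w)[(headPos (segDir (Fin.last r)) w.length j).toNat]? = some (.letter x) ∧
      (x.2 (n, Fin.last r)).block ≠ none ∧ (x.2 (n, Fin.last r)).row = i ∧
      (x.2 (n, Fin.last r)).state = q := by
    cases hd : segDir (Fin.last r) with
    | fwd =>
      simp only [EndsBetween, hd] at he
      obtain ⟨h1, x, rfl, h2⟩ := he
      rcases g with _ | j
      · rw [wrap_getElem?_zero] at hc'
        cases hc'
      · have hj : j < w.length := by
          rw [wrap_getElem?_letter] at hc'
          split_ifs at hc' with h3
          · exact h3
          · simp at hc'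
        refine ⟨j, x, hj, rfl, ?_, ?_, h2⟩
        · rw [← active_headPos (x := c'') (by omega)]
          · exact h1
          · rw [hd]
            exact hc''
        · exact hc'
    | bwd =>
      simp only [EndsBetween, hd] at he
      obtain ⟨h1, x, rfl, h2⟩ := he
      have hj : g < w.length := by
        rw [wrap_getElem?_letter] at hc''
        split_ifs at hc'' with h3
        · exact h3
        · simp at hc''
      refine ⟨w.length - 1 - g, x, by omega, by simp only [gapAt]; omega, ?_, ?_, h2⟩
      · rw [← active_headPos (x := c') (by omega)]
        · exact h1
        · rw [hd]
          have h3 : (headPos .bwd w.length (w.length - 1 - g + 1)).toNat = g := by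
            simp only [headPos]
            omega
          rw [h3]
          exact hc'
      · have h3 : (headPos .bwd w.length (w.length - 1 - g)).toNat = g + 1 := by
          simp only [headPos]
          omega
        rw [h3]
        exact hc''
  obtain ⟨j, z, hj, hgap, hnext, hget, hb, hrow, hst⟩ := key
  obtain ⟨ev, e, h1, h2, h3, h4, h5, h6, h7⟩ := pathEvents_spec (n := n) (h := Fin.last r) hj
  rw [hget] at h2
  simp only [Option.some.injEq, Marked.letter.injEq] at h2
  subst h2
  simp only [h4] at hb hrow hst
  have hnil : activeOnly ((pathEvents w n (Fin.last r)).drop (j + 1)) = [] := by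
    refine activeOnly_drop_eq_nil fun l hl hact => hnext ?_
    exact EventActive.of_between hc ⟨ev, h1, hb⟩ hact (by omega) hl
  have hsplit : ∃ l, activeOnly (events w n) = l ++ [ev] := by
    have h8 : events w n = (((List.finRange (r + 1)).take r).flatMap (pathEvents w n)) ++
        pathEvents w n (Fin.last r) := by
      rw [events]
      conv_lhs => rw [← List.take_append_drop r (List.finRange (r + 1)), List.flatMap_append,
        List.drop_eq_getElem_cons (by simp), List.flatMap_cons, List.drop_of_length_le (by simp),
        List.flatMap_nil, List.append_nil]
      rw [List.getElem_finRange]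
      rfl
    have h9 : activeOnly (pathEvents w n (Fin.last r)) =
        activeOnly ((pathEvents w n (Fin.last r)).take j) ++ [ev] := by
      conv_lhs => rw [← List.take_append_drop j (pathEvents w n (Fin.last r)), activeOnly_append,
        activeOnly_drop_of_active h1 hb, hnil]
    rw [h8, activeOnly_append, h9, ← List.append_assoc]
    exact ⟨_, rfl⟩
  obtain ⟨l, hl⟩ := hsplit
  rw [hl] at h
  rw [h.eq_of_getLast, h7, hgap, hrow, hst]

theorem pairwise_path_events : (events w n).Pairwise fun ev ev' => ev.path ≤ ev'.path := by
  have hpath : ∀ h, ∀ ev ∈ pathEvents w n h, ev.path = h := by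
    intro h ev hev
    have h1 : ∀ ev ∈ w.zipIdx.map fun x => (⟨h, x.2, x.1.1, x.1.2 (n, h)⟩ : Event A Q m r k),
        ev.path = h := by
      intro ev hev
      obtain ⟨x, -, rfl⟩ := List.mem_map.1 hev
      rfl
    rw [pathEvents] at hev
    cases hd : segDir h <;> simp only [hd] at hev
    · exact h1 ev hev
    · exact h1 ev (List.mem_reverse.1 hev)
  rw [events, List.pairwise_flatMap]
  refine ⟨fun h _ => ?_, ?_⟩
  · refine List.pairwise_of_forall_mem_list fun ev hev ev' hev' => ?_
    rw [hpath h ev hev, hpath h ev' hev']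
  · refine (List.pairwise_lt_finRange _).imp fun {h h'} hlt ev hev ev' hev' => ?_
    rw [hpath h ev hev, hpath h' ev' hev']
    exact hlt.le

theorem exists_letter_of_mem_events {ev : Event A Q m r k} (hev : ev ∈ events w n) :
    ∃ e, w[ev.pos]? = some (ev.letter, e) := by
  obtain ⟨h, -, hev⟩ := List.mem_flatMap.1 hev
  obtain ⟨j, hj⟩ := List.getElem?_of_mem hev
  have hjL : j < w.length := by
    rw [← length_pathEvents (n := n) (h := h)]
    exact (List.getElem?_eq_some_iff.1 hj).1
  obtain ⟨ev', e, h1, -, h3, -⟩ := pathEvents_spec (n := n) (h := h) hjL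
  rw [hj] at h1
  cases h1
  exact ⟨e, h3⟩

/-- Rows that meet in one of the letters next to a gap are at the same node in this gap. -/
theorem IsTrace.eq_of_meet {N : Type*} {E : Set (N × N × A)} {s : N} {id : N → Option (Fin k)}
    {loc : ℕ → Row m r → N} (hT : IsTrace E s id (w.map Prod.fst) loc) {g : ℕ}
    {c' c'' : Marked (Letter A Q m r k)} (hc' : (Marked.wrap w)[g]? = some c')
    (hc'' : (Marked.wrap w)[g + 1]? = some c'') {x : Letter A Q m r k}
    (hx : c' = .letter x ∨ c'' = .letter x) {I : Set (Row m r)} (hI : x.1.Meet I)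
    {i i' : Row m r} (hi : i ∈ I) (hi' : i' ∈ I) : loc g i = loc g i' := by
  have hp : ∃ p, w[p]? = some x ∧ (g = p + 1 ∨ g = p) := by
    have hw : ∀ p, (Marked.wrap w)[p + 1]? = some (.letter x) → w[p]? = some x := by
      intro p hp
      rw [wrap_getElem?_letter] at hp
      split_ifs at hp
      · simpa using hp
      · simp at hp
    rcases hx with rfl | rfl
    · rcases g with _ | p
      · rw [wrap_getElem?_zero] at hc'
        cases hc'
      · exact ⟨p, hw p hc', Or.inl rfl⟩
    · exact ⟨g, hw g hc'', Or.inr rfl⟩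
  obtain ⟨p, hp, hg⟩ := hp
  have hW : (w.map Prod.fst)[p]? = some x.1 := by
    rw [List.getElem?_map, hp]
    rfl
  obtain ⟨a, e⟩ := x
  have both : loc p i = loc p i' ∧ loc (p + 1) i = loc (p + 1) i' := by
    cases a with
    | node idx =>
      have h1 := (hT.node p idx hW i).2 i' (hI i hi i' hi')
      refine ⟨h1, ?_⟩
      rw [(hT.node p idx hW i).1, (hT.node p idx hW i').1, h1]
    | edge f => exact hT.meet p f i i' hW (hI.1 i hi) (hI.1 i' hi') (hI.2 i hi i' hi')
  rcases hg with rfl | rfl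
  · exact both.2
  · exact both.1

/-- A word in the intersection of all the automata yields a run. -/
theorem exists_run_of_word {V : Type*} [Finite A] [Finite V] {𝒢 : SPGG A V} {F : ConfigProp Q}
    (hW : w.map Prod.fst ∈ (grammarPDA 𝒢 m r k).language)
    (hreg : Marked.wrap (w.map Prod.fst) ∈ (registerNFA A m r k).accepts)
    (hexec : ∀ n, w ∈ (execTwoNFA M r k n).language) (hrw : w ∈ (rwTwoNFA A Q m r k).language)
    (hF : Marked.wrap w ∈ (propertyNFA A m r k F).accepts) :
    ∃ (G : Graph (A × Dir)) (κ : G.Node → Bool) (ρ : Run M m G κ),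
      𝒢.IsMarkedGraph k G κ ∧ ρ.ReversalBounded r ∧ ∃ i, (ρ.config i).Satisfies F := by
  obtain ⟨H, hH, id, loc, hT, hne⟩ := exists_isTrace_of_mem_language hW hreg
  rw [mem_language_rwTwoNFA] at hrw
  obtain ⟨V, V', hcons⟩ := blocksConsistent_of_rwRest hrw
  have hexec := fun n => exists_trackChain_of_mem_language (hexec n)
  choose hact i₀ y htrack using hexec
  obtain ⟨l, hl, U, hU⟩ := hcons.exists_interleaving fun n ev hev =>
    Option.isSome_iff_ne_none.1 (List.mem_filter.1 hev).2
  have hmem : ∀ x ∈ l, ∃ e, w[x.2.pos]? = some (x.2.letter, e) := by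
    intro x hx
    have h1 : x.2 ∈ eventsOf l x.1 :=
      List.mem_map.2 ⟨x, List.mem_filter.2 ⟨hx, by simp⟩, rfl⟩
    rw [hl] at h1
    exact exists_letter_of_mem_events (List.mem_filter.1 h1).1
  obtain ⟨tr, b, hrun, hend, hdirs⟩ := exists_moves (M := M) hT hmem
    (a := ⟨fun _ => H.source, fun _ => M.start, fun _ => false⟩) (y := y)
    (fun n => ⟨0, i₀ n, hT.start _, by rw [hl]; exact htrack n⟩) hU
    (by
      intro x
      cases id x <;> rfl)
  have hne' : ∀ e ∈ H.symmClosure.edges, e.1 ≠ e.2.1 := by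
    intro e he
    rcases Multiset.mem_add.1 he with he | he
    · obtain ⟨d, hd, rfl⟩ := Multiset.mem_map.1 he
      exact hne d hd
    · obtain ⟨d, hd, rfl⟩ := Multiset.mem_map.1 he
      exact (hne d hd).symm
  obtain ⟨ρ, hρ, hρ'⟩ := exists_run (show _ ∈ (moveNFA m M _).start from rfl) hrun hne'
  refine ⟨H.symmClosure, fun x => (id x).isSome, ρ, ⟨⟨H, hH, rfl⟩, ?_⟩, ?_, Fin.last _, ?_⟩
  · have hcard : (Set.range (some : Fin k → Option (Fin k))).ncard = k := by
      rw [← Set.image_univ, Set.ncard_image_of_injective _ (Option.some_injective _),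
        Set.ncard_univ, Nat.card_fin]
    change {x : H.Node | (id x).isSome = true}.ncard ≤ k
    refine le_trans (Set.ncard_le_ncard_of_injOn id ?_ ?_ (Set.toFinite _)) hcard.le
    · intro x hx
      obtain ⟨j, hj⟩ := Option.isSome_iff_exists.1 hx
      exact ⟨j, hj.symm⟩
    · intro x hx x' hx' hxx
      obtain ⟨j, hj⟩ := Option.isSome_iff_exists.1 hx
      exact hT.inj x x' j hj (hxx ▸ hj)
  · intro n
    obtain ⟨hs, hsub, hd⟩ := hdirs n
    rw [hρ' n, hd]
    refine reversals_segDir_le hs (List.Pairwise.sublist hsub ?_)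
    rw [hl, List.pairwise_map]
    exact (pairwise_path_events (w := w) (n := n)).sublist List.filter_sublist
  · rw [hρ]
    rw [mem_accepts_propertyNFA] at hF
    refine hF.mono ?_
    rintro S - ⟨g, c', c'', hc', hc'', N, row, state, h1, h2, x, hx, hI⟩
    have hy : ∀ n ∈ N, y n = (g, row n, state n) := fun n hn =>
      (htrack n).eq_of_endsBetween (hact n _).2 hc' hc'' (h1 n hn)
    have hfin : ∀ s : Set (Fin m), s.Finite := fun s => Set.toFinite s
    rcases N.eq_empty_or_nonempty with rfl | ⟨n₀, hn₀⟩
    · exact ⟨H.source, fun q => (h2 q).trans (by simp)⟩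
    · refine ⟨loc g (row n₀), fun q => (h2 q).trans (Set.ncard_le_ncard ?_ (hfin _))⟩
      rintro n ⟨hn, hq⟩
      obtain ⟨h3, h4⟩ := hend n
      rw [hy n hn] at h3 h4
      refine ⟨?_, ?_⟩
      · change b.loc n = _
        rw [h3]
        exact hT.eq_of_meet hc' hc'' hx hI ⟨n, hn, rfl⟩ ⟨n₀, hn₀, rfl⟩
      · change b.st n = _
        rw [h4]
        exact hq

end Sound

/-! ### Schedules -/

/-- What is needed of a run to describe it by a word. Machine `n` makes `steps n` moves; after `s`
moves it is at `node n s` in the state `state n s`, and the next move is along `edge n s`, with the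
values `read n s` and `write n s`. The moves on path `h` are those with the numbers from `bound n h`
to `bound n (h + 1)`. The block after `s` moves is `block n s`, and `pre b` and `post b` are the
valuations at the beginning and at the end of block `b`. -/
structure Schedule {A Q : Type*} (M : Machine A Q) (H : Graph A) (m r : ℕ) {k : ℕ}
    (id : H.Node → Option (Fin k)) where
  steps : Fin m → ℕ
  node : Fin m → ℕ → H.Node
  state : Fin m → ℕ → Q
  edge : Fin m → ℕ → H.Node × H.Node × A
  bound : Fin m → ℕ → ℕ
  read : Fin m → ℕ → Bool
  write : Fin m → ℕ → Bool
  block : Fin m → ℕ → Fin (blockBound m r k)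
  pre : Fin (blockBound m r k) → Valuation k
  post : Fin (blockBound m r k) → Valuation k
  node_zero : ∀ n, node n 0 = H.source
  state_zero : ∀ n, state n 0 = M.start
  bound_zero : ∀ n, bound n 0 = 0
  bound_mono : ∀ n, Monotone (bound n)
  bound_last : ∀ n, bound n (r + 1) = steps n
  edge_mem : ∀ n (h : Fin (r + 1)) s, bound n h ≤ s → s < bound n (h + 1) → edge n s ∈ H.edges
  edge_nodes : ∀ n (h : Fin (r + 1)) s, bound n h ≤ s → s < bound n (h + 1) → match segDir h with
    | .fwd => (edge n s).1 = node n s ∧ (edge n s).2.1 = node n (s + 1)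
    | .bwd => (edge n s).1 = node n (s + 1) ∧ (edge n s).2.1 = node n s
  trans : ∀ n (h : Fin (r + 1)) s, bound n h ≤ s → s < bound n (h + 1) →
    (state n s, ((edge n s).2.2, segDir h), read n s, state n (s + 1), write n s) ∈ M.δ
  silent : ∀ n s, s < steps n → id (node n s) = none →
    read n s = false ∧ write n s = false ∧ block n (s + 1) = block n s
  operation : ∀ n s, s < steps n → ∀ j, id (node n s) = some j → block n s < block n (s + 1) ∧
    read n s = pre (block n (s + 1)) j ∧
    post (block n (s + 1)) = Function.update (pre (block n (s + 1))) j (write n s)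
  first : ∀ n, post (block n 0) = pre (block n 0)
  owner : ∀ n s n' s', s ≤ steps n → s' ≤ steps n' → block n s = block n' s' → n = n'
  discharged : ∀ n s, s ≤ steps n →
    ((block n s).val = 0 ∧ pre (block n s) = fun _ => false) ∨
    ∃ n' s', s' ≤ steps n' ∧ (block n' s').val + 1 = (block n s).val ∧
      post (block n' s') = pre (block n s)

theorem isWalk_range_map {N A : Type*} {E : Set (N × N × A)} {f : ℕ → N × N × A} {x : ℕ → N} {l : ℕ}
    (h : ∀ y < l, f y ∈ E ∧ (f y).1 = x y ∧ (f y).2.1 = x (y + 1)) :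
    IsWalk E (x 0) ((List.range l).map f) (x l) := by
  induction l with
  | zero => exact rfl
  | succ l ih =>
    rw [List.range_succ, List.map_append, isWalk_append]
    obtain ⟨h1, h2, h3⟩ := h l (Nat.lt_succ_self l)
    exact ⟨x l, ih fun y hy => h y (by omega), h1, h2, h3⟩

namespace Schedule

variable {A Q : Type*} {M : Machine A Q} {H : Graph A} {m r k : ℕ} {id : H.Node → Option (Fin k)}
  (𝒮 : Schedule M H m r id)

/-- The number of moves on the path of row `i`. -/
def len (i : Row m r) : ℕ := 𝒮.bound i.1 (i.2 + 1) - 𝒮.bound i.1 i.2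

/-- The number of moves that machine `i.1` has made when, on the path of row `i`, it is `y` edges
behind the first node of this path in the direction of the graph. -/
def num (i : Row m r) (y : ℕ) : ℕ :=
  match segDir i.2 with
  | .fwd => 𝒮.bound i.1 i.2 + y
  | .bwd => 𝒮.bound i.1 (i.2 + 1) - y

/-- The number of the move along the edge number `y` of the path of row `i`, in the direction of the
graph. -/
def moveNum (i : Row m r) (y : ℕ) : ℕ :=
  match segDir i.2 with
  | .fwd => 𝒮.bound i.1 i.2 + y
  | .bwd => 𝒮.bound i.1 (i.2 + 1) - 1 - y

variable {𝒮}

theorem bound_le_succ (i : Row m r) : 𝒮.bound i.1 i.2 ≤ 𝒮.bound i.1 (i.2 + 1) :=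
  𝒮.bound_mono i.1 (Nat.le_succ _)

theorem bound_le_steps (n : Fin m) (h : Fin (r + 1)) : 𝒮.bound n (h + 1) ≤ 𝒮.steps n := by
  rw [← 𝒮.bound_last n]
  exact 𝒮.bound_mono n (Nat.succ_le_of_lt h.isLt)

theorem moveNum_mem {i : Row m r} {y : ℕ} (hy : y < 𝒮.len i) :
    𝒮.bound i.1 i.2 ≤ 𝒮.moveNum i y ∧ 𝒮.moveNum i y < 𝒮.bound i.1 (i.2 + 1) := by
  have h := bound_le_succ (𝒮 := 𝒮) i
  unfold len at hy
  unfold moveNum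
  cases segDir i.2 <;> simp only <;> omega

theorem num_le_steps {i : Row m r} {y : ℕ} (hy : y ≤ 𝒮.len i) : 𝒮.num i y ≤ 𝒮.steps i.1 := by
  have h := bound_le_succ (𝒮 := 𝒮) i
  have h' := bound_le_steps (𝒮 := 𝒮) i.1 i.2
  unfold len at hy
  unfold num
  cases segDir i.2 <;> simp only <;> omega

theorem edge_moveNum {i : Row m r} {y : ℕ} (hy : y < 𝒮.len i) :
    𝒮.edge i.1 (𝒮.moveNum i y) ∈ H.edges ∧
      (𝒮.edge i.1 (𝒮.moveNum i y)).1 = 𝒮.node i.1 (𝒮.num i y) ∧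
      (𝒮.edge i.1 (𝒮.moveNum i y)).2.1 = 𝒮.node i.1 (𝒮.num i (y + 1)) := by
  obtain ⟨h1, h2⟩ := moveNum_mem hy
  have h3 := 𝒮.edge_nodes i.1 i.2 _ h1 h2
  refine ⟨𝒮.edge_mem i.1 i.2 _ h1 h2, ?_⟩
  have h := bound_le_succ (𝒮 := 𝒮) i
  unfold len at hy
  unfold moveNum num at *
  cases hd : segDir i.2 <;> simp only [hd] at h3 ⊢
  · exact h3
  · have e1 : 𝒮.bound i.1 (i.2 + 1) - 1 - y + 1 = 𝒮.bound i.1 (i.2 + 1) - y := by omega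
    have e2 : 𝒮.bound i.1 (i.2 + 1) - 1 - y = 𝒮.bound i.1 (i.2 + 1) - (y + 1) := by omega
    rw [e1] at h3
    rw [← e2]
    exact h3

theorem node_mem {S : Set H.Node} (hs : H.source ∈ S) (hS : ∀ e ∈ H.edges, e.1 ∈ S ∧ e.2.1 ∈ S)
    (i : Row m r) {y : ℕ} (hy : y ≤ 𝒮.len i) : 𝒮.node i.1 (𝒮.num i y) ∈ S := by
  have key : ∀ n s, s ≤ 𝒮.steps n → 𝒮.node n s ∈ S := by
    intro n s hs'
    rcases s with _ | s
    · rw [𝒮.node_zero]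
      exact hs
    · -- the path on which the move before is made
      have hex : ∃ h, s < 𝒮.bound n (h + 1) := ⟨r, by rw [𝒮.bound_last]; omega⟩
      classical
      have h1 := Nat.find_spec hex
      have h2 : 𝒮.bound n (Nat.find hex) ≤ s := by
        rcases h3 : Nat.find hex with _ | h
        · rw [𝒮.bound_zero]
          exact Nat.zero_le _
        · have := Nat.find_min hex (m := h) (by omega)
          omega
      have h4 : Nat.find hex < r + 1 :=
        Nat.lt_succ_of_le (Nat.find_min' hex (by rw [𝒮.bound_last]; omega))
      have h5 := hS _ (𝒮.edge_mem n ⟨_, h4⟩ s h2 h1)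
      have h6 := 𝒮.edge_nodes n ⟨_, h4⟩ s h2 h1
      revert h6
      cases segDir (⟨_, h4⟩ : Fin (r + 1)) <;> intro h6
      · rw [← h6.2]
        exact h5.2
      · rw [← h6.1]
        exact h5.1
  exact key _ _ (num_le_steps hy)

end Schedule

/-- The word `W` describes the paths of a schedule. After `p` letters, row `i` has taken `τ p i`
edges, `o i` of them before the path of the machine begins, and `P x` is the position of the letter
at which the rows that visit `x` meet. -/
structure Placement {A Q : Type*} {M : Machine A Q} {H : Graph A} {m r k : ℕ}
    {id : H.Node → Option (Fin k)} (𝒮 : Schedule M H m r id) (W : List (TraceLetter A m r k))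
    (τ : ℕ → Row m r → ℕ) (P : H.Node → ℕ) (o : Row m r → ℕ) : Prop where
  length_pos : 0 < W.length
  node : ∀ i y, y ≤ 𝒮.len i → ∃ idx, W[P (𝒮.node i.1 (𝒮.num i y))]? = some (.node idx) ∧
    τ (P (𝒮.node i.1 (𝒮.num i y))) i = o i + y ∧
    ∀ i' y', y' ≤ 𝒮.len i' → 𝒮.node i'.1 (𝒮.num i' y') = 𝒮.node i.1 (𝒮.num i y) → idx i' = idx i
  letter : ∀ p x, W[p]? = some x → ∀ i,
    (∃ idx, x = .node idx ∧ τ (p + 1) i = τ p i) ∨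
    (∃ f, x = .edge f ∧ (f i).sym = none ∧ τ (p + 1) i = τ p i) ∨
    ∃ f, x = .edge f ∧ τ (p + 1) i = τ p i + 1 ∧ ∀ y < 𝒮.len i, τ p i = o i + y →
      (f i).sym = some (𝒮.edge i.1 (𝒮.moveNum i y)).2.2 ∧
      (f i).src = id (𝒮.node i.1 (𝒮.num i y)) ∧ (f i).tgt = id (𝒮.node i.1 (𝒮.num i (y + 1)))
  source : P H.source = 0

theorem Schedule.exists_placement {A V Q : Type*} [Finite A] [Finite V] {𝒢 : SPGG A V}
    {M : Machine A Q} {H : Graph A} {m r k : ℕ} {id : H.Node → Option (Fin k)}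
    (hH : H ∈ 𝒢.language) (hid : ∀ x y j, id x = some j → id y = some j → x = y)
    (𝒮 : Schedule M H m r id) :
    ∃ (W : List (TraceLetter A m r k)) (τ : ℕ → Row m r → ℕ) (P : H.Node → ℕ) (o : Row m r → ℕ),
      W ∈ (grammarPDA 𝒢 m r k).language ∧ Marked.wrap W ∈ (registerNFA A m r k).accepts ∧
      Placement 𝒮 W τ P o := by
  obtain ⟨S, hs, hS, hwalk⟩ := exists_walk_of_mem_language hH
  have hpre : ∀ i : Row m r, ∃ l, IsWalk {e | e ∈ H.edges} H.source l (𝒮.node i.1 (𝒮.num i 0)) :=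
    fun i => (hwalk _ (node_mem hs hS i (Nat.zero_le _))).1
  have hpost : ∀ i : Row m r, ∃ l, IsWalk {e | e ∈ H.edges} (𝒮.node i.1 (𝒮.num i
    (𝒮.len i))) l H.sink :=
    fun i => (hwalk _ (node_mem hs hS i le_rfl)).2
  choose a ha using hpre
  choose b hb using hpost
  set seg : Row m r → List (H.Node × H.Node × A) := fun i =>
    (List.range (𝒮.len i)).map fun y => 𝒮.edge i.1 (𝒮.moveNum i y) with hseg
  have hsegw : ∀ i y, y ≤ 𝒮.len i → IsWalk {e | e ∈ H.edges} (𝒮.node i.1 (𝒮.num i 0))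
      ((seg i).take y) (𝒮.node i.1 (𝒮.num i y)) := by
    intro i y hy
    rw [hseg]
    simp only
    rw [← List.map_take, List.take_range, min_eq_left hy]
    exact isWalk_range_map (x := fun y => 𝒮.node i.1 (𝒮.num i y)) fun y' hy' =>
      edge_moveNum (by omega)
  have hsegl : ∀ i, (seg i).length = 𝒮.len i := fun i => by simp [hseg]
  have hπ : ∀ i, IsWalk {e | e ∈ H.edges} H.source (a i ++ (seg i ++ b i)) H.sink := by
    intro i
    have h1 := hsegw i _ le_rfl
    rw [List.take_of_length_le (hsegl i).le] at h1
    exact isWalk_append.2 ⟨_, ha i, isWalk_append.2 ⟨_, h1, hb i⟩⟩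
  obtain ⟨W, τ, P, hW, hreg, hword⟩ := exists_isWord hH id hid _ hπ
  have hnode : ∀ i y, y ≤ 𝒮.len i → (a i).length + y ≤ (a i ++ (seg i ++ b i)).length ∧
      walkEnd H.source ((a i ++ (seg i ++ b i)).take ((a i).length + y)) =
        𝒮.node i.1 (𝒮.num i y) := by
    intro i y hy
    refine ⟨by simp only [List.length_append, hsegl]; omega, ?_⟩
    rw [List.take_length_add_append, walkEnd_append, (ha i).walkEnd_eq,
      List.take_append_of_le_length (by rw [hsegl]; exact hy)]
    exact (hsegw i y hy).walkEnd_eq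
  refine ⟨W, τ, P, fun i => (a i).length, hW, hreg, hword.length_pos, ?_, ?_, hword.source⟩
  · intro i y hy
    obtain ⟨h1, h2⟩ := hnode i y hy
    obtain ⟨idx, h3, h4, h5⟩ := hword.node i _ h1
    rw [h2] at h3 h4 h5
    refine ⟨idx, h3, h4, fun i' y' hy' hx => ?_⟩
    obtain ⟨h6, h7⟩ := hnode i' y' hy'
    exact h5 i' _ h6 (h7.trans hx)
  · intro p x hx i
    rcases hword.letter p x hx i with h | h | ⟨f, e, h1, h2, h3, h4, h5, h6⟩
    · exact Or.inl h
    · exact Or.inr (Or.inl h)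
    · refine Or.inr (Or.inr ⟨f, h1, h6, fun y hy hτ => ?_⟩)
      have h7 : (a i ++ (seg i ++ b i))[(a i).length + y]? =
          some (𝒮.edge i.1 (𝒮.moveNum i y)) := by
        rw [List.getElem?_append_right (by omega), Nat.add_sub_cancel_left,
          List.getElem?_append_left (by rw [hsegl]; exact hy)]
        simp [hseg, hy]
      rw [hτ, h7, Option.some.injEq] at h2
      obtain ⟨-, h8, h9⟩ := edge_moveNum hy
      rw [← h8, ← h9, h2]
      exact ⟨h3, h4, h5⟩

/-! ### The word of a schedule -/

/-- The gap before the letter at position `p`, in a pass in direction `d`. -/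
def gapIn (d : Dir) (p : ℕ) : ℕ :=
  match d with
  | .fwd => p
  | .bwd => p + 1

/-- The gap after the letter at position `p`, in a pass in direction `d`. -/
def gapOut (d : Dir) (p : ℕ) : ℕ :=
  match d with
  | .fwd => p + 1
  | .bwd => p

/-- The row of the next path of the same machine, if there is one. -/
def nextRow {m r : ℕ} (i : Row m r) : Row m r :=
  if h : i.2.val + 1 < r + 1 then (i.1, ⟨i.2.val + 1, h⟩) else i

namespace Schedule

variable {A Q : Type*} {M : Machine A Q} {H : Graph A} {m r k : ℕ} {id : H.Node → Option (Fin k)}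
  (𝒮 : Schedule M H m r id)

section Cells

variable (τ : ℕ → Row m r → ℕ) (P : H.Node → ℕ) (o : Row m r → ℕ) (i : Row m r)

/-- The position of the leftmost letter at which the machine is active on the path of row `i`. -/
def lo : ℕ := P (𝒮.node i.1 (𝒮.num i 0))

/-- The position of the rightmost letter at which the machine is active on the path of row `i`. -/
def hi : ℕ := P (𝒮.node i.1 (𝒮.num i (𝒮.len i)))

/-- The number of moves that the machine has made when it is at the gap `g` on the path of row
`i`. -/
def numAt (g : ℕ) : ℕ := 𝒮.num i (τ g i - o i)

open Classical in
/-- The row that is read at the gap `g` in the pass over the word for the path of row `i`. -/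
noncomputable def rowAt (g : ℕ) : Row m r :=
  if (match segDir i.2 with
    | .fwd => 𝒮.hi P i < g
    | .bwd => g ≤ 𝒮.lo P i) then nextRow i else i

/-- The cell in row `i` at position `p`. Its block number is `none` outside the active interval of
the path, and the values read and written are `false` where no move is made. -/
noncomputable def cell (p : ℕ) : ExecCell Q m r k where
  block := if 𝒮.lo P i ≤ p ∧ p ≤ 𝒮.hi P i then
    some (𝒮.block i.1 (𝒮.numAt τ o i (gapOut (segDir i.2) p))) else none
  read := if 𝒮.numAt τ o i (gapOut (segDir i.2) p) = 𝒮.numAt τ o i (gapIn (segDir i.2) p) then false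
    else 𝒮.read i.1 (𝒮.numAt τ o i (gapIn (segDir i.2) p))
  write := if 𝒮.numAt τ o i (gapOut (segDir i.2) p) = 𝒮.numAt τ o i (gapIn
    (segDir i.2) p) then false
    else 𝒮.write i.1 (𝒮.numAt τ o i (gapIn (segDir i.2) p))
  state := 𝒮.state i.1 (𝒮.numAt τ o i (gapOut (segDir i.2) p))
  row := 𝒮.rowAt P i (gapOut (segDir i.2) p)

/-- The word `W`, together with the cells of the schedule. -/
noncomputable def word (W : List (TraceLetter A m r k)) : List (Letter A Q m r k) :=
  W.mapIdx fun p x => (x, fun i => 𝒮.cell τ P o i p)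

/-- Where the machine is at the gap `g` in the pass over the word for the path of row `i`: the last
gap that it has reached, the row and the number of moves. -/
noncomputable def ghost (g : ℕ) : ℕ × Row m r × ℕ :=
  (max (𝒮.lo P i) (min g (𝒮.hi P i + 1)), 𝒮.rowAt P i g,
    𝒮.numAt τ o i (max (𝒮.lo P i) (min g (𝒮.hi P i + 1))))

end Cells

/-- Machine `n`, having made `s` moves, processes the event `ev` with the row `i`, and has made `s'`
moves afterwards. -/
structure EventOk (n : Fin m) (g : ℕ) (i : Row m r) (s s' : ℕ) (ev : Event A Q m r k) : Prop where
  gap : ev.gapBefore = g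
  processes : Processes M (segDir ev.path) ev.letter i (𝒮.state n s) ev.cell
  state : ev.cell.state = 𝒮.state n s'
  block : ev.cell.block = some (𝒮.block n s')
  le_steps : s' ≤ 𝒮.steps n
  succ : s' = s ∨ s' = s + 1
  same : 𝒮.block n s' = 𝒮.block n s → ∀ β, Operates (segDir ev.path) ev.letter ev.cell β β
  new : 𝒮.block n s' ≠ 𝒮.block n s → Operates (segDir ev.path) ev.letter ev.cell
    (𝒮.pre (𝒮.block n s')) (𝒮.post (𝒮.block n s'))

/-- The events in the list follow the schedule of machine `n`. -/
def Follows (n : Fin m) : ℕ × Row m r × ℕ → List (Event A Q m r k) → ℕ × Row m r × ℕ → Prop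
  | x, [], y => x = y
  | x, ev :: l, y => ∃ s', 𝒮.EventOk n x.1 x.2.1 x.2.2 s' ev ∧
      Follows n (ev.gapAfter, ev.cell.row, s') l y

variable {𝒮} {n : Fin m} {x y z : ℕ × Row m r × ℕ} {l l' : List (Event A Q m r k)}

theorem Follows.append (h : 𝒮.Follows n x l y) (h' : 𝒮.Follows n y l' z) :
    𝒮.Follows n x (l ++ l') z := by
  induction l generalizing x with
  | nil =>
    cases h
    exact h'
  | cons ev l ih =>
    obtain ⟨s', h1, h2⟩ := h
    exact ⟨s', h1, ih h2⟩

theorem follows_activeOnly (x : ℕ → ℕ × Row m r × ℕ)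
    (h : ∀ j ev, l[j]? = some ev → (ev.cell.block = none ∧ x (j + 1) = x j) ∨
      ∃ s', 𝒮.EventOk n (x j).1 (x j).2.1 (x j).2.2 s' ev ∧
        x (j + 1) = (ev.gapAfter, ev.cell.row, s')) :
    𝒮.Follows n (x 0) (activeOnly l) (x l.length) := by
  induction l generalizing x with
  | nil => exact rfl
  | cons ev l ih =>
    have h1 := ih (fun j => x (j + 1)) fun j ev' hj => h (j + 1) ev' hj
    rcases h 0 ev rfl with ⟨hb, hx⟩ | ⟨s', hs, hx⟩
    · have h2 : activeOnly (ev :: l) = activeOnly l := List.filter_cons_of_neg (by simp [hb])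
      rw [h2, ← hx]
      exact h1
    · have h2 : activeOnly (ev :: l) = ev :: activeOnly l :=
        List.filter_cons_of_pos (by simp [hs.block])
      rw [h2]
      refine ⟨s', hs, ?_⟩
      rw [← hx]
      exact h1

theorem Follows.trackChain (h : 𝒮.Follows n x l y) :
    TrackChain M (x.1, x.2.1, 𝒮.state n x.2.2) l (y.1, y.2.1, 𝒮.state n y.2.2) := by
  induction l generalizing x with
  | nil =>
    cases h
    exact rfl
  | cons ev l ih =>
    obtain ⟨s', h1, h2⟩ := h
    have h3 := ih h2
    rw [← h1.state] at h3
    exact ⟨h1.gap, h1.processes, h3⟩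

theorem block_le_succ {s : ℕ} (hs : s < 𝒮.steps n) : 𝒮.block n s ≤ 𝒮.block n (s + 1) := by
  cases hid : id (𝒮.node n s) with
  | none => exact (𝒮.silent n s hs hid).2.2.ge
  | some j => exact (𝒮.operation n s hs j hid).1.le

theorem EventOk.block_le {g : ℕ} {i : Row m r} {s s' : ℕ} {ev : Event A Q m r k}
    (h : 𝒮.EventOk n g i s s' ev) : 𝒮.block n s ≤ 𝒮.block n s' := by
  rcases h.succ with h1 | h1
  · rw [h1]
  · rw [h1]
    exact block_le_succ (by have := h.le_steps; omega)

theorem Follows.exists_block (h : 𝒮.Follows n x l y) {ev : Event A Q m r k} (hev : ev ∈ l) :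
    ∃ s ≤ 𝒮.steps n, ev.cell.block = some (𝒮.block n s) ∧ 𝒮.block n x.2.2 ≤ 𝒮.block n s := by
  induction l generalizing x with
  | nil => cases hev
  | cons ev' l ih =>
    obtain ⟨s', h1, h2⟩ := h
    rcases List.mem_cons.1 hev with rfl | hev
    · exact ⟨s', h1.le_steps, h1.block, h1.block_le⟩
    · obtain ⟨s, h3, h4, h5⟩ := ih h2 hev
      exact ⟨s, h3, h4, h1.block_le.trans h5⟩

theorem Follows.blocksSorted (h : 𝒮.Follows n x l y) : BlocksSorted l := by
  induction l generalizing x with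
  | nil => exact List.Pairwise.nil
  | cons ev l ih =>
    obtain ⟨s', h1, h2⟩ := h
    refine List.Pairwise.cons (fun ev' hev' b b' hb hb' => ?_) (ih h2)
    obtain ⟨s, -, h4, h5⟩ := h2.exists_block hev'
    rw [h1.block, Option.some.injEq] at hb
    rw [h4, Option.some.injEq] at hb'
    rw [← hb, ← hb']
    exact h5

theorem Follows.opsChain (h : 𝒮.Follows n x l y) (b : Fin (blockBound m r k)) :
    (𝒮.block n x.2.2 = b → OpsChain (𝒮.post b) (ofBlock b l) (𝒮.post b)) ∧
      (𝒮.block n x.2.2 ≠ b → ofBlock b l ≠ [] → OpsChain (𝒮.pre b) (ofBlock b l) (𝒮.post b)) := by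
  induction l generalizing x with
  | nil => exact ⟨fun _ => rfl, fun _ h => absurd rfl h⟩
  | cons ev l ih =>
    obtain ⟨s', h1, h2⟩ := h
    obtain ⟨i1, i2⟩ := ih h2
    simp only at i1 i2
    by_cases hb : 𝒮.block n s' = b
    · have hev : ev.cell.block = some b := by rw [h1.block, hb]
      rw [ofBlock_cons_of_eq hev]
      refine ⟨fun hx => ⟨_, h1.same (hb.trans hx.symm) _, i1 hb⟩, fun hx _ => ⟨_, ?_, i1 hb⟩⟩
      have h3 := h1.new (by rw [hb]; exact Ne.symm hx)
      rwa [hb] at h3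
    · have hev : ev.cell.block ≠ some b := by
        rw [h1.block]
        simpa using hb
      rw [ofBlock_cons_of_ne hev]
      refine ⟨fun hx => ?_, fun _ => i2 hb⟩
      have hnil : ofBlock b l = [] := by
        by_contra hne
        obtain ⟨ev', hev', hb'⟩ := ofBlock_ne_nil.1 hne
        obtain ⟨s, -, h4, h5⟩ := h2.exists_block hev'
        rw [h4, Option.some.injEq] at hb'
        exact hb (le_antisymm (hb' ▸ h5) (hx ▸ h1.block_le))
      rw [hnil]
      exact rfl

end Schedule

namespace Placement

open Schedule

variable {A Q : Type*} {M : Machine A Q} {H : Graph A} {m r k : ℕ} {id : H.Node → Option (Fin k)}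
  {𝒮 : Schedule M H m r id} {W : List (TraceLetter A m r k)} {τ : ℕ → Row m r → ℕ}
  {P : H.Node → ℕ} {o : Row m r → ℕ} (hP : Placement 𝒮 W τ P o)
include hP

theorem mono (i : Row m r) {p q : ℕ} (hpq : p ≤ q) (hq : q ≤ W.length) : τ p i ≤ τ q i := by
  induction q with
  | zero => rw [Nat.le_zero.1 hpq]
  | succ q ih =>
    rcases hpq.eq_or_lt with rfl | hpq
    · exact le_rfl
    · refine (ih (by omega) (by omega)).trans ?_
      rcases hP.letter q _ (List.getElem?_eq_getElem hq) i with ⟨_, _, h⟩ | ⟨_, _, _, h⟩ | ⟨_, _,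
        h, -⟩ <;>
        omega

theorem pos_lt {i : Row m r} {y : ℕ} (hy : y ≤ 𝒮.len i) :
    P (𝒮.node i.1 (𝒮.num i y)) < W.length := by
  obtain ⟨idx, h, -⟩ := hP.node i y hy
  exact (List.getElem?_eq_some_iff.1 h).1

theorem pos_mem {i : Row m r} {y : ℕ} (hy : y ≤ 𝒮.len i) :
    𝒮.lo P i ≤ P (𝒮.node i.1 (𝒮.num i y)) ∧ P (𝒮.node i.1 (𝒮.num i y)) ≤ 𝒮.hi P i := by
  obtain ⟨-, -, h1, -⟩ := hP.node i y hy
  constructor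
  · by_contra hlt
    have h2 := hP.mono i (Nat.le_of_not_le hlt) (hP.pos_lt (Nat.zero_le _)).le
    obtain ⟨-, -, h3, -⟩ := hP.node i 0 (Nat.zero_le _)
    rw [lo] at h2 hlt
    have h4 : y = 0 := by omega
    subst h4
    exact hlt le_rfl
  · by_contra hlt
    have h2 := hP.mono i (Nat.le_of_not_le hlt) (hP.pos_lt hy).le
    obtain ⟨-, -, h3, -⟩ := hP.node i _ le_rfl
    rw [hi] at h2 hlt
    have h4 : y = 𝒮.len i := by omega
    subst h4
    exact hlt le_rfl

theorem lo_le_hi (i : Row m r) : 𝒮.lo P i ≤ 𝒮.hi P i := (hP.pos_mem (Nat.zero_le _)).2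

theorem hi_lt (i : Row m r) : 𝒮.hi P i < W.length := hP.pos_lt le_rfl

/-- The number of edges taken on the path of the machine, at a gap where it is active. -/
theorem exists_count (i : Row m r) {g : ℕ} (h1 : 𝒮.lo P i ≤ g) (h2 : g ≤ 𝒮.hi P i + 1) :
    ∃ y ≤ 𝒮.len i, τ g i = o i + y ∧ 𝒮.numAt τ o i g = 𝒮.num i y := by
  obtain ⟨-, -, h3, -⟩ := hP.node i 0 (Nat.zero_le _)
  obtain ⟨idx, h4, h5, -⟩ := hP.node i _ le_rfl
  have hhi := hP.hi_lt i
  have h6 := hP.mono i h1 (by omega)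
  have h7 := hP.mono i h2 (by omega)
  have h8 : τ (𝒮.hi P i + 1) i = τ (𝒮.hi P i) i := by
    rcases hP.letter _ _ h4 i with ⟨_, _, h⟩ | ⟨f, h, -⟩ | ⟨f, h, -⟩
    · exact h
    · cases h
    · cases h
  rw [lo] at h6
  rw [hi] at h7 h8
  refine ⟨τ g i - o i, by omega, by omega, rfl⟩

theorem numAt_pos {i : Row m r} {y : ℕ} (hy : y ≤ 𝒮.len i) :
    𝒮.numAt τ o i (P (𝒮.node i.1 (𝒮.num i y))) = 𝒮.num i y ∧
      𝒮.numAt τ o i (P (𝒮.node i.1 (𝒮.num i y)) + 1) = 𝒮.num i y := by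
  obtain ⟨idx, h1, h2, -⟩ := hP.node i y hy
  have h3 : τ (P (𝒮.node i.1 (𝒮.num i y)) + 1) i = τ (P (𝒮.node i.1 (𝒮.num i y))) i := by
    rcases hP.letter _ _ h1 i with ⟨_, _, h⟩ | ⟨f, h, -⟩ | ⟨f, h, -⟩
    · exact h
    · cases h
    · cases h
  rw [numAt, numAt, h3, h2, Nat.add_sub_cancel_left]
  exact ⟨rfl, rfl⟩

/-- Where a path ends, the next path begins. -/
theorem idx_nextRow {i : Row m r} {p : ℕ} {idx : Row m r → PathIndex m r}
    (hp : W[p]? = some (.node idx)) : idx (𝒮.rowAt P i (gapOut (segDir i.2) p)) = idx i ∨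
      ¬(𝒮.lo P i ≤ p ∧ p ≤ 𝒮.hi P i) := by
  rw [or_iff_not_imp_right, not_not]
  rintro ⟨h1, h2⟩
  rw [rowAt]
  split_ifs with h
  swap
  · rfl
  rw [nextRow]
  split_ifs with hr
  swap
  · rfl
  set i' : Row m r := (i.1, ⟨i.2.val + 1, hr⟩) with hi'
  have hle := bound_le_succ (𝒮 := 𝒮) i
  have hle' := bound_le_succ (𝒮 := 𝒮) i'
  have hdir := segDir_succ (h := i.2) (h' := i'.2) rfl
  -- the last node of the path of row `i` is the first one of the path of row `i'`
  obtain ⟨y, y', hy, hy', hyp, hyy⟩ : ∃ y y', y ≤ 𝒮.len i ∧ y' ≤ 𝒮.len i' ∧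
      p = P (𝒮.node i.1 (𝒮.num i y)) ∧ 𝒮.num i' y' = 𝒮.num i y := by
    rcases hdir with ⟨e1, e2⟩ | ⟨e1, e2⟩
    · simp only [e1, gapOut] at h
      refine ⟨𝒮.len i, 𝒮.len i', le_rfl, le_rfl, le_antisymm h2 (Nat.lt_succ_iff.1 h), ?_⟩
      simp only [num, e1, e2, len] at hle hle' ⊢
      change 𝒮.bound i.1 (i.2 + 1) ≤ _ at hle'
      change _ - (_ - 𝒮.bound i.1 (i.2 + 1)) = _
      omega
    · simp only [e1, gapOut] at h
      refine ⟨0, 0, Nat.zero_le _, Nat.zero_le _, le_antisymm h h1, ?_⟩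
      simp only [num, e1, e2]
      rfl
  obtain ⟨idx', h3, -, h4⟩ := hP.node i y hy
  rw [← hyp, hp, Option.some.injEq, TraceLetter.node.injEq] at h3
  subst h3
  exact h4 i' y' hy' (by rw [hyy])

/-- The cell at a position where the machine is active describes what the machine does there. -/
theorem eventOk {i : Row m r} {p : ℕ} {x : TraceLetter A m r k} (hp : W[p]? = some x)
    (h1 : 𝒮.lo P i ≤ p) (h2 : p ≤ 𝒮.hi P i) :
    𝒮.EventOk i.1 (gapIn (segDir i.2) p) i (𝒮.numAt τ o i (gapIn (segDir i.2) p))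
      (𝒮.numAt τ o i (gapOut (segDir i.2) p)) ⟨i.2, p, x, 𝒮.cell τ P o i p⟩ := by
  have hblock : (𝒮.cell τ P o i p).block =
    some (𝒮.block i.1 (𝒮.numAt τ o i (gapOut (segDir i.2) p))) := if_pos ⟨h1, h2⟩
  have hsteps : 𝒮.numAt τ o i (gapOut (segDir i.2) p) ≤ 𝒮.steps i.1 := by
    obtain ⟨y, hy, -, h3⟩ := hP.exists_count i (g := gapOut (segDir i.2) p)
      (by cases segDir i.2 <;> simp only [gapOut] <;> omega)
      (by cases segDir i.2 <;> simp only [gapOut] <;> omega)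
    rw [h3]
    exact num_le_steps hy
  have hstay : τ (p + 1) i = τ p i → 𝒮.numAt τ o i (gapOut (segDir i.2) p) =
      𝒮.numAt τ o i (gapIn (segDir i.2) p) := by
    intro h
    cases segDir i.2 <;> simp only [gapIn, gapOut, numAt, h]
  have hrow : ∀ f, x = .edge f → (𝒮.cell τ P o i p).row = i := by
    rintro f rfl
    change 𝒮.rowAt P i _ = i
    rw [rowAt, if_neg]
    obtain ⟨_, h3, -⟩ := hP.node i 0 (Nat.zero_le _)
    obtain ⟨_, h4, -⟩ := hP.node i _ le_rfl
    cases segDir i.2 <;> simp only [gapOut] <;> intro h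
    · have h5 : 𝒮.hi P i = p := by omega
      rw [hi] at h5
      rw [h5, hp] at h4
      cases h4
    · have h5 : 𝒮.lo P i = p := by omega
      rw [lo] at h5
      rw [h5, hp] at h3
      cases h3
  rcases hP.letter p x hp i with ⟨idx, rfl, h⟩ | ⟨f, rfl, h3, h⟩ | ⟨f, rfl, h, h3⟩
  · have hs := hstay h
    refine ⟨rfl, ⟨(hP.idx_nextRow hp).resolve_right (not_not.2 ⟨h1, h2⟩), congrArg _ hs⟩, rfl,
      hblock, hsteps, Or.inl hs, fun _ β => rfl, fun hb => absurd (congrArg _ hs) hb⟩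
  · have hs := hstay h
    refine ⟨rfl, ⟨hrow f rfl, ?_⟩, rfl, hblock, hsteps, Or.inl hs, fun _ β => ?_,
      fun hb => absurd (congrArg _ hs) hb⟩
    · simp only [h3]
      exact congrArg _ hs
    · simp only [Operates, hrow f rfl, h3]
  · have hne : p ≠ 𝒮.hi P i := by
      rintro rfl
      obtain ⟨_, h4, -⟩ := hP.node i _ le_rfl
      rw [hi] at hp
      rw [hp] at h4
      cases h4
    obtain ⟨y, hy, hτ, hnum⟩ := hP.exists_count i h1 (by omega)
    obtain ⟨y', hy', hτ', hnum'⟩ := hP.exists_count i (g := p + 1) (by omega) (by omega)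
    have hyy : y' = y + 1 := by omega
    subst hyy
    obtain ⟨e1, e2, e3⟩ := h3 y (by omega) hτ
    obtain ⟨b1, b2⟩ := moveNum_mem (𝒮 := 𝒮) (i := i) (y := y) (by omega)
    have hle := bound_le_succ (𝒮 := 𝒮) i
    have hs : 𝒮.numAt τ o i (gapIn (segDir i.2) p) = 𝒮.moveNum i y ∧
        𝒮.numAt τ o i (gapOut (segDir i.2) p) = 𝒮.moveNum i y + 1 ∧
        (f i).reg (segDir i.2) = id (𝒮.node i.1 (𝒮.moveNum i y)) := by
      unfold len at hy'
      unfold moveNum num TraceCell.reg at *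
      cases hd : segDir i.2 <;> simp only [hd, gapIn, gapOut] at e2 e3 hnum hnum' ⊢
      · exact ⟨hnum, hnum', e2⟩
      · have h5 : 𝒮.bound i.1 (i.2 + 1) - (y + 1) = 𝒮.bound i.1 (i.2 + 1) - 1 - y := by omega
        rw [h5] at hnum' e3
        exact ⟨hnum', hnum.trans (by omega), e3⟩
    obtain ⟨hin, hout, hreg⟩ := hs
    have hsteps' : 𝒮.moveNum i y < 𝒮.steps i.1 := by omega
    have htrans := 𝒮.trans i.1 i.2 _ b1 b2
    have hread : (𝒮.cell τ P o i p).read = 𝒮.read i.1 (𝒮.moveNum i y) := by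
      simp only [Schedule.cell, hin, hout, Nat.succ_ne_self, if_false]
    have hwrite : (𝒮.cell τ P o i p).write = 𝒮.write i.1 (𝒮.moveNum i y) := by
      simp only [Schedule.cell, hin, hout, Nat.succ_ne_self, if_false]
    have hstate : (𝒮.cell τ P o i p).state = 𝒮.state i.1 (𝒮.moveNum i y + 1) := congrArg _ hout
    have hsome : ∀ j, id (𝒮.node i.1 (𝒮.moveNum i y)) = some j → ∀ β β',
        Operates (segDir i.2) (.edge f) (𝒮.cell τ P o i p) β β' ↔
          𝒮.read i.1 (𝒮.moveNum i y) = β j ∧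
            β' = Function.update β j (𝒮.write i.1 (𝒮.moveNum i y)) := by
      intro j hj β β'
      rw [← hread, ← hwrite]
      simp only [Operates, hrow f rfl, e1, hreg, hj]
    refine ⟨rfl, ⟨hrow f rfl, ?_⟩, rfl, hblock, hsteps, Or.inr (by rw [hin, hout]), fun hb β => ?_,
      fun hb => ?_⟩
    · simp only [e1]
      rw [hin, hread, hwrite, hstate, hreg]
      exact ⟨htrans, fun h => ⟨(𝒮.silent _ _ hsteps' h).1, (𝒮.silent _ _ hsteps' h).2.1⟩⟩
    · rw [hin, hout] at hb
      cases hj : id (𝒮.node i.1 (𝒮.moveNum i y)) with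
      | none => simp only [Operates, hrow f rfl, e1, hreg, hj]
      | some j => exact absurd hb (𝒮.operation _ _ hsteps' j hj).1.ne'
    · rw [hin, hout] at hb
      cases hj : id (𝒮.node i.1 (𝒮.moveNum i y)) with
      | none => exact absurd (𝒮.silent _ _ hsteps' hj).2.2 hb
      | some j =>
        obtain ⟨-, h5, h6⟩ := 𝒮.operation _ _ hsteps' j hj
        rw [hout]
        exact (hsome j hj _ _).2 ⟨h5, h6⟩

omit hP in
theorem getElem?_word (p : ℕ) :
    (𝒮.word τ P o W)[p]? = W[p]?.map fun x => (x, fun i => 𝒮.cell τ P o i p) := by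
  rw [word, List.getElem?_mapIdx]

omit hP in
theorem length_word : (𝒮.word τ P o W).length = W.length := by
  rw [word, List.length_mapIdx]

omit hP in
theorem map_fst_word : (𝒮.word τ P o W).map Prod.fst = W := by
  refine List.ext_getElem? fun p => ?_
  rw [List.getElem?_map, getElem?_word, Option.map_map]
  exact Option.map_id'

end Placement

/-! ### The word of a schedule is accepted -/

namespace Placement

open Schedule

variable {A Q : Type*} {M : Machine A Q} {H : Graph A} {m r k : ℕ} {id : H.Node → Option (Fin k)}
  {𝒮 : Schedule M H m r id} {W : List (TraceLetter A m r k)} {τ : ℕ → Row m r → ℕ}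
  {P : H.Node → ℕ} {o : Row m r → ℕ} (hP : Placement 𝒮 W τ P o)
include hP

theorem mem_activeSet_word {n : Fin m} {h : Fin (r + 1)} {p : ℕ} :
    p ∈ activeSet (𝒮.word τ P o W) n h ↔ 𝒮.lo P (n, h) ≤ p ∧ p ≤ 𝒮.hi P (n, h) := by
  constructor
  · rintro ⟨x, hx, hb⟩
    rw [getElem?_word] at hx
    obtain ⟨a, -, rfl⟩ := Option.map_eq_some_iff.1 hx
    by_contra hne
    exact hb (if_neg hne)
  · rintro ⟨h1, h2⟩
    have h3 : p < W.length := h2.trans_lt (hP.hi_lt _)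
    refine ⟨_, by rw [getElem?_word, List.getElem?_eq_getElem h3]; rfl, ?_⟩
    change (𝒮.cell τ P o (n, h) p).block ≠ none
    rw [Schedule.cell, if_pos ⟨h1, h2⟩]
    exact Option.some_ne_none _

omit hP in
theorem pathEvents_word {n : Fin m} {h : Fin (r + 1)} {j : ℕ} {ev : Event A Q m r k}
    (hj : (pathEvents (𝒮.word τ P o W) n h)[j]? = some ev) :
    ∃ p x, W[p]? = some x ∧ ev = ⟨h, p, x, 𝒮.cell τ P o (n, h) p⟩ ∧
      gapIn (segDir h) p = gapAt (segDir h) W.length j ∧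
      gapOut (segDir h) p = gapAt (segDir h) W.length (j + 1) := by
  have hjL : j < (𝒮.word τ P o W).length := by
    rw [← length_pathEvents (n := n) (h := h)]
    exact (List.getElem?_eq_some_iff.1 hj).1
  obtain ⟨ev', e, h1, -, h3, h4, h5, h6, h7⟩ := pathEvents_spec (n := n) (h := h) hjL
  rw [hj] at h1
  cases h1
  rw [getElem?_word] at h3
  obtain ⟨x, hx, h8⟩ := Option.map_eq_some_iff.1 h3
  obtain ⟨path, p, letter, c⟩ := ev
  cases h8
  obtain rfl : path = h := h5
  rw [length_word] at h6 h7
  exact ⟨p, _, hx, congrArg (Event.mk path p letter) h4.symm, h6, h7⟩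

/-- Outside of the interval in which the machine is active, nothing changes. -/
theorem follows_path (i : Row m r) :
    𝒮.Follows i.1 (𝒮.ghost τ P o i (gapAt (segDir i.2) W.length 0))
      (activeOnly (pathEvents (𝒮.word τ P o W) i.1 i.2))
      (𝒮.ghost τ P o i (gapAt (segDir i.2) W.length W.length)) := by
  have h1 := follows_activeOnly (𝒮 := 𝒮) (n := i.1) (l := pathEvents (𝒮.word τ P o W) i.1 i.2)
    (fun j => 𝒮.ghost τ P o i (gapAt (segDir i.2) W.length j)) (by
    intro j ev hj
    obtain ⟨p, x, hx, rfl, h1, h2⟩ := pathEvents_word hj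
    have hlohi := hP.lo_le_hi i
    simp only [← h1, ← h2]
    by_cases hp : 𝒮.lo P i ≤ p ∧ p ≤ 𝒮.hi P i
    · refine Or.inr ⟨𝒮.numAt τ o i (gapOut (segDir i.2) p), ?_, ?_⟩
      · have h3 := hP.eventOk hx hp.1 hp.2
        have h4 : max (𝒮.lo P i) (min (gapIn (segDir i.2) p) (𝒮.hi P i + 1)) =
            gapIn (segDir i.2) p := by
          cases segDir i.2 <;> simp only [gapIn] <;> omega
        have h5 : 𝒮.rowAt P i (gapIn (segDir i.2) p) = i := by
          rw [rowAt, if_neg]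
          cases segDir i.2 <;> simp only [gapIn] <;> omega
        simp only [ghost, h4, h5]
        exact h3
      · have h4 : max (𝒮.lo P i) (min (gapOut (segDir i.2) p) (𝒮.hi P i + 1)) =
            gapOut (segDir i.2) p := by
          cases segDir i.2 <;> simp only [gapOut] <;> omega
        simp only [ghost, h4]
        rfl
    · refine Or.inl ⟨if_neg hp, ?_⟩
      have h4 : max (𝒮.lo P i) (min (gapOut (segDir i.2) p) (𝒮.hi P i + 1)) =
          max (𝒮.lo P i) (min (gapIn (segDir i.2) p) (𝒮.hi P i + 1)) := by
        cases segDir i.2 <;> simp only [gapIn, gapOut] <;> omega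
      have h5 : 𝒮.rowAt P i (gapOut (segDir i.2) p) = 𝒮.rowAt P i (gapIn (segDir i.2) p) := by
        rw [rowAt, rowAt]
        congr 1
        refine propext ?_
        cases segDir i.2 <;> simp only [gapIn, gapOut] <;> omega
      simp only [ghost, h4, h5])
  rwa [length_pathEvents, length_word] at h1

/-- Where the machine is at the beginning and at the end of a path. -/
theorem ghost_ends (i : Row m r) :
    𝒮.ghost τ P o i (gapAt (segDir i.2) W.length 0) =
      (gapIn (segDir i.2) (P (𝒮.node i.1 (𝒮.bound i.1 i.2))), i, 𝒮.bound i.1 i.2) ∧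
    𝒮.ghost τ P o i (gapAt (segDir i.2) W.length W.length) =
      (gapOut (segDir i.2) (P (𝒮.node i.1 (𝒮.bound i.1 (i.2 + 1)))), nextRow i,
        𝒮.bound i.1 (i.2 + 1)) := by
  have hlohi := hP.lo_le_hi i
  have hhi := hP.hi_lt i
  have hle := bound_le_succ (𝒮 := 𝒮) i
  obtain ⟨a1, -⟩ := hP.numAt_pos (i := i) (Nat.zero_le _)
  obtain ⟨-, b2⟩ := hP.numAt_pos (i := i) (le_refl (𝒮.len i))
  change 𝒮.numAt τ o i (𝒮.lo P i) = _ at a1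
  change 𝒮.numAt τ o i (𝒮.hi P i + 1) = _ at b2
  cases hd : segDir i.2 <;> simp only [gapAt, gapIn, gapOut, ghost]
  · have h0 : 𝒮.num i 0 = 𝒮.bound i.1 i.2 := by simp [num, hd]
    have h1 : 𝒮.num i (𝒮.len i) = 𝒮.bound i.1 (i.2 + 1) := by
      simp only [num, hd, len]
      omega
    have e1 : max (𝒮.lo P i) (min 0 (𝒮.hi P i + 1)) = 𝒮.lo P i := by omega
    have e2 : max (𝒮.lo P i) (min W.length (𝒮.hi P i + 1)) = 𝒮.hi P i + 1 := by omega
    have e3 : 𝒮.rowAt P i 0 = i := by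
      rw [rowAt, if_neg]
      simp [hd]
    have e4 : 𝒮.rowAt P i W.length = nextRow i := by
      rw [rowAt, if_pos]
      simpa [hd] using hhi
    rw [e1, e2, e3, e4, a1, b2, lo, hi, h0, h1]
    exact ⟨rfl, rfl⟩
  · have h0 : 𝒮.num i 0 = 𝒮.bound i.1 (i.2 + 1) := by simp [num, hd]
    have h1 : 𝒮.num i (𝒮.len i) = 𝒮.bound i.1 i.2 := by
      simp only [num, hd, len]
      omega
    have e1 : max (𝒮.lo P i) (min (W.length - 0) (𝒮.hi P i + 1)) = 𝒮.hi P i + 1 := by omega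
    have e2 : max (𝒮.lo P i) (min (W.length - W.length) (𝒮.hi P i + 1)) = 𝒮.lo P i := by omega
    have e3 : 𝒮.rowAt P i (W.length - 0) = i := by
      rw [rowAt, if_neg]
      simp only [hd]
      omega
    have e4 : 𝒮.rowAt P i (W.length - W.length) = nextRow i := by
      rw [rowAt, if_pos]
      simp [hd]
    rw [e1, e2, e3, e4, a1, b2, lo, hi, h0, h1]
    exact ⟨rfl, rfl⟩

theorem follows_events (n : Fin m) : ∃ z : ℕ × Row m r × ℕ,
    𝒮.Follows n (0, (n, 0), 0) (activeOnly (events (𝒮.word τ P o W) n)) z := by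
  have key : ∀ d (h : Fin (r + 1)), h.val + d = r → ∃ z, 𝒮.Follows n
      (gapIn (segDir h) (P (𝒮.node n (𝒮.bound n h))), (n, h), 𝒮.bound n h)
      (activeOnly (pathEvents (𝒮.word τ P o W) n h ++ laterEvents (𝒮.word τ P o W) n h)) z := by
    intro d
    induction d with
    | zero =>
      intro h hh
      have hlast : h = Fin.last r := Fin.ext (by simpa using hh)
      obtain ⟨h1, -⟩ := hP.ghost_ends (n, h)
      have h2 := hP.follows_path (n, h)
      rw [h1] at h2
      rw [hlast, laterEvents_last, List.append_nil, ← hlast]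
      exact ⟨_, h2⟩
    | succ d ih =>
      intro h hh
      have hlt : h.val + 1 < r + 1 := by omega
      obtain ⟨z, hz⟩ := ih ⟨h.val + 1, hlt⟩ (by simp only; omega)
      obtain ⟨h1, h1'⟩ := hP.ghost_ends (n, h)
      have h2 := hP.follows_path (n, h)
      rw [h1, h1'] at h2
      rw [laterEvents_eq (h := h) (h' := ⟨h.val + 1, hlt⟩) rfl, activeOnly_append]
      have h3 : nextRow (n, h) = (n, ⟨h.val + 1, hlt⟩) := dif_pos hlt
      have h4 : ∀ p, gapOut (segDir h) p = gapIn (segDir (⟨h.val + 1, hlt⟩ : Fin (r + 1))) p := by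
        intro p
        rcases segDir_succ (h := h) (h' := ⟨h.val + 1, hlt⟩) rfl with ⟨e1, e2⟩ | ⟨e1, e2⟩ <;>
          rw [e1, e2] <;> rfl
      rw [h3, h4] at h2
      exact ⟨z, h2.append hz⟩
  obtain ⟨z, hz⟩ := key r 0 (by simp)
  rw [← events_eq] at hz
  simp only [Fin.val_zero, 𝒮.bound_zero, 𝒮.node_zero, hP.source, segDir_zero, gapIn] at hz
  exact ⟨z, hz⟩

theorem word_mem_execTwoNFA (n : Fin m) :
    𝒮.word τ P o W ∈ (execTwoNFA M r k n).language := by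
  obtain ⟨z, hz⟩ := hP.follows_events n
  have h1 := hz.trackChain
  simp only [𝒮.state_zero] at h1
  refine mem_language_execTwoNFA (fun h => ?_) h1
  have h2 : activeSet (𝒮.word τ P o W) n h = Set.Icc (𝒮.lo P (n, h)) (𝒮.hi P (n, h)) :=
    Set.ext fun p => hP.mem_activeSet_word
  rw [h2]
  exact ⟨Set.nonempty_Icc.2 (hP.lo_le_hi _), Set.ordConnected_Icc⟩

/-- At the node letter where a machine is after `s` moves, its block is the one after `s` moves. -/
theorem ofBlock_word_ne_nil {n : Fin m} {s : ℕ} (hs : s ≤ 𝒮.steps n) :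
    ofBlock (𝒮.block n s) (activeOnly (events (𝒮.word τ P o W) n)) ≠ [] := by
  classical
  obtain ⟨h, h1, h2⟩ : ∃ h : Fin (r + 1), 𝒮.bound n h ≤ s ∧ s ≤ 𝒮.bound n (h + 1) := by
    have hex : ∃ h, s ≤ 𝒮.bound n (h + 1) := ⟨r, by rwa [𝒮.bound_last]⟩
    refine ⟨⟨Nat.find hex, Nat.lt_succ_of_le (Nat.find_min' hex (by rwa [𝒮.bound_last]))⟩, ?_,
      Nat.find_spec hex⟩
    change 𝒮.bound n (Nat.find hex) ≤ s
    rcases h3 : Nat.find hex with _ | h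
    · rw [𝒮.bound_zero]
      exact Nat.zero_le _
    · exact (lt_of_not_ge (Nat.find_min hex (m := h) (by omega))).le
  obtain ⟨y, hy, hys⟩ : ∃ y ≤ 𝒮.len (n, h), 𝒮.num (n, h) y = s := by
    simp only [len, num]
    cases segDir h
    · exact ⟨s - 𝒮.bound n h, by omega, by simp only; omega⟩
    · exact ⟨𝒮.bound n (h + 1) - s, by omega, by simp only; omega⟩
  obtain ⟨h3, h4⟩ := hP.pos_mem hy
  obtain ⟨a1, a2⟩ := hP.numAt_pos hy
  have hlt := hP.pos_lt hy
  simp only [hys] at h3 h4 a1 a2 hlt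
  set p := P (𝒮.node n s)
  have hget : (𝒮.word τ P o W)[p]? = some (W[p], fun i => 𝒮.cell τ P o i p) := by
    rw [getElem?_word, List.getElem?_eq_getElem hlt]
    rfl
  have hblock : (𝒮.cell τ P o (n, h) p).block = some (𝒮.block n s) := by
    rw [Schedule.cell, if_pos ⟨h3, h4⟩]
    simp only
    cases segDir h <;> simp only [gapOut, a1, a2]
  refine ofBlock_ne_nil.2 ⟨⟨h, p, W[p], 𝒮.cell τ P o (n, h) p⟩, List.mem_filter.2 ⟨?_, ?_⟩, hblock⟩
  · refine List.mem_flatMap.2 ⟨h, List.mem_finRange h, ?_⟩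
    have h5 : (⟨h, p, W[p], 𝒮.cell τ P o (n, h) p⟩ : Event A Q m r k) ∈
        (𝒮.word τ P o W).zipIdx.map fun x =>
          (⟨h, x.2, x.1.1, x.1.2 (n, h)⟩ : Event A Q m r k) :=
      List.mem_map.2 ⟨(_, p), List.mem_zipIdx_iff_getElem?.2 hget, rfl⟩
    rw [pathEvents]
    cases segDir h
    · exact h5
    · exact List.mem_reverse.2 h5
  · rw [hblock]
    rfl

theorem word_mem_rwTwoNFA : 𝒮.word τ P o W ∈ (rwTwoNFA A Q m r k).language := by
  rw [mem_language_rwTwoNFA]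
  have hE := hP.follows_events
  have hmem : ∀ n b, ofBlock b (activeOnly (events (𝒮.word τ P o W) n)) ≠ [] →
      ∃ s ≤ 𝒮.steps n, 𝒮.block n s = b := by
    intro n b hb
    obtain ⟨z, hz⟩ := hE n
    obtain ⟨ev, hev, hevb⟩ := ofBlock_ne_nil.1 hb
    obtain ⟨s, h1, h2, -⟩ := hz.exists_block hev
    exact ⟨s, h1, by rw [h2] at hevb; simpa using hevb⟩
  refine BlocksConsistent.rwRest (V := 𝒮.pre) (V' := 𝒮.post) ⟨fun n => ?_, ?_, ?_, ?_⟩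
  · obtain ⟨z, hz⟩ := hE n
    exact hz.blocksSorted
  · intro n n' b h h'
    obtain ⟨s, h1, h2⟩ := hmem n b h
    obtain ⟨s', h3, h4⟩ := hmem n' b h'
    exact 𝒮.owner n s n' s' h1 h3 (h2.trans h4.symm)
  · intro n b hb
    obtain ⟨z, hz⟩ := hE n
    by_cases h : 𝒮.block n 0 = b
    · have h1 := (hz.opsChain b).1 h
      have h2 := 𝒮.first n
      rw [h] at h2
      rwa [h2] at h1 ⊢
    · exact (hz.opsChain b).2 h hb
  · intro n b hb
    obtain ⟨s, h1, rfl⟩ := hmem n b hb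
    refine (𝒮.discharged n s h1).imp_right ?_
    rintro ⟨n', s', h2, h3, h4⟩
    exact ⟨_, n', h3, hP.ofBlock_word_ne_nil h2, h4⟩

omit hP in
theorem not_active_word {n : Fin m} {h : Fin (r + 1)} {g : ℕ} {c : Marked (Letter A Q m r k)}
    (hc : (Marked.wrap (𝒮.word τ P o W))[g]? = some c)
    (hg : ∀ p, g = p + 1 → p ∉ activeSet (𝒮.word τ P o W) n h) : ¬Active n h c := by
  rcases g with _ | g
  · rw [wrap_getElem?_zero] at hc
    cases hc
    exact fun h => h
  · rw [wrap_getElem?_letter] at hc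
    split_ifs at hc
    · obtain ⟨x, hx, rfl⟩ := Option.map_eq_some_iff.1 hc
      exact fun hb => hg g rfl ⟨x, hx, hb⟩
    · cases hc
      exact fun h => h

/-- The machines that are finally at the same node end their last paths around the letter where the
rows that visit this node meet. -/
theorem exists_nodeProperty {S : Q → ℕ} {x : H.Node} (hS : ∀ q, S q ≤
      {n | 𝒮.node n (𝒮.steps n) = x ∧ 𝒮.state n (𝒮.steps n) = q}.ncard) :
    ∃ i c' c'', (Marked.wrap (𝒮.word τ P o W))[i]? = some c' ∧
      (Marked.wrap (𝒮.word τ P o W))[i + 1]? = some c'' ∧ NodeProperty S c' c'' := by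
  have hletter : ∀ p (hp : p < W.length), (Marked.wrap (𝒮.word τ P o W))[p + 1]? =
      some (.letter (W[p], fun i => 𝒮.cell τ P o i p)) := by
    intro p hp
    rw [wrap_getElem?_letter, length_word, if_pos hp, getElem?_word, List.getElem?_eq_getElem hp]
    rfl
  by_cases hN : ∃ n, 𝒮.node n (𝒮.steps n) = x
  · obtain ⟨n₀, rfl⟩ := hN
    -- the count of edges at the end of the last path
    obtain ⟨y, hy, hnum⟩ : ∃ y : Fin m → ℕ, (∀ n, y n ≤ 𝒮.len (n, Fin.last r)) ∧
        ∀ n, 𝒮.num (n, Fin.last r) (y n) = 𝒮.steps n := by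
      refine ⟨fun n => match segDir (Fin.last r) with
        | .fwd => 𝒮.len (n, Fin.last r)
        | .bwd => 0, fun n => ?_, fun n => ?_⟩
      · cases segDir (Fin.last r)
        · exact le_rfl
        · exact Nat.zero_le _
      · have h1 := bound_le_succ (𝒮 := 𝒮) (n, Fin.last r)
        simp only [num, len, Fin.val_last, 𝒮.bound_last] at h1 ⊢
        cases segDir (Fin.last r) <;> simp only <;> omega
    set p := P (𝒮.node n₀ (𝒮.steps n₀)) with hpdef
    obtain ⟨idx, hp, -, hidx⟩ := hP.node (n₀, Fin.last r) (y n₀) (hy n₀)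
    rw [hnum, ← hpdef] at hp
    have hpW : p < W.length := (List.getElem?_eq_some_iff.1 hp).1
    have hmeet : ∀ n, 𝒮.node n (𝒮.steps n) = 𝒮.node n₀ (𝒮.steps n₀) →
        idx (n, Fin.last r) = idx (n₀, Fin.last r) := by
      intro n hn
      refine hidx (n, Fin.last r) (y n) (hy n) ?_
      rw [hnum, hnum]
      exact hn
    have hcell : ∀ n, 𝒮.node n (𝒮.steps n) = 𝒮.node n₀ (𝒮.steps n₀) →
        p ∈ activeSet (𝒮.word τ P o W) n (Fin.last r) ∧
        (𝒮.cell τ P o (n, Fin.last r) p).block ≠ none ∧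
        (𝒮.cell τ P o (n, Fin.last r) p).row = (n, Fin.last r) ∧
        (𝒮.cell τ P o (n, Fin.last r) p).state = 𝒮.state n (𝒮.steps n) := by
      intro n hn
      have h1 := hP.pos_mem (hy n)
      obtain ⟨a1, a2⟩ := hP.numAt_pos (hy n)
      simp only [hnum] at h1 a1 a2
      rw [hn, ← hpdef] at h1 a1 a2
      refine ⟨hP.mem_activeSet_word.2 h1, ?_, ?_, ?_⟩
      · rw [Schedule.cell, if_pos h1]
        exact Option.some_ne_none _
      · change 𝒮.rowAt P _ _ = _
        rw [rowAt]
        split_ifs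
        · exact dif_neg (by simp)
        · rfl
      · change 𝒮.state n _ = _
        cases segDir (Fin.last r) <;> simp only [gapOut, a1, a2]
    have hends : ∀ n, 𝒮.node n (𝒮.steps n) = 𝒮.node n₀ (𝒮.steps n₀) →
        p = match segDir (Fin.last r) with
          | .fwd => 𝒮.hi P (n, Fin.last r)
          | .bwd => 𝒮.lo P (n, Fin.last r) := by
      intro n hn
      have h1 := bound_le_succ (𝒮 := 𝒮) (n, Fin.last r)
      rw [hpdef, ← hn]
      simp only [lo, hi, num, len, Fin.val_last, 𝒮.bound_last] at h1 ⊢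
      cases segDir (Fin.last r) <;> simp only [Nat.sub_zero]
      congr 2
      omega
    have hW : (W[p], fun i => 𝒮.cell τ P o i p) = ((.node idx, fun i => 𝒮.cell τ P o i p) :
        Letter A Q m r k) := by
      rw [(List.getElem?_eq_some_iff.1 hp).2]
    have hmeet' : (TraceLetter.node idx : TraceLetter A m r k).Meet
        ((fun n => (n, Fin.last r)) '' {n | 𝒮.node n (𝒮.steps n) = 𝒮.node n₀ (𝒮.steps n₀)}) := by
      rintro _ ⟨n, hn, rfl⟩ _ ⟨n', hn', rfl⟩
      exact (hmeet n hn).trans (hmeet n' hn').symm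
    cases hd : segDir (Fin.last r) <;> simp only [hd] at hends
    · obtain ⟨c'', hc''⟩ : ∃ c'', (Marked.wrap (𝒮.word τ P o W))[p + 1 + 1]? = some c'' :=
        ⟨_, List.getElem?_eq_getElem (by rw [length_wrap, length_word]; omega)⟩
      refine ⟨p + 1, _, c'', hletter p hpW, hc'', _, fun n => (n, Fin.last r), fun n => 𝒮.state n
        (𝒮.steps n),
        fun n hn => ?_, hS, _, Or.inl rfl, by rw [hW]; exact hmeet'⟩
      obtain ⟨-, h2, h3, h4⟩ := hcell n hn
      simp only [EndsBetween, hd]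
      refine ⟨not_active_word hc'' ?_, _, rfl, h2, h3, h4⟩
      rintro q hq hact
      have h5 := (hP.mem_activeSet_word.1 hact).2
      rw [← hends n hn] at h5
      omega
    · obtain ⟨c', hc'⟩ : ∃ c', (Marked.wrap (𝒮.word τ P o W))[p]? = some c' :=
        ⟨_, List.getElem?_eq_getElem (by rw [length_wrap, length_word]; omega)⟩
      refine ⟨p, c', _, hc', hletter p hpW, _, fun n => (n, Fin.last r), fun n => 𝒮.state n
        (𝒮.steps n),
        fun n hn => ?_, hS, _, Or.inr rfl, by rw [hW]; exact hmeet'⟩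
      obtain ⟨-, h2, h3, h4⟩ := hcell n hn
      simp only [EndsBetween, hd]
      refine ⟨not_active_word hc' ?_, _, rfl, h2, h3, h4⟩
      rintro q hq hact
      have h5 := (hP.mem_activeSet_word.1 hact).1
      rw [← hends n hn] at h5
      omega
  · -- no machine is at `x`, so that nothing is required
    have hS0 : ∀ q, S q = 0 := by
      intro q
      have h1 := hS q
      have h2 : {n | 𝒮.node n (𝒮.steps n) = x ∧ 𝒮.state n (𝒮.steps n) = q} = ∅ :=
        Set.eq_empty_of_forall_notMem fun n hn => hN ⟨n, hn.1⟩
      rw [h2, Set.ncard_empty] at h1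
      omega
    refine ⟨0, _, _, wrap_getElem?_zero _, hletter 0 hP.length_pos, ∅, fun n => (n, 0),
      fun _ => M.start, by simp, fun q => by rw [hS0]; exact Nat.zero_le _, _, Or.inr rfl, ?_⟩
    rw [Set.image_empty]
    cases W[0]'hP.length_pos <;> simp [TraceLetter.Meet]

end Placement

/-! ### The schedule of a run -/

open Classical in
/-- The number of times before `t` at which `p` holds. -/
noncomputable def countBefore (p : ℕ → Prop) (t : ℕ) : ℕ := Nat.count p t

theorem countBefore_succ_of_pos {p : ℕ → Prop} {t : ℕ} (h : p t) :
    countBefore p (t + 1) = countBefore p t + 1 := by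
  classical
  rw [countBefore, Nat.count_succ, if_pos h, countBefore]

theorem countBefore_succ_of_neg {p : ℕ → Prop} {t : ℕ} (h : ¬p t) :
    countBefore p (t + 1) = countBefore p t := by
  classical
  rw [countBefore, Nat.count_succ, if_neg h, countBefore, Nat.add_zero]

theorem countBefore_zero (p : ℕ → Prop) : countBefore p 0 = 0 := by
  classical exact Nat.count_zero _

theorem countBefore_mono (p : ℕ → Prop) {t t' : ℕ} (h : t ≤ t') :
    countBefore p t ≤ countBefore p t' := by
  classical exact Nat.count_monotone _ h

theorem countBefore_lt {p : ℕ → Prop} {t t' : ℕ} (h : p t) (ht : t < t') :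
    countBefore p t < countBefore p t' := by
  classical exact Nat.count_strict_mono h ht

theorem countBefore_inj {p : ℕ → Prop} {t t' : ℕ} (h : p t) (h' : p t')
    (ht : countBefore p t = countBefore p t') : t = t' := by
  classical exact Nat.count_injective h h' ht

theorem exists_of_lt_countBefore {p : ℕ → Prop} {T s : ℕ} (h : s < countBefore p T) :
    ∃ t < T, p t ∧ countBefore p t = s := by
  induction T with
  | zero =>
    rw [countBefore_zero] at h
    omega
  | succ T ih =>
    by_cases hs : s < countBefore p T
    · obtain ⟨t, h1, h2⟩ := ih hs
      exact ⟨t, by omega, h2⟩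
    · by_cases hT : p T
      · rw [countBefore_succ_of_pos hT] at h
        exact ⟨T, Nat.lt_succ_self T, hT, by omega⟩
      · rw [countBefore_succ_of_neg hT] at h
        exact absurd h hs

open Classical in
/-- The time before `T` at which `p` holds for the time number `s`, or `T` if there is none. -/
noncomputable def timeOf (p : ℕ → Prop) (T s : ℕ) : ℕ :=
  if h : ∃ t < T, p t ∧ countBefore p t = s then h.choose else T

theorem timeOf_spec {p : ℕ → Prop} {T s : ℕ} (h : s < countBefore p T) :
    timeOf p T s < T ∧ p (timeOf p T s) ∧ countBefore p (timeOf p T s) = s := by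
  have h1 := exists_of_lt_countBefore h
  rw [timeOf, dif_pos h1]
  exact h1.choose_spec

theorem timeOf_countBefore {p : ℕ → Prop} {T t : ℕ} (h : p t) (ht : t < T) :
    timeOf p T (countBefore p t) = t := by
  obtain ⟨-, h2, h3⟩ := timeOf_spec (countBefore_lt h ht)
  exact countBefore_inj h2 h h3

/-- What changes only at the times at which `p` holds is determined by the number of these times. -/
theorem eq_timeOf {α : Type*} {p : ℕ → Prop} {T : ℕ} {f : ℕ → α}
    (hf : ∀ t < T, ¬p t → f (t + 1) = f t) {t : ℕ} (ht : t ≤ T) :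
    f (timeOf p T (countBefore p t)) = f t := by
  have key : ∀ t', t ≤ t' → t' ≤ T → countBefore p t' = countBefore p t → f t' = f t := by
    intro t' htt'
    induction t', htt' using Nat.le_induction with
    | base => exact fun _ _ => rfl
    | succ t' htt' ih =>
      intro hT hc
      have h1 := countBefore_mono p htt'
      by_cases hp : p t'
      · rw [countBefore_succ_of_pos hp] at hc
        omega
      · rw [countBefore_succ_of_neg hp] at hc
        rw [hf t' (by omega) hp]
        exact ih (by omega) hc
  rcases (countBefore_mono p ht).lt_or_eq with h | h
  · obtain ⟨h1, h2, h3⟩ := timeOf_spec h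
    have h4 : t ≤ timeOf p T (countBefore p t) := by
      by_contra hlt
      have := countBefore_lt h2 (Nat.lt_of_not_le hlt)
      omega
    exact key _ h4 h1.le h3
  · have h1 : timeOf p T (countBefore p t) = T := by
      rw [timeOf, dif_neg]
      rintro ⟨t', h2, h3, h4⟩
      have := countBefore_lt h3 h2
      omega
    rw [h1]
    exact key T ht le_rfl h.symm

theorem timeOf_zero {p : ℕ → Prop} {T : ℕ} {α : Type*} {f : ℕ → α}
    (hf : ∀ t < T, ¬p t → f (t + 1) = f t) : f (timeOf p T 0) = f 0 := by
  rw [← countBefore_zero p]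
  exact eq_timeOf hf (Nat.zero_le T)

/-- A run on the symmetric closure of `H`, in which every edge is replaced by the edge of `H` from
which it comes. Machine `n` moves at the times `t` with `mover n t`. -/
structure Timeline {A Q : Type*} (M : Machine A Q) (H : Graph A) (κ : H.Node → Bool) (m : ℕ) where
  T : ℕ
  mover : Fin m → ℕ → Prop
  edge : ℕ → H.Node × H.Node × A
  dir : ℕ → Dir
  loc : ℕ → Fin m → H.Node
  st : ℕ → Fin m → Q
  β : ℕ → H.Node → Bool
  write : ℕ → Bool
  loc_zero : ∀ n, loc 0 n = H.source
  st_zero : ∀ n, st 0 n = M.start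
  β_zero : ∀ x, β 0 x = false
  lt : ∀ n t, mover n t → t < T
  exists_mover : ∀ t < T, ∃ n, mover n t
  unique : ∀ n n' t, mover n t → mover n' t → n = n'
  edge_mem : ∀ n t, mover n t → edge t ∈ H.edges
  edge_nodes : ∀ n t, mover n t → match dir t with
    | .fwd => (edge t).1 = loc t n ∧ (edge t).2.1 = loc (t + 1) n
    | .bwd => (edge t).1 = loc (t + 1) n ∧ (edge t).2.1 = loc t n
  trans : ∀ n t, mover n t → (st t n, ((edge t).2.2, dir t), κ (loc t n) && β t (loc t n),
    st (t + 1) n, write t) ∈ M.δ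
  silent : ∀ n t, mover n t → κ (loc t n) = false → write t = false
  other : ∀ n n' t, mover n t → n' ≠ n → loc (t + 1) n' = loc t n' ∧ st (t + 1) n' = st t n'
  register : ∀ n t, mover n t → β (t + 1) (loc t n) = write t
  register_other : ∀ n t x, mover n t → x ≠ loc t n → β (t + 1) x = β t x

namespace Timeline

variable {A Q : Type*} {M : Machine A Q} {H : Graph A} {κ : H.Node → Bool} {m : ℕ}
  (𝒯 : Timeline M H κ m)

/-- The number of moves of machine `n`. -/
noncomputable def steps (n : Fin m) : ℕ := countBefore (𝒯.mover n) 𝒯.T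

/-- The time of the move number `s` of machine `n`. -/
noncomputable def time (n : Fin m) (s : ℕ) : ℕ := timeOf (𝒯.mover n) 𝒯.T s

/-- The node at which machine `n` is after `s` moves. -/
noncomputable def node (n : Fin m) (s : ℕ) : H.Node := 𝒯.loc (𝒯.time n s) n

/-- The state of machine `n` after `s` moves. -/
noncomputable def state (n : Fin m) (s : ℕ) : Q := 𝒯.st (𝒯.time n s) n

/-- At time `t`, a register is read and written. -/
def op (t : ℕ) : Prop := ∃ n, 𝒯.mover n t ∧ κ (𝒯.loc t n) = true

open Classical in
/-- The block of machine `n` after `s` moves: the initial one, whose number is `n`, or, for the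
last operation of the machine, which is the operation number `c` of the run, the one with the number
`m + c`. -/
noncomputable def block (n : Fin m) : ℕ → ℕ
  | 0 => n
  | s + 1 => if κ (𝒯.node n s) = true then m + countBefore 𝒯.op (𝒯.time n s) else block n s

open Classical in
/-- The valuation of the registers at time `t`. -/
noncomputable def val {k : ℕ} (id : H.Node → Option (Fin k)) (t : ℕ) : Valuation k :=
  fun j => decide (∃ x, id x = some j ∧ 𝒯.β t x = true)

/-- The valuation after `c` operations. -/
noncomputable def valOf {k : ℕ} (id : H.Node → Option (Fin k)) (c : ℕ) : Valuation k :=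
  𝒯.val id (timeOf 𝒯.op 𝒯.T c)

variable {𝒯} {n : Fin m}

theorem unchanged {t : ℕ} (ht : t < 𝒯.T) (hn : ¬𝒯.mover n t) :
    𝒯.loc (t + 1) n = 𝒯.loc t n ∧ 𝒯.st (t + 1) n = 𝒯.st t n := by
  obtain ⟨n', hn'⟩ := 𝒯.exists_mover t ht
  refine 𝒯.other n' n t hn' ?_
  rintro rfl
  exact hn hn'

theorem node_countBefore {t : ℕ} (ht : t ≤ 𝒯.T) :
    𝒯.node n (countBefore (𝒯.mover n) t) = 𝒯.loc t n ∧
      𝒯.state n (countBefore (𝒯.mover n) t) = 𝒯.st t n :=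
  ⟨eq_timeOf (f := fun t => 𝒯.loc t n) (fun _ h1 h2 => (unchanged h1 h2).1) ht,
    eq_timeOf (f := fun t => 𝒯.st t n) (fun _ h1 h2 => (unchanged h1 h2).2) ht⟩

theorem time_spec {s : ℕ} (hs : s < 𝒯.steps n) : 𝒯.time n s < 𝒯.T ∧ 𝒯.mover n (𝒯.time n s) ∧
    countBefore (𝒯.mover n) (𝒯.time n s) = s := timeOf_spec hs

theorem node_succ {s : ℕ} (hs : s < 𝒯.steps n) :
    𝒯.node n (s + 1) = 𝒯.loc (𝒯.time n s + 1) n ∧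
      𝒯.state n (s + 1) = 𝒯.st (𝒯.time n s + 1) n := by
  obtain ⟨h1, h2, h3⟩ := time_spec hs
  have h4 := node_countBefore (𝒯 := 𝒯) (n := n) (t := 𝒯.time n s + 1) h1
  rwa [countBefore_succ_of_pos h2, h3] at h4

theorem exists_of_mover {t : ℕ} (ht : 𝒯.mover n t) : ∃ s < 𝒯.steps n, 𝒯.time n s = t :=
  ⟨countBefore (𝒯.mover n) t, countBefore_lt ht (𝒯.lt n t ht),
    timeOf_countBefore ht (𝒯.lt n t ht)⟩

/-- A block is either initial or that of an operation of its machine. -/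
theorem block_spec (n : Fin m) {s : ℕ} (hs : s ≤ 𝒯.steps n) : 𝒯.block n s = n ∨
    ∃ s' < s, κ (𝒯.node n s') = true ∧
      𝒯.block n s = m + countBefore 𝒯.op (𝒯.time n s') := by
  induction s with
  | zero => exact Or.inl rfl
  | succ s ih =>
    rw [block]
    split_ifs with hκ
    · exact Or.inr ⟨s, Nat.lt_succ_self s, hκ, rfl⟩
    · refine (ih (by omega)).imp_right ?_
      rintro ⟨s', h1, h2⟩
      exact ⟨s', by omega, h2⟩

theorem op_time {s : ℕ} (hs : s < 𝒯.steps n) (hκ : κ (𝒯.node n s) = true) :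
    𝒯.op (𝒯.time n s) := ⟨n, (time_spec hs).2.1, hκ⟩

theorem block_lt_succ {s : ℕ} (hs : s < 𝒯.steps n) (hκ : κ (𝒯.node n s) = true) :
    𝒯.block n s < 𝒯.block n (s + 1) := by
  rw [block, if_pos hκ]
  rcases block_spec n hs.le with h | ⟨s', h1, h2, h3⟩
  · rw [h]
    omega
  · rw [h3]
    refine Nat.add_lt_add_left (countBefore_lt (op_time (by omega) h2) ?_) m
    by_contra hlt
    have h4 := countBefore_mono (𝒯.mover n) (Nat.le_of_not_lt hlt)
    rw [(time_spec hs).2.2, (time_spec (h1.trans hs)).2.2] at h4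
    omega

theorem block_owner {n' : Fin m} {s s' : ℕ} (hs : s ≤ 𝒯.steps n) (hs' : s' ≤ 𝒯.steps n')
    (h : 𝒯.block n s = 𝒯.block n' s') : n = n' := by
  have hn := n.isLt
  have hn' := n'.isLt
  rcases block_spec n hs with h1 | ⟨u, h1, h2, h3⟩ <;>
    rcases block_spec n' hs' with h4 | ⟨u', h4, h5, h6⟩
  · exact Fin.ext (by omega)
  · omega
  · omega
  · have h7 := countBefore_inj (op_time (by omega) h2) (op_time (by omega) h5) (by omega)
    have h8 := (time_spec (𝒯 := 𝒯) (n := n) (s := u) (by omega)).2.1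
    rw [h7] at h8
    exact 𝒯.unique n n' _ h8 (time_spec (by omega)).2.1

section Registers

variable {k : ℕ} {id : H.Node → Option (Fin k)} (hid : ∀ x y j, id x = some j → id y = some j → x =
    y)
  (hκ : ∀ x, id x = none ↔ κ x = false)
include hid

theorem val_of {x : H.Node} {j : Fin k} (hx : id x = some j) (t : ℕ) : 𝒯.val id t j = 𝒯.β t x := by
  classical
  cases h : 𝒯.β t x
  · refine decide_eq_false ?_
    rintro ⟨y, h1, h2⟩
    rw [hid y x j h1 hx, h] at h2
    cases h2
  · exact decide_eq_true ⟨x, hx, h⟩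

theorem val_update {t : ℕ} (hn : 𝒯.mover n t) {j : Fin k} (hj : id (𝒯.loc t n) = some j) :
    𝒯.val id (t + 1) = Function.update (𝒯.val id t) j (𝒯.write t) := by
  funext j'
  by_cases hjj : j' = j
  · subst hjj
    rw [Function.update_self, val_of hid hj, 𝒯.register n t hn]
  · rw [Function.update_of_ne hjj]
    refine decide_eq_decide.2 (exists_congr fun x => and_congr_right fun hx => ?_)
    rw [𝒯.register_other n t x hn]
    rintro rfl
    rw [hj, Option.some.injEq] at hx
    exact hjj hx.symm

omit hid in
include hκ in
theorem val_unchanged {t : ℕ} (ht : t < 𝒯.T) (hop : ¬𝒯.op t) : 𝒯.val id (t + 1) = 𝒯.val id t := by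
  obtain ⟨n, hn⟩ := 𝒯.exists_mover t ht
  funext j
  refine decide_eq_decide.2 (exists_congr fun x => and_congr_right fun hx => ?_)
  rw [𝒯.register_other n t x hn]
  rintro rfl
  refine hop ⟨n, hn, ?_⟩
  by_contra h
  rw [(hκ _).2 (by simpa using h)] at hx
  cases hx

omit hid in
include hκ in
theorem valOf_countBefore {t : ℕ} (ht : t ≤ 𝒯.T) :
    𝒯.valOf id (countBefore 𝒯.op t) = 𝒯.val id t :=
  eq_timeOf (f := 𝒯.val id) (fun _ h1 h2 => val_unchanged hκ h1 h2) ht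

omit hid in
include hκ in
theorem valOf_zero : 𝒯.valOf id 0 = fun _ => false := by
  rw [valOf, timeOf_zero (f := 𝒯.val id) fun _ h1 h2 => val_unchanged hκ h1 h2]
  funext j
  rw [val, decide_eq_false_iff_not]
  rintro ⟨x, -, h⟩
  rw [𝒯.β_zero] at h
  cases h

end Registers

section Paths

variable {r : ℕ} {f : Fin m → ℕ → ℕ} (hmono : ∀ n, Monotone (f n))
  (hle : ∀ n s, s < 𝒯.steps n → f n s ≤ r)
  (hdir : ∀ n s, s < 𝒯.steps n → 𝒯.dir (𝒯.time n s) = if f n s % 2 = 0 then .fwd else .bwd)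
  {rank : H.Node → ℕ} (hrank : ∀ e ∈ H.edges, rank e.1 < rank e.2.1)
include hmono hdir hrank

/-- No node is visited twice on a path. -/
theorem node_ne_on_path {s s' : ℕ} (hss : s < s') (hs' : s' < 𝒯.steps n) (hf : f n s = f n s') :
    𝒯.node n s ≠ 𝒯.node n s' := by
  have key : ∀ u, s ≤ u → u ≤ s' → match (if f n s % 2 = 0 then Dir.fwd else .bwd) with
      | .fwd => rank (𝒯.node n s) + u ≤ rank (𝒯.node n u) + s
      | .bwd => rank (𝒯.node n u) + u ≤ rank (𝒯.node n s) + s := by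
    intro u hu
    induction u, hu using Nat.le_induction with
    | base =>
      intro _
      cases (if f n s % 2 = 0 then Dir.fwd else .bwd) <;> exact le_rfl
    | succ u hu ih =>
      intro hus
      have h1 := ih (by omega)
      have hus' : u < 𝒯.steps n := by omega
      have hfu : f n u = f n s :=
        le_antisymm ((hmono n (show u ≤ s' by omega)).trans hf.ge) (hmono n hu)
      obtain ⟨-, h2, -⟩ := time_spec hus'
      have h3 := 𝒯.edge_nodes n _ h2
      have h4 := hrank _ (𝒯.edge_mem n _ h2)
      rw [hdir n u hus', hfu, ← (node_succ hus').1] at h3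
      change match (if f n s % 2 = 0 then Dir.fwd else .bwd) with
        | .fwd => (𝒯.edge _).1 = 𝒯.node n u ∧ _
        | .bwd => _ ∧ (𝒯.edge _).2.1 = 𝒯.node n u at h3
      revert h1 h3
      cases (if f n s % 2 = 0 then Dir.fwd else .bwd) <;> simp only <;> rintro h1 ⟨h5, h6⟩ <;>
        rw [h5, h6] at h4 <;> omega
  intro heq
  have h1 := key s' hss.le le_rfl
  rw [heq] at h1
  revert h1
  cases (if f n s % 2 = 0 then Dir.fwd else .bwd) <;> simp only <;> omega

include hle in
theorem countBefore_op_le {k : ℕ} {id : H.Node → Option (Fin k)}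
    (hid : ∀ x y j, id x = some j → id y = some j → x = y)
    (hκ : ∀ x, id x = none ↔ κ x = false) : countBefore 𝒯.op 𝒯.T ≤ m * (k * (r + 1)) := by
  classical
  rw [countBefore, Nat.count_eq_card_filter_range]
  -- every operation belongs to a machine, a path and a register
  have hop : ∀ t, ∃ y : ℕ × ℕ × ℕ, t < 𝒯.T → 𝒯.op t → ∃ n s j, s < 𝒯.steps n ∧ 𝒯.time n s = t ∧
      id (𝒯.node n s) = some j ∧ y = (n.val, j.val, f n s) := by
    intro t
    by_cases h : t < 𝒯.T ∧ 𝒯.op t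
    · obtain ⟨ht, n, hn, hκn⟩ := h
      obtain ⟨s, hs, rfl⟩ := exists_of_mover hn
      obtain ⟨j, hj⟩ : ∃ j, id (𝒯.node n s) = some j := by
        refine Option.ne_none_iff_exists'.1 fun h => ?_
        have h1 : κ (𝒯.loc (𝒯.time n s) n) = false := (hκ _).1 h
        rw [hκn] at h1
        cases h1
      exact ⟨_, fun _ _ => ⟨n, s, j, hs, rfl, hj, rfl⟩⟩
    · exact ⟨default, fun h1 h2 => absurd ⟨h1, h2⟩ h⟩
  choose y hy using hop
  have hcard : (Finset.range m ×ˢ Finset.range k ×ˢ Finset.range (r + 1)).card =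
      m * (k * (r + 1)) := by simp
  rw [← hcard]
  refine Finset.card_le_card_of_injOn y ?_ ?_
  · intro t ht
    obtain ⟨h1, h2⟩ := Finset.mem_filter.1 ht
    obtain ⟨n, s, j, hs, -, -, h3⟩ := hy t (Finset.mem_range.1 h1) h2
    simp [h3, Nat.lt_succ_of_le (hle n s hs)]
  · intro t ht t' ht' htt
    obtain ⟨h1, h2⟩ := Finset.mem_filter.1 ht
    obtain ⟨h1', h2'⟩ := Finset.mem_filter.1 ht'
    obtain ⟨n, s, j, hs, rfl, hj, h3⟩ := hy t (Finset.mem_range.1 h1) h2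
    obtain ⟨n', s', j', hs', rfl, hj', h3'⟩ := hy t' (Finset.mem_range.1 h1') h2'
    rw [h3, h3', Prod.mk.injEq, Prod.mk.injEq] at htt
    obtain ⟨hn, hjj, hf⟩ := htt
    have hn := Fin.ext hn
    have hjj := Fin.ext hjj
    subst hn hjj
    have hnode := hid _ _ _ hj hj'
    rcases lt_trichotomy s s' with h | h | h
    · exact absurd hnode (node_ne_on_path hmono hdir hrank h hs' hf)
    · rw [h]
    · exact absurd hnode.symm (node_ne_on_path hmono hdir hrank h hs hf.symm)

include hle in
/-- The schedule of a run whose moves are distributed over the paths. -/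
theorem exists_schedule {k : ℕ} {id : H.Node → Option (Fin k)}
    (hid : ∀ x y j, id x = some j → id y = some j → x = y)
    (hκ : ∀ x, id x = none ↔ κ x = false) : ∃ 𝒮 : Schedule M H m r id, ∀ n,
      𝒮.node n (𝒮.steps n) = 𝒯.loc 𝒯.T n ∧ 𝒮.state n (𝒮.steps n) = 𝒯.st 𝒯.T n := by
  classical
  -- the moves on the paths before path `h` come first
  have hbound : ∀ n h, ∃ b, ∀ s, s < b ↔ s < 𝒯.steps n ∧ f n s < h := by
    intro n h
    have hex : ∃ s, ¬(s < 𝒯.steps n ∧ f n s < h) := ⟨𝒯.steps n, fun h => lt_irrefl _ h.1⟩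
    refine ⟨Nat.find hex, fun s => ⟨fun hs => not_not.1 (Nat.find_min hex hs), fun hs => ?_⟩⟩
    by_contra hlt
    have h1 := hmono n (Nat.le_of_not_lt hlt)
    exact Nat.find_spec hex ⟨(Nat.le_of_not_lt hlt).trans_lt hs.1, h1.trans_lt hs.2⟩
  choose bound hbound using hbound
  have hpath : ∀ n (h : Fin (r + 1)) s, bound n h ≤ s → s < bound n (h + 1) →
      s < 𝒯.steps n ∧ segDir h = 𝒯.dir (𝒯.time n s) := by
    intro n h s h1 h2
    rw [hbound] at h2
    have h3 : f n s = h := by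
      have : ¬(s < 𝒯.steps n ∧ f n s < h) := by
        rw [← hbound]
        omega
      omega
    rw [hdir n s h2.1, h3]
    exact ⟨h2.1, rfl⟩
  have hops := countBefore_op_le hmono hle hdir hrank hid hκ
  have hlt : ∀ n s, (if s ≤ 𝒯.steps n then 𝒯.block n s else n) < blockBound m r k := by
    intro n s
    have hn := n.isLt
    have h1 : blockBound m r k = m + m * (k * (r + 1)) := by
      rw [blockBound]
      ring
    rw [h1]
    split_ifs with hs
    · rcases block_spec n hs with h | ⟨s', h2, h3, h4⟩
      · omega
      · have h5 := countBefore_lt (op_time (by omega) h3) (time_spec (by omega)).1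
        omega
    · omega
  have hblock : ∀ n s, s ≤ 𝒯.steps n →
      (if s ≤ 𝒯.steps n then 𝒯.block n s else n) = 𝒯.block n s := fun n s hs => if_pos hs
  refine ⟨{
    steps := 𝒯.steps
    node := 𝒯.node
    state := 𝒯.state
    edge := fun n s => 𝒯.edge (𝒯.time n s)
    bound := bound
    read := fun n s => κ (𝒯.node n s) && 𝒯.β (𝒯.time n s) (𝒯.node n s)
    write := fun n s => 𝒯.write (𝒯.time n s)
    block := fun n s => ⟨_, hlt n s⟩
    -- operation number `c` is the one of block `m + c`, and there is none in the initial blocks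
    pre := fun b => 𝒯.valOf id (b - m)
    post := fun b => 𝒯.valOf id (b + 1 - m)
    node_zero := ?_
    state_zero := ?_
    bound_zero := ?_
    bound_mono := ?_
    bound_last := ?_
    edge_mem := ?_
    edge_nodes := ?_
    trans := ?_
    silent := ?_
    operation := ?_
    first := ?_
    owner := ?_
    discharged := ?_ }, fun n => node_countBefore le_rfl⟩
  · intro n
    exact (timeOf_zero (f := fun t => 𝒯.loc t n) fun _ h1 h2 => (unchanged h1 h2).1).trans
      (𝒯.loc_zero n)
  · intro n
    exact (timeOf_zero (f := fun t => 𝒯.st t n) fun _ h1 h2 => (unchanged h1 h2).2).trans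
      (𝒯.st_zero n)
  · intro n
    by_contra h
    exact absurd ((hbound n 0 0).1 (Nat.pos_of_ne_zero h)).2 (Nat.not_lt_zero _)
  · intro n h h' hh
    refine le_of_forall_lt fun s hs => ?_
    rw [hbound] at hs ⊢
    exact ⟨hs.1, hs.2.trans_le hh⟩
  · intro n
    refine eq_of_forall_lt_iff fun s => ?_
    rw [hbound]
    exact ⟨fun h => h.1, fun h => ⟨h, Nat.lt_succ_of_le (hle n s h)⟩⟩
  · intro n h s h1 h2
    obtain ⟨h3, -⟩ := hpath n h s h1 h2
    exact 𝒯.edge_mem n _ (time_spec h3).2.1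
  · intro n h s h1 h2
    obtain ⟨h3, h4⟩ := hpath n h s h1 h2
    rw [h4, (node_succ h3).1]
    exact 𝒯.edge_nodes n _ (time_spec h3).2.1
  · intro n h s h1 h2
    obtain ⟨h3, h4⟩ := hpath n h s h1 h2
    rw [h4, (node_succ h3).2]
    exact 𝒯.trans n _ (time_spec h3).2.1
  · intro n s hs h
    have h1 : κ (𝒯.node n s) = false := (hκ _).1 h
    refine ⟨by rw [h1]; rfl, 𝒯.silent n _ (time_spec hs).2.1 h1, Fin.ext ?_⟩
    change (if _ then _ else _) = if _ then _ else _
    rw [hblock n s hs.le, hblock n (s + 1) hs, block, if_neg (by rw [h1]; simp)]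
  · intro n s hs j hj
    have h1 : κ (𝒯.node n s) = true := by
      by_contra h
      rw [(hκ _).2 (by simpa using h)] at hj
      cases hj
    obtain ⟨ht, hn, -⟩ := time_spec hs
    have h2 := block_lt_succ hs h1
    have h3 : 𝒯.block n (s + 1) = m + countBefore 𝒯.op (𝒯.time n s) := by
      rw [block, if_pos h1]
    simp only [Fin.mk_lt_mk]
    rw [hblock n s hs.le, hblock n (s + 1) hs]
    refine ⟨h2, ?_, ?_⟩
    · rw [h3, Nat.add_sub_cancel_left, valOf_countBefore hκ ht.le, val_of hid hj, h1, Bool.true_and]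
    · rw [h3, Nat.add_assoc, Nat.add_sub_cancel_left, Nat.add_sub_cancel_left,
        valOf_countBefore hκ ht.le, ← countBefore_succ_of_pos (op_time hs h1),
        valOf_countBefore hκ ht]
      exact val_update hid hn hj
  · intro n
    have hn := n.isLt
    simp only
    rw [hblock n 0 (Nat.zero_le _), block]
    congr 1
    omega
  · intro n s n' s' hs hs' h
    have h1 := Fin.mk.inj_iff.1 h
    rw [hblock n s hs, hblock n' s' hs'] at h1
    exact block_owner hs hs' h1
  · intro n s hs
    have hn := n.isLt
    simp only
    rw [hblock n s hs]
    -- before the first operation, all registers are `0`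
    have hinit : ∀ B, B ≤ m → B ≠ 0 → ∃ n' s', s' ≤ 𝒯.steps n' ∧
        (if s' ≤ 𝒯.steps n' then 𝒯.block n' s' else n') + 1 = B ∧
        𝒯.valOf id ((if s' ≤ 𝒯.steps n' then 𝒯.block n' s' else n') + 1 - m) =
          𝒯.valOf id (B - m) := by
      intro B hB hB0
      refine ⟨⟨B - 1, by omega⟩, 0, Nat.zero_le _, ?_⟩
      rw [hblock _ 0 (Nat.zero_le _), block]
      simp only
      exact ⟨by omega, by congr 1; omega⟩
    rcases block_spec n hs with h | ⟨s', h1, h2, h3⟩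
    · by_cases h0 : n.val = 0
      · left
        rw [h, h0, Nat.zero_sub]
        exact ⟨rfl, valOf_zero hκ⟩
      · right
        rw [h]
        exact hinit n hn.le h0
    · right
      rw [h3]
      rcases hc : countBefore 𝒯.op (𝒯.time n s') with _ | c
      · exact hinit m le_rfl (by omega)
      · -- the preceding operation
        obtain ⟨ht, ⟨n', hn', hκ'⟩, hcount⟩ := timeOf_spec (p := 𝒯.op) (T := 𝒯.time n s') (s := c)
          (by omega)
        obtain ⟨u, hu, hut⟩ := exists_of_mover hn'
        rw [← hut] at hκ' hcount
        change κ (𝒯.node n' u) = true at hκ'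
        refine ⟨n', u + 1, hu, ?_⟩
        rw [hblock n' (u + 1) hu, block, if_pos hκ', hcount]
        exact ⟨rfl, rfl⟩

end Paths

end Timeline

/-! ### Completeness -/

/-- A sequence of directions is distributed over paths that are followed alternately forwards and
backwards; there are as many changes of the path as there are reversals. -/
theorem exists_paths (l : List Dir) (h₀ : ℕ)
    (hd : ∀ d, l[0]? = some d → d = if h₀ % 2 = 0 then .fwd else .bwd) :
    ∃ f : ℕ → ℕ, Monotone f ∧ f 0 = h₀ ∧ ∀ s d, l[s]? = some d →
      (d = if f s % 2 = 0 then .fwd else .bwd) ∧ f s ≤ h₀ + reversals l := by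
  induction l generalizing h₀ with
  | nil => exact ⟨fun _ => h₀, monotone_const, rfl, by simp⟩
  | cons d l ih =>
    rcases l with _ | ⟨d', l⟩
    · refine ⟨fun _ => h₀, monotone_const, rfl, fun s e he => ?_⟩
      rcases s with _ | s
      · exact ⟨hd e he, Nat.le_add_right _ _⟩
      · simp at he
    · have h1 := hd d rfl
      obtain ⟨f, hf, hf0, hfs⟩ := ih (h₀ + open Classical in if d ≠ d' then 1 else 0) (by
        intro e he
        obtain rfl : d' = e := by simpa using he
        rcases Nat.mod_two_eq_zero_or_one h₀ with h2 | h2 <;> cases d' <;>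
          simp [h2, Nat.add_mod] at h1 ⊢ <;> simp [h1])
      refine ⟨fun s => Nat.casesOn s h₀ f, monotone_nat_of_le_succ ?_, rfl, ?_⟩
      · rintro (_ | s)
        · change h₀ ≤ f 0
          rw [hf0]
          exact Nat.le_add_right _ _
        · exact hf (Nat.le_succ s)
      · rintro (_ | s) e he
        · exact ⟨hd e he, Nat.le_add_right _ _⟩
        · obtain ⟨h2, h3⟩ := hfs s e he
          refine ⟨h2, h3.trans ?_⟩
          rw [reversals_cons_cons, Nat.add_assoc]

theorem SPTree.nonempty_label {N L : Type*} (T : SPTree N L) : Nonempty L := by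
  induction T with
  | leaf a => exact ⟨a⟩
  | ser _ _ _ ih _ => exact ih
  | par _ _ ih _ => exact ih

section Complete

variable {A V Q : Type*} {𝒢 : SPGG A V} {M : Machine A Q} {H : Graph A} {m r k : ℕ}

/-- The moves of a run on the symmetric closure of `H`, along edges of `H`. -/
theorem exists_timeline (hH : H ∈ 𝒢.language) {κ : H.symmClosure.Node → Bool}
    {a b : FConfig H.symmClosure.Node Q m}
    {tr : List (Fin m × H.symmClosure.Node × H.symmClosure.Node × (A × Dir))}
    (ha : a ∈ (moveNFA m M κ).start) (hrun : NRun (moveNFA m M κ) a tr b) :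
    ∃ 𝒯 : Timeline M H κ m, (∀ n, 𝒯.loc 𝒯.T n = b.loc n ∧ 𝒯.st 𝒯.T n = b.st n) ∧
      ∀ n s, s < 𝒯.steps n → (moveDirs tr n)[s]? = some (𝒯.dir (𝒯.time n s)) := by
  classical
  obtain ⟨c, hc0, hcT, hstep⟩ := hrun.exists_states
  obtain ⟨T₀, -⟩ := exists_tree_of_mem_language hH
  obtain ⟨a₀⟩ := T₀.nonempty_label
  have ha' : a = ⟨fun _ => H.source, fun _ => M.start, fun _ => false⟩ := ha
  have hmove : ∀ t, ∃ y : (H.Node × H.Node × A) × Dir × Bool, ∀ n e, tr[t]? = some (n, e) →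
      e.2.2.2 = y.2.1 ∧ y.1 ∈ H.edges ∧
      (match y.2.1 with
        | .fwd => y.1.1 = (c t).loc n ∧ y.1.2.1 = (c (t + 1)).loc n
        | .bwd => y.1.1 = (c (t + 1)).loc n ∧ y.1.2.1 = (c t).loc n) ∧
      ((c t).st n, (y.1.2.2, y.2.1), κ ((c t).loc n) && (c t).β ((c t).loc n), (c (t + 1)).st n,
        y.2.2) ∈ M.δ ∧
      (κ ((c t).loc n) = false → y.2.2 = false) ∧
      (∀ n', n' ≠ n → (c (t + 1)).loc n' = (c t).loc n' ∧ (c (t + 1)).st n' = (c t).st n') ∧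
      (c (t + 1)).β ((c t).loc n) = y.2.2 ∧
      ∀ x, x ≠ (c t).loc n → (c (t + 1)).β x = (c t).β x := by
    intro t
    cases ht : tr[t]? with
    | none => exact ⟨((H.source, H.source, a₀), .fwd, false), by simp⟩
    | some x =>
      obtain ⟨n, e⟩ := x
      obtain ⟨he, hloc, q', b', h1, h2, h3⟩ := hstep t _ ht
      obtain ⟨d, hd, hdir⟩ : ∃ d ∈ H.edges, match e.2.2.2 with
          | .fwd => e = (d.1, d.2.1, (d.2.2, Dir.fwd))
          | .bwd => e = (d.2.1, d.1, (d.2.2, Dir.bwd)) := by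
        rcases Multiset.mem_add.1 he with he | he
        · obtain ⟨d, hd, rfl⟩ := Multiset.mem_map.1 he
          exact ⟨d, hd, rfl⟩
        · obtain ⟨d, hd, rfl⟩ := Multiset.mem_map.1 he
          exact ⟨d, hd, rfl⟩
      refine ⟨(d, e.2.2.2, b'), fun n' e' hx => ?_⟩
      obtain ⟨rfl, rfl⟩ := Prod.mk.inj (Option.some.inj hx)
      have hσ : e.2.2 = (d.2.2, e.2.2.2) := by
        obtain ⟨x, y, σ, δ⟩ := e
        cases δ <;> simp only at hdir ⊢ <;> cases hdir <;> rfl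
      simp only at h1 h2 h3 ⊢
      rw [h3]
      simp only [Function.update_self]
      rw [hloc, ← hσ]
      refine ⟨trivial, hd, ?_, ?_, fun h => (h2 h).1, fun n' hn' => ?_,
        Function.update_self _ _ _, fun x hx => ?_⟩
      · obtain ⟨x, y, σ, δ⟩ := e
        cases δ <;> simp only at hdir ⊢ <;> cases hdir <;> exact ⟨rfl, rfl⟩
      · cases hκ : κ e.1
        · rw [Bool.false_and, (h2 hκ).1]
          exact (h2 hκ).2
        · rw [Bool.true_and]
          exact h1 hκ
      · rw [Function.update_of_ne hn', Function.update_of_ne hn']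
        exact ⟨rfl, rfl⟩
      · exact Function.update_of_ne hx _ _
  choose y hy using hmove
  let 𝒯 : Timeline M H κ m := {
    T := tr.length
    mover := fun n t => ∃ e, tr[t]? = some (n, e)
    edge := fun t => (y t).1
    dir := fun t => (y t).2.1
    loc := fun t => (c t).loc
    st := fun t => (c t).st
    β := fun t => (c t).β
    write := fun t => (y t).2.2
    loc_zero := fun n => by rw [hc0, ha']
    st_zero := fun n => by rw [hc0, ha']
    β_zero := fun x => by rw [hc0, ha']
    lt := fun n t ⟨e, h⟩ => (List.getElem?_eq_some_iff.1 h).1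
    exists_mover := fun t ht => ⟨_, _, List.getElem?_eq_getElem ht⟩
    unique := by
      rintro n n' t ⟨e, h⟩ ⟨e', h'⟩
      rw [h] at h'
      exact (Prod.mk.inj (Option.some.inj h')).1
    edge_mem := fun n t ⟨e, h⟩ => (hy t n e h).2.1
    edge_nodes := fun n t ⟨e, h⟩ => (hy t n e h).2.2.1
    trans := fun n t ⟨e, h⟩ => (hy t n e h).2.2.2.1
    silent := fun n t ⟨e, h⟩ => (hy t n e h).2.2.2.2.1
    other := fun n n' t ⟨e, h⟩ => (hy t n e h).2.2.2.2.2.1 n'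
    register := fun n t ⟨e, h⟩ => (hy t n e h).2.2.2.2.2.2.1
    register_other := fun n t x ⟨e, h⟩ => (hy t n e h).2.2.2.2.2.2.2 x }
  refine ⟨𝒯, fun n => ?_, fun n s hs => ?_⟩
  · change (c tr.length).loc n = _ ∧ (c tr.length).st n = _
    rw [hcT]
    exact ⟨rfl, rfl⟩
  · have hlen : ∀ t ≤ tr.length, (moveDirs (tr.take t) n).length = countBefore (𝒯.mover n) t := by
      intro t
      induction t with
      | zero =>
        intro _
        rw [countBefore_zero]
        rfl
      | succ t ih =>
        intro ht
        rw [List.take_add_one, moveDirs_append, List.length_append, ih (by omega),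
          List.getElem?_eq_getElem ht]
        by_cases hn : tr[t].1 = n
        · rw [countBefore_succ_of_pos ⟨tr[t].2, by rw [List.getElem?_eq_getElem ht, ← hn]⟩]
          simp [moveDirs, hn]
        · rw [countBefore_succ_of_neg]
          · simp [moveDirs, hn]
          · rintro ⟨e, he⟩
            rw [List.getElem?_eq_getElem ht, Option.some.injEq] at he
            exact hn (by rw [he])
    obtain ⟨ht, ⟨e, he⟩, hcount⟩ := Timeline.time_spec hs
    generalize 𝒯.time n s = t at ht he hcount ⊢
    have hsplit : tr = tr.take t ++ (n, e) :: tr.drop (t + 1) := by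
      obtain ⟨h1, h2⟩ := List.getElem?_eq_some_iff.1 he
      rw [← h2, ← List.drop_eq_getElem_cons, List.take_append_drop]
    have hl := hlen t (le_of_lt ht)
    rw [hcount] at hl
    conv_lhs => rw [hsplit, moveDirs_append]
    rw [List.getElem?_append_right hl.le, hl, Nat.sub_self]
    have h1 : (moveDirs ((n, e) :: tr.drop (t + 1)) n)[0]? = some e.2.2.2 := by
      simp [moveDirs]
    rw [h1, (hy t n e he).1]

/-- Identifiers for the marked nodes. -/
theorem exists_identifiers {N : Type*} [Finite N] (κ : N → Bool)
    (hκ : {x | κ x = true}.ncard ≤ k) : ∃ id : N → Option (Fin k),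
      (∀ x y j, id x = some j → id y = some j → x = y) ∧ ∀ x, id x = none ↔ κ x = false := by
  classical
  have e := Finite.equivFin {x // κ x = true}
  refine ⟨fun x => if h : κ x = true then some (Fin.castLE hκ (e ⟨x, h⟩)) else none, ?_, fun x =>
    ?_⟩
  · intro x y j hx hy
    simp only at hx hy
    split_ifs at hx hy with h1 h2
    rw [← hy, Option.some.injEq] at hx
    have h3 := e.injective (Fin.castLE_injective hκ hx)
    simpa using h3
  · simp only
    split_ifs with h
    · simp [h]
    · simpa using h

/-- A run that is bounded in reversals yields a word in the intersection of all the automata. -/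
theorem exists_word_of_run [Finite A] [Finite V] {F : ConfigProp Q} {G : Graph (A × Dir)}
    {κ : G.Node → Bool} {ρ : Run M m G κ} (hG : 𝒢.IsMarkedGraph k G κ) (hr : ρ.ReversalBounded r)
    {i : Fin (ρ.length + 1)} (hF : (ρ.config i).Satisfies F) :
    ∃ w : List (Letter A Q m r k), w.map Prod.fst ∈ (grammarPDA 𝒢 m r k).language ∧
      Marked.wrap (w.map Prod.fst) ∈ (registerNFA A m r k).accepts ∧
      (∀ n, w ∈ (execTwoNFA M r k n).language) ∧ w ∈ (rwTwoNFA A Q m r k).language ∧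
      Marked.wrap w ∈ (propertyNFA A m r k F).accepts := by
  obtain ⟨⟨H, hH, rfl⟩, hcard⟩ := hG
  have := H.finite_node
  obtain ⟨id, hid, hκ⟩ := exists_identifiers (N := H.Node) κ hcard
  obtain ⟨a, ha, tr, b, hrun, hb, hrev⟩ := exists_moves_of_run ρ i hr
  obtain ⟨𝒯, hend, hdirs⟩ := exists_timeline hH ha hrun
  obtain ⟨rank, hrank⟩ := exists_rank_of_mem_language hH
  -- no edge enters the source, so that the first path is followed forwards
  have hfirst : ∀ n, ∃ f : ℕ → ℕ, Monotone f ∧ f 0 = 0 ∧ ∀ s, s < 𝒯.steps n →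
      (𝒯.dir (𝒯.time n s) = if f s % 2 = 0 then .fwd else .bwd) ∧ f s ≤ r := by
    intro n
    by_cases h0 : 0 < 𝒯.steps n
    · obtain ⟨f, h1, h2, h3⟩ := exists_paths (moveDirs tr n) 0 (by
        intro d hd
        rw [hdirs n 0 h0, Option.some.injEq] at hd
        rw [← hd]
        have h2 := (Timeline.time_spec h0).2.1
        have h3 := 𝒯.edge_nodes n _ h2
        have h4 := ne_source_of_mem_language hH (𝒯.edge_mem n _ h2)
        have h5 : 𝒯.loc (𝒯.time n 0) n = H.source :=
          (timeOf_zero (f := fun t => 𝒯.loc t n) fun _ h1 h2 =>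
            (Timeline.unchanged h1 h2).1).trans (𝒯.loc_zero n)
        cases hd' : 𝒯.dir (𝒯.time n 0)
        · rfl
        · rw [hd'] at h3
          exact absurd (h3.2.trans h5) h4)
      refine ⟨f, h1, h2, fun s hs => ?_⟩
      obtain ⟨h4, h5⟩ := h3 s _ (hdirs n s hs)
      exact ⟨h4, h5.trans (by rw [Nat.zero_add]; exact hrev n)⟩
    · exact ⟨fun _ => 0, monotone_const, rfl, fun s hs => absurd hs (by omega)⟩
  choose f hmono _ hf using hfirst
  obtain ⟨𝒮, h𝒮⟩ := Timeline.exists_schedule hmono (fun n s hs => (hf n s hs).2)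
    (fun n s hs => (hf n s hs).1) hrank hid hκ
  obtain ⟨W, τ, P, o, hW, hreg, hP⟩ := Schedule.exists_placement hH hid 𝒮
  have hfst := Placement.map_fst_word (𝒮 := 𝒮) (W := W) (τ := τ) (P := P) (o := o)
  refine ⟨𝒮.word τ P o W, by rwa [hfst], by rwa [hfst], hP.word_mem_execTwoNFA,
    hP.word_mem_rwTwoNFA, ?_⟩
  rw [mem_accepts_propertyNFA]
  refine hF.mono ?_
  rintro S - ⟨x, hx⟩
  refine hP.exists_nodeProperty (x := x) fun q => (hx q).trans (le_of_eq ?_)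
  congr 1
  ext n
  obtain ⟨h1, h2⟩ := h𝒮 n
  obtain ⟨h3, h4⟩ := hend n
  have h5 := h1.trans h3
  have h6 := h2.trans h4
  rw [hb]
  exact ⟨fun h => ⟨h5.trans h.1, h6.trans h.2⟩, fun h => ⟨h5.symm.trans h.1, h6.symm.trans h.2⟩⟩

end Complete

end SPAutomata

theorem mainTheorem2 {A V Q : Type*} [Finite A] [Finite V] [Finite Q]
    (M : SPAutomata.Machine A Q) (m r k : ℕ) (𝒢 : SPAutomata.SPGG A V)
    (F : SPAutomata.ConfigProp Q) :
    (∃ w, w ∈ (SPAutomata.reachPDA M m r k 𝒢 F).language) ↔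
      ∃ (G : SPAutomata.Graph (A × SPAutomata.Dir)) (κ : G.Node → Bool)
        (ρ : SPAutomata.Run M m G κ),
        𝒢.IsMarkedGraph k G κ ∧ ρ.ReversalBounded r ∧ ∃ i, (ρ.config i).Satisfies F := by
  constructor
  · rintro ⟨w, hw⟩
    obtain ⟨hW, hreg, w', rfl, hexec, hrw, hF⟩ :=
      (SPAutomata.mem_language_reachPDA M m r k 𝒢 F w).1 hw
    exact SPAutomata.exists_run_of_word hW hreg hexec hrw hF
  · rintro ⟨G, κ, ρ, hG, hr, i, hF⟩
    obtain ⟨w, hW, hreg, hexec, hrw, hF⟩ := SPAutomata.exists_word_of_run hG hr hF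
    exact ⟨_, (SPAutomata.mem_language_reachPDA M m r k 𝒢 F _).2
      ⟨hW, hreg, w, rfl, hexec, hrw, hF⟩⟩
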